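/- **Notation.** All graphs are finite, simple and undirected; $N(v)$ is the neighborhood of $v$, and $\overline A = V(G)\setminus A$. A *rooted layout* $(T,\delta)$ of a graph $G$ is a rooted binary tree $T$ (every internal node has two children) with a bijection $\delta$ between $V(G)$ and the leaves of $T$; $V_x$ is the set of vertices whose leaf lies below (or is) the node $x$. For $\mathsf f:2^{V(G)}\to\mathbb N$ put $\mathsf f(T,\delta)=\max_{x\in V(T)}\mathsf f(V_x)$. For $A\subseteq V(G)$: * $\mathsf{mw}(A)=|\{N(v)\cap\overline A : v\in A\}|$; $\mathsf{rw}(A)$ and $\mathsf{rw}_{\mathbb Q}(A)$ are the ranks over $GF(2)$ and over $\mathbb Q$ of the adjacency matrix between $A$ and $\overline A$; $\mathsf{mim}(A)$ is the maximum size of an induced matching of the bipartite graph formed by the edges between $A$ and $\overline A$; * for $d\ge 1$, $\mathsf{nec}_d(A)$ is the number of classes of the equivalence relation on the subsets of $A$ given by $X\equiv Y$ iff $\min(d,|X\cap N(u)|)=\min(d,|Y\cap N(u)|)$ for all $u\in\overline A$, and $\mathsf{s\text{-}nec}_d(A)=\max(\mathsf{nec}_d(A),\mathsf{nec}_d(\overline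 A))$. For an $n$-vertex graph let $\mathcal N_{\mathsf{mw}}=2^{\mathsf{mw}(T,\delta)}\cdot 2n$, $\ \mathcal N_{\mathsf{rw}}=2^{2\,\mathsf{rw}(T,\delta)^2}\cdot 2n$, $\ \mathcal N_{\mathsf{rw}_{\mathbb Q}}=(2\,\mathsf{rw}_{\mathbb Q}(T,\delta)+1)^{\mathsf{rw}_{\mathbb Q}(T,\delta)}\cdot 2n$, $\ \mathcal N_{\mathsf{mim}}=2\,n^{2\,\mathsf{mim}(T,\delta)+1}$ (all depending on $(T,\delta)$). Let $\omega$ be the exponent of matrix multiplication (over an arbitrary fixed field). Let $\sigma,\rho\subseteq\mathbb N$ be non-empty sets, each finite or co-finite. Put $d(\mathbb N)=0$ and $d(\mu)=1+\min(\max\mu,\max(\mathbb N\setminus\mu))$ for $\mu\neq\mathbb N$ (the maximum of an infinite set being $+\infty$), and $d=\max\{2,d(\sigma),d(\rho)\}$. A set $D\subseteq V(G)$ is *$(\sigma,\rho)$-dominating* if $|N(u)\cap D|\in\sigma$ for all $u\in D$ and $|N(u)\cap D|\in\rho$ for all $u\in V(G)\setminus D$. It is *acyclic* if moreover $G[D]$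 is a forest. The *Acyclic $(\sigma,\rho)$-Dominating Set* problem (in its maximization or its minimization version) asks, given $G$ with vertex weights $\mathsf w:V(G)\to\mathbb Q$, for an acyclic $(\sigma,\rho)$-dominating set of maximum (respectively minimum) total weight, or for the answer that none exists. (For instance, $\sigma=\rho=\mathbb N$ with maximization is Maximum Induced Forest, equivalently Feedback Vertex Set.) **Theorem.** For each $\mathsf f\in\{\mathsf{mw},\mathsf{rw},\mathsf{rw}_{\mathbb Q},\mathsf{mim}\}$ there is a constant $c$ such that, for all $\sigma,\rho$ as above and for both versions, there is an algorithm that, given an $n$-vertex graph $G$, weights $\mathsf w:V(G)\to\mathbb Q$ and a rooted layout $(T,\delta)$ of $G$, solves the Acyclic $(\sigma,\rho)$-Dominating Set problem on $(G,\mathsf w)$ in time $$O\bigl(\mathsf{s\text{-}nec}_d(T,\delta)^{3}\cdot \mathsf{s\text{-}nec}_1(T,\delta)^{2(\omega+1)}\cdot \mathcal N_{\mathsf f}(T,\delta)^{c}\cdot n^{3}\bigr),$$ where the constant hidden in $O(\cdot)$ depends only on $\mathsf f$, $\sigma$, $\rho$, the version, and the field chosen for $\omega$. Time is counted on a random access machine,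 at logarithmic cost for integers (so the bound also holds for the number of steps) and at unit cost for copying, adding and comparing weights. -/

import Mathlib

namespace AcyclicDom

/-! ### Rooted layouts -/

/-- Rooted binary trees whose leaves carry labels (every internal node has two children). -/
inductive LayoutTree (V : Type) : Type
  | leaf (v : V) : LayoutTree V
  | node (l r : LayoutTree V) : LayoutTree V

namespace LayoutTree

variable {V : Type}

/-- The labels of the leaves, from left to right. -/
def leaves : LayoutTree V → List V
  | leaf v => [v]
  | node l r => l.leaves ++ r.leaves

/-- `T` is a rooted layout of a graph on `V`: its leaves are in bijection with `V`. -/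
def IsLayout (T : LayoutTree V) : Prop :=
  T.leaves.Nodup ∧ ∀ v : V, v ∈ T.leaves

/-- The set `V_x` of the vertices below the root `x` of a (sub)tree. -/
def verts [DecidableEq V] (T : LayoutTree V) : Finset V :=
  T.leaves.toFinset

/-- The `f`-width of `T`: the maximum of `f V_x` over all nodes `x` of `T`. -/
def width [DecidableEq V] (f : Finset V → ℕ) : LayoutTree V → ℕ
  | leaf v => f (leaf v).verts
  | node l r => max (f (node l r).verts) (max (width f l) (width f r))

/-- The post-order listing of a layout tree on `Fin n`: a leaf with label `v` contributes the
number `v + 1`, an internal node contributes `0` (after its two subtrees). -/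
def postorder {n : ℕ} : LayoutTree (Fin n) → List ℕ
  | leaf v => [v.val + 1]
  | node l r => l.postorder ++ r.postorder ++ [0]

end LayoutTree

/-! ### Set functions of a graph -/

section Widths

variable {V : Type} [Fintype V] [DecidableEq V] (G : SimpleGraph V)

/-- `|N(u) ∩ X|`. -/
noncomputable def nbrCount (X : Finset V) (u : V) : ℕ :=
  (G.neighborSet u ∩ (X : Set V)).ncard

/-- The `d`-neighbor equivalence over `A`, as an equivalence relation on the subsets of `A`. -/
def nbrSetoid (d : ℕ) (A : Finset V) : Setoid {X : Finset V // X ⊆ A} where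
  r X Y := ∀ u : V, u ∉ A → min d (nbrCount G X.1 u) = min d (nbrCount G Y.1 u)
  iseqv := ⟨fun _ _ _ => rfl, fun h u hu => (h u hu).symm,
    fun h h' u hu => (h u hu).trans (h' u hu)⟩

/-- `nec_d(A)`: the number of classes of the `d`-neighbor equivalence over `A`. -/
noncomputable def nec (d : ℕ) (A : Finset V) : ℕ :=
  Nat.card (Quotient (nbrSetoid G d A))

/-- `s-nec_d(A) = max (nec_d(A), nec_d(V ∖ A))`. -/
noncomputable def snec (d : ℕ) (A : Finset V) : ℕ :=
  max (nec G d A) (nec G d Aᶜ)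

/-- `mw(A)`: the number of sets `N(v) ∖ A` with `v ∈ A`. -/
noncomputable def mw (A : Finset V) : ℕ :=
  ((fun v => G.neighborSet v ∩ (A : Set V)ᶜ) '' (A : Set V)).ncard

open Classical in
/-- The adjacency matrix between `A` and its complement, with entries in `K`. -/
noncomputable def cutMatrix (K : Type) [Field K] (A : Finset V) :
    Matrix {v // v ∈ A} {v // v ∈ Aᶜ} K :=
  fun a b => if G.Adj a.1 b.1 then 1 else 0

/-- `rw(A)`: the rank over `GF(2)` of the adjacency matrix between `A` and its complement. -/
noncomputable def rw (A : Finset V) : ℕ :=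
  (cutMatrix G (ZMod 2) A).rank

/-- `rw_ℚ(A)`: the rank over `ℚ` of the adjacency matrix between `A` and its complement. -/
noncomputable def rwQ (A : Finset V) : ℕ :=
  (cutMatrix G ℚ A).rank

/-- `mim(A)`: the maximum number of edges of an induced matching of the bipartite graph of the
edges of `G` between `A` and its complement. -/
noncomputable def mim (A : Finset V) : ℕ :=
  sSup {k : ℕ | ∃ M : (SimpleGraph.between (A : Set V) (A : Set V)ᶜ G).Subgraph,
    M.IsMatching ∧ M.IsInduced ∧ M.edgeSet.ncard = k}

end Widths

/-- The four width parameters. -/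
inductive WidthParam : Type
  | mw | rw | rwQ | mim

/-- The term `𝒩_f(T, δ)`, for a layout of a graph on `n` vertices. -/
noncomputable def boundN {n : ℕ} (G : SimpleGraph (Fin n)) (T : LayoutTree (Fin n)) :
    WidthParam → ℕ
  | .mw => 2 ^ T.width (mw G) * (2 * n)
  | .rw => 2 ^ (2 * T.width (rw G) ^ 2) * (2 * n)
  | .rwQ => (2 * T.width (rwQ G) + 1) ^ T.width (rwQ G) * (2 * n)
  | .mim => 2 * n ^ (2 * T.width (mim G) + 1)

/-! ### The matrix multiplication exponent -/

/-- `g` is a straight-line program over `K` with variables indexed by `ι`: each step is a constant,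
or the sum, difference or product of two operands, each a variable or the result of an earlier
step. -/
def IsStraightLine {K ι : Type} [Field K] {L : ℕ} (g : Fin L → MvPolynomial ι K) : Prop :=
  ∀ i : Fin L, (∃ a : K, g i = MvPolynomial.C a) ∨
    ∃ p q : MvPolynomial ι K,
      ((∃ s, p = MvPolynomial.X s) ∨ ∃ j < i, p = g j) ∧
      ((∃ s, q = MvPolynomial.X s) ∨ ∃ j < i, q = g j) ∧
      (g i = p + q ∨ g i = p - q ∨ g i = p * q)

/-- Two `m × m` matrices over `K` can be multiplied with `L` arithmetic operations.
The variables `(false, i, j)` and `(true, i, j)` are the entries of the two matrices. -/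
def MatMulIn (K : Type) [Field K] (m L : ℕ) : Prop :=
  ∃ g : Fin L → MvPolynomial (Bool × Fin m × Fin m) K, IsStraightLine g ∧
    ∀ i j : Fin m, ∃ t : Fin L,
      g t = ∑ k : Fin m, MvPolynomial.X (false, i, k) * MvPolynomial.X (true, k, j)

/-- The matrix multiplication exponent `ω` over `K`: the infimum of all `τ` such that two `m × m`
matrices can be multiplied with `O(m ^ τ)` arithmetic operations. -/
noncomputable def matMulExponent (K : Type) [Field K] : ℝ :=
  sInf {τ : ℝ | ∃ C : ℝ, ∀ m : ℕ, ∃ L : ℕ, MatMulIn K m L ∧ (L : ℝ) ≤ C * (m : ℝ) ^ τ}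

/-! ### Acyclic `(σ, ρ)`-dominating sets -/

open Classical in
/-- `d(ℕ) = 0`, and `d(μ) = 1 + min (max μ, max (ℕ ∖ μ))` for the other non-empty finite or
co-finite sets `μ`; the minimum is the maximum of the finite one of the two sets. -/
noncomputable def dOf (μ : Set ℕ) : ℕ :=
  if μ = Set.univ then 0 else 1 + (if μ.Finite then sSup μ else sSup μᶜ)

/-- `D` is a `(σ, ρ)`-dominating set of `G` that induces a forest. -/
def IsAcyclicDominating {V : Type} (G : SimpleGraph V) (σ ρ : Set ℕ) (D : Finset V) : Prop :=
  (∀ u : V, (u ∈ D → nbrCount G D u ∈ σ) ∧ (u ∉ D → nbrCount G D u ∈ ρ)) ∧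
    (G.induce (D : Set V)).IsAcyclic

/-- Maximization or minimization. -/
inductive Goal : Type
  | max | min

/-- `D` is an acyclic `(σ, ρ)`-dominating set of `G` of optimum weight. -/
def IsOptimal {V : Type} (goal : Goal) (G : SimpleGraph V) (σ ρ : Set ℕ) (w : V → ℚ)
    (D : Finset V) : Prop :=
  IsAcyclicDominating G σ ρ D ∧ ∀ D', IsAcyclicDominating G σ ρ D' →
    match goal with
    | .max => ∑ v ∈ D', w v ≤ ∑ v ∈ D, w v
    | .min => ∑ v ∈ D, w v ≤ ∑ v ∈ D', w v

/-! ### The machine model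

Structured programs over a random access memory. The memory has integer variables, integer arrays
and arrays of rational weights. A program mentions finitely many variables and arrays; array cells
are addressed by computed indices. Weights can only be copied, added and compared. Integers are
charged by bit length (logarithmic cost), an operation on weights has cost one. -/

/-- Memory contents. -/
structure State where
  /-- integer variables -/
  var : ℕ → ℕ
  /-- integer arrays: `arr a i` is cell `i` of array `a` -/
  arr : ℕ → ℕ → ℕ
  /-- weight arrays: `wt b i` is cell `i` of weight array `b` -/
  wt : ℕ → ℕ → ℚ

/-- Integer expressions. `sub` is truncated subtraction, `div` is division with rounding down,
`less` and `wle` (comparison of two weights) have value `1` for true and `0` for false. -/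
inductive Expr : Type
  | const (k : ℕ)
  | var (x : ℕ)
  | get (a : ℕ) (i : Expr)
  | add (e₁ e₂ : Expr)
  | sub (e₁ e₂ : Expr)
  | mul (e₁ e₂ : Expr)
  | div (e₁ e₂ : Expr)
  | less (e₁ e₂ : Expr)
  | wle (b₁ : ℕ) (i₁ : Expr) (b₂ : ℕ) (i₂ : Expr)

namespace Expr

/-- The value of an expression. -/
def eval (s : State) : Expr → ℕ
  | const k => k
  | var x => s.var x
  | get a i => s.arr a (i.eval s)
  | add e₁ e₂ => e₁.eval s + e₂.eval s
  | sub e₁ e₂ => e₁.eval s - e₂.eval s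
  | mul e₁ e₂ => e₁.eval s * e₂.eval s
  | div e₁ e₂ => e₁.eval s / e₂.eval s
  | less e₁ e₂ => if e₁.eval s < e₂.eval s then 1 else 0
  | wle b₁ i₁ b₂ i₂ => if s.wt b₁ (i₁.eval s) ≤ s.wt b₂ (i₂.eval s) then 1 else 0

/-- The cost of evaluating an expression: each subexpression is charged one plus the bit length of
its value. -/
def cost (s : State) : Expr → ℕ
  | const k => 1 + k.size
  | var x => 1 + (s.var x).size
  | get a i => i.cost s + (1 + ((get a i).eval s).size)
  | add e₁ e₂ => e₁.cost s + e₂.cost s + (1 + ((add e₁ e₂).eval s).size)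
  | sub e₁ e₂ => e₁.cost s + e₂.cost s + (1 + ((sub e₁ e₂).eval s).size)
  | mul e₁ e₂ => e₁.cost s + e₂.cost s + (1 + ((mul e₁ e₂).eval s).size)
  | div e₁ e₂ => e₁.cost s + e₂.cost s + (1 + ((div e₁ e₂).eval s).size)
  | less e₁ e₂ => e₁.cost s + e₂.cost s + (1 + ((less e₁ e₂).eval s).size)
  | wle b₁ i₁ b₂ i₂ => i₁.cost s + i₂.cost s + (1 + ((wle b₁ i₁ b₂ i₂).eval s).size)

end Expr

/-- Programs. -/
inductive Prog : Type
  | skip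
  /-- variable `x := e` -/
  | assign (x : ℕ) (e : Expr)
  /-- cell `i` of array `a := e` -/
  | store (a : ℕ) (i e : Expr)
  /-- cell `i` of weight array `b :=` cell `i₁` of weight array `b₁` -/
  | wcopy (b : ℕ) (i : Expr) (b₁ : ℕ) (i₁ : Expr)
  /-- cell `i` of weight array `b :=` cell `i₁` of `b₁` plus cell `i₂` of `b₂` -/
  | wadd (b : ℕ) (i : Expr) (b₁ : ℕ) (i₁ : Expr) (b₂ : ℕ) (i₂ : Expr)
  | seq (p q : Prog)
  /-- run `p` if `e` is non-zero, and `q` otherwise -/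
  | branch (e : Expr) (p q : Prog)
  /-- run `p` as long as `e` is non-zero -/
  | loop (e : Expr) (p : Prog)

/-- Assignment to a variable. -/
def State.setVar (s : State) (x v : ℕ) : State :=
  { s with var := Function.update s.var x v }

/-- Assignment to an array cell. -/
def State.setArr (s : State) (a i v : ℕ) : State :=
  { s with arr := Function.update s.arr a (Function.update (s.arr a) i v) }

/-- Assignment to a cell of a weight array. -/
def State.setWt (s : State) (b i : ℕ) (v : ℚ) : State :=
  { s with wt := Function.update s.wt b (Function.update (s.wt b) i v) }

/-- `Run p s s' t`: program `p`, started in memory `s`, terminates in memory `s'` at cost `t`. -/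
inductive Run : Prog → State → State → ℕ → Prop
  | skip (s : State) : Run .skip s s 1
  | assign (s : State) (x : ℕ) (e : Expr) :
      Run (.assign x e) s (s.setVar x (e.eval s)) (1 + e.cost s)
  | store (s : State) (a : ℕ) (i e : Expr) :
      Run (.store a i e) s (s.setArr a (i.eval s) (e.eval s)) (1 + i.cost s + e.cost s)
  | wcopy (s : State) (b : ℕ) (i : Expr) (b₁ : ℕ) (i₁ : Expr) :
      Run (.wcopy b i b₁ i₁) s (s.setWt b (i.eval s) (s.wt b₁ (i₁.eval s)))
        (1 + i.cost s + i₁.cost s)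
  | wadd (s : State) (b : ℕ) (i : Expr) (b₁ : ℕ) (i₁ : Expr) (b₂ : ℕ) (i₂ : Expr) :
      Run (.wadd b i b₁ i₁ b₂ i₂) s
        (s.setWt b (i.eval s) (s.wt b₁ (i₁.eval s) + s.wt b₂ (i₂.eval s)))
        (1 + i.cost s + i₁.cost s + i₂.cost s)
  | seq {p q : Prog} {s s' s'' : State} {t t' : ℕ} (hp : Run p s s' t) (hq : Run q s' s'' t') :
      Run (.seq p q) s s'' (1 + t + t')
  | branchTrue {e : Expr} {p q : Prog} {s s' : State} {t : ℕ} (he : e.eval s ≠ 0)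
      (hp : Run p s s' t) : Run (.branch e p q) s s' (1 + e.cost s + t)
  | branchFalse {e : Expr} {p q : Prog} {s s' : State} {t : ℕ} (he : e.eval s = 0)
      (hq : Run q s s' t) : Run (.branch e p q) s s' (1 + e.cost s + t)
  | loopDone {e : Expr} {p : Prog} {s : State} (he : e.eval s = 0) :
      Run (.loop e p) s s (1 + e.cost s)
  | loopStep {e : Expr} {p : Prog} {s s' s'' : State} {t t' : ℕ} (he : e.eval s ≠ 0)
      (hp : Run p s s' t) (hl : Run (.loop e p) s' s'' t') :
      Run (.loop e p) s s'' (1 + e.cost s + t + t')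

open Classical in
/-- The initial memory on input `(G, w, T)`: variable `0` holds `n`, array `0` holds the adjacency
matrix of `G` row by row, array `1` holds the post-order listing of `T`, weight array `0` holds the
vertex weights; everything else is zero. -/
noncomputable def input {n : ℕ} (G : SimpleGraph (Fin n)) (w : Fin n → ℚ)
    (T : LayoutTree (Fin n)) : State where
  var x := if x = 0 then n else 0
  arr a k :=
    if a = 0 then
      if ∃ i j : Fin n, G.Adj i j ∧ k = i.val * n + j.val then 1 else 0
    else if a = 1 then T.postorder.getD k 0
    else 0
  wt b k := if h : b = 0 ∧ k < n then w ⟨k, h.2⟩ else 0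

/-- The set written in the output array (array `2`): the vertices whose cell is non-zero. -/
def outputSet (n : ℕ) (s : State) : Finset (Fin n) :=
  Finset.univ.filter fun v => s.arr 2 v.val ≠ 0

/-- The final memory `s` holds a correct answer: either variable `0` is zero and there is no
acyclic `(σ, ρ)`-dominating set, or variable `0` is non-zero and the output set is an optimum
one. -/
def CorrectOutput {n : ℕ} (goal : Goal) (G : SimpleGraph (Fin n)) (σ ρ : Set ℕ) (w : Fin n → ℚ)
    (s : State) : Prop :=
  (s.var 0 = 0 ∧ ¬ ∃ D, IsAcyclicDominating G σ ρ D) ∨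
    (s.var 0 ≠ 0 ∧ IsOptimal goal G σ ρ w (outputSet n s))

end AcyclicDom

/-! A partial solution at a node of the layout is a set `X ⊆ A`, where `A` is the set of vertices
below the node. Whether the degree conditions survive a completion `Y ⊆ Aᶜ` depends only on the
`d`-neighbor classes of `X` over `A` and of `Y` over `Aᶜ`. The tables are therefore indexed by pairs
of classes, and the join of two children runs over triples of representatives. This triple loop is
the source of the third power of the `d`-neighbor width.

Acyclicity is turned into a count and a connectivity condition by marking one vertex in each
component: `X` induces a forest exactly if some `M ⊆ X` satisfies `|X| = e(X) + |M|` and meets every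
component (`Inst.Good`). Equivalently, the graph with an apex joined to `M` and to all vertices
outside of `X` is a tree (`cone_isTree_iff`, `exists_good`). The count is controlled by the
invariants in `SameKey` (`adjPairs_union_congr`). Connectivity is tested modulo two: the number of
unions of components of `G[X ∪ Y]` that contain all marks is one if every component is marked, and
even otherwise. Such a union splits into one of `G[X]` and one of `G[Y]`, so for a fixed completion
the parity is a linear functional of the vector `feature` of `X`, whose coordinates are pairs of
1-neighbor classes over `Aᶜ` (`card_closed_mod_two`, `reach_union_eq`). Within a class of `SameKey`
it is thus enough to keep a best basis of the feature vectors, and Gaussian elimination in the order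
of the weights finds one (`exists_mem_elim`, `exists_mem_reduce`).

A class keeps at most as many elements as there are coordinates. The number of classes is bounded as
follows. The only long invariant is the vector of neighbor counts of the vertices of `X` that have
at least two neighbors in `Y`. If `X ∪ Y` induces a forest, these vertices split into two sets in
which every vertex has a private neighbor (`splitList_big_ne_nil`); all other partial solutions are
discarded. The invariant is then a sum of two elements of `irrSums`, and the number of these is at
most `boundN` for each of the four parameters (`card_irrSums_le_boundN`). The same number bounds the
1-neighbor classes on both sides of the cut.

Hence everything except the triple loop is polynomial in `boundN` and `d`. The factors with
`s-nec_1` and `n ^ 3` are only used through being at least one, for which `0 ≤ ω` suffices, and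
plain elimination is fast enough. Running times are derived for functional programs on an
append-only heap; the logarithmic cost contributes the bit length of the addresses, which is
absorbed by doubling the exponent of `boundN` (`time_le`). -/

namespace AcyclicDom

/-! ### Immutable data on a heap -/

/-- Binary trees with weights at some of the leaves. -/
inductive Data : Type
  | nil
  | cons (a b : Data)
  | wt (q : ℚ)

/-- The pointer `p` represents a tree in memory. The cell `p` of the heap has its two components in
arrays `3` and `4`; a weight is represented by its position in weight array `0`; variable `1` is the
first free position. -/
def Rep (s : State) : Data → ℕ → Prop
  | .nil, p => p = 0
  | .cons a b, p => p ≠ 0 ∧ p < s.var 1 ∧ Rep s a (s.arr 3 p) ∧ Rep s b (s.arr 4 p)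
  | .wt q, p => p < s.var 1 ∧ s.wt 0 p = q

/-- The null pointer is reserved, and its components are null. -/
structure HeapOk (s : State) : Prop where
  pos : 1 ≤ s.var 1
  fst_zero : s.arr 3 0 = 0
  snd_zero : s.arr 4 0 = 0

/-- The heap of `s'` extends the heap of `s`, and the input data are the same. -/
structure Extends (s s' : State) : Prop where
  ptr_le : s.var 1 ≤ s'.var 1
  fst_eq : ∀ p < s.var 1, s'.arr 3 p = s.arr 3 p
  snd_eq : ∀ p < s.var 1, s'.arr 4 p = s.arr 4 p
  wt_eq : ∀ p < s.var 1, s'.wt 0 p = s.wt 0 p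
  var_zero : s'.var 0 = s.var 0
  arr_zero : s'.arr 0 = s.arr 0
  arr_one : s'.arr 1 = s.arr 1

theorem Extends.refl (s : State) : Extends s s :=
  ⟨le_rfl, fun _ _ => rfl, fun _ _ => rfl, fun _ _ => rfl, rfl, rfl, rfl⟩

theorem Extends.trans {s s' s'' : State} (h : Extends s s') (h' : Extends s' s'') :
    Extends s s'' where
  ptr_le := h.ptr_le.trans h'.ptr_le
  fst_eq p hp := (h'.fst_eq p (hp.trans_le h.ptr_le)).trans (h.fst_eq p hp)
  snd_eq p hp := (h'.snd_eq p (hp.trans_le h.ptr_le)).trans (h.snd_eq p hp)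
  wt_eq p hp := (h'.wt_eq p (hp.trans_le h.ptr_le)).trans (h.wt_eq p hp)
  var_zero := h'.var_zero.trans h.var_zero
  arr_zero := h'.arr_zero.trans h.arr_zero
  arr_one := h'.arr_one.trans h.arr_one

theorem HeapOk.extends {s s' : State} (hs : HeapOk s) (h : Extends s s') : HeapOk s' where
  pos := hs.pos.trans h.ptr_le
  fst_zero := (h.fst_eq 0 hs.pos).trans hs.fst_zero
  snd_zero := (h.snd_eq 0 hs.pos).trans hs.snd_zero

/-- Cells below the free pointer are never changed, so a pointer keeps its meaning for the rest of
the computation. This allows subtrees to be shared and results to be reused without copying. -/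
theorem Rep.extends {s s' : State} (h : Extends s s') :
    ∀ {x : Data} {p : ℕ}, Rep s x p → Rep s' x p
  | .nil, _, hx => hx
  | .cons _ _, p, ⟨h0, hp, ha, hb⟩ => by
    refine ⟨h0, hp.trans_le h.ptr_le, ?_, ?_⟩
    · rw [h.fst_eq p hp]; exact ha.extends h
    · rw [h.snd_eq p hp]; exact hb.extends h
  | .wt _, p, ⟨hp, hq⟩ => ⟨hp.trans_le h.ptr_le, (h.wt_eq p hp).trans hq⟩

theorem Rep.lt {s : State} (hs : HeapOk s) {x : Data} {p : ℕ} (h : Rep s x p) : p < s.var 1 := by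
  cases x with
  | nil => rw [show p = 0 from h]; exact hs.pos
  | cons a b => exact h.2.1
  | wt q => exact h.1

/-- `p`, started in `s`, extends the heap by at most `b`, in time `O(b)` times the bit length of
pointers, preserves the variables `2, …, k - 1`, and ends in a memory with property `Q`. -/
def Exec (p : Prog) (s : State) (k b : ℕ) (Q : State → Prop) : Prop :=
  ∃ s' t, Run p s s' t ∧ Extends s s' ∧ (∀ j, 2 ≤ j → j < k → s'.var j = s.var j) ∧
    s'.var 1 ≤ s.var 1 + b ∧ t ≤ b * (1 + (s'.var 1).size) ∧ Q s'

theorem Exec.mono {p : Prog} {s : State} {k k' b b' : ℕ} {Q Q' : State → Prop}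
    (h : Exec p s k b Q) (hk : k' ≤ k) (hb : b ≤ b')
    (hQ : ∀ s', Extends s s' → (∀ j, 2 ≤ j → j < k → s'.var j = s.var j) → Q s' → Q' s') :
    Exec p s k' b' Q' := by
  obtain ⟨s', t, hr, he, hf, hp, ht, hq⟩ := h
  exact ⟨s', t, hr, he, fun j h2 hj => hf j h2 (hj.trans_le hk), by omega,
    ht.trans (Nat.mul_le_mul_right _ hb), hQ s' he hf hq⟩

theorem Exec.seq {p q : Prog} {s : State} {k b b' : ℕ} {Q : State → Prop}
    (h : Exec p s k b fun s' => Exec q s' k b' Q) : Exec (p.seq q) s k (b + b' + 1) Q := by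
  obtain ⟨s₁, t₁, hr₁, he₁, hf₁, hp₁, ht₁, s₂, t₂, hr₂, he₂, hf₂, hp₂, ht₂, hq⟩ := h
  refine ⟨s₂, _, .seq hr₁ hr₂, he₁.trans he₂, fun j h2 hj => (hf₂ j h2 hj).trans (hf₁ j h2 hj),
    by omega, ?_, hq⟩
  -- The free pointer only grows, so the first part may be charged with the bit length of the final
  -- pointer.
  have := Nat.mul_le_mul_left b (Nat.add_le_add_left (Nat.size_le_size he₂.ptr_le) 1)
  nlinarith

theorem Exec.seq' {p q : Prog} {s : State} {k k' b b' c : ℕ} {P Q : State → Prop}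
    (h : Exec p s k' b P) (hk : k ≤ k') (hc : b + b' + 1 ≤ c)
    (h' : ∀ s', Extends s s' → (∀ j, 2 ≤ j → j < k' → s'.var j = s.var j) → P s' →
      Exec q s' k b' Q) : Exec (p.seq q) s k c Q :=
  (Exec.seq (h.mono hk le_rfl h')).mono le_rfl hc fun _ _ _ h => h

theorem setVar_var_of_ne {s : State} {x v j : ℕ} (h : j ≠ x) : (s.setVar x v).var j = s.var j :=
  Function.update_of_ne h _ _

@[simp] theorem setVar_var_self (s : State) (x v : ℕ) : (s.setVar x v).var x = v :=
  Function.update_self _ _ _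

theorem extends_setVar (s : State) {x : ℕ} (v : ℕ) (hx : 2 ≤ x) : Extends s (s.setVar x v) where
  ptr_le := by rw [setVar_var_of_ne (by omega)]
  fst_eq _ _ := rfl
  snd_eq _ _ := rfl
  wt_eq _ _ := rfl
  var_zero := by rw [setVar_var_of_ne (by omega)]
  arr_zero := rfl
  arr_one := rfl

theorem exec_assign {s : State} {x k : ℕ} {e : Expr} (c : ℕ) (hx : 2 ≤ x) (hk : k ≤ x)
    (he : 1 + e.cost s ≤ c * (1 + (s.var 1).size)) :
    Exec (.assign x e) s k c fun s' =>
      s' = s.setVar x (e.eval s) :=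
  ⟨_, _, .assign s x e, extends_setVar s _ hx, fun j _ hj => setVar_var_of_ne (by omega),
    by rw [setVar_var_of_ne (by omega)]; omega,
    by rwa [setVar_var_of_ne (by omega)], rfl⟩

theorem exec_copy {s : State} {x y k : ℕ} (hx : 2 ≤ x) (hk : k ≤ x) (hy : s.var y ≤ s.var 1) :
    Exec (.assign x (.var y)) s k 2 fun s' => s' = s.setVar x (s.var y) := by
  refine exec_assign 2 hx hk ?_
  have := Nat.size_le_size hy
  simp only [Expr.cost]
  omega

theorem exec_get {s : State} {x y k a : ℕ} (hx : 2 ≤ x) (hk : k ≤ x) (hy : s.var y ≤ s.var 1)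
    (ha : s.arr a (s.var y) ≤ s.var 1) :
    Exec (.assign x (.get a (.var y))) s k 3 fun s' => s' = s.setVar x (s.arr a (s.var y)) := by
  refine exec_assign 3 hx hk ?_
  have := Nat.size_le_size hy
  have := Nat.size_le_size ha
  simp only [Expr.cost, Expr.eval]
  omega

/-- Allocation of a heap cell. -/
def consProg (x y z : ℕ) : Prog :=
  .seq (.store 3 (.var 1) (.var y)) <| .seq (.store 4 (.var 1) (.var z)) <|
    .seq (.assign x (.var 1)) (.assign 1 (.add (.var 1) (.const 1)))

theorem size_succ_le (n : ℕ) : (n + 1).size ≤ n.size + 1 := by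
  rw [Nat.size_le]
  have := Nat.lt_size_self n
  have h1 : 1 ≤ 2 ^ n.size := Nat.one_le_two_pow
  rw [pow_succ]; omega

/-- Both components are stored before variable `x` is overwritten, so `x` may coincide with `y` or
`z`. The new cell lies at the old free position, which is not zero, and all pointers in use are
smaller. -/
theorem exec_cons {s : State} {x y z k : ℕ} {a b : Data} (hs : HeapOk s) (hx : 2 ≤ x) (hk : k ≤ x)
    (ha : Rep s a (s.var y)) (hb : Rep s b (s.var z)) :
    Exec (consProg x y z) s k 20 fun s' =>
      (∀ j, j ≠ 1 → j ≠ x → s'.var j = s.var j) ∧ Rep s' (.cons a b) (s'.var x) := by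
  have h1 := Nat.size_le_size (ha.lt hs).le
  have h2 := Nat.size_le_size (hb.lt hs).le
  have h3 := size_succ_le (s.var 1)
  have h4 := Nat.size_le_size (Nat.le_succ (s.var 1))
  have h0 := hs.pos
  have hx1 : x ≠ 1 := by omega
  have hx0 : x ≠ 0 := by omega
  have hrun := Run.seq (.store s 3 (.var 1) (.var y)) (.seq (.store _ 4 (.var 1) (.var z))
    (.seq (.assign _ x (.var 1)) (.assign _ 1 (.add (.var 1) (.const 1)))))
  set s' := State.setVar _ 1 _ with hs'
  have hext : Extends s s' := by
    constructor <;> simp [hs', State.setVar, State.setArr, Expr.eval, Function.update_apply, hx1,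
      hx0.symm] <;> intros <;> omega
  refine ⟨s', _, hrun, hext, ?_, ?_, ?_, ?_, ?_, ?_, ?_, ?_⟩
  · intro j h2 hj
    simp [hs', State.setVar, State.setArr, Expr.eval, Function.update_apply, show j ≠ 1 by omega,
      show j ≠ x by omega]
  · simp [hs', State.setVar, State.setArr, Expr.eval, Function.update_apply, hx1]
  · simp [hs', State.setVar, State.setArr, Expr.eval, Expr.cost, Function.update_apply, hx1,
      hx1.symm, Nat.size_one]
    simp only [Nat.succ_eq_add_one] at h4
    omega
  · intro j hj1 hjx
    simp [hs', State.setVar, State.setArr, Expr.eval, Function.update_apply, hj1, hjx]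
  · simp [hs', State.setVar, State.setArr, Expr.eval, Function.update_apply, hx1]
    omega
  · simp [hs', State.setVar, State.setArr, Expr.eval, Function.update_apply, hx1, hx1.symm]
  · have h : s'.arr 3 (s'.var x) = s.var y := by
      simp [hs', State.setVar, State.setArr, Expr.eval, Function.update_apply, hx1, hx1.symm]
    rw [h]
    exact ha.extends hext
  · have h : s'.arr 4 (s'.var x) = s.var z := by
      simp [hs', State.setVar, State.setArr, Expr.eval, Function.update_apply, hx1, hx1.symm]
    rw [h]
    exact hb.extends hext

theorem exec_zero {s : State} {x k : ℕ} (hx : 2 ≤ x) (hk : k ≤ x) :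
    Exec (.assign x (.const 0)) s k 2 fun s' => s' = s.setVar x 0 := by
  refine exec_assign 2 hx hk ?_
  simp [Expr.cost]

theorem exec_branch {e : Expr} {p q : Prog} {s : State} {k b c : ℕ} {Q : State → Prop}
    (he : 1 + e.cost s ≤ c * (1 + (s.var 1).size))
    (hp : e.eval s ≠ 0 → Exec p s k b Q) (hq : e.eval s = 0 → Exec q s k b Q) :
    Exec (.branch e p q) s k (b + c) Q := by
  by_cases h : e.eval s = 0
  · obtain ⟨s', t, hr, hx, hf, hb, ht, hq⟩ := hq h
    refine ⟨s', _, .branchFalse h hr, hx, hf, by omega, ?_, hq⟩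
    have := Nat.mul_le_mul_left c (Nat.add_le_add_left (Nat.size_le_size hx.ptr_le) 1)
    nlinarith
  · obtain ⟨s', t, hr, hx, hf, hb, ht, hq⟩ := hp h
    refine ⟨s', _, .branchTrue h hr, hx, hf, by omega, ?_, hq⟩
    have := Nat.mul_le_mul_left c (Nat.add_le_add_left (Nat.size_le_size hx.ptr_le) 1)
    nlinarith

theorem exec_loop_done {e : Expr} {p : Prog} {s : State} {k c : ℕ} {Q : State → Prop}
    (he : 1 + e.cost s ≤ c * (1 + (s.var 1).size)) (h : e.eval s = 0) (hQ : Q s) :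
    Exec (.loop e p) s k c Q :=
  ⟨s, _, .loopDone h, .refl s, fun _ _ _ => rfl, by omega, he, hQ⟩

theorem exec_loop_step {e : Expr} {p : Prog} {s : State} {k b b' c : ℕ} {Q : State → Prop}
    (he : 1 + e.cost s ≤ c * (1 + (s.var 1).size)) (h : e.eval s ≠ 0)
    (hp : Exec p s k b fun s' => Exec (.loop e p) s' k b' Q) :
    Exec (.loop e p) s k (b + b' + c) Q := by
  obtain ⟨s₁, t₁, hr₁, he₁, hf₁, hp₁, ht₁, s₂, t₂, hr₂, he₂, hf₂, hp₂, ht₂, hq⟩ := hp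
  refine ⟨s₂, _, .loopStep h hr₁ hr₂, he₁.trans he₂,
    fun j h2 hj => (hf₂ j h2 hj).trans (hf₁ j h2 hj), by omega, ?_, hq⟩
  have := Nat.mul_le_mul_left b (Nat.add_le_add_left (Nat.size_le_size he₂.ptr_le) 1)
  have := Nat.mul_le_mul_left c
    (Nat.add_le_add_left (Nat.size_le_size (he₁.trans he₂).ptr_le) 1)
  nlinarith

theorem var_cost_le {s : State} {y : ℕ} (h : s.var y ≤ s.var 1) :
    1 + (Expr.var y).cost s ≤ 2 * (1 + (s.var 1).size) := by
  have := Nat.size_le_size h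
  simp only [Expr.cost]
  omega

/-! ### Computable families of data -/

/-- `f γ` can be computed from the data `g γ` with `g ∈ env`, by a program that does not depend
on `γ`, in `O(T γ + 1)` steps. -/
def Computes {Γ : Type} (env : Set (Γ → Data)) (f : Γ → Data) (T : Γ → ℕ) : Prop :=
  ∃ c, ∀ (ρ : (Γ → Data) → ℕ) (k : ℕ), 2 ≤ k → (∀ g ∈ env, 2 ≤ ρ g ∧ ρ g < k) →
    ∃ p, ∀ s γ, HeapOk s → (∀ g ∈ env, Rep s (g γ) (s.var (ρ g))) →
      Exec p s k (c * (T γ + 1)) fun s' => Rep s' (f γ) (s'.var k)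

namespace Computes

variable {Γ : Type} {env : Set (Γ → Data)} {f g : Γ → Data} {T T' : Γ → ℕ}

theorem of_le (h : Computes env f T) (C : ℕ) (hT : ∀ γ, T γ ≤ C * (T' γ + 1)) :
    Computes env f T' := by
  obtain ⟨c, h⟩ := h
  refine ⟨c * (C + 1), fun ρ k hk hρ => ?_⟩
  obtain ⟨p, hp⟩ := h ρ k hk hρ
  refine ⟨p, fun s γ hs hr => (hp s γ hs hr).mono le_rfl ?_ fun _ _ _ h => h⟩
  have := hT γ
  rw [mul_assoc]
  apply Nat.mul_le_mul_left
  nlinarith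

theorem mem (h : f ∈ env) : Computes env f fun _ => 0 := by
  refine ⟨2, fun ρ k hk hρ => ⟨.assign k (.var (ρ f)), fun s γ hs hr => ?_⟩⟩
  refine (exec_copy hk le_rfl ((hr f h).lt hs).le).mono le_rfl (by simp) fun s' he _ e => ?_
  subst e
  simpa using (hr f h).extends he

/-- Change of parameters. -/
theorem reindex {Δ : Type} {env' : Set (Δ → Data)} (h : Computes env f T) (π : Δ → Γ)
    (henv : ∀ g ∈ env, (fun δ => g (π δ)) ∈ env') :
    Computes env' (fun δ => f (π δ)) fun δ => T (π δ) := by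
  obtain ⟨c, h⟩ := h
  refine ⟨c, fun ρ k hk hρ => ?_⟩
  obtain ⟨p, hp⟩ := h (fun g => ρ fun δ => g (π δ)) k hk fun g hg => hρ _ (henv g hg)
  exact ⟨p, fun s δ hs hr => hp s (π δ) hs fun g hg => hr _ (henv g hg)⟩

theorem cons {Tf Tg : Γ → ℕ} (hf : Computes env f Tf) (hg : Computes env g Tg) :
    Computes env (fun γ => .cons (f γ) (g γ)) fun γ => Tf γ + Tg γ := by
  obtain ⟨c, hf⟩ := hf
  obtain ⟨d, hg⟩ := hg
  refine ⟨c + d + 22, fun ρ k hk hρ => ?_⟩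
  obtain ⟨p, hp⟩ := hf ρ k hk hρ
  -- The first component waits in variable `k`; the second computation starts at `k + 1` and must
  -- leave it alone.
  obtain ⟨q, hq⟩ := hg ρ (k + 1) (by omega) fun g hg => ⟨(hρ g hg).1, (hρ g hg).2.trans (by omega)⟩
  refine ⟨.seq p (.seq q (consProg k k (k + 1))), fun s γ hs hr => ?_⟩
  refine (hp s γ hs hr).seq' le_rfl (b' := d * (Tg γ + 1) + 20 + 1) (by nlinarith)
    fun s₁ he₁ hf₁ h₁ => ?_
  have hs₁ := hs.extends he₁
  refine (hq s₁ γ hs₁ fun g hg => ?_).seq' (by omega) le_rfl fun s₂ he₂ hf₂ h₂ => ?_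
  · rw [hf₁ _ (hρ g hg).1 (hρ g hg).2]; exact (hr g hg).extends he₁
  · refine (exec_cons (hs₁.extends he₂) hk le_rfl ?_ h₂).mono le_rfl le_rfl fun _ _ _ h => h.2
    rw [hf₂ k hk (by omega)]
    exact h₁.extends he₂

theorem nil : Computes env (fun _ => .nil) fun _ => 0 := by
  refine ⟨2, fun ρ k hk hρ => ⟨.assign k (.const 0), fun s γ hs hr => ?_⟩⟩
  refine (exec_zero hk le_rfl).mono le_rfl (by simp) fun s' he _ e => ?_
  subst e
  simp [Rep]

theorem fst (hf : Computes env (fun γ => .cons (f γ) (g γ)) T) : Computes env f T := by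
  obtain ⟨c, hf⟩ := hf
  refine ⟨c + 4, fun ρ k hk hρ => ?_⟩
  obtain ⟨p, hp⟩ := hf ρ k hk hρ
  refine ⟨.seq p (.assign k (.get 3 (.var k))), fun s γ hs hr => ?_⟩
  refine (hp s γ hs hr).seq' le_rfl (b' := 3) (by nlinarith) fun s₁ he₁ hf₁ h₁ => ?_
  have hs₁ := hs.extends he₁
  refine (exec_get hk le_rfl (h₁.lt hs₁).le (h₁.2.2.1.lt hs₁).le).mono le_rfl le_rfl
    fun s' he _ e => ?_
  subst e
  simpa using h₁.2.2.1.extends he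

theorem snd (hf : Computes env (fun γ => .cons (f γ) (g γ)) T) : Computes env g T := by
  obtain ⟨c, hf⟩ := hf
  refine ⟨c + 4, fun ρ k hk hρ => ?_⟩
  obtain ⟨p, hp⟩ := hf ρ k hk hρ
  refine ⟨.seq p (.assign k (.get 4 (.var k))), fun s γ hs hr => ?_⟩
  refine (hp s γ hs hr).seq' le_rfl (b' := 3) (by nlinarith) fun s₁ he₁ hf₁ h₁ => ?_
  have hs₁ := hs.extends he₁
  refine (exec_get hk le_rfl (h₁.lt hs₁).le (h₁.2.2.2.lt hs₁).le).mono le_rfl le_rfl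
    fun s' he _ e => ?_
  subst e
  simpa using h₁.2.2.2.extends he

end Computes

/-- The list with the given entries. -/
def encL : List Data → Data
  | [] => .nil
  | x :: l => .cons x (encL l)

/-- The list `l`, with entries encoded by `e`. -/
def encList {β : Type} (e : β → Data) (l : List β) : Data := encL (l.map e)

@[simp] theorem encList_nil {β : Type} (e : β → Data) : encList e [] = .nil := rfl

@[simp] theorem encList_cons {β : Type} (e : β → Data) (b : β) (l : List β) :
    encList e (b :: l) = .cons (e b) (encList e l) := rfl

open Classical in
/-- Truth values. -/
noncomputable def encProp (P : Prop) : Data := if P then .cons .nil .nil else .nil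

/-- Falsity is the null pointer, so a branch can test the pointer itself without looking into the
heap. -/
theorem rep_encProp {s : State} {P : Prop} {p : ℕ} (h : Rep s (encProp P) p) : p ≠ 0 ↔ P := by
  unfold encProp at h
  split_ifs at h with hP
  · simp [h.1, hP]
  · simp [show p = 0 from h, hP]

namespace Computes

variable {Γ : Type} {env : Set (Γ → Data)} {f g : Γ → Data} {T T' : Γ → ℕ}

/-- The tail of a list. -/
theorem tail {β : Γ → Type} {e : ∀ γ, β γ → Data} {l : ∀ γ, List (β γ)}
    (hf : Computes env (fun γ => encList (e γ) (l γ)) T) :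
    Computes env (fun γ => encList (e γ) (l γ).tail) T := by
  obtain ⟨c, hf⟩ := hf
  refine ⟨c + 4, fun ρ k hk hρ => ?_⟩
  obtain ⟨p, hp⟩ := hf ρ k hk hρ
  refine ⟨.seq p (.assign k (.get 4 (.var k))), fun s γ hs hr => ?_⟩
  refine (hp s γ hs hr).seq' le_rfl (b' := 3) (by nlinarith) fun s₁ he₁ hf₁ h₁ => ?_
  have hs₁ := hs.extends he₁
  have key : Rep s₁ (encList (e γ) (l γ).tail) (s₁.arr 4 (s₁.var k)) := by
    change Rep s₁ (encList (e γ) (l γ)) _ at h₁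
    generalize l γ = l' at h₁
    cases l' with
    -- The components of the null pointer are null, so the tail of the empty list needs no case
    -- distinction in the program.
    | nil => rw [show s₁.var k = 0 from h₁, hs₁.snd_zero]; rfl
    | cons a l' => exact h₁.2.2.2
  refine (exec_get hk le_rfl (h₁.lt hs₁).le (key.lt hs₁).le).mono le_rfl le_rfl
    fun s' he _ e => ?_
  subst e
  simpa using key.extends he

open Classical in
/-- Case distinction. -/
theorem ite {P : Γ → Prop} {TP Tf Tg : Γ → ℕ} (hP : Computes env (fun γ => encProp (P γ)) TP)
    (hf : Computes env f Tf) (hg : Computes env g Tg) :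
    Computes env (fun γ => if P γ then f γ else g γ)
      fun γ => TP γ + if P γ then Tf γ else Tg γ := by
  obtain ⟨b, hP⟩ := hP
  obtain ⟨c, hf⟩ := hf
  obtain ⟨d, hg⟩ := hg
  refine ⟨b + c + d + 3, fun ρ k hk hρ => ?_⟩
  obtain ⟨r, hr⟩ := hP ρ k hk hρ
  obtain ⟨p, hp⟩ := hf ρ k hk hρ
  obtain ⟨q, hq⟩ := hg ρ k hk hρ
  refine ⟨.seq r (.branch (.var k) p q), fun s γ hs he => ?_⟩
  refine (hr s γ hs he).seq' le_rfl (b' := (c + d) * ((if P γ then Tf γ else Tg γ) + 1) + 2)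
    (by beta_reduce; generalize (if P γ then Tf γ else Tg γ) = z; nlinarith)
    fun s₁ he₁ hf₁ h₁ => ?_
  have hs₁ := hs.extends he₁
  have hk' := rep_encProp h₁
  have henv : ∀ g ∈ env, Rep s₁ (g γ) (s₁.var (ρ g)) := fun g hg => by
    rw [hf₁ _ (hρ g hg).1 (hρ g hg).2]; exact (he g hg).extends he₁
  refine exec_branch (var_cost_le (h₁.lt hs₁).le) (fun h => ?_) fun h => ?_
  · have hPγ : P γ := hk'.1 h
    simp only [hPγ, if_true]
    exact (hp s₁ γ hs₁ henv).mono le_rfl (by nlinarith) fun _ _ _ h => h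
  · have hPγ : ¬ P γ := fun h' => hk'.2 h' h
    simp only [hPγ, if_false]
    exact (hq s₁ γ hs₁ henv).mono le_rfl (by nlinarith) fun _ _ _ h => h

/-- Test for the empty list. -/
theorem eq_nil {β : Γ → Type} {e : ∀ γ, β γ → Data} {l : ∀ γ, List (β γ)}
    (hf : Computes env (fun γ => encList (e γ) (l γ)) T) :
    Computes env (fun γ => encProp (l γ = [])) T := by
  obtain ⟨c, hf⟩ := hf
  refine ⟨c + 30, fun ρ k hk hρ => ?_⟩
  obtain ⟨p, hp⟩ := hf ρ k hk hρ
  refine ⟨.seq p (.branch (.var k) (.assign k (.const 0))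
    (.seq (.assign k (.const 0)) (consProg k k k))), fun s γ hs hr => ?_⟩
  refine (hp s γ hs hr).seq' le_rfl (b' := 25 + 2) (by nlinarith) fun s₁ he₁ hf₁ h₁ => ?_
  have hs₁ := hs.extends he₁
  change Rep s₁ (encList (e γ) (l γ)) _ at h₁
  refine exec_branch (var_cost_le (h₁.lt hs₁).le) (fun h => ?_) fun h => ?_
  · refine (exec_zero hk le_rfl).mono le_rfl (by simp) fun s' he _ e' => ?_
    have : l γ ≠ [] := by
      intro h'; rw [h'] at h₁; exact h h₁
    subst e'
    simp [encProp, Rep, this]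
  · refine (exec_zero hk le_rfl).seq' (b' := 20) le_rfl (by simp) fun s₂ he₂ _ e' => ?_
    have : l γ = [] := by
      generalize l γ = l' at h₁
      cases l' with
      | nil => rfl
      | cons a l' => exact absurd h h₁.1
    subst e'
    have h0 : Rep (s₁.setVar k 0) .nil ((s₁.setVar k 0).var k) := by simp [Rep]
    refine (exec_cons (hs₁.extends he₂) hk le_rfl h0 h0).mono le_rfl le_rfl fun _ _ _ h => ?_
    simpa [encProp, this] using h.2

/-- Comparison of two weights. -/
theorem wle {v w : Γ → ℚ} {Tv Tw : Γ → ℕ} (hv : Computes env (fun γ => .wt (v γ)) Tv)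
    (hw : Computes env (fun γ => .wt (w γ)) Tw) :
    Computes env (fun γ => encProp (v γ ≤ w γ)) fun γ => Tv γ + Tw γ := by
  obtain ⟨c, hv⟩ := hv
  obtain ⟨d, hw⟩ := hw
  refine ⟨c + d + 40, fun ρ k hk hρ => ?_⟩
  obtain ⟨p, hp⟩ := hv ρ k hk hρ
  obtain ⟨q, hq⟩ := hw ρ (k + 1) (by omega) fun g hg => ⟨(hρ g hg).1, (hρ g hg).2.trans (by omega)⟩
  refine ⟨.seq p (.seq q (.branch (.wle 0 (.var k) 0 (.var (k + 1)))
    (.seq (.assign k (.const 0)) (consProg k k k)) (.assign k (.const 0)))), fun s γ hs hr => ?_⟩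
  refine (hp s γ hs hr).seq' le_rfl (b' := d * (Tw γ + 1) + (25 + 5) + 1) (by nlinarith)
    fun s₁ he₁ hf₁ h₁ => ?_
  have hs₁ := hs.extends he₁
  refine (hq s₁ γ hs₁ fun g hg => ?_).seq' (by omega) le_rfl fun s₂ he₂ hf₂ h₂ => ?_
  · rw [hf₁ _ (hρ g hg).1 (hρ g hg).2]; exact (hr g hg).extends he₁
  have hs₂ := hs₁.extends he₂
  have h₁' : Rep s₂ (.wt (v γ)) (s₂.var k) := by
    rw [hf₂ k hk (by omega)]
    exact h₁.extends he₂
  have e1 : s₂.wt 0 (s₂.var k) = v γ := h₁'.2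
  have e2 : s₂.wt 0 (s₂.var (k + 1)) = w γ := h₂.2
  have c1 := Nat.size_le_size (h₁'.lt hs₂).le
  have c2 := Nat.size_le_size (h₂.lt hs₂).le
  refine exec_branch (b := 25) (c := 5) ?_ (fun h => ?_) fun h => ?_
  · have c3 : ((Expr.wle 0 (.var k) 0 (.var (k + 1))).eval s₂).size ≤ 1 := by
      rw [Nat.size_le, Expr.eval]
      split_ifs <;> norm_num
    simp only [Expr.cost] at c3 ⊢
    omega
  · have hle : v γ ≤ w γ := by
      by_contra hn; simp [Expr.eval, e1, e2, hn] at h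
    refine (exec_zero hk le_rfl).seq' (b' := 20) le_rfl (by simp) fun s₃ he₃ _ e => ?_
    subst e
    have h0 : Rep (s₂.setVar k 0) .nil ((s₂.setVar k 0).var k) := by simp [Rep]
    refine (exec_cons (hs₂.extends he₃) hk le_rfl h0 h0).mono le_rfl le_rfl fun _ _ _ h => ?_
    simpa [encProp, hle] using h.2
  · have hle : ¬ v γ ≤ w γ := by
      intro hn; simp [Expr.eval, e1, e2, hn] at h
    refine (exec_zero hk le_rfl).mono le_rfl (by simp) fun s' he _ e => ?_
    subst e
    simp [encProp, Rep, hle]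

/-- The sum of two weights. -/
theorem wadd {v w : Γ → ℚ} {Tv Tw : Γ → ℕ} (hv : Computes env (fun γ => .wt (v γ)) Tv)
    (hw : Computes env (fun γ => .wt (w γ)) Tw) :
    Computes env (fun γ => .wt (v γ + w γ)) fun γ => Tv γ + Tw γ := by
  obtain ⟨c, hv⟩ := hv
  obtain ⟨d, hw⟩ := hw
  refine ⟨c + d + 40, fun ρ k hk hρ => ?_⟩
  obtain ⟨p, hp⟩ := hv ρ k hk hρ
  obtain ⟨q, hq⟩ := hw ρ (k + 1) (by omega) fun g hg => ⟨(hρ g hg).1, (hρ g hg).2.trans (by omega)⟩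
  refine ⟨.seq p (.seq q (.seq (.wadd 0 (.var 1) 0 (.var k) 0 (.var (k + 1)))
    (.seq (.assign k (.var 1)) (.assign 1 (.add (.var 1) (.const 1)))))), fun s γ hs hr => ?_⟩
  refine (hp s γ hs hr).seq' le_rfl (b' := d * (Tw γ + 1) + 20 + 1) (by nlinarith)
    fun s₁ he₁ hf₁ h₁ => ?_
  have hs₁ := hs.extends he₁
  refine (hq s₁ γ hs₁ fun g hg => ?_).seq' (by omega) le_rfl fun s₂ he₂ hf₂ h₂ => ?_
  · rw [hf₁ _ (hρ g hg).1 (hρ g hg).2]; exact (hr g hg).extends he₁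
  have hs₂ := hs₁.extends he₂
  have h₁' : Rep s₂ (.wt (v γ)) (s₂.var k) := by
    rw [hf₂ k hk (by omega)]
    exact h₁.extends he₂
  have e1 : s₂.wt 0 (s₂.var k) = v γ := h₁'.2
  have e2 : s₂.wt 0 (s₂.var (k + 1)) = w γ := h₂.2
  have c1 := Nat.size_le_size (h₁'.lt hs₂).le
  have c2 := Nat.size_le_size (h₂.lt hs₂).le
  have c3 := size_succ_le (s₂.var 1)
  have hk1 : k ≠ 1 := by omega
  have hk0 : k ≠ 0 := by omega
  refine ⟨_, _, .seq (.wadd _ _ _ _ _ _ _) (.seq (.assign _ _ _) (.assign _ _ _)), ?_, ?_, ?_,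
    ?_, ?_⟩
  · constructor <;> simp [State.setVar, State.setWt, Expr.eval, Function.update_apply, hk1.symm,
      hk0.symm]
    intros; omega
  · simp only [State.setVar, State.setWt, Expr.eval, Function.update_apply]; grind
  · simp [State.setVar, State.setWt, Expr.eval, Function.update_apply, hk1, hk1.symm]
  · have c4 := Nat.size_le_size (Nat.le_succ (s₂.var 1))
    simp [State.setVar, State.setWt, Expr.eval, Expr.cost, Function.update_apply, hk1, hk1.symm,
      Nat.size_one]
    simp only [Nat.succ_eq_add_one] at c4
    omega
  · simp [Rep, State.setVar, State.setWt, Expr.eval, Function.update_apply, hk1, hk1.symm, e1, e2]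

end Computes

/-! ### Iteration over lists -/

/-- The cost of a fold whose step costs `c`. -/
def foldCost {α β : Type} (f : α → β → α) (c : α → β → ℕ) : List β → α → ℕ
  | [], _ => 0
  | b :: l, a => c a b + 1 + foldCost f c l (f a b)

theorem foldCost_append {α β : Type} (f : α → β → α) (c : α → β → ℕ) (l l' : List β) (a : α) :
    foldCost f c (l ++ l') a = foldCost f c l a + foldCost f c l' (l.foldl f a) := by
  induction l generalizing a with
  | nil => simp [foldCost]
  | cons b l ih => simp [foldCost, ih, add_assoc]

/-- The data available in the body of a fold: the accumulator, the list entry, and the old ones. -/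
def foldEnv {Γ : Type} {α β : Γ → Type} (env : Set (Γ → Data)) (ea : ∀ γ, α γ → Data)
    (eb : ∀ γ, β γ → Data) : Set ((Σ γ, α γ × β γ) → Data) :=
  {fun q => ea q.1 q.2.1, fun q => eb q.1 q.2.2} ∪ (fun g q => g q.1) '' env

namespace Computes

variable {Γ : Type} {env : Set (Γ → Data)} {α β : Γ → Type}

/-- Variable `k` runs through the list, `k + 1` holds the accumulator and `k + 2` the current entry;
the body uses `k + 3` and above. The cost is summed over the accumulators that really occur, which
later allows bounds that hold only for those. -/
theorem foldl {ea : ∀ γ, α γ → Data} {eb : ∀ γ, β γ → Data} {l : ∀ γ, List (β γ)}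
    {a : ∀ γ, α γ} {f : ∀ γ, α γ → β γ → α γ} {Tl Ta : Γ → ℕ} {Tf : (Σ γ, α γ × β γ) → ℕ}
    (hl : Computes env (fun γ => encList (eb γ) (l γ)) Tl)
    (ha : Computes env (fun γ => ea γ (a γ)) Ta)
    (hf : Computes (foldEnv env ea eb) (fun q => ea q.1 (f q.1 q.2.1 q.2.2)) Tf) :
    Computes env (fun γ => ea γ ((l γ).foldl (f γ) (a γ)))
      fun γ => Tl γ + Ta γ + foldCost (f γ) (fun a b => Tf ⟨γ, a, b⟩) (l γ) (a γ) := by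
  classical
  obtain ⟨cl, hl⟩ := hl
  obtain ⟨ca, ha⟩ := ha
  obtain ⟨cf, hf⟩ := hf
  refine ⟨cl + ca + cf + 20, fun ρ k hk hρ => ?_⟩
  obtain ⟨pl, hpl⟩ := hl ρ k hk hρ
  obtain ⟨pa, hpa⟩ := ha ρ (k + 1) (by omega)
    fun g hg => ⟨(hρ g hg).1, (hρ g hg).2.trans (by omega)⟩
  have hsrc : ∀ h ∈ foldEnv env ea eb, ∃ v, 2 ≤ v ∧ v < k + 3 ∧
      ((v = k + 1 ∧ h = fun q => ea q.1 q.2.1) ∨ (v = k + 2 ∧ h = fun q => eb q.1 q.2.2) ∨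
        ∃ g ∈ env, v = ρ g ∧ h = fun q => g q.1) := by
    rintro h ((rfl | rfl) | ⟨g, hg, rfl⟩)
    · exact ⟨k + 1, by omega, by omega, .inl ⟨rfl, rfl⟩⟩
    · exact ⟨k + 2, by omega, by omega, .inr (.inl ⟨rfl, rfl⟩)⟩
    · exact ⟨ρ g, (hρ g hg).1, by have := (hρ g hg).2; omega, .inr (.inr ⟨g, hg, rfl, rfl⟩)⟩
  -- The members of `foldEnv` are known only as functions, and different roles may give the same
  -- function. One register is chosen for each, and every possible choice holds the right value.
  let ρ' : ((Σ γ, α γ × β γ) → Data) → ℕ :=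
    fun h => if hh : h ∈ foldEnv env ea eb then (hsrc h hh).choose else 0
  have hρ' : ∀ h ∈ foldEnv env ea eb, 2 ≤ ρ' h ∧ ρ' h < k + 3 ∧
      ((ρ' h = k + 1 ∧ h = fun q => ea q.1 q.2.1) ∨ (ρ' h = k + 2 ∧ h = fun q => eb q.1 q.2.2) ∨
        ∃ g ∈ env, ρ' h = ρ g ∧ h = fun q => g q.1) := by
    intro h hh
    simp only [ρ', dif_pos hh]
    exact (hsrc h hh).choose_spec
  obtain ⟨pf, hpf⟩ := hf ρ' (k + 3) (by omega) fun h hh => ⟨(hρ' h hh).1, (hρ' h hh).2.1⟩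
  let body : Prog := .seq (.assign (k + 2) (.get 3 (.var k))) <| .seq pf <|
    .seq (.assign (k + 1) (.var (k + 3))) (.assign k (.get 4 (.var k)))
  refine ⟨.seq pl (.seq pa (.seq (.loop (.var k) body) (.assign k (.var (k + 1))))),
    fun s γ hs hr => ?_⟩
  -- the loop
  have hloop : ∀ (l' : List (β γ)) (a' : α γ) (s : State), HeapOk s →
      (∀ g ∈ env, Rep s (g γ) (s.var (ρ g))) → Rep s (encList (eb γ) l') (s.var k) →
      Rep s (ea γ a') (s.var (k + 1)) →
      Exec (.loop (.var k) body) s k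
        ((cf + 13) * foldCost (f γ) (fun a b => Tf ⟨γ, a, b⟩) l' a' + 2)
        fun s' => Rep s' (ea γ (l'.foldl (f γ) a')) (s'.var (k + 1)) := by
    intro l'
    induction l' with
    | nil =>
      intro a' s hs _ hl ha
      exact (exec_loop_done (c := 2) (var_cost_le (hl.lt hs).le) hl ha).mono le_rfl
        (by simp [foldCost]) fun _ _ _ h => h
    | cons b l' ih =>
      intro a' s hs hr hl ha
      refine (exec_loop_step (c := 2)
        (b := cf * (Tf ⟨γ, a', b⟩ + 1) + 11)
        (b' := (cf + 13) * foldCost (f γ) (fun a b => Tf ⟨γ, a, b⟩) l' (f γ a' b) + 2)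
        (var_cost_le (hl.lt hs).le) hl.1 ?_).mono le_rfl (by simp only [foldCost]; nlinarith)
        fun _ _ _ h => h
      refine (exec_get (k := k + 2) (by omega) (by omega) (hl.lt hs).le
        (hl.2.2.1.lt hs).le).seq'
        (by omega) (b' := cf * (Tf ⟨γ, a', b⟩ + 1) + (2 + 3 + 1) + 1) (by omega)
        fun s₁ he₁ hf₁ e₁ => ?_
      have hs₁ := hs.extends he₁
      have hk₁ : s₁.var k = s.var k := hf₁ k hk (by omega)
      have ha₁ : s₁.var (k + 1) = s.var (k + 1) := hf₁ (k + 1) (by omega) (by omega)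
      have hb₁ : s₁.var (k + 2) = s.arr 3 (s.var k) := by subst e₁; simp
      refine (hpf s₁ ⟨γ, a', b⟩ hs₁ fun h hh => ?_).seq' (by omega) le_rfl
        fun s₂ he₂ hf₂ h₂ => ?_
      · obtain ⟨h2, h3, ⟨e, rfl⟩ | ⟨e, rfl⟩ | ⟨g, hg, e, rfl⟩⟩ := hρ' h hh
        · rw [e, ha₁]; exact ha.extends he₁
        · rw [e, hb₁]; exact hl.2.2.1.extends he₁
        · rw [e, hf₁ _ (hρ g hg).1 (by have := (hρ g hg).2; omega)]
          exact (hr g hg).extends he₁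
      have hs₂ := hs₁.extends he₂
      have hk₂ : s₂.var k = s.var k := (hf₂ k hk (by omega)).trans hk₁
      refine (exec_copy (k := k + 1) (by omega) le_rfl (h₂.lt hs₂).le).seq' (b' := 3) (by omega) le_rfl
        fun s₃ he₃ hf₃ e₃ => ?_
      have hs₃ := hs₂.extends he₃
      have h0 := he₁.trans (he₂.trans he₃)
      have hk₃ : s₃.var k = s.var k := (hf₃ k hk (by omega)).trans hk₂
      have hl₃ : Rep s₃ (encList (eb γ) (b :: l')) (s₃.var k) := by
        rw [hk₃]; exact hl.extends h0
      have ha₃ : Rep s₃ (ea γ (f γ a' b)) (s₃.var (k + 1)) := by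
        have : s₃.var (k + 1) = s₂.var (k + 3) := by subst e₃; simp
        rw [this]; exact h₂.extends he₃
      refine (exec_get hk le_rfl (hl₃.lt hs₃).le (hl₃.2.2.2.lt hs₃).le).mono
        le_rfl le_rfl fun s₄ he₄ hf₄ e₄ => ?_
      have h0' := h0.trans he₄
      refine (ih (f γ a' b) s₄ (hs₃.extends he₄) ?_ ?_ ?_).mono le_rfl le_rfl fun _ _ _ h => h
      · intro g hg
        have hg2 := hρ g hg
        rw [hf₄ _ hg2.1 hg2.2, hf₃ _ hg2.1 (by omega), hf₂ _ hg2.1 (by omega),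
          hf₁ _ hg2.1 (by omega)]
        exact (hr g hg).extends h0'
      · have : s₄.var k = s₃.arr 4 (s₃.var k) := by subst e₄; simp
        rw [this]; exact hl₃.2.2.2.extends he₄
      · have : s₄.var (k + 1) = s₃.var (k + 1) := by
          subst e₄; exact setVar_var_of_ne (by omega)
        rw [this]; exact ha₃.extends he₄
  set F := foldCost (f γ) (fun a b => Tf ⟨γ, a, b⟩) (l γ) (a γ)
  refine (hpl s γ hs hr).seq' le_rfl
    (b' := ca * (Ta γ + 1) + (((cf + 13) * F + 2) + 2 + 1) + 1) (by nlinarith)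
    fun s₁ he₁ hf₁ h₁ => ?_
  have hs₁ := hs.extends he₁
  have hr₁ : ∀ g ∈ env, Rep s₁ (g γ) (s₁.var (ρ g)) := fun g hg => by
    rw [hf₁ _ (hρ g hg).1 (hρ g hg).2]; exact (hr g hg).extends he₁
  refine (hpa s₁ γ hs₁ hr₁).seq' (by omega) le_rfl fun s₂ he₂ hf₂ h₂ => ?_
  have hs₂ := hs₁.extends he₂
  refine (hloop (l γ) (a γ) s₂ hs₂ ?_ ?_ h₂).seq' (b' := 2) le_rfl le_rfl fun s₃ he₃ hf₃ h₃ => ?_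
  · intro g hg
    have hg2 := hρ g hg
    rw [hf₂ _ hg2.1 (by omega)]; exact (hr₁ g hg).extends he₂
  · rw [hf₂ k hk (by omega)]; exact h₁.extends he₂
  · have hs₃ := hs₂.extends he₃
    refine (exec_copy hk le_rfl (h₃.lt hs₃).le).mono le_rfl le_rfl fun s' he _ e => ?_
    subst e
    simpa using h₃.extends he

end Computes


/-! ### Polynomial bounds -/

/-- `g` is bounded by a polynomial in `m`. -/
def PolyBdd {Γ : Type} (m g : Γ → ℕ) : Prop := ∃ c k, ∀ γ, g γ ≤ c * (m γ + 1) ^ k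

namespace PolyBdd

variable {Γ : Type} {m g h : Γ → ℕ}

theorem of_le (hg : PolyBdd m g) (hle : ∀ γ, h γ ≤ g γ) : PolyBdd m h := by
  obtain ⟨c, k, hg⟩ := hg
  exact ⟨c, k, fun γ => (hle γ).trans (hg γ)⟩

theorem const (a : ℕ) : PolyBdd m fun _ => a := ⟨a, 0, fun _ => by simp⟩

theorem self : PolyBdd m m := ⟨1, 1, fun _ => by simp⟩

theorem le_self (hle : ∀ γ, g γ ≤ m γ) : PolyBdd m g := self.of_le hle

theorem add (hg : PolyBdd m g) (hh : PolyBdd m h) : PolyBdd m fun γ => g γ + h γ := by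
  obtain ⟨c, k, hg⟩ := hg
  obtain ⟨d, l, hh⟩ := hh
  refine ⟨c + d, max k l, fun γ => (Nat.add_le_add (hg γ) (hh γ)).trans ?_⟩
  have h1 := Nat.pow_le_pow_right (Nat.succ_pos (m γ)) (le_max_left k l)
  have h2 := Nat.pow_le_pow_right (Nat.succ_pos (m γ)) (le_max_right k l)
  rw [add_mul]
  exact Nat.add_le_add (Nat.mul_le_mul_left c h1) (Nat.mul_le_mul_left d h2)

theorem mul (hg : PolyBdd m g) (hh : PolyBdd m h) : PolyBdd m fun γ => g γ * h γ := by
  obtain ⟨c, k, hg⟩ := hg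
  obtain ⟨d, l, hh⟩ := hh
  refine ⟨c * d, k + l, fun γ => (Nat.mul_le_mul (hg γ) (hh γ)).trans (le_of_eq ?_)⟩
  rw [pow_add]; ring

theorem pow (hg : PolyBdd m g) (j : ℕ) : PolyBdd m fun γ => g γ ^ j := by
  induction j with
  | zero => simpa using const 1
  | succ j ih => simpa only [pow_succ] using ih.mul hg

theorem comp {Δ : Type} (hg : PolyBdd m g) (π : Δ → Γ) :
    PolyBdd (fun δ => m (π δ)) fun δ => g (π δ) := by
  obtain ⟨c, k, hg⟩ := hg
  exact ⟨c, k, fun δ => hg (π δ)⟩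

theorem trans {m' : Γ → ℕ} (hm : PolyBdd m' m) (hg : PolyBdd m g) : PolyBdd m' g := by
  obtain ⟨c, k, hg⟩ := hg
  have := (const (m := m') c).mul ((hm.add (const 1)).pow k)
  exact this.of_le hg

end PolyBdd

/-! ### Polynomial time -/

/-- `f γ` can be computed from the data `g γ` with `g ∈ env` in time polynomial in `m γ`. -/
def PT {Γ : Type} (m : Γ → ℕ) (env : Set (Γ → Data)) (f : Γ → Data) : Prop :=
  ∃ T, PolyBdd m T ∧ Computes env f T

/-- The data available in a loop over a list: the list entry and the old ones. -/
def elEnv {Γ : Type} {β : Γ → Type} (env : Set (Γ → Data)) (eb : ∀ γ, β γ → Data) :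
    Set ((Σ γ, β γ) → Data) :=
  {fun q => eb q.1 q.2} ∪ (fun g q => g q.1) '' env

/-- Natural numbers, in unary. -/
def encNat (k : ℕ) : Data := encList (fun _ : Unit => .nil) (List.replicate k ())

/-- Families indexed by `Fin n`. -/
def encVec {n : ℕ} (g : Fin n → Data) : Data := encList g (List.finRange n)

/-- Sets of vertices. -/
noncomputable def encSet {n : ℕ} (X : Finset (Fin n)) : Data := encVec fun v => encProp (v ∈ X)

namespace PT

variable {Γ : Type} {m : Γ → ℕ} {env : Set (Γ → Data)} {f g : Γ → Data} {α β : Γ → Type}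
  {ea : ∀ γ, α γ → Data} {eb : ∀ γ, β γ → Data}

theorem congr (h : PT m env f) (hfg : ∀ γ, f γ = g γ) : PT m env g := by
  rwa [← funext hfg]

theorem measure {m' : Γ → ℕ} (h : PT m env f) (hm : PolyBdd m' m) : PT m' env f := by
  obtain ⟨T, hT, h⟩ := h
  exact ⟨T, hm.trans hT, h⟩

theorem mem (h : f ∈ env) : PT m env f := ⟨_, .const 0, .mem h⟩

theorem nil : PT m env fun _ => .nil := ⟨_, .const 0, .nil⟩

theorem cons (hf : PT m env f) (hg : PT m env g) : PT m env fun γ => .cons (f γ) (g γ) := by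
  obtain ⟨T, hT, hf⟩ := hf
  obtain ⟨U, hU, hg⟩ := hg
  exact ⟨_, hT.add hU, hf.cons hg⟩

theorem fst (h : PT m env fun γ => .cons (f γ) (g γ)) : PT m env f := by
  obtain ⟨T, hT, h⟩ := h
  exact ⟨_, hT, h.fst⟩

theorem snd (h : PT m env fun γ => .cons (f γ) (g γ)) : PT m env g := by
  obtain ⟨T, hT, h⟩ := h
  exact ⟨_, hT, h.snd⟩

open Classical in
theorem ite {P : Γ → Prop} (hP : PT m env fun γ => encProp (P γ)) (hf : PT m env f)
    (hg : PT m env g) : PT m env fun γ => if P γ then f γ else g γ := by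
  obtain ⟨S, hS, hP⟩ := hP
  obtain ⟨T, hT, hf⟩ := hf
  obtain ⟨U, hU, hg⟩ := hg
  exact ⟨_, (hS.add (hT.add hU)).of_le fun γ => by split_ifs <;> omega, hP.ite hf hg⟩

theorem wadd {v w : Γ → ℚ} (hv : PT m env fun γ => .wt (v γ)) (hw : PT m env fun γ => .wt (w γ)) :
    PT m env fun γ => .wt (v γ + w γ) := by
  obtain ⟨T, hT, hv⟩ := hv
  obtain ⟨U, hU, hw⟩ := hw
  exact ⟨_, hT.add hU, hv.wadd hw⟩

theorem reindex {Δ : Type} {env' : Set (Δ → Data)} (h : PT m env f) (π : Δ → Γ)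
    (henv : ∀ g ∈ env, (fun δ => g (π δ)) ∈ env') :
    PT (fun δ => m (π δ)) env' fun δ => f (π δ) := by
  obtain ⟨T, hT, h⟩ := h
  exact ⟨_, hT.comp π, h.reindex π henv⟩

theorem lift (h : PT m env f) : PT (fun q => m q.1) (elEnv env eb) fun q => f q.1 :=
  h.reindex Sigma.fst fun g hg => .inr ⟨g, hg, rfl⟩

theorem elem : PT (fun q => m q.1) (elEnv env eb) fun q => eb q.1 q.2 :=
  mem (.inl rfl)

theorem foldLift {m' : (Σ γ, α γ × β γ) → ℕ} (h : PT m env f) (hm : ∀ q, m q.1 ≤ m' q) :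
    PT m' (foldEnv env ea eb) fun q => f q.1 :=
  (h.reindex Sigma.fst fun g hg => .inr ⟨g, hg, rfl⟩).measure (.le_self hm)

theorem foldAcc {m' : (Σ γ, α γ × β γ) → ℕ} : PT m' (foldEnv env ea eb) fun q => ea q.1 q.2.1 :=
  mem (.inl (.inl rfl))

theorem foldElem {m' : (Σ γ, α γ × β γ) → ℕ} : PT m' (foldEnv env ea eb) fun q => eb q.1 q.2.2 :=
  mem (.inl (.inr rfl))

theorem ofElem {h : (Σ γ, β γ) → Data} (hh : PT (fun q => m q.1) (elEnv env eb) h) :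
    PT (fun q => m q.1) (foldEnv env ea eb) fun q => h ⟨q.1, q.2.2⟩ := by
  refine hh.reindex (fun q : Σ γ, α γ × β γ => (⟨q.1, q.2.2⟩ : Σ γ, β γ)) ?_
  rintro g (rfl | ⟨g, hg, rfl⟩)
  · exact .inl (.inr rfl)
  · exact .inr ⟨g, hg, rfl⟩

section Lists

variable {l : ∀ γ, List (β γ)}

theorem tail (h : PT m env fun γ => encList (eb γ) (l γ)) :
    PT m env fun γ => encList (eb γ) (l γ).tail := by
  obtain ⟨T, hT, h⟩ := h
  exact ⟨_, hT, h.tail⟩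

theorem head (h : PT m env fun γ => encList (eb γ) (l γ)) {b : ∀ γ, β γ}
    (hb : ∀ γ, (l γ).head? = some (b γ)) : PT m env fun γ => eb γ (b γ) := by
  refine fst (g := fun γ => encList (eb γ) (l γ).tail) (h.congr fun γ => ?_)
  have := hb γ
  cases hl : l γ with
  | nil => simp [hl] at this
  | cons a l' => simp only [hl, List.head?_cons, Option.some.injEq] at this; simp [this]

end Lists

end PT

/-- A bound for the cost of the body is needed only for accumulators that arise from a prefix of the
list. For arbitrary accumulators, such as lists of unbounded length, there would be none. -/
theorem foldCost_le_of_prefix {α β : Type} {f : α → β → α} {c : α → β → ℕ} {K : ℕ} {l : List β}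
    {a : α} (hc : ∀ l₁ b l₂, l = l₁ ++ b :: l₂ → c (l₁.foldl f a) b ≤ K) :
    foldCost f c l a ≤ l.length * (K + 1) := by
  induction l generalizing a with
  | nil => simp [foldCost]
  | cons b l ih =>
    have h1 := hc [] b l rfl
    have h2 := ih (a := f a b) fun l₁ b' l₂ h => hc (b :: l₁) b' l₂ (by rw [h]; rfl)
    simp only [List.foldl_nil] at h1
    simp only [foldCost, List.length_cons]
    nlinarith

namespace PT

variable {Γ : Type} {m : Γ → ℕ} {env : Set (Γ → Data)} {f g : Γ → Data} {α β : Γ → Type}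
  {ea : ∀ γ, α γ → Data} {eb : ∀ γ, β γ → Data}

/-- Folds, where the cost of the body is polynomial in a measure `m'` that is bounded, in the
course of the iteration, by a polynomial in `m`. -/
theorem foldl_of_prefix {l : ∀ γ, List (β γ)} {a : ∀ γ, α γ} {f : ∀ γ, α γ → β γ → α γ}
    (m' : (Σ γ, α γ × β γ) → ℕ) (M : Γ → ℕ) (hM : PolyBdd m M)
    (hlen : PolyBdd m fun γ => (l γ).length)
    (hm' : ∀ γ (l₁ : List (β γ)) (b : β γ) (l₂ : List (β γ)), l γ = l₁ ++ b :: l₂ → m' ⟨γ, l₁.foldl (f γ) (a γ), b⟩ ≤ M γ)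
    (hl : PT m env fun γ => encList (eb γ) (l γ)) (ha : PT m env fun γ => ea γ (a γ))
    (hf : PT m' (foldEnv env ea eb) fun q => ea q.1 (f q.1 q.2.1 q.2.2)) :
    PT m env fun γ => ea γ ((l γ).foldl (f γ) (a γ)) := by
  obtain ⟨Tl, hTl, hl⟩ := hl
  obtain ⟨Ta, hTa, ha⟩ := ha
  obtain ⟨Tf, ⟨c, k, hTf⟩, hf⟩ := hf
  refine ⟨_, ?_, hl.foldl ha hf⟩
  have hK : PolyBdd m fun γ => c * (M γ + 1) ^ k :=
    (PolyBdd.const c).mul ((hM.add (.const 1)).pow k)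
  refine (hTl.add hTa |>.add (hlen.mul (hK.add (.const 1)))).of_le fun γ => ?_
  refine Nat.add_le_add_left (foldCost_le_of_prefix fun l₁ b l₂ h => (hTf _).trans ?_) _
  exact Nat.mul_le_mul_left c (Nat.pow_le_pow_left (Nat.succ_le_succ (hm' γ l₁ b l₂ h)) k)

theorem foldl {l : ∀ γ, List (β γ)} {a : ∀ γ, α γ} {f : ∀ γ, α γ → β γ → α γ}
    (hlen : PolyBdd m fun γ => (l γ).length)
    (hl : PT m env fun γ => encList (eb γ) (l γ)) (ha : PT m env fun γ => ea γ (a γ))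
    (hf : PT (fun q => m q.1) (foldEnv env ea eb) fun q => ea q.1 (f q.1 q.2.1 q.2.2)) :
    PT m env fun γ => ea γ ((l γ).foldl (f γ) (a γ)) :=
  foldl_of_prefix _ m .self hlen (fun _ _ _ _ _ => le_rfl) hl ha hf

section Lists

variable {l l' : ∀ γ, List (β γ)}

theorem reverse (hl : PT m env fun γ => encList (eb γ) (l γ))
    (hlen : PolyBdd m fun γ => (l γ).length) : PT m env fun γ => encList (eb γ) (l γ).reverse := by
  refine (foldl (α := fun γ => List (β γ)) (ea := fun γ => encList (eb γ)) (a := fun _ => [])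
    (f := fun γ acc b => b :: acc) hlen hl nil ?_).congr fun γ => ?_
  · exact foldElem.cons foldAcc
  · simp

theorem foldr (hl : PT m env fun γ => encList (eb γ) (l γ))
    (hlen : PolyBdd m fun γ => (l γ).length)
    {a : ∀ γ, α γ} {f : ∀ γ, β γ → α γ → α γ} (ha : PT m env fun γ => ea γ (a γ))
    (hf : PT (fun q => m q.1) (foldEnv env ea eb) fun q => ea q.1 (f q.1 q.2.2 q.2.1)) :
    PT m env fun γ => ea γ ((l γ).foldr (f γ) (a γ)) := by
  refine (foldl (f := fun γ acc b => f γ b acc) (by simpa using hlen) (reverse hl hlen) ha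
    hf).congr fun γ => ?_
  simp

theorem append (hl : PT m env fun γ => encList (eb γ) (l γ))
    (hlen : PolyBdd m fun γ => (l γ).length)
    (hl' : PT m env fun γ => encList (eb γ) (l' γ)) :
    PT m env fun γ => encList (eb γ) (l γ ++ l' γ) := by
  refine (foldr (α := fun γ => List (β γ)) (ea := fun γ => encList (eb γ)) hl hlen
    (f := fun γ b acc => b :: acc) hl' ?_).congr fun γ => ?_
  · exact foldElem.cons foldAcc
  · simp

theorem map (hl : PT m env fun γ => encList (eb γ) (l γ))
    (hlen : PolyBdd m fun γ => (l γ).length)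
    {δ : Γ → Type} {ed : ∀ γ, δ γ → Data} {f : ∀ γ, β γ → δ γ}
    (hf : PT (fun q => m q.1) (elEnv env eb) fun q => ed q.1 (f q.1 q.2)) :
    PT m env fun γ => encList (ed γ) ((l γ).map (f γ)) := by
  refine (foldr (α := fun γ => List (δ γ)) (ea := fun γ => encList (ed γ)) hl hlen
    (a := fun _ => []) (f := fun γ b acc => f γ b :: acc) nil ?_).congr fun γ => ?_
  · exact (ofElem hf).cons foldAcc
  · induction l γ <;> simp_all

open Classical in
theorem filter (hl : PT m env fun γ => encList (eb γ) (l γ))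
    (hlen : PolyBdd m fun γ => (l γ).length)
    {P : ∀ γ, β γ → Prop}
    (hP : PT (fun q => m q.1) (elEnv env eb) fun q => encProp (P q.1 q.2)) :
    PT m env fun γ => encList (eb γ) ((l γ).filter fun b => P γ b) := by
  refine (foldr (α := fun γ => List (β γ)) (ea := fun γ => encList (eb γ)) hl hlen
    (a := fun _ => []) (f := fun γ b acc => if P γ b then b :: acc else acc) nil ?_).congr
    fun γ => ?_
  · refine (ite (ofElem hP) (foldElem.cons foldAcc) foldAcc).congr fun q => ?_
    simp only
    split_ifs <;> rfl
  · congr 1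
    induction l γ with
    | nil => rfl
    | cons b l ih => simp [List.filter_cons, ih]

theorem flatMap (hl : PT m env fun γ => encList (eb γ) (l γ))
    (hlen : PolyBdd m fun γ => (l γ).length)
    {δ : Γ → Type} {ed : ∀ γ, δ γ → Data} {f : ∀ γ, β γ → List (δ γ)}
    (hflen : PolyBdd (fun q : Σ γ, β γ => m q.1) fun q => (f q.1 q.2).length)
    (hf : PT (fun q => m q.1) (elEnv env eb) fun q => encList (ed q.1) (f q.1 q.2)) :
    PT m env fun γ => encList (ed γ) ((l γ).flatMap (f γ)) := by
  refine (foldr (α := fun γ => List (δ γ)) (ea := fun γ => encList (ed γ)) hl hlen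
    (a := fun _ => []) (f := fun γ b acc => f γ b ++ acc) nil ?_).congr fun γ => ?_
  · exact append (ofElem hf)
      (hflen.comp fun q : Σ γ, List (δ γ) × β γ => (⟨q.1, q.2.2⟩ : Σ γ, β γ)) foldAcc
  · congr 1
    induction l γ with
    | nil => rfl
    | cons b l ih => rw [List.foldr_cons, ih, List.flatMap_cons]

theorem length (hl : PT m env fun γ => encList (eb γ) (l γ))
    (hlen : PolyBdd m fun γ => (l γ).length) : PT m env fun γ => encNat (l γ).length := by
  refine (map (δ := fun _ => Unit) (ed := fun _ _ => .nil) (f := fun _ _ => ()) hl hlen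
    nil).congr fun γ => ?_
  simp [encNat, List.map_const']

end Lists

theorem eq_nil {l : ∀ γ, List (β γ)} (hl : PT m env fun γ => encList (eb γ) (l γ)) :
    PT m env fun γ => encProp (l γ = []) := by
  obtain ⟨T, hT, h⟩ := hl
  exact ⟨_, hT, h.eq_nil⟩

theorem drop {l : ∀ γ, List (β γ)} (hl : PT m env fun γ => encList (eb γ) (l γ)) {i : Γ → ℕ}
    (hi : PT m env fun γ => encNat (i γ)) (hi' : PolyBdd m i) :
    PT m env fun γ => encList (eb γ) ((l γ).drop (i γ)) := by
  refine (foldl (α := fun γ => List (β γ)) (ea := fun γ => encList (eb γ)) (β := fun _ => Unit)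
    (eb := fun _ _ => .nil) (l := fun γ => List.replicate (i γ) ()) (a := l)
    (f := fun γ acc _ => acc.tail) (by simpa using hi') hi hl ?_).congr fun γ => ?_
  · exact tail (l := fun q : Σ γ, List (β γ) × Unit => q.2.1) foldAcc
  · congr 1
    generalize l γ = l'
    generalize i γ = k
    induction k generalizing l' with
    | zero => simp
    | succ k ih => rw [List.replicate_succ, List.foldl_cons, ih, List.drop_tail]

theorem getElem {l : ∀ γ, List (β γ)} (hl : PT m env fun γ => encList (eb γ) (l γ)) {i : Γ → ℕ}
    (hi : PT m env fun γ => encNat (i γ)) (hi' : PolyBdd m i) {b : ∀ γ, β γ}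
    (hb : ∀ γ, (l γ)[i γ]? = some (b γ)) : PT m env fun γ => eb γ (b γ) :=
  head (drop hl hi hi') fun γ => by rw [List.head?_drop, hb]

theorem vec_get {n : Γ → ℕ} {g : ∀ γ, Fin (n γ) → Data} {v : ∀ γ, Fin (n γ)}
    (hg : PT m env fun γ => encVec (g γ)) (hv : PT m env fun γ => encNat (v γ))
    (hn : PolyBdd m n) : PT m env fun γ => g γ (v γ) :=
  getElem (l := fun γ => List.finRange (n γ)) (b := v) hg hv (hn.of_le fun γ => (v γ).2.le)
    fun γ => by simp

end PT

/-! ### Decidable properties -/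

/-- The truth value of `P γ` can be computed in time polynomial in `m γ`. -/
def PD {Γ : Type} (m : Γ → ℕ) (env : Set (Γ → Data)) (P : Γ → Prop) : Prop :=
  PT m env fun γ => encProp (P γ)

namespace PD

variable {Γ : Type} {m : Γ → ℕ} {env : Set (Γ → Data)} {P Q : Γ → Prop} {β : Γ → Type}
  {eb : ∀ γ, β γ → Data}

theorem congr (h : PD m env P) (hPQ : ∀ γ, P γ ↔ Q γ) : PD m env Q := by
  rwa [← funext fun γ => propext (hPQ γ)]

theorem lift (h : PD m env P) : PD (fun q => m q.1) (elEnv env eb) fun q => P q.1 :=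
  PT.lift h

theorem const (p : Prop) : PD m env fun _ => p := by
  by_cases h : p
  · exact (PT.nil.cons .nil).congr fun γ => by simp [encProp, h]
  · exact PT.nil.congr fun γ => by simp [encProp, h]

theorem not (hP : PD m env P) : PD m env fun γ => ¬ P γ :=
  (PT.ite hP .nil (PT.nil.cons .nil)).congr fun γ => by
    unfold encProp; split_ifs <;> simp_all

theorem and (hP : PD m env P) (hQ : PD m env Q) : PD m env fun γ => P γ ∧ Q γ :=
  (PT.ite hP hQ .nil).congr fun γ => by
    unfold encProp; split_ifs <;> simp_all

theorem or (hP : PD m env P) (hQ : PD m env Q) : PD m env fun γ => P γ ∨ Q γ :=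
  (hP.not.and hQ.not).not.congr fun γ => by tauto

theorem imp (hP : PD m env P) (hQ : PD m env Q) : PD m env fun γ => P γ → Q γ :=
  (hP.not.or hQ).congr fun γ => by tauto

theorem iff (hP : PD m env P) (hQ : PD m env Q) : PD m env fun γ => (P γ ↔ Q γ) :=
  ((hP.imp hQ).and (hQ.imp hP)).congr fun γ => by tauto

theorem exists_mem {l : ∀ γ, List (β γ)} {P : ∀ γ, β γ → Prop}
    (hl : PT m env fun γ => encList (eb γ) (l γ)) (hlen : PolyBdd m fun γ => (l γ).length)
    (hP : PD (fun q => m q.1) (elEnv env eb) fun q => P q.1 q.2) :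
    PD m env fun γ => ∃ b ∈ l γ, P γ b := by
  classical
  refine (PD.not (PT.eq_nil (PT.filter hl hlen hP))).congr fun γ => ?_
  simp

theorem forall_mem {l : ∀ γ, List (β γ)} {P : ∀ γ, β γ → Prop}
    (hl : PT m env fun γ => encList (eb γ) (l γ)) (hlen : PolyBdd m fun γ => (l γ).length)
    (hP : PD (fun q => m q.1) (elEnv env eb) fun q => P q.1 q.2) :
    PD m env fun γ => ∀ b ∈ l γ, P γ b :=
  (exists_mem (P := fun γ b => ¬ P γ b) hl hlen hP.not).not.congr fun γ => by push Not; rfl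

theorem wle {v w : Γ → ℚ} (hv : PT m env fun γ => .wt (v γ)) (hw : PT m env fun γ => .wt (w γ)) :
    PD m env fun γ => v γ ≤ w γ := by
  obtain ⟨T, hT, hv⟩ := hv
  obtain ⟨U, hU, hw⟩ := hw
  exact ⟨_, hT.add hU, hv.wle hw⟩

/-- In unary, `a ≤ b` means that nothing is left of a list of length `a` after `b` deletions. The
loop runs `b` times, so only `b` has to be bounded. -/
theorem nat_le {a b : Γ → ℕ} (ha : PT m env fun γ => encNat (a γ))
    (hb : PT m env fun γ => encNat (b γ)) (hb' : PolyBdd m b) : PD m env fun γ => a γ ≤ b γ :=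
  (PT.eq_nil (PT.drop (l := fun γ => List.replicate (a γ) ()) ha hb hb')).congr fun γ => by
    rw [List.drop_eq_nil_iff, List.length_replicate]

theorem nat_lt {a b : Γ → ℕ} (ha : PT m env fun γ => encNat (a γ)) (ha' : PolyBdd m a)
    (hb : PT m env fun γ => encNat (b γ)) : PD m env fun γ => a γ < b γ :=
  (nat_le hb ha ha').not.congr fun γ => by omega

theorem nat_eq {a b : Γ → ℕ} (ha : PT m env fun γ => encNat (a γ)) (ha' : PolyBdd m a)
    (hb : PT m env fun γ => encNat (b γ)) (hb' : PolyBdd m b) : PD m env fun γ => a γ = b γ :=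
  ((nat_le ha hb hb').and (nat_le hb ha ha')).congr fun γ => by omega

end PD

namespace PT

variable {Γ : Type} {m : Γ → ℕ} {env : Set (Γ → Data)} {a b : Γ → ℕ}

theorem nat_zero : PT m env fun _ => encNat 0 := nil

theorem nat_succ (ha : PT m env fun γ => encNat (a γ)) : PT m env fun γ => encNat (a γ + 1) :=
  (nil.cons ha).congr fun γ => by simp [encNat, List.replicate_succ]

theorem nat_pred (ha : PT m env fun γ => encNat (a γ)) : PT m env fun γ => encNat (a γ - 1) :=
  (tail (l := fun γ => List.replicate (a γ) ()) ha).congr fun γ => by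
    rw [List.tail_replicate]; rfl

theorem nat_add (ha : PT m env fun γ => encNat (a γ)) (ha' : PolyBdd m a)
    (hb : PT m env fun γ => encNat (b γ)) : PT m env fun γ => encNat (a γ + b γ) :=
  (append (l := fun γ => List.replicate (a γ) ()) (l' := fun γ => List.replicate (b γ) ()) ha
    (by simpa using ha') hb).congr fun γ => by simp [encNat]

theorem nat_mul (ha : PT m env fun γ => encNat (a γ)) (ha' : PolyBdd m a)
    (hb : PT m env fun γ => encNat (b γ)) (hb' : PolyBdd m b) :
    PT m env fun γ => encNat (a γ * b γ) :=
  (flatMap (l := fun γ => List.replicate (a γ) ()) (δ := fun _ => Unit)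
    (f := fun γ _ => List.replicate (b γ) ()) ha (by simpa using ha')
    (by simpa using hb'.comp (Sigma.fst : (Σ _ : Γ, Unit) → Γ))
    hb.lift).congr fun γ => by
      unfold encNat
      congr 1
      apply List.eq_replicate_of_mem (a := ()) (by simp) |>.trans
      simp

theorem nat_min (ha : PT m env fun γ => encNat (a γ))
    (hb : PT m env fun γ => encNat (b γ)) (hb' : PolyBdd m b) :
    PT m env fun γ => encNat (min (a γ) (b γ)) :=
  (ite (PD.nat_le ha hb hb') ha hb).congr fun γ => by
    rw [min_def]; split_ifs <;> rfl

end PT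

/-! ### Vertices and sets of vertices -/

/-- The list of the elements of `Fin n` is available. -/
structure HasVerts {Γ : Type} (m : Γ → ℕ) (env : Set (Γ → Data)) (n : Γ → ℕ) : Prop where
  verts : PT m env fun γ => encVec fun v : Fin (n γ) => encNat v
  bdd : PolyBdd m n

/-- The data available in a loop over `Fin n`. -/
abbrev finEnv {Γ : Type} (env : Set (Γ → Data)) (n : Γ → ℕ) : Set ((Σ γ, Fin (n γ)) → Data) :=
  elEnv env fun _ v => encNat v

section Verts

variable {Γ : Type} {m : Γ → ℕ} {env : Set (Γ → Data)} {n : Γ → ℕ}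

theorem HasVerts.lift {β : Γ → Type} {eb : ∀ γ, β γ → Data} (h : HasVerts m env n) :
    HasVerts (fun q => m q.1) (elEnv env eb) fun q => n q.1 :=
  ⟨h.verts.lift, h.bdd.comp _⟩

theorem HasVerts.foldLift {α β : Γ → Type} {ea : ∀ γ, α γ → Data} {eb : ∀ γ, β γ → Data}
    {m' : (Σ γ, α γ × β γ) → ℕ} (h : HasVerts m env n) (hm : ∀ q, m q.1 ≤ m' q) :
    HasVerts m' (foldEnv env ea eb) fun q => n q.1 :=
  ⟨h.verts.foldLift hm, (PolyBdd.le_self hm).trans (h.bdd.comp _)⟩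

theorem HasVerts.len (h : HasVerts m env n) :
    PolyBdd m fun γ => (List.finRange (n γ)).length := by
  simpa using h.bdd

theorem PT.vec (h : HasVerts m env n) {g : ∀ γ, Fin (n γ) → Data}
    (hg : PT (fun q => m q.1) (finEnv env n) fun q => g q.1 q.2) :
    PT m env fun γ => encVec (g γ) :=
  (PT.map (δ := fun _ => Data) (ed := fun _ x => x) h.verts h.len hg).congr fun γ => by
    simp [encVec, encList, Function.comp_def]

theorem PD.exists_fin (h : HasVerts m env n) {P : ∀ γ, Fin (n γ) → Prop}
    (hP : PD (fun q => m q.1) (finEnv env n) fun q => P q.1 q.2) :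
    PD m env fun γ => ∃ v, P γ v :=
  (PD.exists_mem h.verts h.len hP).congr fun γ => by simp

theorem PD.forall_fin (h : HasVerts m env n) {P : ∀ γ, Fin (n γ) → Prop}
    (hP : PD (fun q => m q.1) (finEnv env n) fun q => P q.1 q.2) :
    PD m env fun γ => ∀ v, P γ v :=
  (PD.forall_mem h.verts h.len hP).congr fun γ => by simp

theorem PT.set (h : HasVerts m env n) {X : ∀ γ, Finset (Fin (n γ))} {P : ∀ γ, Fin (n γ) → Prop}
    (hP : PD (fun q => m q.1) (finEnv env n) fun q => P q.1 q.2)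
    (hX : ∀ γ v, v ∈ X γ ↔ P γ v) : PT m env fun γ => encSet (X γ) :=
  PT.vec h (PD.congr hP fun q => (hX q.1 q.2).symm)

theorem PD.mem_set (h : HasVerts m env n) {X : ∀ γ, Finset (Fin (n γ))} {v : ∀ γ, Fin (n γ)}
    (hX : PT m env fun γ => encSet (X γ)) (hv : PT m env fun γ => encNat (v γ)) :
    PD m env fun γ => v γ ∈ X γ :=
  PT.vec_get (g := fun γ v => encProp (v ∈ X γ)) hX hv h.bdd

theorem PT.card_set (h : HasVerts m env n) {X : ∀ γ, Finset (Fin (n γ))}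
    (hX : PT m env fun γ => encSet (X γ)) : PT m env fun γ => encNat (X γ).card := by
  classical
  refine (PT.length (PT.filter (P := fun γ v => v ∈ X γ) h.verts h.len
    (PD.mem_set h.lift hX.lift PT.elem)) (h.bdd.of_le fun γ => ?_)).congr fun γ => ?_
  · exact (List.length_filter_le _ _).trans (by simp)
  · congr 1
    rw [← List.toFinset_card_of_nodup ((List.nodup_finRange _).filter _)]
    congr 1
    ext; simp

theorem PD.fin_eq (h : HasVerts m env n) {u v : ∀ γ, Fin (n γ)}
    (hu : PT m env fun γ => encNat (u γ)) (hv : PT m env fun γ => encNat (v γ)) :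
    PD m env fun γ => u γ = v γ :=
  (PD.nat_eq hu (h.bdd.of_le fun γ => (u γ).2.le) hv (h.bdd.of_le fun γ => (v γ).2.le)).congr
    fun γ => Fin.ext_iff.symm

theorem PD.fin_lt (h : HasVerts m env n) {u v : ∀ γ, Fin (n γ)}
    (hu : PT m env fun γ => encNat (u γ)) (hv : PT m env fun γ => encNat (v γ)) :
    PD m env fun γ => u γ < v γ :=
  (PD.nat_lt hu (h.bdd.of_le fun γ => (u γ).2.le) hv).congr
    fun γ => Fin.lt_def.symm

theorem PolyBdd.card (h : HasVerts m env n) (X : ∀ γ, Finset (Fin (n γ))) :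
    PolyBdd m fun γ => (X γ).card :=
  h.bdd.of_le fun γ => by simpa using Finset.card_le_univ (X γ)

end Verts


/-! ### Intermediate results, and running times with a distinguished factor. -/

namespace Computes

variable {Γ : Type} {env : Set (Γ → Data)} {f g : Γ → Data} {T T' : Γ → ℕ}

/-- Storing an intermediate result. -/
theorem bind {Tf Tg : Γ → ℕ} (hg : Computes env g Tg) (hf : Computes (insert g env) f Tf) :
    Computes env f fun γ => Tg γ + Tf γ := by
  classical
  obtain ⟨d, hg⟩ := hg
  obtain ⟨c, hf⟩ := hf
  refine ⟨c + d + 4, fun ρ k hk hρ => ?_⟩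
  obtain ⟨q, hq⟩ := hg ρ k hk hρ
  obtain ⟨p, hp⟩ := hf (fun h => if h = g then k else ρ h) (k + 1) (by omega) fun h hh => by
    split_ifs with e
    · omega
    · have := hρ h (hh.resolve_left e); omega
  refine ⟨.seq q (.seq p (.assign k (.var (k + 1)))), fun s γ hs hr => ?_⟩
  refine (hq s γ hs hr).seq' le_rfl (b' := c * (Tf γ + 1) + 2 + 1) (by nlinarith)
    fun s₁ he₁ hf₁ h₁ => ?_
  have hs₁ := hs.extends he₁
  refine (hp s₁ γ hs₁ fun h hh => ?_).seq' (b' := 2) (by omega) le_rfl fun s₂ he₂ hf₂ h₂ => ?_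
  · split_ifs with e
    · rw [e]; exact h₁
    · have hh := hh.resolve_left e
      rw [hf₁ _ (hρ h hh).1 (hρ h hh).2]; exact (hr h hh).extends he₁
  · refine (exec_copy hk le_rfl (h₂.lt (hs₁.extends he₂)).le).mono le_rfl le_rfl
      fun s' he _ e => ?_
    subst e
    simpa using h₂.extends he

/-- The first component of a pair, or of the null pointer. -/
theorem fst_of (hg : Computes env g T)
    (h : ∀ γ, (g γ = .nil ∧ f γ = .nil) ∨ ∃ b, g γ = .cons (f γ) b) : Computes env f T := by
  obtain ⟨c, hf⟩ := hg
  refine ⟨c + 4, fun ρ k hk hρ => ?_⟩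
  obtain ⟨p, hp⟩ := hf ρ k hk hρ
  refine ⟨.seq p (.assign k (.get 3 (.var k))), fun s γ hs hr => ?_⟩
  refine (hp s γ hs hr).seq' le_rfl (b' := 3) (by nlinarith) fun s₁ he₁ hf₁ h₁ => ?_
  have hs₁ := hs.extends he₁
  have key : Rep s₁ (f γ) (s₁.arr 3 (s₁.var k)) := by
    obtain ⟨e1, e2⟩ | ⟨b, e⟩ := h γ
    · rw [e1] at h₁
      rw [show s₁.var k = 0 from h₁, hs₁.fst_zero, e2]; rfl
    · rw [e] at h₁; exact h₁.2.2.1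
  refine (exec_get hk le_rfl (h₁.lt hs₁).le (key.lt hs₁).le).mono le_rfl le_rfl
    fun s' he _ e => ?_
  subst e
  simpa using key.extends he

/-- The second component of a pair, or of the null pointer. -/
theorem snd_of (hg : Computes env g T)
    (h : ∀ γ, (g γ = .nil ∧ f γ = .nil) ∨ ∃ a, g γ = .cons a (f γ)) : Computes env f T := by
  obtain ⟨c, hf⟩ := hg
  refine ⟨c + 4, fun ρ k hk hρ => ?_⟩
  obtain ⟨p, hp⟩ := hf ρ k hk hρ
  refine ⟨.seq p (.assign k (.get 4 (.var k))), fun s γ hs hr => ?_⟩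
  refine (hp s γ hs hr).seq' le_rfl (b' := 3) (by nlinarith) fun s₁ he₁ hf₁ h₁ => ?_
  have hs₁ := hs.extends he₁
  have key : Rep s₁ (f γ) (s₁.arr 4 (s₁.var k)) := by
    obtain ⟨e1, e2⟩ | ⟨b, e⟩ := h γ
    · rw [e1] at h₁
      rw [show s₁.var k = 0 from h₁, hs₁.snd_zero, e2]; rfl
    · rw [e] at h₁; exact h₁.2.2.2
  refine (exec_get hk le_rfl (h₁.lt hs₁).le (key.lt hs₁).le).mono le_rfl le_rfl
    fun s' he _ e => ?_
  subst e
  simpa using key.extends he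

end Computes

/-- `f γ` can be computed in time `W γ` times a polynomial in `m γ`. -/
def CT {Γ : Type} (W m : Γ → ℕ) (env : Set (Γ → Data)) (f : Γ → Data) : Prop :=
  ∃ T, PolyBdd m T ∧ Computes env f fun γ => W γ * T γ

namespace PT

variable {Γ : Type} {m W : Γ → ℕ} {env : Set (Γ → Data)} {f g : Γ → Data}

theorem weaken (h : PT m env f) (g : Γ → Data) : PT m (insert g env) f :=
  h.reindex id fun _ h => .inr h

theorem toCT (h : PT m env f) (hW : ∀ γ, 1 ≤ W γ) : CT W m env f := by
  obtain ⟨T, hT, h⟩ := h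
  refine ⟨T, hT, h.of_le 1 fun γ => ?_⟩
  have := Nat.mul_le_mul_right (T γ) (hW γ)
  omega

theorem fst_of (hg : PT m env g)
    (h : ∀ γ, (g γ = .nil ∧ f γ = .nil) ∨ ∃ b, g γ = .cons (f γ) b) : PT m env f := by
  obtain ⟨U, hU, hg⟩ := hg
  exact ⟨_, hU, hg.fst_of h⟩

theorem snd_of (hg : PT m env g)
    (h : ∀ γ, (g γ = .nil ∧ f γ = .nil) ∨ ∃ a, g γ = .cons a (f γ)) : PT m env f := by
  obtain ⟨U, hU, hg⟩ := hg
  exact ⟨_, hU, hg.snd_of h⟩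

end PT

namespace CT

variable {Γ : Type} {m W W' : Γ → ℕ} {env : Set (Γ → Data)} {f g : Γ → Data} {α β : Γ → Type}
  {ea : ∀ γ, α γ → Data} {eb : ∀ γ, β γ → Data}

theorem congr (h : CT W m env f) (hfg : ∀ γ, f γ = g γ) : CT W m env g := by
  rwa [← funext hfg]

theorem mono (h : CT W m env f) (hW : ∀ γ, W γ ≤ W' γ) : CT W' m env f := by
  obtain ⟨T, hT, h⟩ := h
  exact ⟨T, hT, h.of_le 1 fun γ => by
    have := Nat.mul_le_mul_right (T γ) (hW γ); omega⟩

theorem reindex {Δ : Type} {env' : Set (Δ → Data)} (h : CT W m env f) (π : Δ → Γ)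
    (henv : ∀ g ∈ env, (fun δ => g (π δ)) ∈ env') :
    CT (fun δ => W (π δ)) (fun δ => m (π δ)) env' fun δ => f (π δ) := by
  obtain ⟨T, hT, h⟩ := h
  exact ⟨_, hT.comp π, h.reindex π henv⟩

theorem cons (hf : CT W m env f) (hg : CT W m env g) :
    CT W m env fun γ => .cons (f γ) (g γ) := by
  obtain ⟨T, hT, hf⟩ := hf
  obtain ⟨U, hU, hg⟩ := hg
  exact ⟨_, hT.add hU, (hf.cons hg).of_le 1 fun γ => by
    have := mul_add (W γ) (T γ) (U γ); omega⟩

theorem bind (hg : CT W m env g) (hf : CT W m (insert g env) f) : CT W m env f := by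
  obtain ⟨T, hT, hf⟩ := hf
  obtain ⟨U, hU, hg⟩ := hg
  exact ⟨_, hU.add hT, (hg.bind hf).of_le 1 fun γ => by
    have := mul_add (W γ) (U γ) (T γ); omega⟩

open Classical in
theorem ite {P : Γ → Prop} (hP : CT W m env fun γ => encProp (P γ)) (hf : CT W m env f)
    (hg : CT W m env g) : CT W m env fun γ => if P γ then f γ else g γ := by
  obtain ⟨S, hS, hP⟩ := hP
  obtain ⟨T, hT, hf⟩ := hf
  obtain ⟨U, hU, hg⟩ := hg
  exact ⟨_, hS.add (hT.add hU), (hP.ite hf hg).of_le 1 fun γ => by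
    have := mul_add (W γ) (S γ) (T γ + U γ)
    have := mul_add (W γ) (T γ) (U γ)
    split_ifs <;> omega⟩

/-- The distinguished factor and the polynomial part are bounded separately: `w'` dominates the
factor of one run of the body, `M` its polynomial measure, both only for accumulators that occur.
The length of the list enters the factor `W` rather than the polynomial. -/
theorem foldl_of_prefix {l : ∀ γ, List (β γ)} {a : ∀ γ, α γ} {f : ∀ γ, α γ → β γ → α γ}
    (w m' : (Σ γ, α γ × β γ) → ℕ) (w' M : Γ → ℕ) (hM : PolyBdd m M)
    (hw : ∀ γ, (l γ).length * w' γ ≤ W γ) (hw1 : ∀ γ, 1 ≤ w' γ)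
    (hwm : ∀ γ (l₁ : List (β γ)) (b : β γ) (l₂ : List (β γ)), l γ = l₁ ++ b :: l₂ →
      w ⟨γ, l₁.foldl (f γ) (a γ), b⟩ ≤ w' γ ∧ m' ⟨γ, l₁.foldl (f γ) (a γ), b⟩ ≤ M γ)
    (hl : CT W m env fun γ => encList (eb γ) (l γ)) (ha : CT W m env fun γ => ea γ (a γ))
    (hf : CT w m' (foldEnv env ea eb) fun q => ea q.1 (f q.1 q.2.1 q.2.2)) :
    CT W m env fun γ => ea γ ((l γ).foldl (f γ) (a γ)) := by
  obtain ⟨Tl, hTl, hl⟩ := hl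
  obtain ⟨Ta, hTa, ha⟩ := ha
  obtain ⟨Tf, ⟨c, k, hTf⟩, hf⟩ := hf
  have hK : PolyBdd m fun γ => c * (M γ + 1) ^ k :=
    (PolyBdd.const c).mul ((hM.add (.const 1)).pow k)
  refine ⟨fun γ => Tl γ + Ta γ + (c * (M γ + 1) ^ k + 1), (hTl.add hTa).add (hK.add (.const 1)),
    (hl.foldl ha hf).of_le 1 fun γ => ?_⟩
  have h := foldCost_le_of_prefix (f := f γ) (l := l γ) (a := a γ)
    (c := fun a b => w ⟨γ, a, b⟩ * Tf ⟨γ, a, b⟩) (K := w' γ * (c * (M γ + 1) ^ k))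
    fun l₁ b l₂ h => by
      obtain ⟨h1, h2⟩ := hwm γ l₁ b l₂ h
      refine Nat.mul_le_mul h1 ((hTf _).trans ?_)
      exact Nat.mul_le_mul_left c (Nat.pow_le_pow_left (Nat.succ_le_succ h2) k)
  have h1 : (l γ).length * (w' γ * (c * (M γ + 1) ^ k) + 1) ≤
      W γ * (c * (M γ + 1) ^ k + 1) := by
    refine le_trans ?_ (Nat.mul_le_mul_right _ (hw γ))
    rw [mul_assoc]
    refine Nat.mul_le_mul_left _ ?_
    have := hw1 γ
    rw [mul_add]
    omega
  have h2 := mul_add (W γ) (Tl γ + Ta γ) (c * (M γ + 1) ^ k + 1)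
  have h3 := mul_add (W γ) (Tl γ) (Ta γ)
  beta_reduce
  omega

theorem exists_mem {l : ∀ γ, List (β γ)} {P : ∀ γ, β γ → Prop} (hW : ∀ γ, 1 ≤ W γ)
    (hw : ∀ γ, (l γ).length ≤ W γ)
    (hl : CT W m env fun γ => encList (eb γ) (l γ))
    (hP : PD (fun q => m q.1) (elEnv env eb) fun q => P q.1 q.2) :
    CT W m env fun γ => encProp (∃ b ∈ l γ, P γ b) := by
  refine (foldl_of_prefix (α := fun _ => Prop) (ea := fun _ => encProp) (a := fun _ => False)
    (f := fun γ acc b => acc ∨ P γ b) (fun _ => 1) (fun q => m q.1) (fun _ => 1) m .self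
    (by simpa using hw) (fun _ => le_rfl) (fun γ _ _ _ _ => ⟨le_rfl, le_rfl⟩) hl
    ((PD.const False).toCT hW) (PT.toCT ?_ fun _ => le_rfl)).congr fun γ => ?_
  · exact PD.or PT.foldAcc (PT.ofElem hP)
  · congr 1
    have : ∀ (p : Prop) (l : List (β γ)), l.foldl (fun acc b => acc ∨ P γ b) p =
        (p ∨ ∃ b ∈ l, P γ b) := by
      intro p l
      induction l generalizing p with
      | nil => simp
      | cons b l ih => simp [ih, or_assoc]
    simp [this]

end CT

/-! ### Tries -/

/-- Binary tries with values of type `α` at the nodes. -/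
inductive Trie (α : Type) : Type
  | empty
  | node (a : α) (l r : Trie α)

namespace Trie

variable {α : Type}

/-- The left or right subtree. -/
def child : Trie (List α) → Bool → Trie (List α)
  | empty, _ => empty
  | node _ l _, false => l
  | node _ _ r, true => r

/-- The value at the root. -/
def val : Trie (List α) → List α
  | empty => []
  | node a _ _ => a

/-- The value stored at `k`. -/
def lookup (t : Trie (List α)) (k : List Bool) : List α := (k.foldl child t).val

/-- Change of the value at `k`. -/
def insert (t : Trie (List α)) : List Bool → List α → Trie (List α)
  | [], a => node a (t.child false) (t.child true)
  | false :: k, a => node t.val ((t.child false).insert k a) (t.child true)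
  | true :: k, a => node t.val (t.child false) ((t.child true).insert k a)

theorem lookup_empty (k : List Bool) : (empty : Trie (List α)).lookup k = [] := by
  have : k.foldl child (empty : Trie (List α)) = empty := by
    induction k with
    | nil => rfl
    | cons b k ih => exact ih
  rw [lookup, this]; rfl

theorem lookup_insert (t : Trie (List α)) (k : List Bool) (a : List α) {k' : List Bool}
    (h : k.length = k'.length) :
    (t.insert k a).lookup k' = if k = k' then a else t.lookup k' := by
  induction k generalizing t k' with
  | nil =>
    obtain rfl : k' = [] := List.length_eq_zero_iff.1 h.symm
    rfl
  | cons b k ih =>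
    obtain _ | ⟨b', k'⟩ := k'
    · simp at h
    have ih' := fun t => ih t (k' := k') (by simpa using h)
    have h1 : ∀ (t : Trie (List α)) b k, t.lookup (b :: k) = (t.child b).lookup k :=
      fun _ _ _ => rfl
    rw [h1, h1]
    cases b <;> cases b' <;> simp [insert, child, ih']

/-- Codes of tries. -/
def enc (e : List α → Data) : Trie (List α) → Data
  | empty => .nil
  | node a l r => .cons (e a) (.cons (l.enc e) (r.enc e))

/-- Reconstruction of a trie along a path to the root. -/
def rebuild (t : Trie (List α)) (p : Trie (List α) × Bool) : Trie (List α) :=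
  node p.1.val (if p.2 = true then p.1.child false else t) (if p.2 = true then t else p.1.child true)

/-- Folds are the only available recursion. Hence the key is followed downwards while the path is
recorded on a stack, and the nodes of the path are rebuilt on the way back. -/
theorem insert_eq_foldl (t : Trie (List α)) (k : List Bool) (a : List α) :
    t.insert k a = (k.foldl (fun p b => (p.1.child b, (p.1, b) :: p.2)) (t, [])).2.foldl rebuild
      (node a ((k.foldl child t).child false) ((k.foldl child t).child true)) := by
  have h : ∀ (k : List Bool) (t : Trie (List α)) (s : List (Trie (List α) × Bool)),
      ((k.foldl (fun p b => (p.1.child b, (p.1, b) :: p.2)) (t, s)).2.foldl rebuild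
      (node a ((k.foldl child t).child false) ((k.foldl child t).child true))) =
      s.foldl rebuild (t.insert k a) := by
    intro k
    induction k with
    | nil => intro t s; rfl
    | cons b k ih =>
      intro t s
      simp only [List.foldl_cons, ih]
      cases b <;> simp [insert, rebuild]
  simpa using (h k t []).symm

end Trie

/-- Codes of bit strings. -/
noncomputable def encBits : List Bool → Data := encList fun b => encProp (b = true)

namespace PT

variable {Γ : Type} {m : Γ → ℕ} {env : Set (Γ → Data)} {α : Γ → Type}
  {ea : ∀ γ, α γ → Data} {t : ∀ γ, Trie (List (α γ))}

theorem trie_val (ht : PT m env fun γ => (t γ).enc (encList (ea γ))) :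
    PT m env fun γ => encList (ea γ) (t γ).val :=
  fst_of ht fun γ => by cases t γ <;> simp [Trie.enc, Trie.val]

theorem trie_child_false (ht : PT m env fun γ => (t γ).enc (encList (ea γ))) :
    PT m env fun γ => ((t γ).child false).enc (encList (ea γ)) :=
  fst_of (snd_of (f := fun γ => match t γ with
    | .empty => .nil
    | .node _ l r => .cons (l.enc (encList (ea γ))) (r.enc (encList (ea γ)))) ht fun γ => by
      cases t γ <;> simp [Trie.enc]) fun γ => by cases t γ <;> simp [Trie.enc, Trie.child]

theorem trie_child_true (ht : PT m env fun γ => (t γ).enc (encList (ea γ))) :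
    PT m env fun γ => ((t γ).child true).enc (encList (ea γ)) :=
  snd_of (snd_of (f := fun γ => match t γ with
    | .empty => .nil
    | .node _ l r => .cons (l.enc (encList (ea γ))) (r.enc (encList (ea γ)))) ht fun γ => by
      cases t γ <;> simp [Trie.enc]) fun γ => by cases t γ <;> simp [Trie.enc, Trie.child]

theorem trie_child {b : Γ → Bool} (ht : PT m env fun γ => (t γ).enc (encList (ea γ)))
    (hb : PD m env fun γ => b γ = true) :
    PT m env fun γ => ((t γ).child (b γ)).enc (encList (ea γ)) :=
  (ite hb (trie_child_true ht) (trie_child_false ht)).congr fun γ => by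
    cases b γ <;> simp

theorem trie_walk {k : Γ → List Bool} (ht : PT m env fun γ => (t γ).enc (encList (ea γ)))
    (hk : PT m env fun γ => encBits (k γ)) (hk' : PolyBdd m fun γ => (k γ).length) :
    PT m env fun γ => ((k γ).foldl Trie.child (t γ)).enc (encList (ea γ)) := by
  refine foldl (α := fun γ => Trie (List (α γ))) (β := fun _ => Bool)
    (ea := fun γ t => t.enc (encList (ea γ))) (eb := fun _ b => encProp (b = true))
    (f := fun _ => Trie.child) hk' hk ht ?_
  refine trie_child (t := fun q : Σ γ, Trie (List (α γ)) × Bool => q.2.1) (b := fun q => q.2.2)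
    (ea := fun q => ea q.1) ?_ ?_
  · exact foldAcc
  · exact foldElem

theorem trie_lookup {k : Γ → List Bool} (ht : PT m env fun γ => (t γ).enc (encList (ea γ)))
    (hk : PT m env fun γ => encBits (k γ)) (hk' : PolyBdd m fun γ => (k γ).length) :
    PT m env fun γ => encList (ea γ) ((t γ).lookup (k γ)) :=
  trie_val (trie_walk ht hk hk')

/-- The cost depends on the length of the key and not on the size of the table. A search through a
list of entries would multiply the running time by the number of neighbor classes and spoil the
third power. -/
theorem trie_insert {k : Γ → List Bool} {a : ∀ γ, List (α γ)}
    (ht : PT m env fun γ => (t γ).enc (encList (ea γ)))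
    (hk : PT m env fun γ => encBits (k γ)) (hk' : PolyBdd m fun γ => (k γ).length)
    (ha : PT m env fun γ => encList (ea γ) (a γ)) :
    PT m env fun γ => ((t γ).insert (k γ) (a γ)).enc (encList (ea γ)) := by
  let ep : ∀ γ, Trie (List (α γ)) × Bool → Data :=
    fun γ p => .cons (p.1.enc (encList (ea γ))) (encProp (p.2 = true))
  let es : ∀ γ, Trie (List (α γ)) × List (Trie (List (α γ)) × Bool) → Data :=
    fun γ p => .cons (p.1.enc (encList (ea γ))) (encList (ep γ) p.2)
  have hpath := foldl (α := fun γ => Trie (List (α γ)) × List (Trie (List (α γ)) × Bool))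
    (β := fun _ => Bool) (ea := es) (eb := fun _ b => encProp (b = true)) (f := fun _ p b => (p.1.child b, (p.1, b) :: p.2))
    (a := fun γ => (t γ, [])) hk' hk (ht.cons nil) (by
      have h1 : PT (fun q : Σ γ, (Trie (List (α γ)) × List (Trie (List (α γ)) × Bool)) × Bool =>
          m q.1) (foldEnv env es fun _ b => encProp (b = true)) fun q => .cons (q.2.1.1.enc (encList (ea q.1)))
            (encList (ep q.1) q.2.1.2) := foldAcc
      have h2 : PD (fun q : Σ γ, (Trie (List (α γ)) × List (Trie (List (α γ)) × Bool)) × Bool =>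
          m q.1) (foldEnv env es fun _ b => encProp (b = true)) fun q => q.2.2 = true := foldElem
      exact (trie_child h1.fst h2).cons ((h1.fst.cons h2).cons h1.snd))
  have hend := trie_walk ht hk hk'
  refine (foldl (α := fun γ => Trie (List (α γ))) (β := fun γ => Trie (List (α γ)) × Bool)
    (ea := fun γ t => t.enc (encList (ea γ))) (eb := ep) (f := fun _ => Trie.rebuild)
    (l := fun γ => ((k γ).foldl (fun p b => (p.1.child b, (p.1, b) :: p.2)) (t γ, [])).2)
    (a := fun γ => .node (a γ) (((k γ).foldl Trie.child (t γ)).child false)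
      (((k γ).foldl Trie.child (t γ)).child true)) (hk'.of_le fun γ => le_of_eq ?_) hpath.snd
      (ha.cons ((trie_child_false hend).cons (trie_child_true hend))) ?_).congr fun γ => ?_
  · have : ∀ (k : List Bool) (t : Trie (List (α γ))) s,
        (k.foldl (fun p b => (p.1.child b, (p.1, b) :: p.2)) (t, s)).2.length =
          s.length + k.length := by
      intro k
      induction k with
      | nil => simp
      | cons b k ih => intro t s; simp [ih]; omega
    simp [this]
  · have h1 : PT (fun q : Σ γ, Trie (List (α γ)) × (Trie (List (α γ)) × Bool) => m q.1)
        (foldEnv env (fun γ t => t.enc (encList (ea γ))) ep)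
        fun q => q.2.1.enc (encList (ea q.1)) := foldAcc
    have h2 : PT (fun q : Σ γ, Trie (List (α γ)) × (Trie (List (α γ)) × Bool) => m q.1)
        (foldEnv env (fun γ t => t.enc (encList (ea γ))) ep)
        fun q => .cons (q.2.2.1.enc (encList (ea q.1))) (encProp (q.2.2.2 = true)) := foldElem
    refine ((trie_val h2.fst).cons ((ite h2.snd (trie_child_false h2.fst) h1).cons
      (ite h2.snd h1 (trie_child_true h2.fst)))).congr fun q => ?_
    simp only [Trie.rebuild, Trie.enc]
    split_ifs <;> rfl
  · rw [Trie.insert_eq_foldl]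

end PT


/-! ### Operations on sets of vertices -/

section Definitions

variable {n : ℕ} (G : SimpleGraph (Fin n))

open Classical in
/-- The vertices of `X` with a neighbour in `R`. -/
noncomputable def touch (X R : Finset (Fin n)) : Finset (Fin n) :=
  X.filter fun v => ∃ u, u ∈ R ∧ G.Adj u v

open Classical in
/-- The vertices of `X` in `S` or with a neighbour in `S`. -/
noncomputable def grow (X S : Finset (Fin n)) : Finset (Fin n) :=
  X.filter fun v => v ∈ S ∨ ∃ u, u ∈ S ∧ G.Adj u v

/-- The vertices of `X` that can be reached from `S` within `X`. -/
noncomputable def reach (X S : Finset (Fin n)) : Finset (Fin n) :=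
  (List.finRange n).foldl (fun S _ => grow G X S) S

/-- Every vertex of `C` has a private neighbour outside of `A`. -/
def Irredundant (A C : Finset (Fin n)) : Prop :=
  C ⊆ A ∧ ∀ x, x ∈ C → ∃ u, u ∉ A ∧ ∀ y, y ∈ C → (G.Adj u y ↔ y = x)

open Classical in
/-- One step in the enumeration of the partitions of `S` into two irredundant sets. -/
noncomputable def splitStep (A S : Finset (Fin n)) (acc : List (Finset (Fin n) × Finset (Fin n)))
    (v : Fin n) : List (Finset (Fin n) × Finset (Fin n)) :=
  if v ∈ S then
    (acc.flatMap fun p => [(insert v p.1, p.2), (p.1, insert v p.2)]).filter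
      fun p => Irredundant G A p.1 ∧ Irredundant G A p.2
  else acc

/-- The partitions of `S` into two irredundant sets. -/
noncomputable def splitList (A S : Finset (Fin n)) : List (Finset (Fin n) × Finset (Fin n)) :=
  (List.finRange n).foldl (splitStep G A S) [(∅, ∅)]

open Classical in
/-- The vertices of `X` with at least two neighbours in `R`. -/
noncomputable def big (R X : Finset (Fin n)) : Finset (Fin n) :=
  X.filter fun v => 2 ≤ nbrCount G R v

open Classical in
/-- The vertices of `X` with exactly one neighbour in `R`. -/
noncomputable def one (R X : Finset (Fin n)) : Finset (Fin n) :=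
  X.filter fun v => nbrCount G R v = 1

open Classical in
/-- Twice the number of edges of `G[X]`. -/
noncomputable def adjPairs (X : Finset (Fin n)) : ℕ :=
  ∑ v, if v ∈ X then nbrCount G X v else 0

/-- No cut of `G[X]` with `M` and the neighbours of `R` on one side and the neighbours of `R'` on
the other one, or an even number of them, unless this property holds. -/
def Compat (X M R R' : Finset (Fin n)) : Prop :=
  ∀ v, v ∈ X → (v ∈ reach G X (M ∪ touch G X R) ↔ v ∉ reach G X (touch G X R'))

end Definitions

/-- Partial solutions: a set of vertices, a set of marked vertices in it, and its weight. -/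
structure Config (n : ℕ) : Type where
  X : Finset (Fin n)
  M : Finset (Fin n)
  w : ℚ

noncomputable def Config.enc {n : ℕ} (c : Config n) : Data :=
  .cons (encSet c.X) (.cons (encSet c.M) (.wt c.w))

/-- `b` is at least as good as `a`. -/
def Goal.le : Goal → ℚ → ℚ → Prop
  | .max, a, b => a ≤ b
  | .min, a, b => b ≤ a

/-! ### Invariants and feature vectors of partial solutions, elimination and sorting. -/

section Reduction

variable {n : ℕ} (G : SimpleGraph (Fin n))

/-- The invariants that determine the number of edges between `c.X` and a set `Y` that is equivalent
to `R`. -/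
def SameKey (A R : Finset (Fin n)) (c c' : Config n) : Prop :=
  c.X.card = c'.X.card ∧ adjPairs G c.X = adjPairs G c'.X ∧
    (one G R c.X).card = (one G R c'.X).card ∧ c.M.card = c'.M.card ∧
    ∀ u, u ∉ A → nbrCount G (big G R c.X) u = nbrCount G (big G R c'.X) u

open Classical in
/-- The parities of the numbers of cuts. -/
noncomputable def feature (P : List (Finset (Fin n) × Finset (Fin n))) (c : Config n) :
    Fin P.length → ZMod 2 :=
  fun j => if Compat G c.X c.M P[j].1 P[j].2 then 1 else 0

end Reduction

/-- `v` is non-zero at the position of the first non-zero entry of `r`. -/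
def Hits {ℓ : ℕ} (r v : Fin ℓ → ZMod 2) : Prop :=
  ∃ j, r j = 1 ∧ (∀ i, i < j → ¬ r i = 1) ∧ v j = 1

section Elimination

variable {c : Type} {ℓ : ℕ} (same : c → c → Prop) (φ : c → Fin ℓ → ZMod 2)

open Classical in
/-- The result of the elimination of `x` with the rows in the list. -/
noncomputable def residual (kept : List (c × (Fin ℓ → ZMod 2))) (x : c) : Fin ℓ → ZMod 2 :=
  kept.foldl (fun v y => if same x y.1 ∧ Hits y.2 v then v + y.2 else v) (φ x)

-- A zero residual means that the feature vector of `x` is a sum of feature vectors of elements kept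
-- before in the same class; then `x` is redundant. Otherwise the residual is stored as a new row
-- together with `x`.
open Classical in
noncomputable def elimStep (kept : List (c × (Fin ℓ → ZMod 2))) (x : c) :
    List (c × (Fin ℓ → ZMod 2)) :=
  if ∃ j, residual same φ kept x j = 1 then kept ++ [(x, residual same φ kept x)] else kept

/-- Gaussian elimination over `GF(2)`, separately for each class of `same`. -/
noncomputable def elim (l : List c) : List c :=
  (l.foldl (elimStep same φ) []).map Prod.fst

end Elimination

section Sorting

variable {n : ℕ} (goal : Goal)

open Classical in
noncomputable def sortStep (acc : List (Config n)) (c : Config n) : List (Config n) :=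
  (acc.filter fun a => goal.le c.w a.w) ++ c :: acc.filter fun a => ¬ goal.le c.w a.w

/-- Sorting by weight, the best first. -/
noncomputable def sortConfigs (l : List (Config n)) : List (Config n) :=
  l.foldl (sortStep goal) []

end Sorting

open Classical in
/-- A small representative subset of `l`. -/
noncomputable def reduce {n : ℕ} (G : SimpleGraph (Fin n)) (goal : Goal) (A R : Finset (Fin n))
    (P : List (Finset (Fin n) × Finset (Fin n))) (l : List (Config n)) : List (Config n) :=
  elim (SameKey G A R) (feature G P)
    (sortConfigs goal (l.filter fun c => ¬ splitList G A (big G R c.X) = []))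

/-! ### Elementary properties of the enumerations -/

section Lengths

variable {n : ℕ} {G : SimpleGraph (Fin n)}

theorem nbrCount_eq_card [DecidableRel G.Adj] (X : Finset (Fin n)) (u : Fin n) :
    nbrCount G X u = (X.filter fun v => G.Adj u v).card := by
  rw [nbrCount, ← Set.ncard_coe_finset]
  congr 1
  ext v
  simp [and_comm]

/-- Two different subsets of `C` are separated by the private neighbor of an element of their
difference, so all subsets of `C` are pairwise inequivalent. -/
theorem Irredundant.two_pow_le {A C : Finset (Fin n)} (h : Irredundant G A C) :
    2 ^ C.card ≤ nec G 1 A := by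
  classical
  rw [← Finset.card_powerset, nec, ← Nat.card_eq_finsetCard]
  refine Nat.card_le_card_of_injective (fun D => Quotient.mk (nbrSetoid G 1 A)
    ⟨D.1, (Finset.mem_powerset.1 D.2).trans h.1⟩) ?_
  have key : ∀ D D' : Finset (Fin n), D ⊆ C → D' ⊆ C →
      (∀ u ∉ A, min 1 (nbrCount G D u) = min 1 (nbrCount G D' u)) → D ⊆ D' := by
    intro D D' hD hD' hh x hx
    obtain ⟨u, hu, hux⟩ := h.2 x (hD hx)
    have h1 := hh u hu
    have h2 : 0 < nbrCount G D u := by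
      rw [nbrCount_eq_card, Finset.card_pos]
      exact ⟨x, by simp [hx, (hux x (hD hx)).2 rfl]⟩
    have h3 : 0 < nbrCount G D' u := by omega
    rw [nbrCount_eq_card, Finset.card_pos] at h3
    obtain ⟨y, hy⟩ := h3
    rw [Finset.mem_filter] at hy
    rw [← (hux y (hD' hy.1)).1 hy.2]
    exact hy.1
  rintro ⟨D, hD⟩ ⟨D', hD'⟩ hDD
  have hr := Quotient.exact hDD
  rw [Finset.mem_powerset] at hD hD'
  ext1
  exact (key D D' hD hD' hr).antisymm (key D' D hD' hD fun u hu => (hr u hu).symm)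

/-- Invariant after the vertices in `U` have been treated: the list consists of all partitions of `S
∩ U` into two irredundant sets. Pairs can be filtered at once because irredundance passes to
subsets, so no later extension repairs a bad pair. -/
theorem splitFold_spec {A S : Finset (Fin n)} :
    ∀ (l : List (Fin n)) (U : Finset (Fin n)) (acc : List (Finset (Fin n) × Finset (Fin n))),
      l.Nodup → (∀ v ∈ l, v ∉ U) →
      (acc.length ≤ 2 ^ (S ∩ U).card ∧ ∀ p : Finset (Fin n) × Finset (Fin n), p ∈ acc ↔
        Disjoint p.1 p.2 ∧ p.1 ∪ p.2 = S ∩ U ∧ Irredundant G A p.1 ∧ Irredundant G A p.2) →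
      ((l.foldl (splitStep G A S) acc).length ≤ 2 ^ (S ∩ (U ∪ l.toFinset)).card ∧
        ∀ p : Finset (Fin n) × Finset (Fin n), p ∈ l.foldl (splitStep G A S) acc ↔
        Disjoint p.1 p.2 ∧ p.1 ∪ p.2 = S ∩ (U ∪ l.toFinset) ∧ Irredundant G A p.1 ∧
          Irredundant G A p.2) := by
  classical
  intro l
  induction l with
  | nil => intro U acc _ _ h; simpa using h
  | cons v l ih =>
    intro U acc hnd hU ⟨hlen, hmem⟩
    rw [List.nodup_cons] at hnd
    have hvU := hU v (by simp)
    have e : U ∪ (v :: l).toFinset = insert v U ∪ l.toFinset := by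
      ext; simp
    rw [e, List.foldl_cons]
    refine ih _ _ hnd.2 (fun w hw => ?_) ?_
    · rw [Finset.mem_insert, not_or]
      exact ⟨fun h => hnd.1 (h ▸ hw), hU w (by simp [hw])⟩
    by_cases hv : v ∈ S
    · have hS : S ∩ insert v U = insert v (S ∩ U) := by
        rw [Finset.inter_insert_of_mem hv]
      have hvSU : v ∉ S ∩ U := by simp [hvU]
      -- A private neighbor stays private when other vertices are removed.
      have hirr : ∀ {C D : Finset (Fin n)}, Irredundant G A D → C ⊆ D → Irredundant G A C := by
        intro C D hD hCD
        refine ⟨hCD.trans hD.1, fun x hx => ?_⟩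
        obtain ⟨u, hu, h⟩ := hD.2 x (hCD hx)
        exact ⟨u, hu, fun y hy => h y (hCD hy)⟩
      simp only [splitStep, if_pos hv]
      constructor
      · rw [hS, Finset.card_insert_of_notMem hvSU, pow_succ]
        refine (List.length_filter_le _ _).trans ?_
        rw [List.length_flatMap]
        simp only [List.length_cons, List.length_nil, List.map_const', List.sum_replicate]
        simp only [smul_eq_mul]
        omega
      · intro p
        simp only [List.mem_filter, List.mem_flatMap, List.mem_cons, List.not_mem_nil, or_false,
          decide_eq_true_eq, hS]
        constructor
        · rintro ⟨⟨q, hq, rfl | rfl⟩, hi⟩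
          · obtain ⟨h1, h2, -, -⟩ := (hmem q).1 hq
            have hvq : v ∉ q.2 := fun h => hvSU (h2 ▸ Finset.mem_union_right _ h)
            refine ⟨by simp [Finset.disjoint_insert_left, hvq, h1], ?_, hi⟩
            rw [← h2, Finset.insert_union]
          · obtain ⟨h1, h2, -, -⟩ := (hmem q).1 hq
            have hvq : v ∉ q.1 := fun h => hvSU (h2 ▸ Finset.mem_union_left _ h)
            refine ⟨by simp [Finset.disjoint_insert_right, hvq, h1], ?_, hi⟩
            rw [← h2, Finset.union_insert]
        · rintro ⟨h1, h2, h3, h4⟩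
          refine ⟨?_, h3, h4⟩
          have hvp : v ∈ p.1 ∪ p.2 := h2 ▸ Finset.mem_insert_self _ _
          refine ⟨(p.1.erase v, p.2.erase v), (hmem _).2 ⟨?_, ?_, hirr h3 (Finset.erase_subset _ _),
            hirr h4 (Finset.erase_subset _ _)⟩, ?_⟩
          · exact h1.mono (Finset.erase_subset _ _) (Finset.erase_subset _ _)
          · simp only [← Finset.erase_union_distrib, h2, Finset.erase_insert hvSU]
          · rcases Finset.mem_union.1 hvp with h | h
            · left
              have h' : v ∉ p.2 := Finset.disjoint_left.1 h1 h
              simp [Finset.insert_erase h, Finset.erase_eq_of_notMem h']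
            · right
              have h' : v ∉ p.1 := Finset.disjoint_right.1 h1 h
              simp [Finset.insert_erase h, Finset.erase_eq_of_notMem h']
    · have hS : S ∩ insert v U = S ∩ U := Finset.inter_insert_of_notMem hv
      simp only [splitStep, if_neg hv, hS]
      exact ⟨hlen, hmem⟩

theorem splitFold_init {A S : Finset (Fin n)} (l : List (Fin n)) (hl : l.Nodup) :
    ((l.foldl (splitStep G A S) [(∅, ∅)]).length ≤ 2 ^ (S ∩ l.toFinset).card ∧
        ∀ p : Finset (Fin n) × Finset (Fin n), p ∈ l.foldl (splitStep G A S) [(∅, ∅)] ↔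
        Disjoint p.1 p.2 ∧ p.1 ∪ p.2 = S ∩ l.toFinset ∧ Irredundant G A p.1 ∧
          Irredundant G A p.2) := by
  have h0 : Irredundant G A ∅ := ⟨by simp, by simp⟩
  have := splitFold_spec (G := G) (A := A) (S := S) l ∅ [(∅, ∅)] hl (by simp) (by
    refine ⟨by simp, fun p => ?_⟩
    simp only [List.mem_singleton, Finset.inter_empty, Finset.union_eq_empty]
    constructor
    · rintro rfl; simp [h0]
    · rintro ⟨-, ⟨h1, h2⟩, -⟩; exact Prod.ext h1 h2)
  simpa using this

/-- A single surviving partition `C ∪ D` shows that the treated part of `S` has `|C| + |D|`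
elements, where `2 ^ |C|` and `2 ^ |D|` are at most `nec G 1 A`. So the intermediate lists are
short, even if `S` is large: in that case they become empty. -/
theorem splitFold_length_le {A S : Finset (Fin n)} (l : List (Fin n)) (hl : l.Nodup) :
    (l.foldl (splitStep G A S) [(∅, ∅)]).length ≤ nec G 1 A ^ 2 := by
  obtain ⟨h1, h2⟩ := splitFold_init (G := G) (A := A) (S := S) l hl
  cases h : l.foldl (splitStep G A S) [(∅, ∅)] with
  | nil => simp
  | cons p _ =>
    obtain ⟨h3, h4, h5, h6⟩ := (h2 p).1 (by simp [h])
    rw [← h]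
    refine h1.trans ?_
    rw [← h4, Finset.card_union_of_disjoint h3, pow_add, sq]
    exact Nat.mul_le_mul h5.two_pow_le h6.two_pow_le

theorem splitList_ne_nil_iff {A S : Finset (Fin n)} : splitList G A S ≠ [] ↔
    ∃ C D, Disjoint C D ∧ C ∪ D = S ∧ Irredundant G A C ∧ Irredundant G A D := by
  have h := (splitFold_init (G := G) (A := A) (S := S) (List.finRange n)
    (List.nodup_finRange n)).2
  rw [Ne, List.eq_nil_iff_forall_not_mem]
  push Not
  rw [Prod.exists]
  refine exists_congr fun C => exists_congr fun D => ?_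
  rw [splitList, h]
  simp

end Lengths

theorem length_sortStep {n : ℕ} (goal : Goal) (acc : List (Config n)) (c : Config n) :
    (sortStep goal acc c).length = acc.length + 1 := by
  classical
  unfold sortStep
  induction acc with
  | nil => simp
  | cons a acc ih =>
    by_cases h : goal.le c.w a.w
    · simp only [List.filter_cons, h, decide_true, if_true, not_true, decide_false,
        List.length_append, List.length_cons] at ih ⊢
      simp at ih ⊢
      omega
    · simp only [List.filter_cons, h, decide_false, not_false_eq_true, decide_true, if_true,
        List.length_append, List.length_cons] at ih ⊢
      simp at ih ⊢
      omega

theorem length_sortFold {n : ℕ} (goal : Goal) (l acc : List (Config n)) :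
    (l.foldl (sortStep goal) acc).length = acc.length + l.length := by
  induction l generalizing acc with
  | nil => simp
  | cons c l ih => simp [ih, length_sortStep]; omega

theorem length_elimFold {c : Type} {ℓ : ℕ} (same : c → c → Prop) (φ : c → Fin ℓ → ZMod 2)
    (l : List c) (acc : List (c × (Fin ℓ → ZMod 2))) :
    (l.foldl (elimStep same φ) acc).length ≤ acc.length + l.length := by
  induction l generalizing acc with
  | nil => simp
  | cons x l ih =>
    refine (ih _).trans ?_
    unfold elimStep
    split_ifs
    · simp; omega
    · simp


/-! ### Running times of the operations on sets of vertices -/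

/-- The vertices and the adjacency matrix are available. -/
structure HasGraph {Γ : Type} (m : Γ → ℕ) (env : Set (Γ → Data)) (n : Γ → ℕ)
    (G : ∀ γ, SimpleGraph (Fin (n γ))) : Prop extends HasVerts m env n where
  adj : PT m env fun γ => encVec fun u : Fin (n γ) => encVec fun v => encProp ((G γ).Adj u v)

section

variable {Γ : Type} {m : Γ → ℕ} {env : Set (Γ → Data)} {n : Γ → ℕ}
  {G : ∀ γ, SimpleGraph (Fin (n γ))} {α β : Γ → Type} {ea : ∀ γ, α γ → Data}
  {eb : ∀ γ, β γ → Data} {A R S X : ∀ γ, Finset (Fin (n γ))}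

theorem HasGraph.lift (h : HasGraph m env n G) :
    HasGraph (fun q => m q.1) (elEnv env eb) (fun q => n q.1) fun q => G q.1 :=
  ⟨h.toHasVerts.lift, h.adj.lift⟩

theorem HasGraph.foldLift {m' : (Σ γ, α γ × β γ) → ℕ} (h : HasGraph m env n G)
    (hm : ∀ q, m q.1 ≤ m' q) :
    HasGraph m' (foldEnv env ea eb) (fun q => n q.1) fun q => G q.1 :=
  ⟨h.toHasVerts.foldLift hm, h.adj.foldLift hm⟩

theorem HasGraph.weaken (h : HasGraph m env n G) (g : Γ → Data) :
    HasGraph m (insert g env) n G :=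
  ⟨⟨h.verts.weaken g, h.bdd⟩, h.adj.weaken g⟩

theorem PT.finElem {m' : (Σ γ, Fin (n γ)) → ℕ} : PT m'
    (elEnv env fun γ (v : Fin (n γ)) => encNat v) fun q => encNat q.2 :=
  PT.mem (Or.inl rfl)

theorem PT.finElem_lift {β : (Σ γ, Fin (n γ)) → Type} {eb : ∀ γ, β γ → Data}
    {m' : (Σ q, β q) → ℕ} :
    PT m' (elEnv (elEnv env fun γ (v : Fin (n γ)) => encNat v) eb) fun q => encNat q.1.2 :=
  PT.mem (Or.inr ⟨_, Or.inl rfl, rfl⟩)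

theorem PT.finElem_lift_lift {β : (Σ γ, Fin (n γ)) → Type} {eb : ∀ γ, β γ → Data}
    {δ : (Σ q, β q) → Type} {ed : ∀ q, δ q → Data} {m' : (Σ q, δ q) → ℕ} :
    PT m' (elEnv (elEnv (elEnv env fun γ (v : Fin (n γ)) => encNat v) eb) ed)
      fun q => encNat q.1.1.2 :=
  PT.mem (Or.inr ⟨_, Or.inr ⟨_, Or.inl rfl, rfl⟩, rfl⟩)

theorem PD.adj (h : HasGraph m env n G) {u v : ∀ γ, Fin (n γ)}
    (hu : PT m env fun γ => encNat (u γ)) (hv : PT m env fun γ => encNat (v γ)) :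
    PD m env fun γ => (G γ).Adj (u γ) (v γ) :=
  PT.vec_get (g := fun γ v => encProp ((G γ).Adj (u γ) v))
    (PT.vec_get (g := fun γ u => encVec fun v => encProp ((G γ).Adj u v)) h.adj hu h.bdd) hv h.bdd

theorem PT.union (h : HasVerts m env n) (hX : PT m env fun γ => encSet (X γ))
    (hR : PT m env fun γ => encSet (R γ)) : PT m env fun γ => encSet (X γ ∪ R γ) :=
  PT.set h (P := fun γ v => v ∈ X γ ∨ v ∈ R γ)
    (.or (.mem_set h.lift hX.lift .finElem) (.mem_set h.lift hR.lift .finElem)) (by simp)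

theorem PT.compl (h : HasVerts m env n) (hX : PT m env fun γ => encSet (X γ)) :
    PT m env fun γ => encSet (X γ)ᶜ :=
  PT.set h (P := fun γ v => ¬ v ∈ X γ) (.not (.mem_set h.lift hX.lift .finElem)) (by simp)

theorem PT.empty (h : HasVerts m env n) :
    PT m env fun γ => encSet (∅ : Finset (Fin (n γ))) :=
  PT.set h (P := fun γ v => False) (.const _) (by simp)

theorem PT.insert_vert (h : HasVerts m env n) {v : ∀ γ, Fin (n γ)}
    (hv : PT m env fun γ => encNat (v γ)) (hX : PT m env fun γ => encSet (X γ)) :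
    PT m env fun γ => encSet (insert (v γ) (X γ)) :=
  PT.set h (P := fun γ u => u = v γ ∨ u ∈ X γ)
    (.or (.fin_eq h.lift .finElem hv.lift) (.mem_set h.lift hX.lift .finElem)) (by simp)

theorem PT.nbrCount (h : HasGraph m env n G) (hX : PT m env fun γ => encSet (X γ))
    {u : ∀ γ, Fin (n γ)} (hu : PT m env fun γ => encNat (u γ)) :
    PT m env fun γ => encNat (nbrCount (G γ) (X γ) (u γ)) := by
  classical
  refine (PT.card_set h.toHasVerts (X := fun γ => (X γ).filter fun v => (G γ).Adj (u γ) v)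
    (PT.set h.toHasVerts (P := fun γ v => v ∈ X γ ∧ (G γ).Adj (u γ) v)
    (.and (.mem_set h.toHasVerts.lift hX.lift .finElem) (.adj h.lift hu.lift .finElem))
    (by simp))).congr fun γ => ?_
  rw [nbrCount_eq_card]

theorem nbrCount_le {k : ℕ} (H : SimpleGraph (Fin k)) (Y : Finset (Fin k)) (u : Fin k) :
    nbrCount H Y u ≤ k := by
  classical
  rw [nbrCount_eq_card]
  simpa using Finset.card_le_univ (Y.filter fun v => H.Adj u v)

theorem PT.touch (h : HasGraph m env n G) (hX : PT m env fun γ => encSet (X γ))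
    (hR : PT m env fun γ => encSet (R γ)) :
    PT m env fun γ => encSet (touch (G γ) (X γ) (R γ)) :=
  PT.set h.toHasVerts (P := fun γ v => v ∈ X γ ∧ ∃ u, u ∈ R γ ∧ (G γ).Adj u v)
    (.and (.mem_set h.toHasVerts.lift hX.lift .finElem)
      (.exists_fin h.toHasVerts.lift (.and (.mem_set h.toHasVerts.lift.lift hR.lift.lift .finElem)
        (.adj h.lift.lift .finElem PT.finElem_lift)))) (by simp [AcyclicDom.touch])

theorem PT.grow (h : HasGraph m env n G) (hX : PT m env fun γ => encSet (X γ))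
    (hS : PT m env fun γ => encSet (S γ)) :
    PT m env fun γ => encSet (grow (G γ) (X γ) (S γ)) :=
  PT.set h.toHasVerts (P := fun γ v => v ∈ X γ ∧ (v ∈ S γ ∨ ∃ u, u ∈ S γ ∧ (G γ).Adj u v))
    (.and (.mem_set h.toHasVerts.lift hX.lift .finElem)
      (.or (.mem_set h.toHasVerts.lift hS.lift .finElem)
      (.exists_fin h.toHasVerts.lift (.and (.mem_set h.toHasVerts.lift.lift hS.lift.lift .finElem)
        (.adj h.lift.lift .finElem PT.finElem_lift))))) (by simp [AcyclicDom.grow])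

theorem PT.reach (h : HasGraph m env n G) (hX : PT m env fun γ => encSet (X γ))
    (hS : PT m env fun γ => encSet (S γ)) :
    PT m env fun γ => encSet (reach (G γ) (X γ) (S γ)) := by
  refine PT.foldl (α := fun γ => Finset (Fin (n γ))) (β := fun γ => Fin (n γ))
    (ea := fun _ => encSet) (eb := fun _ v => encNat v) (f := fun γ S _ => AcyclicDom.grow (G γ) (X γ) S)
    h.len h.verts hS ?_
  refine PT.grow (h.foldLift fun _ => le_rfl) (hX.foldLift fun _ => le_rfl) ?_
  exact PT.foldAcc

theorem PD.subset (h : HasVerts m env n) (hX : PT m env fun γ => encSet (X γ))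
    (hR : PT m env fun γ => encSet (R γ)) : PD m env fun γ => X γ ⊆ R γ :=
  (PD.forall_fin h (P := fun γ v => v ∈ X γ → v ∈ R γ)
    (.imp (.mem_set h.lift hX.lift .finElem) (.mem_set h.lift hR.lift .finElem))).congr
    fun _ => Iff.rfl

theorem PD.irredundant (h : HasGraph m env n G) (hA : PT m env fun γ => encSet (A γ))
    (hX : PT m env fun γ => encSet (X γ)) :
    PD m env fun γ => Irredundant (G γ) (A γ) (X γ) := by
  refine .and (.subset h.toHasVerts hX hA) (.forall_fin h.toHasVerts
    (.imp (.mem_set h.toHasVerts.lift hX.lift .finElem) (.exists_fin h.toHasVerts.lift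
      (.and (.not (.mem_set h.toHasVerts.lift.lift hA.lift.lift .finElem))
        (.forall_fin h.toHasVerts.lift.lift
          (.imp (.mem_set h.toHasVerts.lift.lift.lift hX.lift.lift.lift .finElem)
            (.iff (.adj h.lift.lift.lift PT.finElem_lift .finElem)
              (.fin_eq h.toHasVerts.lift.lift.lift .finElem PT.finElem_lift_lift))))))))

theorem PT.nat_const (k : ℕ) : PT m env fun _ => encNat k := by
  induction k with
  | zero => exact PT.nat_zero
  | succ k ih => exact PT.nat_succ ih

theorem PT.big (h : HasGraph m env n G) (hR : PT m env fun γ => encSet (R γ))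
    (hX : PT m env fun γ => encSet (X γ)) :
    PT m env fun γ => encSet (big (G γ) (R γ) (X γ)) :=
  PT.set h.toHasVerts (P := fun γ v => v ∈ X γ ∧ 2 ≤ AcyclicDom.nbrCount (G γ) (R γ) v)
    (.and (.mem_set h.toHasVerts.lift hX.lift .finElem)
      (.nat_le (PT.nat_const 2) (PT.nbrCount h.lift hR.lift .finElem)
        ((h.bdd.comp Sigma.fst).of_le fun q => nbrCount_le _ _ _))) (by simp [AcyclicDom.big])

theorem PT.one (h : HasGraph m env n G) (hR : PT m env fun γ => encSet (R γ))
    (hX : PT m env fun γ => encSet (X γ)) :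
    PT m env fun γ => encSet (one (G γ) (R γ) (X γ)) :=
  PT.set h.toHasVerts (P := fun γ v => v ∈ X γ ∧ AcyclicDom.nbrCount (G γ) (R γ) v = 1)
    (.and (.mem_set h.toHasVerts.lift hX.lift .finElem)
      (.nat_eq (PT.nbrCount h.lift hR.lift .finElem) ((h.bdd.comp Sigma.fst).of_le fun q => nbrCount_le _ _ _)
        (PT.nat_const 1) (.const 1))) (by simp [AcyclicDom.one])

theorem PT.adjPairs (h : HasGraph m env n G) (hX : PT m env fun γ => encSet (X γ)) :
    PT m env fun γ => encNat (adjPairs (G γ) (X γ)) := by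
  classical
  refine (PT.foldr (α := fun _ => ℕ) (β := fun γ => Fin (n γ)) (ea := fun _ => encNat)
    (eb := fun _ v => encNat v) (a := fun _ => 0)
    (f := fun γ v acc => (if v ∈ X γ then AcyclicDom.nbrCount (G γ) (X γ) v else 0) + acc) h.verts
    h.len PT.nat_zero ?_).congr fun γ => ?_
  · refine PT.nat_add (.congr (.ite (.ofElem (PD.mem_set h.toHasVerts.lift hX.lift .finElem))
      (.ofElem (.nbrCount h.lift hX.lift .finElem)) .nat_zero) fun q => ?_)
      ((h.bdd.comp fun q : Σ γ, ℕ × Fin (n γ) => q.1).of_le fun q => ?_) .foldAcc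
    · split_ifs <;> rfl
    · split_ifs
      · exact nbrCount_le _ _ _
      · exact Nat.zero_le _
  · congr 1
    rw [AcyclicDom.adjPairs, ← List.sum_ofFn, List.ofFn_eq_map]
    induction List.finRange (n γ) with
    | nil => rfl
    | cons v l ih => simp [ih]

theorem adjPairs_le {k : ℕ} (H : SimpleGraph (Fin k)) (Y : Finset (Fin k)) :
    adjPairs H Y ≤ k * k := by
  classical
  have : adjPairs H Y ≤ ∑ _v : Fin k, k :=
    Finset.sum_le_sum fun v _ => by
      split_ifs
      · exact nbrCount_le _ _ _
      · exact Nat.zero_le _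
  simpa using this

theorem PD.compat (h : HasGraph m env n G) {M R R' : ∀ γ, Finset (Fin (n γ))}
    (hX : PT m env fun γ => encSet (X γ)) (hM : PT m env fun γ => encSet (M γ))
    (hR : PT m env fun γ => encSet (R γ)) (hR' : PT m env fun γ => encSet (R' γ)) :
    PD m env fun γ => Compat (G γ) (X γ) (M γ) (R γ) (R' γ) := by
  have h1 := PT.reach h hX (PT.union h.toHasVerts hM (PT.touch h hX hR))
  have h2 := PT.reach h hX (PT.touch h hX hR')
  exact PD.forall_fin h.toHasVerts (PD.imp (PD.mem_set h.toHasVerts.lift hX.lift .finElem)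
    (PD.iff (PD.mem_set h.toHasVerts.lift h1.lift .finElem)
      (PD.not (PD.mem_set h.toHasVerts.lift h2.lift .finElem))))

/-- Pairs of sets. -/
noncomputable def encPair {k : ℕ} (p : Finset (Fin k) × Finset (Fin k)) : Data :=
  .cons (encSet p.1) (encSet p.2)

theorem PT.splitList (h : HasGraph m env n G) (hA : PT m env fun γ => encSet (A γ))
    (hS : PT m env fun γ => encSet (S γ)) (hnec : PolyBdd m fun γ => nec (G γ) 1 (A γ)) :
    PT m env fun γ => encList encPair (splitList (G γ) (A γ) (S γ)) := by
  classical
  refine PT.foldl_of_prefix (α := fun γ => List (Finset (Fin (n γ)) × Finset (Fin (n γ))))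
    (β := fun γ => Fin (n γ)) (ea := fun _ => encList encPair) (eb := fun _ v => encNat v)
    (f := fun γ => splitStep (G γ) (A γ) (S γ))
    (fun q => m q.1 + q.2.1.length) (fun γ => m γ + nec (G γ) 1 (A γ) ^ 2)
    (PolyBdd.self.add (hnec.pow 2)) h.len (fun γ l₁ b l₂ hl => ?_) h.verts
    (((PT.empty h.toHasVerts).cons (PT.empty h.toHasVerts)).cons PT.nil) ?_
  -- The length bound holds after every prefix of the vertices, so the measure stays polynomial
  -- throughout the loop.
  · refine Nat.add_le_add_left (splitFold_length_le l₁ ?_) _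
    exact (hl ▸ List.nodup_finRange _ : (l₁ ++ b :: l₂).Nodup).of_append_left
  · have hm : ∀ q : Σ γ, List (Finset (Fin (n γ)) × Finset (Fin (n γ))) × Fin (n γ),
        m q.1 ≤ m q.1 + q.2.1.length := fun q => Nat.le_add_right _ _
    have h' := h.foldLift (ea := fun _ => encList encPair)
      (eb := fun γ (v : Fin (n γ)) => encNat v) hm
    have hA' := hA.foldLift (ea := fun _ => encList encPair)
      (eb := fun γ (v : Fin (n γ)) => encNat v) hm
    have hS' := hS.foldLift (ea := fun _ => encList encPair)
      (eb := fun γ (v : Fin (n γ)) => encNat v) hm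
    have hlen : PolyBdd (fun q : Σ γ, List (Finset (Fin (n γ)) × Finset (Fin (n γ))) × Fin (n γ) =>
        m q.1 + q.2.1.length) fun q => q.2.1.length := .le_self fun q => Nat.le_add_left _ _
    refine (PT.ite (PD.mem_set (v := fun q : Σ γ, List (Finset (Fin (n γ)) × Finset (Fin (n γ))) × Fin (n γ) => q.2.2) h'.toHasVerts hS' .foldElem)
      (PT.filter (eb := fun _ => encPair) (l := fun q : Σ γ, List (Finset (Fin (n γ)) × Finset (Fin (n γ))) × Fin (n γ) =>
        q.2.1.flatMap fun p =>
          [(insert q.2.2 p.1, p.2), (p.1, insert q.2.2 p.2)])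
        (P := fun (q : Σ γ, List (Finset (Fin (n γ)) × Finset (Fin (n γ))) × Fin (n γ))
          (p : Finset (Fin (n q.1)) × Finset (Fin (n q.1))) => Irredundant (G q.1) (A q.1) p.1 ∧ Irredundant (G q.1) (A q.1) p.2)
        (PT.flatMap (β := fun q : Σ γ, List (Finset (Fin (n γ)) × Finset (Fin (n γ))) × Fin (n γ) =>
             Finset (Fin (n q.1)) × Finset (Fin (n q.1)))
          (δ := fun q : Σ γ, List (Finset (Fin (n γ)) × Finset (Fin (n γ))) × Fin (n γ) =>
             Finset (Fin (n q.1)) × Finset (Fin (n q.1)))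
          (eb := fun _ => encPair) (ed := fun _ => encPair) (l := fun q : Σ γ, List (Finset (Fin (n γ)) × Finset (Fin (n γ))) × Fin (n γ) => q.2.1)
          (f := fun (q : Σ γ, List (Finset (Fin (n γ)) × Finset (Fin (n γ))) × Fin (n γ)) p =>
            [(insert q.2.2 p.1, p.2), (p.1, insert q.2.2 p.2)]) .foldAcc hlen
          (.const 2) ?_) ?_ ?_)
      PT.foldAcc).congr fun q => ?_
    · have hp : PT (fun q : Σ q : Σ γ, List (Finset (Fin (n γ)) × Finset (Fin (n γ))) × Fin (n γ),
          Finset (Fin (n q.1)) × Finset (Fin (n q.1)) => m q.1.1 + q.1.2.1.length)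
          (elEnv (foldEnv env (fun _ => encList encPair) fun γ (v : Fin (n γ)) => encNat v)
            fun _ => encPair) fun q => .cons (encSet q.2.1) (encSet q.2.2) := PT.mem (.inl rfl)
      have hv : PT (fun q : Σ γ, List (Finset (Fin (n γ)) × Finset (Fin (n γ))) × Fin (n γ) =>
          m q.1 + q.2.1.length) (foldEnv env (fun _ => encList encPair) fun _ v => encNat v)
          fun q => encNat q.2.2 := PT.foldElem
      exact (((PT.insert_vert h'.toHasVerts.lift hv.lift hp.fst).cons hp.snd)).cons
        ((hp.fst.cons (PT.insert_vert h'.toHasVerts.lift hv.lift hp.snd)).cons PT.nil)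
    · refine (hlen.mul (.const 2)).of_le fun q => le_of_eq ?_
      simp
    · have hp : PT (fun q : Σ q : Σ γ, List (Finset (Fin (n γ)) × Finset (Fin (n γ))) × Fin (n γ),
          Finset (Fin (n q.1)) × Finset (Fin (n q.1)) => m q.1.1 + q.1.2.1.length)
          (elEnv (foldEnv env (fun _ => encList encPair) fun γ (v : Fin (n γ)) => encNat v)
            fun _ => encPair) fun q => .cons (encSet q.2.1) (encSet q.2.2) := PT.mem (.inl rfl)
      exact PD.and (PD.irredundant h'.lift hA'.lift hp.fst) (PD.irredundant h'.lift hA'.lift hp.snd)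
    · simp only [splitStep]
      split_ifs
      · congr!
      · rfl

end


/-! ### Running time of the reduction -/

/-- Vectors over `GF(2)`. -/
noncomputable def encFeat {ℓ : ℕ} (v : Fin ℓ → ZMod 2) : Data := encVec fun j => encProp (v j = 1)

/-- The rows in the elimination. -/
noncomputable def encRow {n ℓ : ℕ} (r : Config n × (Fin ℓ → ZMod 2)) : Data :=
  .cons r.1.enc (encFeat r.2)

section

variable {Γ : Type} {m : Γ → ℕ} {env : Set (Γ → Data)} {n ℓ : Γ → ℕ}
  {G : ∀ γ, SimpleGraph (Fin (n γ))} {A R S X : ∀ γ, Finset (Fin (n γ))}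
  {P : ∀ γ, List (Finset (Fin (n γ)) × Finset (Fin (n γ)))} {c c' : ∀ γ, Config (n γ)}
  {v w : ∀ γ, Fin (ℓ γ) → ZMod 2}

/-- The accumulator conses its own length, which produces the numbers in decreasing order. -/
theorem PT.range {k : Γ → ℕ} (hk : PT m env fun γ => encNat (k γ)) (hk' : PolyBdd m k) :
    PT m env fun γ => encList encNat (List.range (k γ)) := by
  have h1 : PT m env fun γ => encList encNat
      ((List.replicate (k γ) ()).foldl (fun l _ => l.length :: l) []) := by
    refine PT.foldl_of_prefix (α := fun _ => List ℕ) (β := fun _ => Unit)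
      (ea := fun _ => encList encNat) (eb := fun _ _ => .nil)
      (fun q => m q.1 + q.2.1.length) (fun γ => m γ + k γ) (PolyBdd.self.add hk')
      (hk'.of_le fun γ => by simp) (fun γ l₁ b l₂ hl => ?_) hk PT.nil ?_
    · have h2 : ∀ (l : List Unit) (a : List ℕ),
          (l.foldl (fun l _ => l.length :: l) a).length = a.length + l.length := by
        intro l
        induction l with
        | nil => simp
        | cons x l ih => intro a; simp [ih]; omega
      have h3 : l₁.length ≤ k γ := by
        have := congrArg List.length hl
        simp at this
        omega
      simpa [h2] using h3
    · have h2 : PT (fun q : Σ _ : Γ, List ℕ × Unit => m q.1 + q.2.1.length)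
        (foldEnv env (fun _ => encList encNat) fun _ _ => .nil)
        fun q => encList encNat q.2.1 := PT.foldAcc
      exact (h2.length (.le_self fun q => Nat.le_add_left _ _)).cons h2
  have h4 : ∀ k : ℕ, (List.replicate k ()).foldl (fun l _ => l.length :: l) [] =
      (List.range k).reverse := by
    intro k
    induction k with
    | zero => rfl
    | succ k ih =>
      rw [List.replicate_succ', List.foldl_append, ih, List.range_succ]
      simp
  refine (h1.reverse (hk'.of_le fun γ => by rw [h4]; simp)).congr fun γ => ?_
  rw [h4, List.reverse_reverse]

theorem PT.list_cons {β : Γ → Type} {eb : ∀ γ, β γ → Data} {b : ∀ γ, β γ} {l : ∀ γ, List (β γ)}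
    (hb : PT m env fun γ => eb γ (b γ)) (hl : PT m env fun γ => encList (eb γ) (l γ)) :
    PT m env fun γ => encList (eb γ) (b γ :: l γ) := hb.cons hl

theorem PT.list_nil {β : Γ → Type} {eb : ∀ γ, β γ → Data} :
    PT m env fun γ => encList (eb γ) [] := PT.nil

theorem HasVerts.of_nat (hk : PT m env fun γ => encNat (n γ)) (hk' : PolyBdd m n) :
    HasVerts m env n :=
  ⟨(PT.range hk hk').congr fun γ => by
    rw [encVec, encList, encList, ← List.map_coe_finRange_eq_range, List.map_map]
    rfl, hk'⟩

theorem PT.vec_of_list {β : Γ → Type} {eb : ∀ γ, β γ → Data} {l : ∀ γ, List (β γ)}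
    (hl : PT m env fun γ => encList (eb γ) (l γ)) :
    PT m env fun γ => encVec fun j : Fin (l γ).length => eb γ (l γ)[j] :=
  hl.congr fun γ => by
    rw [encVec, encList, encList]
    congr 1
    conv_lhs => rw [← List.ofFn_getElem (xs := l γ), List.ofFn_eq_map, List.map_map]
    rfl

theorem PT.feature (h : HasGraph m env n G) (hP : PT m env fun γ => encList encPair (P γ))
    (hP' : PolyBdd m fun γ => (P γ).length) (hc : PT m env fun γ => (c γ).enc) :
    PT m env fun γ => encFeat (feature (G γ) (P γ) (c γ)) := by
  have hV : HasVerts m env fun γ => (P γ).length := .of_nat (hP.length hP') hP'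
  refine PT.vec hV ?_
  have h1 := PT.vec_get (g := fun (q : Σ γ, Fin (P γ).length) j => encPair (P q.1)[j])
    (v := fun q => q.2) (PT.vec_of_list hP).lift
    PT.finElem (hP'.comp Sigma.fst)
  refine PD.congr (PD.compat h.lift hc.fst.lift hc.snd.fst.lift h1.fst h1.snd) fun q => ?_
  unfold AcyclicDom.feature
  split_ifs with h <;> simpa using h

theorem PD.feat (hV : HasVerts m env ℓ) (hv : PT m env fun γ => encFeat (v γ))
    {j : ∀ γ, Fin (ℓ γ)} (hj : PT m env fun γ => encNat (j γ)) :
    PD m env fun γ => v γ (j γ) = 1 :=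
  PT.vec_get (g := fun γ j => encProp (v γ j = 1)) hv hj hV.bdd

theorem zmod_two_add_eq_one (a b : ZMod 2) : a + b = 1 ↔ ¬ (a = 1 ↔ b = 1) := by
  revert a b; decide

theorem PT.feat_add (hV : HasVerts m env ℓ) (hv : PT m env fun γ => encFeat (v γ))
    (hw : PT m env fun γ => encFeat (w γ)) : PT m env fun γ => encFeat (v γ + w γ) :=
  PT.vec hV (PD.congr (PD.not (PD.iff (PD.feat hV.lift hv.lift PT.finElem)
    (PD.feat hV.lift hw.lift PT.finElem))) fun q => (zmod_two_add_eq_one _ _).symm)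

theorem PD.hits (hV : HasVerts m env ℓ) (hv : PT m env fun γ => encFeat (v γ))
    (hw : PT m env fun γ => encFeat (w γ)) : PD m env fun γ => Hits (v γ) (w γ) :=
  PD.exists_fin hV (PD.and (PD.feat hV.lift hv.lift PT.finElem)
    (PD.and (PD.forall_fin hV.lift (PD.imp (PD.fin_lt hV.lift.lift PT.finElem PT.finElem_lift)
      (PD.not (PD.feat hV.lift.lift hv.lift.lift PT.finElem))))
      (PD.feat hV.lift hw.lift PT.finElem)))

theorem PD.sameKey (h : HasGraph m env n G) (hA : PT m env fun γ => encSet (A γ))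
    (hR : PT m env fun γ => encSet (R γ)) (hc : PT m env fun γ => (c γ).enc)
    (hc' : PT m env fun γ => (c' γ).enc) :
    PD m env fun γ => SameKey (G γ) (A γ) (R γ) (c γ) (c' γ) := by
  have hV := h.toHasVerts
  have hadj : ∀ c : ∀ γ, Config (n γ), PolyBdd m fun γ => adjPairs (G γ) (c γ).X := fun c =>
    (h.bdd.mul h.bdd).of_le fun γ => adjPairs_le _ _
  have hn : ∀ (X : ∀ γ, Finset (Fin (n γ))),
      PolyBdd (fun q : Σ γ, Fin (n γ) => m q.1) fun q => nbrCount (G q.1) (X q.1) q.2 := fun X =>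
    (h.bdd.comp Sigma.fst).of_le fun q => nbrCount_le _ _ _
  have h1 := PD.nat_eq (PT.card_set hV hc.fst) (.card hV _) (PT.card_set hV hc'.fst) (.card hV _)
  have h2 := PD.nat_eq (PT.adjPairs h hc.fst) (hadj _) (PT.adjPairs h hc'.fst) (hadj _)
  have h3 := PD.nat_eq (PT.card_set hV (PT.one h hR hc.fst)) (.card hV _)
    (PT.card_set hV (PT.one h hR hc'.fst)) (.card hV _)
  have h4 := PD.nat_eq (PT.card_set hV hc.snd.fst) (.card hV _) (PT.card_set hV hc'.snd.fst)
    (.card hV _)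
  have h5 := PD.nat_eq (PT.nbrCount h.lift (PT.big h hR hc.fst).lift (PT.finElem (n := n)))
    (hn fun γ => big (G γ) (R γ) (c γ).X)
    (PT.nbrCount h.lift (PT.big h hR hc'.fst).lift (PT.finElem (n := n)))
    (hn fun γ => big (G γ) (R γ) (c' γ).X)
  have h6 := PD.forall_fin hV (P := fun γ u => u ∉ A γ →
    nbrCount (G γ) (big (G γ) (R γ) (c γ).X) u = nbrCount (G γ) (big (G γ) (R γ) (c' γ).X) u)
    (PD.imp (PD.not (PD.mem_set hV.lift hA.lift PT.finElem)) h5)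
  exact h1.and (h2.and (h3.and (h4.and h6)))

theorem PT.residual (h : HasGraph m env n G) (hV : HasVerts m env ℓ)
    (hA : PT m env fun γ => encSet (A γ)) (hR : PT m env fun γ => encSet (R γ))
    {kept : ∀ γ, List (Config (n γ) × (Fin (ℓ γ) → ZMod 2))}
    (hkept : PT m env fun γ => encList encRow (kept γ))
    (hlen : PolyBdd m fun γ => (kept γ).length)
    {φ : ∀ γ, Config (n γ) → Fin (ℓ γ) → ZMod 2}
    (hc : PT m env fun γ => (c γ).enc)
    (hφ : PT m env fun γ => encFeat (φ γ (c γ))) :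
    PT m env fun γ => encFeat
      (residual (SameKey (G γ) (A γ) (R γ)) (φ γ) (kept γ) (c γ)) := by
  classical
  refine PT.foldl (α := fun γ => Fin (ℓ γ) → ZMod 2)
    (β := fun γ => Config (n γ) × (Fin (ℓ γ) → ZMod 2)) (ea := fun _ => encFeat)
    (eb := fun _ => encRow)
    (f := fun γ v y => if SameKey (G γ) (A γ) (R γ) (c γ) y.1 ∧ Hits y.2 v then v + y.2 else v)
    hlen hkept hφ ?_
  have hm : ∀ q : Σ γ, (Fin (ℓ γ) → ZMod 2) × Config (n γ) × (Fin (ℓ γ) → ZMod 2),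
    m q.1 ≤ m q.1 := fun _ => le_rfl
  have h1 : PT (fun q : Σ γ, (Fin (ℓ γ) → ZMod 2) × Config (n γ) × (Fin (ℓ γ) → ZMod 2) => m q.1)
    (foldEnv env (fun _ => encFeat) fun _ => encRow) fun q => .cons q.2.2.1.enc (encFeat q.2.2.2) :=
    PT.foldElem
  have h2 : PT (fun q : Σ γ, (Fin (ℓ γ) → ZMod 2) × Config (n γ) × (Fin (ℓ γ) → ZMod 2) => m q.1)
    (foldEnv env (fun _ => encFeat) fun _ => encRow) fun q => encFeat q.2.1 :=
    PT.foldAcc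
  exact (PT.ite (PD.and (PD.sameKey (h.foldLift hm) (hA.foldLift hm) (hR.foldLift hm)
    (hc.foldLift hm) h1.fst) (PD.hits (hV.foldLift hm) h1.snd h2))
    (PT.feat_add (hV.foldLift hm) h2 h1.snd) h2).congr fun q => by split_ifs <;> rfl

theorem PT.elim (h : HasGraph m env n G) (hP : PT m env fun γ => encList encPair (P γ))
    (hP' : PolyBdd m fun γ => (P γ).length)
    (hA : PT m env fun γ => encSet (A γ)) (hR : PT m env fun γ => encSet (R γ))
    {l : ∀ γ, List (Config (n γ))} (hl : PT m env fun γ => encList Config.enc (l γ))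
    (hlen : PolyBdd m fun γ => (l γ).length) :
    PT m env fun γ => encList Config.enc
      (AcyclicDom.elim (SameKey (G γ) (A γ) (R γ)) (AcyclicDom.feature (G γ) (P γ)) (l γ)) := by
  classical
  have hV : HasVerts m env fun γ => (P γ).length := .of_nat (hP.length hP') hP'
  have h1 : PT m env fun γ => encList encRow ((l γ).foldl (elimStep (SameKey (G γ) (A γ) (R γ))
      (AcyclicDom.feature (G γ) (P γ))) []) := by
    refine PT.foldl_of_prefix
      (α := fun γ => List (Config (n γ) × (Fin (P γ).length → ZMod 2)))
      (β := fun γ => Config (n γ)) (ea := fun _ => encList encRow) (eb := fun _ => Config.enc)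
      (fun q => m q.1 + q.2.1.length) (fun γ => m γ + (l γ).length) (PolyBdd.self.add hlen)
      hlen (fun γ l₁ b l₂ hl => ?_) hl PT.nil ?_
    · have := length_elimFold (SameKey (G γ) (A γ) (R γ)) (AcyclicDom.feature (G γ) (P γ)) l₁ []
      have h2 := congrArg List.length hl
      simp at this h2 ⊢
      omega
    · have hm : ∀ q : Σ γ, List (Config (n γ) × (Fin (P γ).length → ZMod 2)) × Config (n γ),
        m q.1 ≤ m q.1 + q.2.1.length := fun q => Nat.le_add_right _ _
      have hlen' : PolyBdd (fun q : Σ γ, List (Config (n γ) × (Fin (P γ).length → ZMod 2)) ×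
        Config (n γ) => m q.1 + q.2.1.length) fun q => q.2.1.length :=
        .le_self fun q => Nat.le_add_left _ _
      have hc : PT (fun q : Σ γ, List (Config (n γ) × (Fin (P γ).length → ZMod 2)) × Config (n γ) =>
        m q.1 + q.2.1.length) (foldEnv env (fun _ => encList encRow) fun _ => Config.enc)
        fun q => q.2.2.enc := PT.foldElem
      have hk : PT (fun q : Σ γ, List (Config (n γ) × (Fin (P γ).length → ZMod 2)) × Config (n γ) =>
        m q.1 + q.2.1.length) (foldEnv env (fun _ => encList encRow) fun _ => Config.enc)
        fun q => encList encRow q.2.1 := PT.foldAcc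
      have hr := PT.residual (h.foldLift hm) (hV.foldLift hm) (hA.foldLift hm) (hR.foldLift hm) hk
        hlen' hc (φ := fun q => AcyclicDom.feature (G q.1) (P q.1))
        (PT.feature (h.foldLift hm) (hP.foldLift hm)
          (PolyBdd.trans (.le_self hm) (hP'.comp Sigma.fst)) hc)
      refine (PT.ite (PD.exists_fin (hV.foldLift hm) (P := fun (q : Σ γ, List (Config (n γ) × (Fin (P γ).length → ZMod 2)) × Config (n γ)) j =>
          AcyclicDom.residual (SameKey (G q.1) (A q.1) (R q.1)) (AcyclicDom.feature (G q.1) (P q.1))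
            q.2.1 q.2.2 j = 1) (PD.feat (hV.foldLift hm).lift hr.lift
        PT.finElem)) (PT.append hk hlen' (PT.list_cons (b := fun q : Σ γ, List (Config (n γ) × (Fin (P γ).length → ZMod 2)) × Config (n γ) =>
          (q.2.2, AcyclicDom.residual (SameKey (G q.1) (A q.1) (R q.1))
            (AcyclicDom.feature (G q.1) (P q.1)) q.2.1 q.2.2)) (hc.cons hr) PT.list_nil)) hk).congr fun q => ?_
      simp only [elimStep]
      split_ifs <;> rfl
  refine h1.map (ed := fun _ => Config.enc) (f := fun _ => Prod.fst) (hlen.of_le fun γ => ?_) ?_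
  · simpa using length_elimFold (SameKey (G γ) (A γ) (R γ)) (AcyclicDom.feature (G γ) (P γ)) (l γ) []
  · have h2 : PT (fun q : Σ γ, Config (n γ) × (Fin (P γ).length → ZMod 2) => m q.1)
      (elEnv env fun _ => encRow) fun q => .cons q.2.1.enc (encFeat q.2.2) := PT.elem
    exact h2.fst

theorem PD.goal_le {goal : Γ → Goal} (hg : PD m env fun γ => goal γ = .max) {a b : Γ → ℚ}
    (ha : PT m env fun γ => .wt (a γ)) (hb : PT m env fun γ => .wt (b γ)) :
    PD m env fun γ => (goal γ).le (a γ) (b γ) :=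
  PD.congr (PD.or (PD.and hg (PD.wle ha hb)) (PD.and (PD.not hg) (PD.wle hb ha))) fun γ => by
    cases h : goal γ <;> simp [Goal.le]

theorem PT.sortConfigs {goal : Γ → Goal} (hg : PD m env fun γ => goal γ = .max)
    {l : ∀ γ, List (Config (n γ))} (hl : PT m env fun γ => encList Config.enc (l γ))
    (hlen : PolyBdd m fun γ => (l γ).length) :
    PT m env fun γ => encList Config.enc (sortConfigs (goal γ) (l γ)) := by
  classical
  refine PT.foldl_of_prefix
    (α := fun γ => List (Config (n γ)))
    (β := fun γ => Config (n γ)) (ea := fun _ => encList Config.enc) (eb := fun _ => Config.enc)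
    (fun q => m q.1 + q.2.1.length) (fun γ => m γ + (l γ).length) (PolyBdd.self.add hlen)
    hlen (fun γ l₁ b l₂ hl => ?_) hl PT.nil ?_
  · have := length_sortFold (goal γ) l₁ []
    have h2 := congrArg List.length hl
    simp at this h2 ⊢
    omega
  · have hm : ∀ q : Σ γ, List (Config (n γ)) × Config (n γ),
      m q.1 ≤ m q.1 + q.2.1.length := fun q => Nat.le_add_right _ _
    have hlen' : PolyBdd (fun q : Σ γ, List (Config (n γ)) × Config (n γ) =>
      m q.1 + q.2.1.length) fun q => q.2.1.length := .le_self fun q => Nat.le_add_left _ _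
    have hc : PT (fun q : Σ γ, List (Config (n γ)) × Config (n γ) =>
      m q.1 + q.2.1.length) (foldEnv env (fun _ => encList Config.enc) fun _ => Config.enc)
      fun q => q.2.2.enc := PT.foldElem
    have hk : PT (fun q : Σ γ, List (Config (n γ)) × Config (n γ) =>
      m q.1 + q.2.1.length) (foldEnv env (fun _ => encList Config.enc) fun _ => Config.enc)
      fun q => encList Config.enc q.2.1 := PT.foldAcc
    have hd : PT (fun q : Σ q : Σ γ, List (Config (n γ)) × Config (n γ), Config (n q.1) =>
      m q.1.1 + q.1.2.1.length) (elEnv (foldEnv env (fun _ => encList Config.enc)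
        fun _ => Config.enc) fun _ => Config.enc)
      fun q => q.2.enc := PT.mem (.inl rfl)
    have hp := PD.goal_le (PT.foldLift (ea := fun γ => encList (Config.enc (n := n γ)))
      (eb := fun γ => Config.enc (n := n γ)) hg hm).lift hc.snd.snd.lift hd.snd.snd
    refine (PT.append (PT.filter hk hlen'
      (P := fun (q : Σ γ, List (Config (n γ)) × Config (n γ)) a => (goal q.1).le q.2.2.w a.w) hp)
      (hlen'.of_le fun q => List.length_filter_le _ _)
      (PT.list_cons (b := fun q : Σ γ, List (Config (n γ)) × Config (n γ) => q.2.2) hc (PT.filter hk hlen'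
        (P := fun (q : Σ γ, List (Config (n γ)) × Config (n γ)) a => ¬ (goal q.1).le q.2.2.w a.w)
        (PD.not hp)))).congr fun q => ?_
    simp only [sortStep]
    congr!

theorem PT.reduce (h : HasGraph m env n G) {goal : Γ → Goal} (hg : PD m env fun γ => goal γ = .max)
    (hP : PT m env fun γ => encList encPair (P γ)) (hP' : PolyBdd m fun γ => (P γ).length)
    (hA : PT m env fun γ => encSet (A γ)) (hnec : PolyBdd m fun γ => nec (G γ) 1 (A γ))
    (hR : PT m env fun γ => encSet (R γ))
    {l : ∀ γ, List (Config (n γ))} (hl : PT m env fun γ => encList Config.enc (l γ))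
    (hlen : PolyBdd m fun γ => (l γ).length) :
    PT m env fun γ => encList Config.enc (reduce (G γ) (goal γ) (A γ) (R γ) (P γ) (l γ)) := by
  have h1 : PT (fun q : Σ γ, Config (n γ) => m q.1) (elEnv env fun _ => Config.enc)
    fun q => q.2.enc := PT.elem
  classical
  have h2 := PT.filter hl hlen (P := fun γ (c : Config (n γ)) =>
    ¬ AcyclicDom.splitList (G γ) (A γ) (AcyclicDom.big (G γ) (R γ) c.X) = []) (PD.not (PT.eq_nil (PT.splitList h.lift hA.lift
    (PT.big h.lift hR.lift h1.fst) (hnec.comp Sigma.fst))))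
  refine (PT.elim h hP hP' hA hR (PT.sortConfigs hg h2 ?_) ?_).congr fun γ => ?_
  · exact hlen.of_le fun γ => List.length_filter_le _ _
  · refine hlen.of_le fun γ => ?_
    rw [AcyclicDom.sortConfigs, length_sortFold]
    simpa using List.length_filter_le _ _
  · unfold AcyclicDom.reduce
    congr!

end


/-! ### Representatives of the neighbor equivalence -/

section

variable {n : ℕ} (G : SimpleGraph (Fin n)) (d : ℕ) (A : Finset (Fin n))

/-- The `d`-neighbor equivalence over `A`. -/
def Similar (X Y : Finset (Fin n)) : Prop :=
  ∀ u, u ∉ A → min d (nbrCount G X u) = min d (nbrCount G Y u)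

open Classical in
noncomputable def addRep (acc : List (Finset (Fin n))) (X : Finset (Fin n)) :
    List (Finset (Fin n)) :=
  if ∃ Y ∈ acc, Similar G d A Y X then acc else X :: acc

open Classical in
noncomputable def repStep (acc : List (Finset (Fin n))) (v : Fin n) : List (Finset (Fin n)) :=
  if v ∈ A then acc.foldl (fun acc X => addRep G d A acc (insert v X)) acc else acc

/-- Representatives of the classes of the `d`-neighbor equivalence over `A`. -/
noncomputable def reps : List (Finset (Fin n)) :=
  (List.finRange n).foldl (repStep G d A) [∅]

open Classical in
/-- The truncated numbers of neighbors in `X` of the vertices outside of `A`, in unary. -/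
noncomputable def keyOf (X : Finset (Fin n)) : List Bool :=
  (List.finRange n).flatMap fun u =>
    (List.range d).map fun i => decide (u ∉ A ∧ i < nbrCount G X u)

variable {G d A} {X Y Z : Finset (Fin n)}

theorem Similar.symm (h : Similar G d A X Y) : Similar G d A Y X := fun u hu => (h u hu).symm

theorem Similar.trans (h : Similar G d A X Y) (h' : Similar G d A Y Z) : Similar G d A X Z :=
  fun u hu => (h u hu).trans (h' u hu)

theorem Similar.refl (X : Finset (Fin n)) : Similar G d A X X := fun _ _ => rfl

theorem Similar.mono {e : ℕ} (h : Similar G d A X Y) (he : e ≤ d) : Similar G e A X Y :=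
  fun u hu => by have := h u hu; omega

theorem length_keyOf : (keyOf G d A X).length = n * d := by
  simp [keyOf, List.length_flatMap]

theorem flatMap_inj_of_length {α β : Type} {f g : α → List β} {k : ℕ} {l : List α}
    (hf : ∀ a ∈ l, (f a).length = k) (hg : ∀ a ∈ l, (g a).length = k) :
    l.flatMap f = l.flatMap g ↔ ∀ a ∈ l, f a = g a := by
  induction l with
  | nil => simp
  | cons a l ih =>
    rw [List.flatMap_cons, List.flatMap_cons, List.forall_mem_cons,
      ← ih (fun b hb => hf b (by simp [hb])) fun b hb => hg b (by simp [hb])]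
    constructor
    · intro h
      exact List.append_inj h (by rw [hf a (by simp), hg a (by simp)])
    · rintro ⟨h1, h2⟩
      rw [h1, h2]

/-- Every vertex contributes a block of exactly `d` bits, the unary code of its truncated count, or
zeros if it lies in `A`. Equal strings therefore have equal blocks. -/
theorem keyOf_eq_iff : keyOf G d A X = keyOf G d A Y ↔ Similar G d A X Y := by
  rw [keyOf, keyOf, flatMap_inj_of_length (k := d) (by simp) (by simp)]
  simp only [List.mem_finRange, true_implies, List.map_inj_left, List.mem_range, decide_eq_decide,
    and_congr_right_iff, Similar]
  refine forall_congr' fun u => ⟨fun h hu => ?_, fun h i hi hu => ?_⟩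
  · by_contra hne
    rcases Nat.lt_or_gt_of_ne hne with hlt | hlt
    · have := h (nbrCount G X u) (by omega) hu
      omega
    · have := h (nbrCount G Y u) (by omega) hu
      omega
  · have := h hu
    omega

theorem length_addRep_le (acc : List (Finset (Fin n))) (X : Finset (Fin n)) :
    (addRep G d A acc X).length ≤ acc.length + 1 := by
  unfold addRep
  split_ifs <;> simp

theorem length_addReps_le (v : Fin n) (l acc : List (Finset (Fin n))) :
    (l.foldl (fun acc X => addRep G d A acc (insert v X)) acc).length ≤ acc.length + l.length := by
  induction l generalizing acc with
  | nil => simp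
  | cons X l ih =>
    have := length_addRep_le (G := G) (d := d) (A := A) acc (insert v X)
    have := ih (addRep G d A acc (insert v X))
    simp only [List.foldl_cons, List.length_cons]
    omega

/-- Pairwise inequivalent subsets of `A`. -/
structure IsReps (G : SimpleGraph (Fin n)) (d : ℕ) (A : Finset (Fin n))
    (l : List (Finset (Fin n))) : Prop where
  subset : ∀ X ∈ l, X ⊆ A
  pairwise : l.Pairwise fun X Y => ¬ Similar G d A Y X

theorem IsReps.length_le {l : List (Finset (Fin n))} (h : IsReps G d A l) :
    l.length ≤ nec G d A := by
  rw [nec, ← Nat.card_fin l.length]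
  refine Nat.card_le_card_of_injective (fun i : Fin l.length => Quotient.mk (nbrSetoid G d A)
    ⟨l[i], h.subset _ (List.getElem_mem _)⟩) fun i j hij => ?_
  have hs : Similar G d A l[i] l[j] := Quotient.exact hij
  by_contra hne
  rcases lt_or_gt_of_ne hne with hlt | hlt
  · exact List.pairwise_iff_getElem.1 h.pairwise i j i.2 j.2 hlt hs.symm
  · exact List.pairwise_iff_getElem.1 h.pairwise j i j.2 i.2 hlt hs

theorem IsReps.addRep {l : List (Finset (Fin n))} (h : IsReps G d A l) (hX : X ⊆ A) :
    IsReps G d A (addRep G d A l X) := by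
  unfold AcyclicDom.addRep
  split_ifs with hY
  · exact h
  · push Not at hY
    exact ⟨by simpa [hX] using h.subset, List.pairwise_cons.2 ⟨fun Y hYl => hY Y hYl, h.pairwise⟩⟩

theorem mem_addRep_of_mem {l : List (Finset (Fin n))} (h : X ∈ l) : X ∈ addRep G d A l Y := by
  unfold AcyclicDom.addRep
  split_ifs <;> simp [h]

theorem exists_similar_addRep (l : List (Finset (Fin n))) (Y : Finset (Fin n)) :
    ∃ X ∈ addRep G d A l Y, Similar G d A X Y := by
  unfold AcyclicDom.addRep
  split_ifs with h
  · exact h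
  · exact ⟨Y, by simp, .refl Y⟩

theorem mem_addRep {l : List (Finset (Fin n))} (h : X ∈ addRep G d A l Y) : X ∈ l ∨ X = Y := by
  unfold AcyclicDom.addRep at h
  split_ifs at h
  · exact .inl h
  · rw [List.mem_cons] at h
    exact h.symm

theorem addReps_spec {v : Fin n} (hv : v ∈ A) :
    ∀ (l acc : List (Finset (Fin n))), IsReps G d A acc → (∀ X ∈ l, X ⊆ A) →
      IsReps G d A (l.foldl (fun acc X => addRep G d A acc (insert v X)) acc) ∧
      (∀ X ∈ acc, X ∈ l.foldl (fun acc X => addRep G d A acc (insert v X)) acc) ∧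
      (∀ X ∈ l, ∃ Y ∈ l.foldl (fun acc X => addRep G d A acc (insert v X)) acc,
        Similar G d A Y (insert v X)) ∧
      ∀ X ∈ l.foldl (fun acc X => addRep G d A acc (insert v X)) acc,
        X ∈ acc ∨ ∃ Y ∈ l, X = insert v Y := by
  intro l
  induction l with
  | nil => intro acc h _; simp [h]
  | cons Z l ih =>
    intro acc h hl
    have hZ : insert v Z ⊆ A := Finset.insert_subset hv (hl Z (by simp))
    obtain ⟨h1, h2, h3, h4⟩ := ih _ (h.addRep hZ) fun X hX => hl X (by simp [hX])
    refine ⟨h1, fun X hX => h2 X (mem_addRep_of_mem hX), ?_, fun X hX => ?_⟩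
    · rw [List.forall_mem_cons]
      refine ⟨?_, h3⟩
      obtain ⟨X, hX, hs⟩ := exists_similar_addRep (G := G) (d := d) (A := A) acc (insert v Z)
      exact ⟨X, h2 X hX, hs⟩
    · rcases h4 X hX with h | ⟨Y, hY, rfl⟩
      · rcases mem_addRep h with h | rfl
        · exact .inl h
        · exact .inr ⟨Z, by simp, rfl⟩
      · exact .inr ⟨Y, by simp [hY], rfl⟩

theorem nbrCount_union {k : ℕ} {H : SimpleGraph (Fin k)} {X Y : Finset (Fin k)}
    (h : Disjoint X Y) (u : Fin k) : nbrCount H (X ∪ Y) u = nbrCount H X u + nbrCount H Y u := by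
  classical
  simp only [nbrCount_eq_card]
  rw [Finset.filter_union, Finset.card_union_of_disjoint (Finset.disjoint_filter_filter h)]

theorem Similar.union {X' Y' : Finset (Fin n)} (h : Similar G d A X Y) (h' : Similar G d A X' Y')
    (hX : Disjoint X X') (hY : Disjoint Y Y') : Similar G d A (X ∪ X') (Y ∪ Y') := fun u hu => by
  have h1 := h u hu
  have h2 := h' u hu
  rw [nbrCount_union hX, nbrCount_union hY]
  omega

theorem Similar.anti {B : Finset (Fin n)} (h : Similar G d A X Y) (hB : A ⊆ B) :
    Similar G d B X Y := fun u hu => h u fun hA => hu (hB hA)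

/-- Equivalence is preserved when the same new vertex `v` is added to both sets. Thus all classes of
subsets of `U ∪ {v}` are met by the old representatives and by the old representatives with `v`
added. -/
theorem repFold_spec : ∀ (l : List (Fin n)) (U : Finset (Fin n)) (acc : List (Finset (Fin n))),
    l.Nodup → (∀ v ∈ l, v ∉ U) → IsReps G d A acc → (∀ X ∈ acc, X ⊆ U) →
    (∀ X, X ⊆ A → X ⊆ U → ∃ Y ∈ acc, Similar G d A Y X) →
    IsReps G d A (l.foldl (repStep G d A) acc) ∧
      ∀ X, X ⊆ A → X ⊆ U ∪ l.toFinset → ∃ Y ∈ l.foldl (repStep G d A) acc, Similar G d A Y X := by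
  classical
  intro l
  induction l with
  | nil => intro U acc _ _ h _ h2; simpa using ⟨h, h2⟩
  | cons v l ih =>
    intro U acc hnd hU h hsub hc
    rw [List.nodup_cons] at hnd
    have e : U ∪ (v :: l).toFinset = insert v U ∪ l.toFinset := by
      ext; simp
    rw [e, List.foldl_cons]
    have hU' : ∀ w ∈ l, w ∉ insert v U := fun w hw => by
      rw [Finset.mem_insert, not_or]
      exact ⟨fun h => hnd.1 (h ▸ hw), hU w (by simp [hw])⟩
    have hvU := hU v (by simp)
    by_cases hv : v ∈ A
    · obtain ⟨h1, h2, h3, h4⟩ := addReps_spec hv acc acc h h.subset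
      have hstep : repStep G d A acc v =
        acc.foldl (fun acc X => addRep G d A acc (insert v X)) acc := by rw [repStep, if_pos hv]
      rw [hstep]
      refine ih _ _ hnd.2 hU' h1 (fun X hX => ?_) fun X hXA hX => ?_
      · rcases h4 X hX with h | ⟨Y, hY, rfl⟩
        · exact (hsub X h).trans (Finset.subset_insert _ _)
        · exact Finset.insert_subset_insert _ (hsub Y hY)
      · by_cases hvX : v ∈ X
        · obtain ⟨Y, hY, hs⟩ := hc (X.erase v) ((Finset.erase_subset _ _).trans hXA)
            (by rwa [← Finset.subset_insert_iff])
          obtain ⟨Z, hZ, hs'⟩ := h3 Y hY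
          refine ⟨Z, hZ, hs'.trans ?_⟩
          have h5 : Similar G d A ({v} ∪ Y) ({v} ∪ X.erase v) :=
            (Similar.refl {v}).union hs (by simpa using fun h => hvU (hsub Y hY h)) (by simp)
          rwa [← Finset.insert_eq, ← Finset.insert_eq, Finset.insert_erase hvX] at h5
        · obtain ⟨Y, hY, hs⟩ := hc X hXA ((Finset.subset_insert_iff_of_notMem hvX).1 hX)
          exact ⟨Y, h2 Y hY, hs⟩
    · have hstep : repStep G d A acc v = acc := by rw [repStep, if_neg hv]
      rw [hstep]
      refine ih _ _ hnd.2 hU' h (fun X hX => (hsub X hX).trans (Finset.subset_insert _ _))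
        fun X hXA hX => hc X hXA ?_
      exact (Finset.subset_insert_iff_of_notMem fun h => hv (hXA h)).1 hX

theorem repFold_init (l : List (Fin n)) (hl : l.Nodup) :
    IsReps G d A (l.foldl (repStep G d A) [∅]) ∧
      ∀ X, X ⊆ A → X ⊆ l.toFinset → ∃ Y ∈ l.foldl (repStep G d A) [∅], Similar G d A Y X := by
  have := repFold_spec (G := G) (d := d) (A := A) l ∅ [∅] hl (by simp) ⟨by simp, by simp⟩ (by simp)
    (fun X _ hX => ⟨∅, by simp, by rw [Finset.subset_empty.1 hX]; exact .refl _⟩)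
  simpa using this

theorem isReps_reps : IsReps G d A (reps G d A) :=
  (repFold_init _ (List.nodup_finRange n)).1

theorem exists_similar_reps (hX : X ⊆ A) : ∃ Y ∈ reps G d A, Similar G d A Y X :=
  (repFold_init _ (List.nodup_finRange n)).2 X hX (by intro; simp)

theorem nec_pos : 1 ≤ nec G d A := by
  have : Nonempty (Quotient (nbrSetoid G d A)) := ⟨Quotient.mk _ ⟨∅, by simp⟩⟩
  exact Nat.card_pos

end

/-! ### Running times for representatives and keys. -/

section

variable {Γ : Type} {m W : Γ → ℕ} {env : Set (Γ → Data)} {n d : Γ → ℕ}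
  {G : ∀ γ, SimpleGraph (Fin (n γ))} {A X Y : ∀ γ, Finset (Fin (n γ))}

theorem PD.similar (h : HasGraph m env n G) (hd : PT m env fun γ => encNat (d γ))
    (hA : PT m env fun γ => encSet (A γ)) (hX : PT m env fun γ => encSet (X γ))
    (hY : PT m env fun γ => encSet (Y γ)) :
    PD m env fun γ => Similar (G γ) (d γ) (A γ) (X γ) (Y γ) := by
  have hn : ∀ (X : ∀ γ, Finset (Fin (n γ))),
      PolyBdd (fun q : Σ γ, Fin (n γ) => m q.1) fun q => nbrCount (G q.1) (X q.1) q.2 := fun X =>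
    (h.bdd.comp Sigma.fst).of_le fun q => nbrCount_le _ _ _
  have hmin : ∀ {X : ∀ γ, Finset (Fin (n γ))}, PT m env (fun γ => encSet (X γ)) →
      PT (fun q => m q.1) (finEnv env n)
        fun q => encNat (min (d q.1) (nbrCount (G q.1) (X q.1) q.2)) := fun {X} hX =>
    PT.nat_min hd.lift (PT.nbrCount h.lift hX.lift PT.finElem) (hn X)
  exact PD.forall_fin h.toHasVerts (PD.imp (PD.not (PD.mem_set h.toHasVerts.lift hA.lift
    PT.finElem)) (PD.nat_eq (hmin hX) ((hn X).of_le fun q => min_le_right _ _) (hmin hY)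
      ((hn Y).of_le fun q => min_le_right _ _)))

theorem CT.absorb {U : Γ → ℕ} {f : Γ → Data} (h : CT (fun γ => U γ * W γ) m env f)
    (hU : PolyBdd m U) : CT W m env f := by
  obtain ⟨T, hT, h⟩ := h
  exact ⟨_, hU.mul hT, h.of_le 1 fun γ => by
    rw [one_mul]
    exact (le_of_eq (by ring)).trans (Nat.le_succ _)⟩

theorem CT.toPT {f : Γ → Data} (h : CT W m env f) (hW : PolyBdd m W) : PT m env f := by
  obtain ⟨T, hT, h⟩ := h
  exact ⟨_, hW.mul hT, h⟩

/-- Each vertex gives one candidate for each of the at most `nec` sets kept so far, and a candidate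
is compared with at most twice as many sets. The cost is quadratic in `nec`, below the third power
that is available; the factor from the number of vertices goes into the polynomial part. -/
theorem CT.reps (h : HasGraph m env n G) (hd : PT m env fun γ => encNat (d γ))
    (hA : PT m env fun γ => encSet (A γ)) :
    CT (fun γ => (2 * nec (G γ) (d γ) (A γ) + 1) ^ 2) m env
      fun γ => encList encSet (reps (G γ) (d γ) (A γ)) := by
  classical
  refine CT.absorb (U := fun γ => n γ + 1) ?_ (h.bdd.add (.const 1))
  have hW : ∀ γ, 1 ≤ (n γ + 1) * (2 * nec (G γ) (d γ) (A γ) + 1) ^ 2 := fun γ =>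
    Nat.mul_pos (Nat.succ_pos _) (by positivity)
  refine CT.foldl_of_prefix (α := fun γ => List (Finset (Fin (n γ)))) (β := fun γ => Fin (n γ))
    (ea := fun _ => encList encSet) (eb := fun _ v => encNat v)
    (f := fun γ => repStep (G γ) (d γ) (A γ))
    (fun q => (2 * q.2.1.length + 1) ^ 2) (fun q => m q.1)
    (fun γ => (2 * nec (G γ) (d γ) (A γ) + 1) ^ 2) m .self (fun γ => ?_) (fun γ => Nat.one_le_pow _ _ (by omega))
    (fun γ l₁ b l₂ hl => ⟨?_, le_rfl⟩) (h.verts.toCT hW)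
    ((PT.list_cons (eb := fun γ => encSet) (PT.empty h.toHasVerts) PT.list_nil).toCT hW) ?_
  · rw [List.length_finRange]
    exact Nat.mul_le_mul_right _ (Nat.le_succ _)
  · have hnd : l₁.Nodup := (hl ▸ List.nodup_finRange _ : (l₁ ++ b :: l₂).Nodup).of_append_left
    have := (repFold_init (G := G γ) (d := d γ) (A := A γ) l₁ hnd).1.length_le
    exact Nat.pow_le_pow_left (by simpa using this) 2
  · have hm : ∀ q : Σ γ, List (Finset (Fin (n γ))) × Fin (n γ), m q.1 ≤ m q.1 := fun _ => le_rfl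
    have h' := h.foldLift (ea := fun _ => encList encSet) (eb := fun γ (v : Fin (n γ)) => encNat v)
      hm
    have hA' := hA.foldLift (ea := fun _ => encList encSet) (eb := fun γ (v : Fin (n γ)) => encNat v)
      hm
    have hd' := hd.foldLift (ea := fun γ => encList (encSet (n := n γ)))
      (eb := fun γ (v : Fin (n γ)) => encNat v) hm
    have hacc : PT (fun q : Σ γ, List (Finset (Fin (n γ))) × Fin (n γ) => m q.1)
      (foldEnv env (fun _ => encList encSet) fun γ (v : Fin (n γ)) => encNat v)
      fun q => encList encSet q.2.1 := PT.foldAcc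
    have hv : PT (fun q : Σ γ, List (Finset (Fin (n γ))) × Fin (n γ) => m q.1)
      (foldEnv env (fun _ => encList encSet) fun γ (v : Fin (n γ)) => encNat v)
      fun q => encNat q.2.2 := PT.foldElem
    have hW' : ∀ q : Σ γ, List (Finset (Fin (n γ))) × Fin (n γ), 1 ≤ (2 * q.2.1.length + 1) ^ 2 :=
      fun q => Nat.one_le_pow _ _ (by omega)
    refine CT.congr (CT.ite ((PD.mem_set (v := fun q : Σ γ, List (Finset (Fin (n γ))) × Fin (n γ) =>
      q.2.2) h'.toHasVerts hA' hv).toCT hW') (CT.foldl_of_prefix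
        (Γ := Σ γ, List (Finset (Fin (n γ))) × Fin (n γ))
        (α := fun q => List (Finset (Fin (n q.1)))) (β := fun q => Finset (Fin (n q.1)))
        (ea := fun _ => encList encSet) (eb := fun _ => encSet)
        (l := fun q => q.2.1) (a := fun q => q.2.1)
        (f := fun q acc X => addRep (G q.1) (d q.1) (A q.1) acc (insert q.2.2 X))
        (fun q => q.2.1.length + 1) (fun q => m q.1.1)
        (fun q => 2 * q.2.1.length + 1) (fun q => m q.1) .self (fun q => ?_) (fun q => by omega)
        (fun q l₁ b l₂ hl => ⟨?_, le_rfl⟩) (hacc.toCT hW') (hacc.toCT hW') ?_) (hacc.toCT hW'))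
      fun q => ?_
    · nlinarith
    · have h1 := length_addReps_le (G := G q.1) (d := d q.1) (A := A q.1) q.2.2 l₁ q.2.1
      have h2 := congrArg List.length hl
      rw [List.length_append] at h2
      rw [List.length_cons] at h2
      refine (Nat.succ_le_succ h1).trans ?_
      omega
    · have hm2 : ∀ q : Σ q : Σ γ, List (Finset (Fin (n γ))) × Fin (n γ),
        List (Finset (Fin (n q.1))) × Finset (Fin (n q.1)), m q.1.1 ≤ m q.1.1 := fun _ => le_rfl
      have h'' := h'.foldLift (ea := fun q => encList (encSet (n := n q.1)))
        (eb := fun q => encSet (n := n q.1)) hm2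
      have hA'' := hA'.foldLift (ea := fun q => encList (encSet (n := n q.1)))
        (eb := fun q => encSet (n := n q.1)) hm2
      have hv'' := hv.foldLift (ea := fun q => encList (encSet (n := n q.1)))
        (eb := fun q => encSet (n := n q.1)) hm2
      have hd'' := hd'.foldLift (ea := fun q => encList (encSet (n := n q.1)))
        (eb := fun q => encSet (n := n q.1)) hm2
      have hl : PT (fun q : Σ q : Σ γ, List (Finset (Fin (n γ))) × Fin (n γ),
          List (Finset (Fin (n q.1))) × Finset (Fin (n q.1)) => m q.1.1)
          (foldEnv (foldEnv env (fun _ => encList encSet) fun γ (v : Fin (n γ)) => encNat v)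
            (fun q => encList (encSet (n := n q.1))) fun q => encSet (n := n q.1))
          fun q => encList encSet q.2.1 := PT.foldAcc
      have hX : PT (fun q : Σ q : Σ γ, List (Finset (Fin (n γ))) × Fin (n γ),
          List (Finset (Fin (n q.1))) × Finset (Fin (n q.1)) => m q.1.1)
          (foldEnv (foldEnv env (fun _ => encList encSet) fun γ (v : Fin (n γ)) => encNat v)
            (fun q => encList (encSet (n := n q.1))) fun q => encSet (n := n q.1))
          fun q => encSet q.2.2 := PT.foldElem
      have hi := PT.insert_vert h''.toHasVerts hv'' hX
      have hW2 : ∀ q : Σ q : Σ γ, List (Finset (Fin (n γ))) × Fin (n γ),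
        List (Finset (Fin (n q.1))) × Finset (Fin (n q.1)), 1 ≤ q.2.1.length + 1 := fun q => by omega
      have hY : PT (fun q : Σ q : Σ q : Σ γ, List (Finset (Fin (n γ))) × Fin (n γ),
          List (Finset (Fin (n q.1))) × Finset (Fin (n q.1)), Finset (Fin (n q.1.1)) => m q.1.1.1)
          (elEnv (foldEnv (foldEnv env (fun _ => encList encSet) fun γ (v : Fin (n γ)) => encNat v)
            (fun q => encList (encSet (n := n q.1))) fun q => encSet (n := n q.1))
            fun q => encSet (n := n q.1.1))
          fun q => encSet q.2 := PT.mem (.inl rfl)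
      refine CT.congr (CT.ite (CT.exists_mem hW2 (fun q => Nat.le_succ _) (hl.toCT hW2)
        (P := fun q Y => Similar (G q.1.1) (d q.1.1) (A q.1.1) Y (insert q.1.2.2 q.2.2))
        (PD.similar h''.lift hd''.lift hA''.lift hY hi.lift)) (hl.toCT hW2)
        ((PT.list_cons (b := fun q : Σ q : Σ γ, List (Finset (Fin (n γ))) × Fin (n γ),
          List (Finset (Fin (n q.1))) × Finset (Fin (n q.1)) => insert q.1.2.2 q.2.2) hi hl).toCT
          hW2)) fun q => ?_
      simp only [addRep]
      split_ifs <;> rfl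
    · simp only [repStep]
      split_ifs <;> rfl

theorem PT.keyOf (h : HasGraph m env n G) (hd : PT m env fun γ => encNat (d γ))
    (hd' : PolyBdd m d) (hA : PT m env fun γ => encSet (A γ))
    (hX : PT m env fun γ => encSet (X γ)) :
    PT m env fun γ => encBits (keyOf (G γ) (d γ) (A γ) (X γ)) := by
  classical
  have hi : PT (fun q : Σ q : Σ γ, Fin (n γ), ℕ => m q.1.1)
      (elEnv (elEnv env fun γ (v : Fin (n γ)) => encNat v) fun _ => encNat) fun q => encNat q.2 :=
    PT.mem (.inl rfl)
  refine PT.flatMap (β := fun γ => Fin (n γ)) (eb := fun _ v => encNat v)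
    (δ := fun _ => Bool) (ed := fun _ b => encProp (b = true)) h.verts h.len
    (f := fun γ u => (List.range (d γ)).map fun i =>
      decide (u ∉ A γ ∧ i < AcyclicDom.nbrCount (G γ) (X γ) u))
    ((hd'.comp Sigma.fst).of_le fun q => by simp) ?_
  refine PT.map (β := fun q => ℕ) (eb := fun _ => encNat) (δ := fun _ => Bool)
    (ed := fun _ b => encProp (b = true)) (PT.range hd hd').lift
    ((hd'.comp Sigma.fst).of_le fun q => by simp) ?_
  refine PD.congr (PD.and (PD.not (PD.mem_set h.toHasVerts.lift.lift hA.lift.lift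
    PT.finElem_lift)) (PD.nat_le (PT.nat_succ hi)
      (PT.nbrCount h.lift.lift hX.lift.lift PT.finElem_lift)
      ((h.bdd.comp fun q : Σ q : Σ γ, Fin (n γ), ℕ => q.1.1).of_le fun q => nbrCount_le _ _ _)))
    fun q => ?_
  simp

end


/-! ### The dynamic program -/

/-- An instance of the problem. -/
structure Inst : Type where
  n : ℕ
  G : SimpleGraph (Fin n)
  w : Fin n → ℚ
  T : LayoutTree (Fin n)
  isLayout : T.IsLayout
  d : ℕ
  two_le : 2 ≤ d
  σ : Set ℕ
  ρ : Set ℕ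
  mem_σ : ∀ k, min d k ∈ σ ↔ k ∈ σ
  mem_ρ : ∀ k, min d k ∈ ρ ↔ k ∈ ρ
  goal : Goal

/-- The union of two partial solutions. -/
noncomputable def Config.union {n : ℕ} (c c' : Config n) : Config n :=
  ⟨c.X ∪ c'.X, c.M ∪ c'.M, c.w + c'.w⟩

namespace Trie

variable {α : Type}

/-- The maximum length of an entry. -/
def maxLen : Trie (List α) → ℕ
  | empty => 0
  | node a l r => max a.length (max l.maxLen r.maxLen)

theorem maxLen_child_le (t : Trie (List α)) (b : Bool) : (t.child b).maxLen ≤ t.maxLen := by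
  cases t <;> cases b <;> simp [child, maxLen]

theorem length_val_le (t : Trie (List α)) : t.val.length ≤ t.maxLen := by
  cases t <;> simp [val, maxLen]

theorem length_lookup_le (t : Trie (List α)) (k : List Bool) :
    (t.lookup k).length ≤ t.maxLen := by
  unfold lookup
  induction k generalizing t with
  | nil => exact t.length_val_le
  | cons b k ih => exact (ih _).trans (t.maxLen_child_le b)

theorem maxLen_insert_le (t : Trie (List α)) (k : List Bool) (a : List α) :
    (t.insert k a).maxLen ≤ max t.maxLen a.length := by
  induction k generalizing t with
  | nil =>
    have := t.maxLen_child_le false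
    have := t.maxLen_child_le true
    simp only [insert, maxLen]
    omega
  | cons b k ih =>
    have h1 := t.maxLen_child_le false
    have h2 := t.maxLen_child_le true
    have h3 := t.length_val_le
    cases b
    · have := ih (t.child false)
      simp only [insert, maxLen]
      omega
    · have := ih (t.child true)
      simp only [insert, maxLen]
      omega

end Trie

/-- A table for the set `A`. -/
structure Item (n : ℕ) : Type where
  A : Finset (Fin n)
  t : Trie (List (Config n))

noncomputable def Item.enc {n : ℕ} (x : Item n) : Data :=
  .cons (encSet x.A) (x.t.enc (encList Config.enc))

namespace Inst

variable (I : Inst)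

/-- The conditions on the vertices in `A` for the set `X ∪ R`. -/
def Ok (A X R : Finset (Fin I.n)) : Prop :=
  ∀ u, u ∈ A → (u ∈ X → nbrCount I.G (X ∪ R) u ∈ I.σ) ∧ (u ∉ X → nbrCount I.G (X ∪ R) u ∈ I.ρ)

/-- `R` stands for the class of the partial solution inside of `A`, and `R'` for the class of the
expected rest of the solution outside of `A`. The address depends on the classes only, so it may be
formed with any members. -/
noncomputable def key (A R R' : Finset (Fin I.n)) : List Bool :=
  keyOf I.G I.d A R ++ keyOf I.G I.d Aᶜ R'

/-- The partial solutions for a single vertex. -/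
def leafConfigs (v : Fin I.n) : List (Config I.n) :=
  [⟨∅, ∅, 0⟩, ⟨{v}, ∅, I.w v⟩, ⟨{v}, {v}, I.w v⟩]

open Classical in
noncomputable def leafEntry (v : Fin I.n) (R R' : Finset (Fin I.n)) : List (Config I.n) :=
  (I.leafConfigs v).filter fun c => Similar I.G I.d {v} c.X R ∧ I.Ok {v} c.X R'

/-- A single vertex has at most the classes of `∅` and of `{v}`. If they coincide, the second
insertion overwrites an entry with an equal one, because the filter in `leafEntry` depends only on
the classes. -/
noncomputable def leafStep (v : Fin I.n) (t : Trie (List (Config I.n))) (R' : Finset (Fin I.n)) :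
    Trie (List (Config I.n)) :=
  (t.insert (I.key {v} ∅ R') (I.leafEntry v ∅ R')).insert (I.key {v} {v} R') (I.leafEntry v {v} R')

noncomputable def leafItem (v : Fin I.n) : Item I.n :=
  ⟨{v}, (reps I.G I.d {v}ᶜ).foldl (I.leafStep v) .empty⟩

/-- The unions of the partial solutions in corresponding entries of two tables. -/
noncomputable def joinEntry (x y : Item I.n) (R S R' : Finset (Fin I.n)) : List (Config I.n) :=
  (x.t.lookup (I.key x.A R (S ∪ R'))).flatMap fun c =>
    (y.t.lookup (I.key y.A S (R ∪ R'))).map fun c' => c.union c'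

/-- Several pairs `R`, `S` may have unions in the same class. The new unions are therefore added to
the present entry, and the result is reduced at once to keep all entries short. -/
noncomputable def joinStep (x y : Item I.n) (P : List (Finset (Fin I.n) × Finset (Fin I.n)))
    (R S : Finset (Fin I.n)) (t : Trie (List (Config I.n))) (R' : Finset (Fin I.n)) :
    Trie (List (Config I.n)) :=
  t.insert (I.key (x.A ∪ y.A) (R ∪ S) R') (reduce I.G I.goal (x.A ∪ y.A) R' P
    (t.lookup (I.key (x.A ∪ y.A) (R ∪ S) R') ++ I.joinEntry x y R S R'))

/-- Pairs of representatives. -/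
noncomputable def cuts (A : Finset (Fin I.n)) : List (Finset (Fin I.n) × Finset (Fin I.n)) :=
  (reps I.G 1 Aᶜ).flatMap fun R => (reps I.G 1 Aᶜ).map fun R' => (R, R')

noncomputable def joinItem (x y : Item I.n) : Item I.n :=
  ⟨x.A ∪ y.A, (reps I.G I.d x.A).foldl (fun t R => (reps I.G I.d y.A).foldl (fun t S =>
    (reps I.G I.d (x.A ∪ y.A)ᶜ).foldl (I.joinStep x y (I.cuts (x.A ∪ y.A)) R S) t) t) .empty⟩

end Inst

/-- The data of an instance are available. -/
structure HasInst {Γ : Type} (m : Γ → ℕ) (env : Set (Γ → Data)) (I : Γ → Inst) : Prop extends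
    HasGraph m env (fun γ => (I γ).n) (fun γ => (I γ).G) where
  wts : PT m env fun γ => encVec fun v : Fin (I γ).n => .wt ((I γ).w v)
  zero : PT m env fun _ => .wt 0
  deg : PT m env fun γ => encNat (I γ).d
  deg_bdd : PolyBdd m fun γ => (I γ).d
  sig : PT m env fun γ => encVec fun i : Fin ((I γ).d + 1) => encProp (i.val ∈ (I γ).σ)
  rho : PT m env fun γ => encVec fun i : Fin ((I γ).d + 1) => encProp (i.val ∈ (I γ).ρ)
  isMax : PD m env fun γ => (I γ).goal = .max

/-! ### Running times for the tables of leaves and internal nodes. -/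

section

variable {Γ : Type} {m W : Γ → ℕ} {env : Set (Γ → Data)} {I : Γ → Inst}
  {A X R S R' : ∀ γ, Finset (Fin (I γ).n)} {x y : ∀ γ, Item (I γ).n}
  {P : ∀ γ, List (Finset (Fin (I γ).n) × Finset (Fin (I γ).n))}
  {c c' : ∀ γ, Config (I γ).n} {α β : Γ → Type} {ea : ∀ γ, α γ → Data} {eb : ∀ γ, β γ → Data}

theorem HasInst.lift (h : HasInst m env I) :
    HasInst (fun q => m q.1) (elEnv env eb) fun q => I q.1 :=
  ⟨h.toHasGraph.lift, h.wts.lift, h.zero.lift, h.deg.lift, h.deg_bdd.comp _, h.sig.lift,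
    h.rho.lift, h.isMax.lift⟩

theorem HasInst.foldLift {m' : (Σ γ, α γ × β γ) → ℕ} (h : HasInst m env I)
    (hm : ∀ q, m q.1 ≤ m' q) : HasInst m' (foldEnv env ea eb) fun q => I q.1 :=
  ⟨h.toHasGraph.foldLift hm, h.wts.foldLift hm, h.zero.foldLift hm, h.deg.foldLift hm,
    (PolyBdd.le_self hm).trans (h.deg_bdd.comp _), h.sig.foldLift hm,
    h.rho.foldLift hm, PT.foldLift h.isMax hm⟩

theorem HasInst.weaken (h : HasInst m env I) (g : Γ → Data) : HasInst m (insert g env) I :=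
  ⟨h.toHasGraph.weaken g, h.wts.weaken g, h.zero.weaken g, h.deg.weaken g, h.deg_bdd,
    h.sig.weaken g, h.rho.weaken g, PT.weaken h.isMax g⟩

theorem PT.config_union (h : HasInst m env I) (hc : PT m env fun γ => (c γ).enc)
    (hc' : PT m env fun γ => (c' γ).enc) : PT m env fun γ => ((c γ).union (c' γ)).enc :=
  (PT.union h.toHasVerts hc.fst hc'.fst).cons
    ((PT.union h.toHasVerts hc.snd.fst hc'.snd.fst).cons (hc.snd.snd.wadd hc'.snd.snd))

/-- Membership depends on the truncation of the number at `d` only, so a vector of `d + 1` bits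
decides it. -/
theorem PD.mem_truncated {σ : Γ → Set ℕ} {d k : Γ → ℕ}
    (hσ : ∀ γ k, min (d γ) k ∈ σ γ ↔ k ∈ σ γ)
    (h : PT m env fun γ => encVec fun i : Fin (d γ + 1) => encProp (i.val ∈ σ γ))
    (hd : PT m env fun γ => encNat (d γ)) (hd' : PolyBdd m d)
    (hk : PT m env fun γ => encNat (k γ)) (hk' : PolyBdd m k) : PD m env fun γ => k γ ∈ σ γ := by
  refine PD.congr (P := fun γ => min (d γ) (k γ) ∈ σ γ) ?_ fun γ => hσ γ _
  exact PT.vec_get (g := fun γ (i : Fin (d γ + 1)) => encProp (i.val ∈ σ γ))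
    (v := fun γ => ⟨min (d γ) (k γ), by omega⟩) h (PT.nat_min hd hk hk') (hd'.add (.const 1))

theorem PD.ok (h : HasInst m env I) (hA : PT m env fun γ => encSet (A γ))
    (hX : PT m env fun γ => encSet (X γ)) (hR : PT m env fun γ => encSet (R γ)) :
    PD m env fun γ => (I γ).Ok (A γ) (X γ) (R γ) := by
  have hV := h.toHasVerts
  have hk := PT.nbrCount h.toHasGraph.lift (PT.union hV hX hR).lift (PT.finElem (n := fun γ => (I γ).n))
  have hk' : PolyBdd (fun q : Σ γ, Fin (I γ).n => m q.1) fun q =>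
      nbrCount (I q.1).G (X q.1 ∪ R q.1) q.2 :=
    (h.bdd.comp Sigma.fst).of_le fun q => nbrCount_le _ _ _
  have hx := PD.mem_set hV.lift hX.lift (PT.finElem (n := fun γ => (I γ).n))
  exact PD.forall_fin hV (P := fun γ u => u ∈ A γ →
    (u ∈ X γ → nbrCount (I γ).G (X γ ∪ R γ) u ∈ (I γ).σ) ∧
      (u ∉ X γ → nbrCount (I γ).G (X γ ∪ R γ) u ∈ (I γ).ρ))
    (PD.imp (PD.mem_set hV.lift hA.lift PT.finElem)
    (PD.and (PD.imp hx (PD.mem_truncated (fun q => (I q.1).mem_σ) h.sig.lift h.deg.lift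
      (h.deg_bdd.comp _) hk hk')) (PD.imp (PD.not hx) (PD.mem_truncated (fun q => (I q.1).mem_ρ)
      h.rho.lift h.deg.lift (h.deg_bdd.comp _) hk hk'))))

theorem length_key {I : Inst} {A R R' : Finset (Fin I.n)} :
    (I.key A R R').length = 2 * (I.n * I.d) := by
  rw [Inst.key, List.length_append, length_keyOf, length_keyOf]
  omega

theorem PolyBdd.key (h : HasInst m env I) : PolyBdd m fun γ =>
    ((I γ).key (A γ) (R γ) (R' γ)).length :=
  ((PolyBdd.const 2).mul (h.bdd.mul h.deg_bdd)).of_le fun γ => by rw [length_key]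

theorem PT.key (h : HasInst m env I) (hA : PT m env fun γ => encSet (A γ))
    (hR : PT m env fun γ => encSet (R γ)) (hR' : PT m env fun γ => encSet (R' γ)) :
    PT m env fun γ => encBits ((I γ).key (A γ) (R γ) (R' γ)) :=
  PT.append (eb := fun _ b => encProp (b = true))
    (PT.keyOf h.toHasGraph h.deg h.deg_bdd hA hR)
    ((h.bdd.mul h.deg_bdd).of_le fun γ => by rw [length_keyOf])
    (PT.keyOf h.toHasGraph h.deg h.deg_bdd (PT.compl h.toHasVerts hA) hR')

theorem PT.singleton (h : HasVerts m env fun γ => (I γ).n) {v : ∀ γ, Fin (I γ).n}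
    (hv : PT m env fun γ => encNat (v γ)) :
    PT m env fun γ => encSet ({v γ} : Finset (Fin (I γ).n)) :=
  (PT.insert_vert h hv (PT.empty h)).congr fun γ => by simp

theorem PT.leafEntry (h : HasInst m env I) {v : ∀ γ, Fin (I γ).n}
    (hv : PT m env fun γ => encNat (v γ)) (hR : PT m env fun γ => encSet (R γ))
    (hR' : PT m env fun γ => encSet (R' γ)) :
    PT m env fun γ => encList Config.enc ((I γ).leafEntry (v γ) (R γ) (R' γ)) := by
  classical
  have hV := h.toHasVerts
  have hs := PT.singleton hV hv
  have he := PT.empty hV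
  have hw := PT.vec_get (g := fun γ v => .wt ((I γ).w v)) h.wts hv h.bdd
  have hl : PT m env fun γ => encList Config.enc ((I γ).leafConfigs (v γ)) :=
    (he.cons (he.cons h.zero)).cons ((hs.cons (he.cons hw)).cons
      ((hs.cons (hs.cons hw)).cons PT.nil))
  have hc : PT (fun q : Σ γ, Config (I γ).n => m q.1) (elEnv env fun _ => Config.enc)
    fun q => q.2.enc := PT.elem
  exact (PT.filter hl (.const 3) (P := fun γ (c : Config (I γ).n) =>
    Similar (I γ).G (I γ).d {v γ} c.X (R γ) ∧ (I γ).Ok {v γ} c.X (R' γ))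
    (PD.and (PD.similar h.toHasGraph.lift h.deg.lift hs.lift hc.fst hR.lift)
      (PD.ok h.lift hs.lift hc.fst hR'.lift))).congr fun γ => by
        unfold Inst.leafEntry
        congr!

theorem PT.leafStep (h : HasInst m env I) {v : ∀ γ, Fin (I γ).n}
    (hv : PT m env fun γ => encNat (v γ)) {t : ∀ γ, Trie (List (Config (I γ).n))}
    (ht : PT m env fun γ => (t γ).enc (encList Config.enc))
    (hR' : PT m env fun γ => encSet (R' γ)) :
    PT m env fun γ => ((I γ).leafStep (v γ) (t γ) (R' γ)).enc (encList Config.enc) := by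
  have hV := h.toHasVerts
  have hs := PT.singleton hV hv
  have he := PT.empty hV
  exact PT.trie_insert (PT.trie_insert ht (PT.key h hs he hR') (PolyBdd.key h)
    (PT.leafEntry h hv he hR')) (PT.key h hs hs hR') (PolyBdd.key h) (PT.leafEntry h hv hs hR')

theorem CT.leafItem (h : HasInst m env I) {v : ∀ γ, Fin (I γ).n}
    (hv : PT m env fun γ => encNat (v γ)) :
    CT (fun γ => (2 * nec (I γ).G (I γ).d {v γ}ᶜ + 1) ^ 2) m env
      fun γ => ((I γ).leafItem (v γ)).enc := by
  have hV := h.toHasVerts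
  have hs := PT.singleton hV hv
  have hW : ∀ γ, 1 ≤ (2 * nec (I γ).G (I γ).d {v γ}ᶜ + 1) ^ 2 :=
    fun γ => Nat.one_le_pow _ _ (by omega)
  refine (hs.toCT hW).cons ?_
  refine CT.foldl_of_prefix (α := fun γ => Trie (List (Config (I γ).n)))
    (β := fun γ => Finset (Fin (I γ).n)) (ea := fun _ => Trie.enc (encList Config.enc))
    (eb := fun _ => encSet) (f := fun γ => (I γ).leafStep (v γ)) (a := fun γ => .empty)
    (fun _ => 1) (fun q => m q.1) (fun _ => 1) m .self (fun γ => ?_) (fun _ => le_rfl)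
    (fun _ _ _ _ _ => ⟨le_rfl, le_rfl⟩)
    (CT.reps h.toHasGraph h.deg (PT.compl hV hs)) (PT.nil.toCT hW) ?_
  · have := (isReps_reps (G := (I γ).G) (d := (I γ).d) (A := {v γ}ᶜ)).length_le
    nlinarith
  · have hm : ∀ q : Σ γ, Trie (List (Config (I γ).n)) × Finset (Fin (I γ).n), m q.1 ≤ m q.1 :=
      fun _ => le_rfl
    refine PT.toCT (PT.leafStep (h.foldLift hm) (hv.foldLift hm) ?_ ?_) fun _ => le_rfl
    · exact PT.foldAcc
    · exact PT.foldElem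

/-- The data for the computation of the table of an internal node are available. -/
structure JoinData {Γ : Type} (m : Γ → ℕ) (env : Set (Γ → Data)) (I : Γ → Inst)
    (x y : ∀ γ, Item (I γ).n) (L₁ L₂ L₃ : ∀ γ, List (Finset (Fin (I γ).n)))
    (P : ∀ γ, List (Finset (Fin (I γ).n) × Finset (Fin (I γ).n))) (B : Γ → ℕ) : Prop extends
    HasInst m env I where
  left : PT m env fun γ => (x γ).enc
  right : PT m env fun γ => (y γ).enc
  left_bdd : PolyBdd m fun γ => (x γ).t.maxLen
  right_bdd : PolyBdd m fun γ => (y γ).t.maxLen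
  nec_bdd : PolyBdd m fun γ => nec (I γ).G 1 ((x γ).A ∪ (y γ).A)
  list₁ : PT m env fun γ => encList encSet (L₁ γ)
  list₂ : PT m env fun γ => encList encSet (L₂ γ)
  list₃ : PT m env fun γ => encList encSet (L₃ γ)
  cuts : PT m env fun γ => encList encPair (P γ)
  cuts_bdd : PolyBdd m fun γ => (P γ).length
  bdd_bdd : PolyBdd m B
  reduce_le : ∀ γ R l, (reduce (I γ).G (I γ).goal ((x γ).A ∪ (y γ).A) R (P γ) l).length ≤ B γ

variable {L₁ L₂ L₃ : ∀ γ, List (Finset (Fin (I γ).n))} {B : Γ → ℕ}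
  {t : ∀ γ, Trie (List (Config (I γ).n))}

theorem JoinData.foldLift {m' : (Σ γ, α γ × β γ) → ℕ} (h : JoinData m env I x y L₁ L₂ L₃ P B)
    (hm : ∀ q, m q.1 ≤ m' q) : JoinData m' (foldEnv env ea eb) (fun q => I q.1) (fun q => x q.1)
      (fun q => y q.1) (fun q => L₁ q.1) (fun q => L₂ q.1) (fun q => L₃ q.1) (fun q => P q.1)
      fun q => B q.1 :=
  have hm' := PolyBdd.le_self hm
  ⟨h.toHasInst.foldLift hm, h.left.foldLift hm, h.right.foldLift hm, hm'.trans (h.left_bdd.comp _),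
    hm'.trans (h.right_bdd.comp _), hm'.trans (h.nec_bdd.comp _), h.list₁.foldLift hm,
    h.list₂.foldLift hm, h.list₃.foldLift hm, h.cuts.foldLift hm, hm'.trans (h.cuts_bdd.comp _),
    hm'.trans (h.bdd_bdd.comp _), fun q => h.reduce_le q.1⟩

theorem PT.joinEntry (h : JoinData m env I x y L₁ L₂ L₃ P B)
    (hR : PT m env fun γ => encSet (R γ)) (hS : PT m env fun γ => encSet (S γ))
    (hR' : PT m env fun γ => encSet (R' γ)) :
    PT m env fun γ => encList Config.enc
      ((I γ).joinEntry (x γ) (y γ) (R γ) (S γ) (R' γ)) := by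
  have hV := h.toHasVerts
  have hI := h.toHasInst
  have h1 := PT.trie_lookup (t := fun γ => (x γ).t) h.left.snd
    (PT.key hI h.left.fst hR (PT.union hV hS hR')) (PolyBdd.key hI)
  have h2 := PT.trie_lookup (t := fun γ => (y γ).t) h.right.snd
    (PT.key hI h.right.fst hS (PT.union hV hR hR')) (PolyBdd.key hI)
  have h1' := h.left_bdd.of_le fun γ =>
    (x γ).t.length_lookup_le ((I γ).key (x γ).A (R γ) (S γ ∪ R' γ))
  have h2' := h.right_bdd.of_le fun γ =>
    (y γ).t.length_lookup_le ((I γ).key (y γ).A (S γ) (R γ ∪ R' γ))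
  have hc : PT (fun q : Σ q : Σ γ, Config (I γ).n, Config (I q.1).n => m q.1.1)
    (elEnv (elEnv env fun _ => Config.enc) fun _ => Config.enc)
    fun q => q.1.2.enc := PT.mem (.inr ⟨_, .inl rfl, rfl⟩)
  have hc' : PT (fun q : Σ q : Σ γ, Config (I γ).n, Config (I q.1).n => m q.1.1)
    (elEnv (elEnv env fun _ => Config.enc) fun _ => Config.enc)
    fun q => q.2.enc := PT.mem (.inl rfl)
  exact PT.flatMap (δ := fun γ => Config (I γ).n) (ed := fun _ => Config.enc) h1 h1'
    (f := fun γ c => ((y γ).t.lookup ((I γ).key (y γ).A (S γ) (R γ ∪ R' γ))).map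
      fun c' => c.union c') ((h2'.comp Sigma.fst).of_le fun q => by simp)
    (PT.map (δ := fun q : Σ γ, Config (I γ).n => Config (I q.1).n) (ed := fun _ => Config.enc)
      (f := fun q c' => q.2.union c') h2.lift
      (h2'.comp Sigma.fst) (PT.config_union hI.lift.lift hc hc'))

theorem PT.joinStep (h : JoinData m env I x y L₁ L₂ L₃ P B)
    (hR : PT m env fun γ => encSet (R γ)) (hS : PT m env fun γ => encSet (S γ))
    (ht : PT m env fun γ => (t γ).enc (encList Config.enc))
    (ht' : PolyBdd m fun γ => (t γ).maxLen)
    (hR' : PT m env fun γ => encSet (R' γ)) :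
    PT m env fun γ => ((I γ).joinStep (x γ) (y γ) (P γ) (R γ) (S γ) (t γ) (R' γ)).enc
      (encList Config.enc) := by
  have hV := h.toHasVerts
  have hI := h.toHasInst
  have hA := PT.union hV h.left.fst h.right.fst
  have hk := PT.key hI hA (PT.union hV hR hS) hR'
  have hl' := ht'.of_le fun γ =>
    (t γ).length_lookup_le ((I γ).key ((x γ).A ∪ (y γ).A) (R γ ∪ S γ) (R' γ))
  refine PT.trie_insert ht hk (PolyBdd.key hI) (PT.reduce h.toHasGraph h.isMax h.cuts h.cuts_bdd hA
    h.nec_bdd hR' (PT.append (PT.trie_lookup ht hk (PolyBdd.key hI)) hl'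
      (PT.joinEntry h hR hS hR')) ?_)
  refine (hl'.add (h.left_bdd.mul h.right_bdd)).of_le fun γ => ?_
  rw [List.length_append, Inst.joinEntry, List.length_flatMap]
  refine Nat.add_le_add_left ?_ _
  simp only [List.length_map, List.map_const', List.sum_replicate, smul_eq_mul]
  exact Nat.mul_le_mul ((x γ).t.length_lookup_le _) ((y γ).t.length_lookup_le _)

/-- Whatever is inserted is the output of `reduce`, whose length has the bound `B` for arbitrary
input. So the entries do not grow with the number of iterations, and every step remains polynomial.
-/
theorem maxLen_foldl_joinStep_le {I : Inst} {x y : Item I.n}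
    {P : List (Finset (Fin I.n) × Finset (Fin I.n))} {B : ℕ} (R S : Finset (Fin I.n))
    (hB : ∀ R l, (reduce I.G I.goal (x.A ∪ y.A) R P l).length ≤ B) (l : List (Finset (Fin I.n)))
    (t : Trie (List (Config I.n))) :
    (l.foldl (I.joinStep x y P R S) t).maxLen ≤ max t.maxLen B := by
  induction l generalizing t with
  | nil => simp
  | cons R' l ih =>
    refine (ih _).trans (max_le ((Trie.maxLen_insert_le _ _ _).trans ?_) (le_max_right _ _))
    exact max_le_max le_rfl (hB _ _)

/-- The three nested loops are treated one at a time. The innermost body takes polynomial time, and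
each loop contributes one factor `s γ + 1`. -/
theorem CT.joinFold₁ (h : JoinData m env I x y L₁ L₂ L₃ P B)
    (hR : PT m env fun γ => encSet (R γ)) (hS : PT m env fun γ => encSet (S γ))
    (ht : PT m env fun γ => (t γ).enc (encList Config.enc))
    (ht' : PolyBdd m fun γ => (t γ).maxLen) {s : Γ → ℕ} (hs : ∀ γ, (L₃ γ).length ≤ s γ) :
    CT (fun γ => s γ + 1) m env fun γ =>
      ((L₃ γ).foldl ((I γ).joinStep (x γ) (y γ) (P γ) (R γ) (S γ)) (t γ)).enc
        (encList Config.enc) := by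
  have hW : ∀ γ, 1 ≤ s γ + 1 := fun γ => by omega
  refine CT.foldl_of_prefix (α := fun γ => Trie (List (Config (I γ).n)))
    (β := fun γ => Finset (Fin (I γ).n)) (ea := fun _ => Trie.enc (encList Config.enc))
    (eb := fun _ => encSet) (f := fun γ => (I γ).joinStep (x γ) (y γ) (P γ) (R γ) (S γ))
    (fun _ => 1) (fun q => m q.1 + q.2.1.maxLen) (fun _ => 1)
    (fun γ => m γ + ((t γ).maxLen + B γ)) (PolyBdd.self.add (ht'.add h.bdd_bdd))
    (fun γ => by have := hs γ; omega) (fun _ => le_rfl) (fun γ l₁ b l₂ hl => ⟨le_rfl, ?_⟩)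
    (h.list₃.toCT hW) (ht.toCT hW) ?_
  · have := maxLen_foldl_joinStep_le (R γ) (S γ) (h.reduce_le γ) l₁ (t γ)
    refine Nat.add_le_add_left (this.trans ?_) _
    omega
  · have hm : ∀ q : Σ γ, Trie (List (Config (I γ).n)) × Finset (Fin (I γ).n),
      m q.1 ≤ m q.1 + q.2.1.maxLen := fun q => Nat.le_add_right _ _
    refine PT.toCT (PT.joinStep (h.foldLift hm) (hR.foldLift hm) (hS.foldLift hm) ?_ ?_ ?_)
      fun _ => le_rfl
    · exact PT.foldAcc
    · exact .le_self fun q => Nat.le_add_left _ _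
    · exact PT.foldElem

theorem maxLen_foldl_le {α β : Type} {f : Trie (List α) → β → Trie (List α)} {B : ℕ}
    (hf : ∀ t b, (f t b).maxLen ≤ max t.maxLen B) (l : List β) (t : Trie (List α)) :
    (l.foldl f t).maxLen ≤ max t.maxLen B := by
  induction l generalizing t with
  | nil => simp
  | cons b l ih => exact (ih _).trans (max_le (hf _ _) (le_max_right _ _))

theorem CT.joinFold₂ (h : JoinData m env I x y L₁ L₂ L₃ P B)
    (hR : PT m env fun γ => encSet (R γ))
    (ht : PT m env fun γ => (t γ).enc (encList Config.enc))
    (ht' : PolyBdd m fun γ => (t γ).maxLen) {s : Γ → ℕ} (hs₂ : ∀ γ, (L₂ γ).length ≤ s γ)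
    (hs₃ : ∀ γ, (L₃ γ).length ≤ s γ) :
    CT (fun γ => (s γ + 1) ^ 2) m env fun γ =>
      ((L₂ γ).foldl (fun t S => (L₃ γ).foldl ((I γ).joinStep (x γ) (y γ) (P γ) (R γ) S) t)
        (t γ)).enc (encList Config.enc) := by
  have hW : ∀ γ, 1 ≤ (s γ + 1) ^ 2 := fun γ => Nat.one_le_pow _ _ (by omega)
  refine CT.foldl_of_prefix (α := fun γ => Trie (List (Config (I γ).n)))
    (β := fun γ => Finset (Fin (I γ).n)) (ea := fun _ => Trie.enc (encList Config.enc))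
    (eb := fun _ => encSet) (f := fun γ t S =>
      (L₃ γ).foldl ((I γ).joinStep (x γ) (y γ) (P γ) (R γ) S) t)
    (fun q => s q.1 + 1) (fun q => m q.1 + q.2.1.maxLen) (fun γ => s γ + 1)
    (fun γ => m γ + ((t γ).maxLen + B γ)) (PolyBdd.self.add (ht'.add h.bdd_bdd))
    (fun γ => by have := hs₂ γ; nlinarith) (fun _ => by omega)
    (fun γ l₁ b l₂ hl => ⟨le_rfl, ?_⟩)
    (h.list₂.toCT hW) (ht.toCT hW) ?_
  · have := maxLen_foldl_le (fun t S => maxLen_foldl_joinStep_le (R γ) S (h.reduce_le γ) (L₃ γ) t)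
      l₁ (t γ)
    refine Nat.add_le_add_left (this.trans ?_) _
    omega
  · have hm : ∀ q : Σ γ, Trie (List (Config (I γ).n)) × Finset (Fin (I γ).n),
      m q.1 ≤ m q.1 + q.2.1.maxLen := fun q => Nat.le_add_right _ _
    refine CT.joinFold₁ (h.foldLift hm) (hR.foldLift hm) ?_ ?_ ?_ fun q => hs₃ q.1
    · exact PT.foldElem
    · exact PT.foldAcc
    · exact .le_self fun q => Nat.le_add_left _ _

theorem CT.joinFold₃ (h : JoinData m env I x y L₁ L₂ L₃ P B)
    {s : Γ → ℕ} (hs₁ : ∀ γ, (L₁ γ).length ≤ s γ) (hs₂ : ∀ γ, (L₂ γ).length ≤ s γ)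
    (hs₃ : ∀ γ, (L₃ γ).length ≤ s γ) :
    CT (fun γ => (s γ + 1) ^ 3) m env fun γ =>
      ((L₁ γ).foldl (fun t R => (L₂ γ).foldl (fun t S =>
        (L₃ γ).foldl ((I γ).joinStep (x γ) (y γ) (P γ) R S) t) t)
        .empty).enc (encList Config.enc) := by
  have hW : ∀ γ, 1 ≤ (s γ + 1) ^ 3 := fun γ => Nat.one_le_pow _ _ (by omega)
  refine CT.foldl_of_prefix (α := fun γ => Trie (List (Config (I γ).n)))
    (β := fun γ => Finset (Fin (I γ).n)) (ea := fun _ => Trie.enc (encList Config.enc))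
    (eb := fun _ => encSet) (f := fun γ t R => (L₂ γ).foldl (fun t S =>
      (L₃ γ).foldl ((I γ).joinStep (x γ) (y γ) (P γ) R S) t) t)
    (fun q => (s q.1 + 1) ^ 2) (fun q => m q.1 + q.2.1.maxLen) (fun γ => (s γ + 1) ^ 2)
    (fun γ => m γ + B γ) (PolyBdd.self.add h.bdd_bdd)
    (fun γ => ?_) (fun _ => Nat.one_le_pow _ _ (by omega))
    (fun γ l₁ b l₂ hl => ⟨le_rfl, ?_⟩)
    (h.list₁.toCT hW) (PT.nil.toCT hW) ?_
  · rw [pow_succ (s γ + 1) 2, mul_comm]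
    exact Nat.mul_le_mul_left _ ((hs₁ γ).trans (Nat.le_succ _))
  · have := maxLen_foldl_le (fun t R => maxLen_foldl_le
      (fun t S => maxLen_foldl_joinStep_le R S (h.reduce_le γ) (L₃ γ) t) (L₂ γ) t) l₁ .empty
    refine Nat.add_le_add_left (this.trans ?_) _
    simp [Trie.maxLen]
  · have hm : ∀ q : Σ γ, Trie (List (Config (I γ).n)) × Finset (Fin (I γ).n),
      m q.1 ≤ m q.1 + q.2.1.maxLen := fun q => Nat.le_add_right _ _
    refine CT.joinFold₂ (h.foldLift hm) ?_ ?_ ?_ (fun q => hs₂ q.1) fun q => hs₃ q.1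
    · exact PT.foldElem
    · exact PT.foldAcc
    · exact .le_self fun q => Nat.le_add_left _ _

theorem length_cuts_le {I : Inst} (A : Finset (Fin I.n)) :
    (I.cuts A).length ≤ nec I.G 1 Aᶜ ^ 2 := by
  have := (isReps_reps (G := I.G) (d := 1) (A := Aᶜ)).length_le
  rw [Inst.cuts, List.length_flatMap]
  simp only [List.length_map, List.map_const', List.sum_replicate, smul_eq_mul]
  nlinarith

theorem PT.cuts (h : HasInst m env I) (hA : PT m env fun γ => encSet (A γ))
    (hnec : PolyBdd m fun γ => nec (I γ).G 1 (A γ)ᶜ) :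
    PT m env fun γ => encList encPair ((I γ).cuts (A γ)) := by
  have h1 := (CT.reps (d := fun _ => 1) h.toHasGraph (PT.nat_const 1)
    (PT.compl h.toHasVerts hA)).toPT ((((PolyBdd.const 2).mul hnec).add (.const 1)).pow 2)
  have h1' := hnec.of_le fun γ => (isReps_reps (G := (I γ).G) (d := 1) (A := (A γ)ᶜ)).length_le
  have hR : PT (fun q : Σ q : Σ γ, Finset (Fin (I γ).n), Finset (Fin (I q.1).n) => m q.1.1)
    (elEnv (elEnv env fun _ => encSet) fun _ => encSet)
    fun q => encSet q.1.2 := PT.mem (.inr ⟨_, .inl rfl, rfl⟩)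
  have hR' : PT (fun q : Σ q : Σ γ, Finset (Fin (I γ).n), Finset (Fin (I q.1).n) => m q.1.1)
    (elEnv (elEnv env fun _ => encSet) fun _ => encSet)
    fun q => encSet q.2 := PT.mem (.inl rfl)
  exact PT.flatMap (δ := fun γ => Finset (Fin (I γ).n) × Finset (Fin (I γ).n))
    (ed := fun _ => encPair) h1 h1'
    (f := fun γ R => (AcyclicDom.reps (I γ).G 1 (A γ)ᶜ).map fun R' => (R, R'))
    ((h1'.comp Sigma.fst).of_le fun q => by simp)
    (PT.map (δ := fun q : Σ γ, Finset (Fin (I γ).n) => Finset (Fin (I q.1).n) ×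
      Finset (Fin (I q.1).n)) (ed := fun _ => encPair) (f := fun q R' => (q.2, R')) h1.lift
      (h1'.comp Sigma.fst) (hR.cons hR'))

theorem CT.weaken {f : Γ → Data} (h : CT W m env f) (g : Γ → Data) : CT W m (insert g env) f :=
  h.reindex id fun _ h => .inr h

theorem CT.joinItem (h : HasInst m env I) (hx : PT m env fun γ => (x γ).enc)
    (hy : PT m env fun γ => (y γ).enc) (hx' : PolyBdd m fun γ => (x γ).t.maxLen)
    (hy' : PolyBdd m fun γ => (y γ).t.maxLen)
    (hnec : PolyBdd m fun γ => nec (I γ).G 1 ((x γ).A ∪ (y γ).A))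
    (hnec' : PolyBdd m fun γ => nec (I γ).G 1 ((x γ).A ∪ (y γ).A)ᶜ)
    (hB : PolyBdd m B)
    (hBr : ∀ γ R l, (AcyclicDom.reduce (I γ).G (I γ).goal ((x γ).A ∪ (y γ).A) R
      ((I γ).cuts ((x γ).A ∪ (y γ).A)) l).length ≤ B γ) {s : Γ → ℕ}
    (hs₁ : ∀ γ, nec (I γ).G (I γ).d (x γ).A ≤ s γ)
    (hs₂ : ∀ γ, nec (I γ).G (I γ).d (y γ).A ≤ s γ)
    (hs₃ : ∀ γ, nec (I γ).G (I γ).d ((x γ).A ∪ (y γ).A)ᶜ ≤ s γ) :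
    CT (fun γ => (2 * s γ + 1) ^ 3) m env fun γ => ((I γ).joinItem (x γ) (y γ)).enc := by
  have hV := h.toHasVerts
  have hA := PT.union hV hx.fst hy.fst
  have hW : ∀ γ, 1 ≤ (2 * s γ + 1) ^ 3 := fun γ => Nat.one_le_pow _ _ (by omega)
  -- The quadratic cost of finding representatives is dominated by the third power for the loops.
  have hmono : ∀ {A : ∀ γ, Finset (Fin (I γ).n)}, (∀ γ, nec (I γ).G (I γ).d (A γ) ≤ s γ) →
      ∀ γ, (2 * nec (I γ).G (I γ).d (A γ) + 1) ^ 2 ≤ (2 * s γ + 1) ^ 3 := fun {A} hs γ =>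
    (Nat.pow_le_pow_left (by have := hs γ; omega) 2).trans
      (Nat.pow_le_pow_right (by omega) (by omega))
  have hlen : ∀ {A : ∀ γ, Finset (Fin (I γ).n)}, (∀ γ, nec (I γ).G (I γ).d (A γ) ≤ s γ) →
      ∀ γ, (AcyclicDom.reps (I γ).G (I γ).d (A γ)).length ≤ 2 * s γ := fun {A} hs γ => by
    have := (isReps_reps (G := (I γ).G) (d := (I γ).d) (A := A γ)).length_le
    have := hs γ
    omega
  refine (hA.toCT hW).cons ?_
  -- The three lists of representatives and the list of cuts are stored before the loops, so that
  -- they are not recomputed in each iteration.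
  refine .bind ((CT.reps h.toHasGraph h.deg hx.fst).mono (hmono hs₁)) ?_
  refine .bind (((CT.reps h.toHasGraph h.deg hy.fst).mono (hmono hs₂)).weaken _) ?_
  refine .bind ((((CT.reps h.toHasGraph h.deg (PT.compl hV hA)).mono (hmono hs₃)).weaken
    _).weaken _) ?_
  refine .bind ((((PT.cuts h hA hnec').weaken _).weaken _).weaken _ |>.toCT hW) ?_
  refine CT.joinFold₃ (s := fun γ => 2 * s γ) (B := B)
    (P := fun γ => (I γ).cuts ((x γ).A ∪ (y γ).A)) ⟨(((h.weaken _).weaken _).weaken _).weaken _,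
      (((hx.weaken _).weaken _).weaken _).weaken _, (((hy.weaken _).weaken _).weaken _).weaken _,
      hx', hy', hnec, .mem (by simp), .mem (by simp), .mem (by simp), .mem (by simp),
      (hnec'.pow 2).of_le fun γ => length_cuts_le _, hB, hBr⟩
    (hlen hs₁) (hlen hs₂) (hlen hs₃)

end


/-! ### Gaussian elimination -/

section Elimination

variable {c κ : Type} {ℓ : ℕ} {same : c → c → Prop} {φ : c → Fin ℓ → ZMod 2} {key : c → κ}

/-- `j` is the position of the first non-zero entry. -/
def IsLead {ℓ : ℕ} (r : Fin ℓ → ZMod 2) (j : Fin ℓ) : Prop := r j = 1 ∧ ∀ i, i < j → ¬ r i = 1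

theorem exists_isLead {r : Fin ℓ → ZMod 2} (h : ∃ j, r j = 1) : ∃ j, IsLead r j := by
  obtain ⟨j, hj, hmin⟩ := WellFounded.has_min (wellFounded_lt (α := Fin ℓ)) {j | r j = 1} h
  exact ⟨j, hj, fun i hi h => hmin i h hi⟩

theorem IsLead.unique {r : Fin ℓ → ZMod 2} {i j : Fin ℓ} (hi : IsLead r i) (hj : IsLead r j) :
    i = j := by
  rcases lt_trichotomy i j with h | h | h
  · exact absurd hi.1 (hj.2 i h)
  · exact h
  · exact absurd hj.1 (hi.2 j h)

open Classical in
/-- The fold in the definition of `residual`. -/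
noncomputable def residualFold (same : c → c → Prop) (x : c) (v : Fin ℓ → ZMod 2)
    (kept : List (c × (Fin ℓ → ZMod 2))) : Fin ℓ → ZMod 2 :=
  kept.foldl (fun v y => if same x y.1 ∧ Hits y.2 v then v + y.2 else v) v

/-- Elimination only adds rows of the class of `x`, and a functional that vanishes on these does not
notice it. -/
theorem map_residualFold (lam : (Fin ℓ → ZMod 2) →+ ZMod 2) (x : c) :
    ∀ (kept : List (c × (Fin ℓ → ZMod 2))) (v : Fin ℓ → ZMod 2),
      (∀ y ∈ kept, same x y.1 → lam y.2 = 0) → lam (residualFold same x v kept) = lam v := by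
  intro kept
  induction kept with
  | nil => intro v _; rfl
  | cons y kept ih =>
    intro v h
    rw [List.forall_mem_cons] at h
    rw [residualFold, List.foldl_cons, ← residualFold, ih _ h.2]
    split_ifs with hy
    · rw [map_add, h.1 hy.1, add_zero]
    · rfl

theorem residualFold_apply_ne (x : c) {j : Fin ℓ} :
    ∀ (kept : List (c × (Fin ℓ → ZMod 2))) (v : Fin ℓ → ZMod 2),
      (∀ y ∈ kept, same x y.1 → y.2 j ≠ 1) → v j ≠ 1 → residualFold same x v kept j ≠ 1 := by
  intro kept
  induction kept with
  | nil => intro v _ h; exact h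
  | cons y kept ih =>
    intro v h hv
    rw [List.forall_mem_cons] at h
    rw [residualFold, List.foldl_cons, ← residualFold]
    refine ih _ h.2 ?_
    split_ifs with hy
    · have := h.1 hy.1
      rw [Pi.add_apply, Ne, zmod_two_add_eq_one]
      tauto
    · exact hv

/-- After the row `y` has been used, the entry at its leading position is zero. Later rows of the
class vanish at this position by the pairwise hypothesis, so the entry is not changed again. -/
theorem residualFold_lead_ne (hsame : ∀ x y, same x y ↔ key x = key y) (x : c) :
    ∀ (kept : List (c × (Fin ℓ → ZMod 2))) (v : Fin ℓ → ZMod 2),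
      kept.Pairwise (fun a b => key a.1 = key b.1 → ∀ j, IsLead a.2 j → b.2 j ≠ 1) →
      ∀ y ∈ kept, key y.1 = key x → ∀ j, IsLead y.2 j → residualFold same x v kept j ≠ 1 := by
  intro kept
  induction kept with
  | nil => simp
  | cons z kept ih =>
    intro v hp y hy hyx j hj
    rw [List.pairwise_cons] at hp
    rw [residualFold, List.foldl_cons, ← residualFold]
    rcases List.mem_cons.1 hy with rfl | hy
    · refine residualFold_apply_ne x kept _ (fun z hz hxz => ?_) ?_
      · exact hp.1 z hz (hyx.trans ((hsame _ _).1 hxz)) j hj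
      · split_ifs with h
        · obtain ⟨-, i, h1, h2, h3⟩ := h
          have hi : IsLead y.2 i := ⟨h1, h2⟩
          rw [hj.unique hi, Pi.add_apply, h1, h3]
          decide
        · exact fun hv => h ⟨(hsame _ _).2 hyx.symm, j, hj.1, hj.2, hv⟩
    · exact ih _ hp.2 y hy hyx j hj

theorem residual_eq (kept : List (c × (Fin ℓ → ZMod 2))) (x : c) :
    residual same φ kept x = residualFold same x (φ x) kept := rfl

theorem mem_elimStep {kept : List (c × (Fin ℓ → ZMod 2))} {x : c} {y : c × (Fin ℓ → ZMod 2)}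
    (h : y ∈ elimStep same φ kept x) : y ∈ kept ∨ y = (x, residual same φ kept x) := by
  unfold elimStep at h
  split_ifs at h
  · simpa using h
  · exact .inl h

theorem subset_elimStep {kept : List (c × (Fin ℓ → ZMod 2))} {x : c} {y : c × (Fin ℓ → ZMod 2)}
    (h : y ∈ kept) : y ∈ elimStep same φ kept x := by
  unfold elimStep
  split_ifs <;> simp [h]

theorem subset_elimFold {l : List c} {kept : List (c × (Fin ℓ → ZMod 2))}
    {y : c × (Fin ℓ → ZMod 2)} (h : y ∈ kept) : y ∈ l.foldl (elimStep same φ) kept := by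
  induction l generalizing kept with
  | nil => exact h
  | cons x l ih => exact ih (subset_elimStep h)

theorem mem_elimFold {l : List c} {kept : List (c × (Fin ℓ → ZMod 2))}
    {y : c × (Fin ℓ → ZMod 2)} (h : y ∈ l.foldl (elimStep same φ) kept) : y ∈ kept ∨ y.1 ∈ l := by
  induction l generalizing kept with
  | nil => exact .inl h
  | cons x l ih =>
    rcases ih h with h | h
    · rcases mem_elimStep h with h | rfl
      · exact .inl h
      · exact .inr (by simp)
    · exact .inr (by simp [h])

/-- The invariants of the elimination. -/
structure ElimInv (φ : c → Fin ℓ → ZMod 2) (key : c → κ) (kept : List (c × (Fin ℓ → ZMod 2))) :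
    Prop where
  span : ∀ (lam : (Fin ℓ → ZMod 2) →+ ZMod 2) (k : κ),
    (∀ y ∈ kept, key y.1 = k → lam (φ y.1) = 0) → ∀ y ∈ kept, key y.1 = k → lam y.2 = 0
  lead : ∀ y ∈ kept, ∃ j, IsLead y.2 j
  pairwise : kept.Pairwise fun a b => key a.1 = key b.1 → ∀ j, IsLead a.2 j → b.2 j ≠ 1

/-- The field `span` says in dual form that the rows of a class lie in the span of the feature
vectors of the elements kept in it. A new residual differs from its feature vector by such rows, and
it vanishes at the leading positions of all earlier rows of its class. -/
theorem ElimInv.step (hsame : ∀ x y, same x y ↔ key x = key y)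
    {kept : List (c × (Fin ℓ → ZMod 2))} (h : ElimInv φ key kept) (x : c) :
    ElimInv φ key (elimStep same φ kept x) := by
  unfold elimStep
  split_ifs with hx
  · refine ⟨fun lam k hk y hy hyk => ?_, fun y hy => ?_, ?_⟩
    · have h1 := h.span lam k fun y hy => hk y (by simp [hy])
      rcases List.mem_append.1 hy with hy | hy
      · exact h1 y hy hyk
      · obtain rfl := List.mem_singleton.1 hy
        rw [residual_eq, map_residualFold]
        · exact hk _ (by simp) hyk
        · intro z hz hxz
          exact h1 z hz (((hsame _ _).1 hxz).symm.trans hyk)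
    · rcases List.mem_append.1 hy with hy | hy
      · exact h.lead y hy
      · obtain rfl := List.mem_singleton.1 hy
        exact exists_isLead hx
    · rw [List.pairwise_append]
      refine ⟨h.pairwise, List.pairwise_singleton _ _, fun y hy z hz hyz j hj => ?_⟩
      obtain rfl := List.mem_singleton.1 hz
      exact residualFold_lead_ne hsame x kept _ h.pairwise y hy hyz j hj
  · exact h

theorem ElimInv.fold (hsame : ∀ x y, same x y ↔ key x = key y) (l : List c)
    {kept : List (c × (Fin ℓ → ZMod 2))} (h : ElimInv φ key kept) :
    ElimInv φ key (l.foldl (elimStep same φ) kept) := by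
  induction l generalizing kept with
  | nil => exact h
  | cons x l ih => exact ih (h.step hsame x)

theorem ElimInv.nil : ElimInv φ key [] := ⟨by simp, by simp, by simp⟩

/-- Suppose that the functional vanishes on the feature vectors of all kept elements of the class.
Then it vanishes on their rows, hence takes the same value on the residual of `x` as on `φ x`. But
this residual is zero unless `x` itself is kept. -/
theorem exists_mem_elimStep (hsame : ∀ x y, same x y ↔ key x = key y)
    {kept : List (c × (Fin ℓ → ZMod 2))} (h : ElimInv φ key kept) (x : c)
    (lam : (Fin ℓ → ZMod 2) →+ ZMod 2) (hx : lam (φ x) ≠ 0) :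
    ∃ y ∈ elimStep same φ kept x, key y.1 = key x ∧ lam (φ y.1) ≠ 0 := by
  by_contra! hcon
  refine hx ?_
  have h1 := h.span lam (key x) fun y hy hyx => hcon y (subset_elimStep hy) hyx
  have h2 : lam (residual same φ kept x) = lam (φ x) := by
    rw [residual_eq, map_residualFold]
    exact fun z hz hxz => h1 z hz ((hsame _ _).1 hxz).symm
  unfold elimStep at hcon
  split_ifs at hcon with hj
  · exact hcon (x, residual same φ kept x) (by simp) rfl
  · have h3 : residual same φ kept x = 0 := by
      funext j
      have : ∀ a : ZMod 2, ¬ a = 1 → a = 0 := by decide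
      exact this _ fun h => hj ⟨j, h⟩
    rw [← h2, h3, map_zero]

/-- This is the greedy argument for a best basis: everything that is kept when `x` has been treated
is `x` itself or precedes `x` in the sorted list, so the witness is related to `x` by `r`. -/
theorem exists_mem_elim (hsame : ∀ x y, same x y ↔ key x = key y) {l : List c} {r : c → c → Prop}
    (hr : l.Pairwise r) (hrefl : ∀ x, r x x) {x : c} (hx : x ∈ l)
    (lam : (Fin ℓ → ZMod 2) →+ ZMod 2) (hlam : lam (φ x) ≠ 0) :
    ∃ y ∈ elim same φ l, key y = key x ∧ r y x ∧ lam (φ y) ≠ 0 := by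
  obtain ⟨l₁, l₂, rfl⟩ := List.append_of_mem hx
  obtain ⟨y, hy, h1, h2⟩ := exists_mem_elimStep hsame
    (ElimInv.fold hsame l₁ (ElimInv.nil (φ := φ))) x lam hlam
  refine ⟨y.1, ?_, h1, ?_, h2⟩
  · rw [elim, List.foldl_append, List.foldl_cons]
    exact List.mem_map_of_mem (subset_elimFold hy)
  · rcases mem_elimStep hy with hy | rfl
    · have := (mem_elimFold hy).resolve_left (by simp)
      exact (List.pairwise_append.1 hr).2.2 y.1 this x (by simp)
    · exact hrefl x

theorem mem_of_mem_elim {l : List c} {x : c} (h : x ∈ elim same φ l) : x ∈ l := by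
  obtain ⟨y, hy, rfl⟩ := List.mem_map.1 h
  exact (mem_elimFold hy).resolve_left (by simp)

/-- Kept rows of the same class have different leading positions. So the pairs of class and leading
position are distinct, and there are at most `K.card * ℓ` of them. -/
theorem length_elim_le [DecidableEq κ] (hsame : ∀ x y, same x y ↔ key x = key y) {l : List c}
    {K : Finset κ} (hK : ∀ x ∈ l, key x ∈ K) : (elim same φ l).length ≤ K.card * ℓ := by
  classical
  have h := ElimInv.fold hsame l (ElimInv.nil (φ := φ))
  rw [elim, List.length_map]
  set kept := l.foldl (elimStep same φ) [] with hkept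
  have hch : ∀ y : c × (Fin ℓ → ZMod 2), ∃ j : Option (Fin ℓ), ∀ i, IsLead y.2 i → j = some i := by
    intro y
    by_cases hy : ∃ j, IsLead y.2 j
    · obtain ⟨j, hj⟩ := hy
      exact ⟨some j, fun i hi => by rw [hj.unique hi]⟩
    · exact ⟨none, fun i hi => (hy ⟨i, hi⟩).elim⟩
  choose lead hlead using hch
  have hnd : (kept.map fun y => (key y.1, lead y)).Nodup := by
    rw [List.Nodup, List.pairwise_map]
    refine h.pairwise.imp_of_mem fun {a b} ha hb hab heq => ?_
    rw [Prod.mk.injEq] at heq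
    obtain ⟨j, hj⟩ := h.lead a ha
    obtain ⟨i, hi⟩ := h.lead b hb
    have h1 := heq.2
    rw [hlead a j hj, hlead b i hi, Option.some.injEq] at h1
    subst h1
    exact hab heq.1 j hj hi.1
  have hsub : (kept.map fun y => (key y.1, lead y)).toFinset ⊆
      K ×ˢ (Finset.univ.image some) := by
    intro p hp
    rw [List.mem_toFinset, List.mem_map] at hp
    obtain ⟨y, hy, rfl⟩ := hp
    obtain ⟨j, hj⟩ := h.lead y hy
    rw [Finset.mem_product]
    refine ⟨hK _ ((mem_elimFold hy).resolve_left (by simp)), ?_⟩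
    simp [hlead y j hj]
  have hcard := Finset.card_le_card hsub
  rw [List.toFinset_card_of_nodup hnd, List.length_map, Finset.card_product,
    Finset.card_image_of_injective _ (Option.some_injective _), Finset.card_univ,
    Fintype.card_fin] at hcard
  exact hcard

end Elimination

/-! ### Sorting -/

section Sorting

variable {n : ℕ} {goal : Goal}

theorem Goal.le_refl (a : ℚ) : goal.le a a := by cases goal <;> exact _root_.le_refl a

theorem Goal.le_trans {a b c : ℚ} (h : goal.le a b) (h' : goal.le b c) : goal.le a c := by
  cases goal
  · exact _root_.le_trans h h'
  · exact _root_.le_trans h' h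

theorem Goal.le_total (a b : ℚ) : goal.le a b ∨ goal.le b a := by
  cases goal
  · exact _root_.le_total a b
  · exact _root_.le_total b a

theorem mem_sortFold (l acc : List (Config n)) (c : Config n) :
    c ∈ l.foldl (sortStep goal) acc ↔ c ∈ acc ∨ c ∈ l := by
  induction l generalizing acc with
  | nil => simp
  | cons x l ih =>
    rw [List.foldl_cons, ih, sortStep]
    simp only [List.mem_append, List.mem_cons, List.mem_filter, decide_eq_true_eq]
    tauto

theorem mem_sortConfigs {l : List (Config n)} {c : Config n} :
    c ∈ sortConfigs goal l ↔ c ∈ l := by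
  rw [sortConfigs, mem_sortFold]
  simp

theorem pairwise_sortFold (l acc : List (Config n))
    (h : acc.Pairwise fun a b => goal.le b.w a.w) :
    (l.foldl (sortStep goal) acc).Pairwise fun a b => goal.le b.w a.w := by
  induction l generalizing acc with
  | nil => exact h
  | cons x l ih =>
    refine ih _ ?_
    rw [sortStep, List.pairwise_append, List.pairwise_cons]
    refine ⟨h.filter _, ⟨fun b hb => ?_, h.filter _⟩, fun a ha b hb => ?_⟩
    · simp only [List.mem_filter, decide_eq_true_eq] at hb
      exact (Goal.le_total _ _).resolve_right hb.2
    · simp only [List.mem_filter, decide_eq_true_eq] at ha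
      rcases List.mem_cons.1 hb with rfl | hb
      · exact ha.2
      · simp only [List.mem_filter, decide_eq_true_eq] at hb
        exact Goal.le_trans ((Goal.le_total _ _).resolve_right hb.2) ha.2

theorem pairwise_sortConfigs (l : List (Config n)) :
    (sortConfigs goal l).Pairwise fun a b => goal.le b.w a.w :=
  pairwise_sortFold l [] .nil

end Sorting

/-! ### The size of the reduced lists -/

section

variable {n : ℕ} (G : SimpleGraph (Fin n)) (A : Finset (Fin n))

open Classical in
/-- The numbers of neighbors in `S` of the vertices outside of `A`. -/
noncomputable def outCount (S : Finset (Fin n)) : Fin n → ℕ :=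
  fun u => if u ∈ A then 0 else nbrCount G S u

open Classical in
/-- The neighbor counts of the irredundant subsets of `A`. -/
noncomputable def irrSums : Finset (Fin n → ℕ) :=
  ((Finset.univ : Finset (Finset (Fin n))).filter fun S => Irredundant G A S).image (outCount G A)

/-- The invariants compared in `SameKey`. -/
noncomputable def configKey (R : Finset (Fin n)) (c : Config n) : ℕ × ℕ × ℕ × ℕ × (Fin n → ℕ) :=
  (c.X.card, adjPairs G c.X, (one G R c.X).card, c.M.card, outCount G A (big G R c.X))

variable {G A}

theorem outCount_eq_iff {S S' : Finset (Fin n)} : outCount G A S = outCount G A S' ↔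
    ∀ u, u ∉ A → nbrCount G S u = nbrCount G S' u := by
  rw [funext_iff]
  refine forall_congr' fun u => ?_
  simp only [outCount]
  split_ifs with h <;> simp [h]

theorem sameKey_iff (R : Finset (Fin n)) (c c' : Config n) :
    SameKey G A R c c' ↔ configKey G A R c = configKey G A R c' := by
  simp only [SameKey, configKey, Prod.mk.injEq, outCount_eq_iff]

/-- After the filter, the set `big G R c.X` is a disjoint union of two irredundant sets, so its
vector of neighbor counts is a sum of two elements of `irrSums`. The other four invariants are
numbers bounded by `n` or `n * n`, and each class keeps at most one element per column. -/
theorem length_reduce_le (goal : Goal) (R : Finset (Fin n))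
    (P : List (Finset (Fin n) × Finset (Fin n))) (l : List (Config n)) :
    (reduce G goal A R P l).length ≤
      (n + 1) ^ 3 * (n * n + 1) * (irrSums G A).card ^ 2 * P.length := by
  classical
  have hn : ∀ X : Finset (Fin n), X.card < n + 1 := fun X =>
    Nat.lt_succ_of_le ((Finset.card_le_univ X).trans (by simp))
  refine (length_elim_le (sameKey_iff R) (K := Finset.range (n + 1) ×ˢ Finset.range (n * n + 1) ×ˢ
    Finset.range (n + 1) ×ˢ Finset.range (n + 1) ×ˢ
      Finset.image₂ (· + ·) (irrSums G A) (irrSums G A)) fun c hc => ?_).trans ?_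
  · rw [mem_sortConfigs, List.mem_filter, decide_eq_true_eq] at hc
    obtain ⟨C, D, hdis, hCD, hC, hD⟩ := splitList_ne_nil_iff.1 hc.2
    simp only [configKey, Finset.mem_product, Finset.mem_range]
    refine ⟨hn _, Nat.lt_succ_of_le (adjPairs_le _ _), hn _, hn _, ?_⟩
    refine Finset.mem_image₂.2 ⟨_, Finset.mem_image_of_mem _ (Finset.mem_filter.2
      ⟨Finset.mem_univ _, hC⟩), _, Finset.mem_image_of_mem _ (Finset.mem_filter.2
      ⟨Finset.mem_univ _, hD⟩), ?_⟩
    funext u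
    simp only [Pi.add_apply, outCount]
    split_ifs
    · rfl
    · rw [← hCD, nbrCount_union hdis]
  · refine Nat.mul_le_mul_right _ ?_
    simp only [Finset.card_product, Finset.card_range]
    have h2 : (Finset.image₂ (· + ·) (irrSums G A) (irrSums G A)).card ≤ (irrSums G A).card ^ 2 := by
      rw [sq]
      exact Finset.card_image₂_le _ _ _
    calc _ ≤ (n + 1) * ((n * n + 1) * ((n + 1) * ((n + 1) * (irrSums G A).card ^ 2))) := by gcongr
      _ = _ := by ring

end


/-! ### The evaluation of the layout -/

namespace LayoutTree

variable {V : Type}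

/-- The subtrees. -/
def nodes : LayoutTree V → List (LayoutTree V)
  | leaf v => [leaf v]
  | node l r => node l r :: (l.nodes ++ r.nodes)

/-- The post-order listing. -/
def tokens : LayoutTree V → List (Option V)
  | leaf v => [some v]
  | node l r => l.tokens ++ r.tokens ++ [none]

theorem self_mem_nodes (T : LayoutTree V) : T ∈ T.nodes := by
  cases T <;> simp [nodes]

theorem le_width [DecidableEq V] (f : Finset V → ℕ) {T S : LayoutTree V} (h : S ∈ T.nodes) :
    f S.verts ≤ T.width f := by
  induction T with
  | leaf v =>
    rw [nodes, List.mem_singleton] at h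
    rw [h]
    exact le_rfl
  | node l r ihl ihr =>
    rw [nodes, List.mem_cons, List.mem_append] at h
    rw [width]
    rcases h with rfl | h | h
    · exact le_max_left _ _
    · exact (ihl h).trans ((le_max_left _ _).trans (le_max_right _ _))
    · exact (ihr h).trans ((le_max_right _ _).trans (le_max_right _ _))

theorem width_le [DecidableEq V] {f : Finset V → ℕ} {T : LayoutTree V} {k : ℕ}
    (h : ∀ S ∈ T.nodes, f S.verts ≤ k) : T.width f ≤ k := by
  induction T with
  | leaf v => exact h _ (self_mem_nodes _)
  | node l r ihl ihr =>
    refine max_le (h _ (self_mem_nodes _)) (max_le (ihl fun S hS => h S ?_) (ihr fun S hS => h S ?_))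
    · simp [nodes, hS]
    · simp [nodes, hS]

theorem length_tokens (T : LayoutTree V) : T.tokens.length + 1 = 2 * T.leaves.length := by
  induction T with
  | leaf v => rfl
  | node l r ihl ihr =>
    simp only [tokens, leaves, List.length_append, List.length_singleton]
    omega

theorem verts_node [DecidableEq V] (l r : LayoutTree V) :
    (node l r).verts = l.verts ∪ r.verts := by
  simp [verts, leaves]

theorem verts_leaf [DecidableEq V] (v : V) : (leaf v).verts = {v} := by
  simp [verts, leaves]

theorem mem_nodes_left {l r S : LayoutTree V} (h : S ∈ l.nodes) : S ∈ (node l r).nodes := by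
  simp [nodes, h]

theorem mem_nodes_right {l r S : LayoutTree V} (h : S ∈ r.nodes) : S ∈ (node l r).nodes := by
  simp [nodes, h]

theorem mem_nodes_trans {S S' T : LayoutTree V} (h : S ∈ S'.nodes) (h' : S' ∈ T.nodes) :
    S ∈ T.nodes := by
  induction T with
  | leaf v =>
    rw [nodes, List.mem_singleton] at h'
    rwa [h'] at h
  | node l r ihl ihr =>
    rw [nodes, List.mem_cons, List.mem_append] at h'
    rcases h' with rfl | h' | h'
    · exact h
    · exact mem_nodes_left (ihl h')
    · exact mem_nodes_right (ihr h')

/-- Evaluation of an expression in postfix notation: a subtree replaces its tokens by one value on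
top of the stack and does not touch what lies below. In this way a fold does the work of the
recursion over the tree. -/
theorem foldl_tokens {α : Type} {f : List α → Option V → List α} {val : LayoutTree V → α}
    (hleaf : ∀ v st, f st (some v) = val (leaf v) :: st)
    (hnode : ∀ l r st, f (val r :: val l :: st) none = val (node l r) :: st)
    (T : LayoutTree V) (st : List α) : T.tokens.foldl f st = val T :: st := by
  induction T generalizing st with
  | leaf v => exact hleaf v st
  | node l r ihl ihr =>
    rw [tokens, List.foldl_append, List.foldl_append, ihl, ihr]
    exact hnode l r st

/-- The hypotheses concern only the stacks of a real evaluation: at an internal node, the two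
topmost entries are the values of its children. -/
theorem foldCost_tokens_le {α : Type} {f : List α → Option V → List α} {val : LayoutTree V → α}
    {c : List α → Option V → ℕ} {K : ℕ} (hleaf : ∀ v st, f st (some v) = val (leaf v) :: st)
    (hnode : ∀ l r st, f (val r :: val l :: st) none = val (node l r) :: st) (T : LayoutTree V)
    (hcl : ∀ v, leaf v ∈ T.nodes → ∀ st, c st (some v) ≤ K)
    (hcn : ∀ l r, node l r ∈ T.nodes → ∀ st, c (val r :: val l :: st) none ≤ K) (st : List α) :
    foldCost f c T.tokens st ≤ T.tokens.length * (K + 1) := by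
  induction T generalizing st with
  | leaf v =>
    have := hcl v (self_mem_nodes _) st
    simp only [tokens, foldCost, List.length_singleton]
    omega
  | node l r ihl ihr =>
    have h1 := ihl (fun v hv => hcl v (mem_nodes_left hv))
      (fun l' r' h => hcn l' r' (mem_nodes_left h)) st
    have h2 := ihr (fun v hv => hcl v (mem_nodes_right hv))
      (fun l' r' h => hcn l' r' (mem_nodes_right h)) (val l :: st)
    have h3 := hcn l r (self_mem_nodes _) st
    rw [tokens, foldCost_append, foldCost_append, List.foldl_append, foldl_tokens hleaf hnode l,
      foldl_tokens hleaf hnode r]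
    simp only [foldCost, List.length_append, List.length_singleton]
    have : (l.tokens.length + r.tokens.length + 1) * (K + 1) =
      l.tokens.length * (K + 1) + r.tokens.length * (K + 1) + (K + 1) := by ring
    omega

end LayoutTree

namespace Inst

variable (I : Inst)

theorem n_pos : 0 < I.n := by
  have : ∀ T : LayoutTree (Fin I.n), 0 < I.n := by
    intro T
    induction T with
    | leaf v => exact v.pos
    | node l r ih => exact ih
  exact this I.T

noncomputable def table : LayoutTree (Fin I.n) → Item I.n
  | .leaf v => I.leafItem v
  | .node l r => I.joinItem (table l) (table r)

/-- One step in the evaluation of the layout with a stack. -/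
noncomputable def step (st : List (Item I.n)) (o : Option (Fin I.n)) : List (Item I.n) :=
  if o = none then I.joinItem (st.tail.headD ⟨∅, .empty⟩) (st.headD ⟨∅, .empty⟩) :: st.tail.tail
  else I.leafItem (o.getD ⟨0, I.n_pos⟩) :: st

theorem step_some (v : Fin I.n) (st : List (Item I.n)) :
    I.step st (some v) = I.table (.leaf v) :: st := rfl

theorem step_none (l r : LayoutTree (Fin I.n)) (st : List (Item I.n)) :
    I.step (I.table r :: I.table l :: st) none = I.table (.node l r) :: st := rfl

/-- `X` is acyclic, with one marked vertex in each component. -/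
def Good {n : ℕ} (G : SimpleGraph (Fin n)) (X M : Finset (Fin n)) : Prop :=
  2 * X.card = adjPairs G X + 2 * M.card ∧ reach G X M = X

open Classical in
/-- The optimum solutions, the best first. -/
noncomputable def solve : List (Config I.n) :=
  sortConfigs I.goal (((I.table I.T).t.lookup (I.key Finset.univ ∅ ∅)).filter
    fun c => Good I.G c.X c.M)

theorem table_A (T : LayoutTree (Fin I.n)) : (I.table T).A = T.verts := by
  induction T with
  | leaf v => rw [LayoutTree.verts_leaf]; rfl
  | node l r ihl ihr => rw [LayoutTree.verts_node, ← ihl, ← ihr]; rfl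

/-- A bound for the length of the entries for the set `A`. -/
noncomputable def entryBound (A : Finset (Fin I.n)) : ℕ :=
  (I.n + 1) ^ 3 * (I.n * I.n + 1) * (irrSums I.G A).card ^ 2 * nec I.G 1 Aᶜ ^ 2

theorem length_reduce_cuts_le (A R : Finset (Fin I.n)) (l : List (Config I.n)) :
    (reduce I.G I.goal A R (I.cuts A) l).length ≤ I.entryBound A :=
  (length_reduce_le _ _ _ _).trans (Nat.mul_le_mul_left _ (length_cuts_le A))

/-- A leaf has at most three partial solutions per entry; at an internal node every entry has been
reduced. -/
theorem maxLen_table_le (T : LayoutTree (Fin I.n)) :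
    (I.table T).t.maxLen ≤ 3 + I.entryBound T.verts := by
  cases T with
  | leaf v =>
    have h3 : ∀ R R', (I.leafEntry v R R').length ≤ 3 := fun R R' => by
      classical
      exact (List.length_filter_le _ _).trans (by simp [leafConfigs])
    refine (maxLen_foldl_le (B := 3) (fun t R' => ?_) _ _).trans (by simp [Trie.maxLen])
    refine (Trie.maxLen_insert_le _ _ _).trans (max_le ((Trie.maxLen_insert_le _ _ _).trans
      (max_le (le_max_left _ _) ((h3 _ _).trans (le_max_right _ _)))) ((h3 _ _).trans
        (le_max_right _ _)))
  | node l r =>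
    rw [LayoutTree.verts_node, ← table_A, ← table_A]
    refine (maxLen_foldl_le (fun t R => maxLen_foldl_le
      (fun t S => maxLen_foldl_joinStep_le R S (I.length_reduce_cuts_le _) _ t) _ t) _ .empty).trans
      ?_
    simp [Trie.maxLen]

/-- The parameters that bound the sizes of the tables. -/
noncomputable def nodeSize (A : Finset (Fin I.n)) : ℕ :=
  nec I.G 1 A + nec I.G 1 Aᶜ + (irrSums I.G A).card

/-- The polynomial part of the running time is measured by this number. The `d`-neighbor classes do
not occur in it, since their number is accounted for by the distinguished factor. -/
noncomputable def measure : ℕ := I.n + I.d + I.T.width I.nodeSize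

end Inst

/-- The elements of the post-order listing. -/
def encToken {n : ℕ} (o : Option (Fin n)) : Data := encNat (o.elim 0 fun v => v + 1)

/-! ### Running time of the evaluation of the layout. -/

section

variable {Γ : Type} {m W : Γ → ℕ} {env : Set (Γ → Data)} {I : Γ → Inst} {α β : Γ → Type}
  {ea : ∀ γ, α γ → Data} {eb : ∀ γ, β γ → Data}

theorem PT.headD {l : ∀ γ, List (β γ)} {a : ∀ γ, β γ}
    (hl : PT m env fun γ => encList (eb γ) (l γ)) (ha : PT m env fun γ => eb γ (a γ)) :
    PT m env fun γ => eb γ ((l γ).headD (a γ)) := by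
  classical
  have h1 : PT m env fun γ => (l γ).head?.elim .nil (eb γ) := PT.fst_of hl fun γ => by
    cases h : l γ with
    | nil => exact .inl ⟨rfl, rfl⟩
    | cons b l => exact .inr ⟨_, rfl⟩
  refine (PT.ite (PT.eq_nil hl) ha h1).congr fun γ => ?_
  cases h : l γ <;> simp

/-- Only the branch that is taken is charged. At a leaf, nothing is known about the topmost entries
of the stack, and the bound for a join would be useless. -/
theorem CT.ite' {W₁ W₂ m₁ m₂ : Γ → ℕ} {P : Γ → Prop} {f g : Γ → Data} [DecidablePred P]
    (hP : PD (fun _ => 0) env P) (hf : CT W₁ m₁ env f) (hg : CT W₂ m₂ env g)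
    (hW₁ : ∀ γ, 1 ≤ W₁ γ) (hW₂ : ∀ γ, 1 ≤ W₂ γ) :
    CT (fun γ => if P γ then W₁ γ else W₂ γ) (fun γ => if P γ then m₁ γ else m₂ γ) env
      fun γ => if P γ then f γ else g γ := by
  obtain ⟨S, ⟨a, k, hS⟩, hP⟩ := hP
  obtain ⟨T, ⟨b, i, hT⟩, hf⟩ := hf
  obtain ⟨U, ⟨c, j, hU⟩, hg⟩ := hg
  refine ⟨fun γ => a + if P γ then T γ else U γ, ?_, ?_⟩
  · refine ⟨a + b + c, i + j, fun γ => ?_⟩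
    have h1 : ∀ x e, e ≤ i + j → (x + 1) ^ e ≤ (x + 1) ^ (i + j) := fun x e he =>
      Nat.pow_le_pow_right (by omega) he
    have h0 : ∀ x, 1 ≤ (x + 1) ^ (i + j) := fun x => Nat.one_le_pow _ _ (by omega)
    beta_reduce
    by_cases h : P γ
    · simp only [h, if_true]
      have h2 := (hT γ).trans (Nat.mul_le_mul_left b (h1 (m₁ γ) i (by omega)))
      have h3 := Nat.le_mul_of_pos_right a (h0 (m₁ γ))
      have h4 := Nat.zero_le (c * (m₁ γ + 1) ^ (i + j))
      calc _ ≤ a * (m₁ γ + 1) ^ (i + j) + b * (m₁ γ + 1) ^ (i + j) := add_le_add h3 h2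
        _ ≤ _ := by rw [add_mul, add_mul]; omega
    · simp only [h, if_false]
      have h2 := (hU γ).trans (Nat.mul_le_mul_left c (h1 (m₂ γ) j (by omega)))
      have h3 := Nat.le_mul_of_pos_right a (h0 (m₂ γ))
      calc _ ≤ a * (m₂ γ + 1) ^ (i + j) + c * (m₂ γ + 1) ^ (i + j) := add_le_add h3 h2
        _ ≤ _ := by rw [add_mul, add_mul]; omega
  · have h := (hP.ite hf hg).of_le (T' := fun γ => (if P γ then W₁ γ else W₂ γ) *
      (a + if P γ then T γ else U γ)) 1 fun γ => ?_
    · convert h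
    have h1 := hS γ
    rw [zero_add, one_pow, mul_one] at h1
    by_cases h : P γ
    · simp only [h, if_true]
      have := Nat.le_mul_of_pos_left a (hW₁ γ)
      have := mul_add (W₁ γ) a (T γ)
      omega
    · simp only [h, if_false]
      have := Nat.le_mul_of_pos_left a (hW₂ γ)
      have := mul_add (W₂ γ) a (U γ)
      omega

/-- The weight of a step in the evaluation of the layout. -/
noncomputable def Inst.stepWidth (I : Inst) (x y : Item I.n) : ℕ :=
  max (nec I.G I.d x.A) (max (nec I.G I.d y.A) (nec I.G I.d (x.A ∪ y.A)ᶜ))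

theorem Inst.le_stepWidth₁ (I : Inst) (x y : Item I.n) : nec I.G I.d x.A ≤ I.stepWidth x y :=
  le_max_left _ _

theorem Inst.le_stepWidth₂ (I : Inst) (x y : Item I.n) : nec I.G I.d y.A ≤ I.stepWidth x y :=
  (le_max_left _ _).trans (le_max_right _ _)

theorem Inst.le_stepWidth₃ (I : Inst) (x y : Item I.n) :
    nec I.G I.d (x.A ∪ y.A)ᶜ ≤ I.stepWidth x y :=
  (le_max_right _ _).trans (le_max_right _ _)

noncomputable def Inst.stepSize (I : Inst) (x y : Item I.n) : ℕ :=
  x.t.maxLen + y.t.maxLen + nec I.G 1 (x.A ∪ y.A) + nec I.G 1 (x.A ∪ y.A)ᶜ +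
    I.entryBound (x.A ∪ y.A)

theorem CT.joinItem_of_stepSize_le {x y : ∀ γ, Item (I γ).n} (h : HasInst m env I)
    (hx : PT m env fun γ => (x γ).enc) (hy : PT m env fun γ => (y γ).enc)
    (hm : ∀ γ, (I γ).stepSize (x γ) (y γ) ≤ m γ) :
    CT (fun γ => (2 * (I γ).stepWidth (x γ) (y γ) + 1) ^ 3) m env
      fun γ => ((I γ).joinItem (x γ) (y γ)).enc := by
  unfold Inst.stepSize at hm
  refine CT.joinItem (B := fun γ => (I γ).entryBound ((x γ).A ∪ (y γ).A)) h hx hy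
    (.le_self fun γ => ?_) (.le_self fun γ => ?_) (.le_self fun γ => ?_) (.le_self fun γ => ?_)
    (.le_self fun γ => ?_) (fun γ R l => (I γ).length_reduce_cuts_le ((x γ).A ∪ (y γ).A) R l)
    (fun γ => (I γ).le_stepWidth₁ (x γ) (y γ))
    (fun γ => (I γ).le_stepWidth₂ (x γ) (y γ)) (fun γ => (I γ).le_stepWidth₃ (x γ) (y γ))
  all_goals
    have := hm γ
    omega

-- The default items and the default vertex only make the step a total function; on a post-order
-- listing they are never used. Weight and measure are those of the case at hand.
open Classical in
theorem CT.step (h : HasInst m env I) :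
    CT (fun q : Σ γ, List (Item (I γ).n) × Option (Fin (I γ).n) =>
        if q.2.2 = none then (2 * (I q.1).stepWidth (q.2.1.tail.headD ⟨∅, .empty⟩)
          (q.2.1.headD ⟨∅, .empty⟩) + 1) ^ 3
        else (2 * nec (I q.1).G (I q.1).d {q.2.2.getD ⟨0, (I q.1).n_pos⟩}ᶜ + 1) ^ 2)
      (fun q : Σ γ, List (Item (I γ).n) × Option (Fin (I γ).n) =>
        if q.2.2 = none then m q.1 + (I q.1).stepSize (q.2.1.tail.headD ⟨∅, .empty⟩)
          (q.2.1.headD ⟨∅, .empty⟩)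
        else m q.1)
      (foldEnv env (fun _ => encList Item.enc) fun _ => encToken)
      fun q => encList Item.enc ((I q.1).step q.2.1 q.2.2) := by
  have hst : ∀ m' : (Σ γ, List (Item (I γ).n) × Option (Fin (I γ).n)) → ℕ,
      PT m' (foldEnv env (fun _ => encList Item.enc) fun _ => encToken)
        fun q => encList Item.enc q.2.1 := fun m' => PT.foldAcc
  have htok : ∀ m' : (Σ γ, List (Item (I γ).n) × Option (Fin (I γ).n)) → ℕ,
      PT m' (foldEnv env (fun _ => encList Item.enc) fun _ => encToken)
        fun q => encToken q.2.2 := fun m' => PT.foldElem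
  have hP : PD (fun _ => 0) (foldEnv env (fun _ => encList Item.enc) fun _ => encToken)
      fun q : Σ γ, List (Item (I γ).n) × Option (Fin (I γ).n) => q.2.2 = none :=
    PD.congr (PT.eq_nil (l := fun q : Σ γ, List (Item (I γ).n) × Option (Fin (I γ).n) =>
      List.replicate (q.2.2.elim 0 fun v => v + 1) ()) (htok _)) fun q => by
        cases q.2.2 <;> simp
  have hdef : ∀ {m' : (Σ γ, List (Item (I γ).n) × Option (Fin (I γ).n)) → ℕ},
      (∀ q, m q.1 ≤ m' q) → PT m' (foldEnv env (fun _ => encList Item.enc) fun _ => encToken)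
        fun q => Item.enc (⟨∅, .empty⟩ : Item (I q.1).n) := fun hm =>
    (PT.empty (h.foldLift hm).toHasVerts).cons PT.nil
  set x : ∀ q : Σ γ, List (Item (I γ).n) × Option (Fin (I γ).n), Item (I q.1).n :=
    fun q => q.2.1.tail.headD ⟨∅, .empty⟩ with hx
  set y : ∀ q : Σ γ, List (Item (I γ).n) × Option (Fin (I γ).n), Item (I q.1).n :=
    fun q => q.2.1.headD ⟨∅, .empty⟩ with hy
  set v : ∀ q : Σ γ, List (Item (I γ).n) × Option (Fin (I γ).n), Fin (I q.1).n :=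
    fun q => q.2.2.getD ⟨0, (I q.1).n_pos⟩ with hv
  have hm₁ : ∀ q : Σ γ, List (Item (I γ).n) × Option (Fin (I γ).n),
    m q.1 ≤ m q.1 + (I q.1).stepSize (x q) (y q) := fun q => Nat.le_add_right _ _
  have hj : CT (fun q => (2 * (I q.1).stepWidth (x q) (y q) + 1) ^ 3)
      (fun q => m q.1 + (I q.1).stepSize (x q) (y q))
      (foldEnv env (fun _ => encList Item.enc) fun _ => encToken)
      fun q => ((I q.1).joinItem (x q) (y q)).enc :=
    CT.joinItem_of_stepSize_le (h.foldLift hm₁) (PT.headD (PT.tail (hst _)) (hdef hm₁))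
      (PT.headD (hst _) (hdef hm₁)) fun q => Nat.le_add_left _ _
  have hl : CT (fun q => (2 * nec (I q.1).G (I q.1).d {v q}ᶜ + 1) ^ 2)
      (fun q : Σ γ, List (Item (I γ).n) × Option (Fin (I γ).n) => m q.1)
      (foldEnv env (fun _ => encList Item.enc) fun _ => encToken)
      fun q => ((I q.1).leafItem (v q)).enc := by
    refine CT.leafItem (h.foldLift fun q => le_rfl) ?_
    refine (PT.nat_pred (htok _)).congr fun q => ?_
    simp only [hv]
    cases q.2.2 <;> rfl
  have h1 : ∀ q : Σ γ, List (Item (I γ).n) × Option (Fin (I γ).n),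
    1 ≤ (2 * (I q.1).stepWidth (x q) (y q) + 1) ^ 3 := fun q => Nat.one_le_pow _ _ (by omega)
  have h2 : ∀ q : Σ γ, List (Item (I γ).n) × Option (Fin (I γ).n),
    1 ≤ (2 * nec (I q.1).G (I q.1).d {v q}ᶜ + 1) ^ 2 := fun q => Nat.one_le_pow _ _ (by omega)
  have ht : PT (fun q => m q.1 + (I q.1).stepSize (x q) (y q))
      (foldEnv env (fun _ => encList Item.enc) fun _ => encToken)
      fun q : Σ γ, List (Item (I γ).n) × Option (Fin (I γ).n) => encList Item.enc q.2.1.tail.tail :=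
    PT.tail (PT.tail (hst _))
  have hj' : CT (fun q => (2 * (I q.1).stepWidth (x q) (y q) + 1) ^ 3)
      (fun q => m q.1 + (I q.1).stepSize (x q) (y q))
      (foldEnv env (fun _ => encList Item.enc) fun _ => encToken)
      fun q => encList Item.enc ((I q.1).joinItem (x q) (y q) :: q.2.1.tail.tail) :=
    CT.cons hj (ht.toCT h1)
  have hl' : CT (fun q => (2 * nec (I q.1).G (I q.1).d {v q}ᶜ + 1) ^ 2)
      (fun q : Σ γ, List (Item (I γ).n) × Option (Fin (I γ).n) => m q.1)
      (foldEnv env (fun _ => encList Item.enc) fun _ => encToken)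
      fun q => encList Item.enc ((I q.1).leafItem (v q) :: q.2.1) :=
    CT.cons hl ((hst _).toCT h2)
  have h3 := CT.ite' hP hj' hl' h1 h2
  refine h3.congr fun q => ?_
  rw [Inst.step]
  split_ifs <;> rfl

theorem Inst.nodeSize_le (I : Inst) {S : LayoutTree (Fin I.n)} (hS : S ∈ I.T.nodes) :
    I.nodeSize S.verts ≤ I.measure :=
  (LayoutTree.le_width _ hS).trans (Nat.le_add_left _ _)

theorem Inst.entryBound_le (I : Inst) {S : LayoutTree (Fin I.n)} (hS : S ∈ I.T.nodes) :
    I.entryBound S.verts ≤ (I.measure + 1) ^ 3 * (I.measure * I.measure + 1) * I.measure ^ 2 *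
      I.measure ^ 2 := by
  have h1 := I.nodeSize_le hS
  have h2 : I.n ≤ I.measure := by unfold Inst.measure; omega
  have h3 : nec I.G 1 S.vertsᶜ ≤ I.measure := by unfold Inst.nodeSize at h1; omega
  have h4 : (irrSums I.G S.verts).card ≤ I.measure := by unfold Inst.nodeSize at h1; omega
  unfold Inst.entryBound
  gcongr

/-- There are fewer than `2 n` tokens. The weight of a join involves the classes over the sets of
the two children and over the complement of the set of the node itself, and all three numbers are at
most the width of `snec`. -/
theorem CT.tables (h : HasInst m env I)
    (htok : PT m env fun γ => encList encToken (I γ).T.tokens)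
    (hm : PolyBdd m fun γ => (I γ).measure) :
    CT (fun γ => (2 * (I γ).T.width (snec (I γ).G (I γ).d) + 1) ^ 3) m env
      fun γ => ((I γ).table (I γ).T).enc := by
  classical
  obtain ⟨U, ⟨c, k, hU⟩, hstep⟩ := CT.step h
  obtain ⟨Tl, hTl, htok⟩ := htok
  set μ : Γ → ℕ := fun γ => (I γ).measure with hμ
  set E : Γ → ℕ := fun γ => (μ γ + 1) ^ 3 * (μ γ * μ γ + 1) * μ γ ^ 2 * μ γ ^ 2 with hE
  have hEb : PolyBdd m E := ((((hm.add (.const 1)).pow 3).mul ((hm.mul hm).add (.const 1))).mul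
    (hm.pow 2)).mul (hm.pow 2)
  -- A bound for the measure of a join: two tables with entries of length at most `3 + E`, two
  -- numbers of 1-neighbor classes, and one bound for the new entries.
  set M : Γ → ℕ := fun γ => m γ + (2 * (3 + E γ) + 2 * μ γ + E γ) with hM
  have hMb : PolyBdd m M := PolyBdd.self.add
    ((((PolyBdd.const 2).mul ((PolyBdd.const 3).add hEb)).add ((PolyBdd.const 2).mul hm)).add hEb)
  set S : Γ → ℕ := fun γ => (I γ).T.width (snec (I γ).G (I γ).d) with hS
  have hlen : ∀ γ, (I γ).T.tokens.length ≤ 2 * μ γ := fun γ => by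
    have h1 := (I γ).T.length_tokens
    have h2 := (I γ).isLayout.1.length_le_card
    rw [Fintype.card_fin] at h2
    have h3 : (I γ).n ≤ μ γ := by simp only [hμ, Inst.measure]; omega
    omega
  have hfold := Computes.foldl (α := fun γ => List (Item (I γ).n))
    (β := fun γ => Option (Fin (I γ).n)) (ea := fun _ => encList Item.enc)
    (eb := fun _ => encToken) (a := fun _ => []) (f := fun γ => (I γ).step) htok Computes.nil hstep
  have hres : Computes env (fun γ => encList Item.enc [(I γ).table (I γ).T]) fun γ =>
      (2 * S γ + 1) ^ 3 * (Tl γ + 2 * μ γ * (c * (M γ + 1) ^ k + 1)) := by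
    have heq : (fun γ => encList Item.enc ((I γ).T.tokens.foldl (I γ).step [])) =
        fun γ => encList Item.enc [(I γ).table (I γ).T] := by
      funext γ
      rw [LayoutTree.foldl_tokens (val := (I γ).table) (I γ).step_some (I γ).step_none]
    rw [← heq]
    refine hfold.of_le 1 fun γ => ?_
    have hW : 1 ≤ (2 * S γ + 1) ^ 3 := Nat.one_le_pow _ _ (by omega)
    have hcost := LayoutTree.foldCost_tokens_le (val := (I γ).table)
      (c := fun a b => (if b = none then (2 * (I γ).stepWidth (a.tail.headD ⟨∅, .empty⟩)
          (a.headD ⟨∅, .empty⟩) + 1) ^ 3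
        else (2 * nec (I γ).G (I γ).d {b.getD ⟨0, (I γ).n_pos⟩}ᶜ + 1) ^ 2) * U ⟨γ, a, b⟩)
      (K := (2 * S γ + 1) ^ 3 * (c * (M γ + 1) ^ k)) (I γ).step_some (I γ).step_none (I γ).T ?_ ?_ []
    · have h1 := Nat.mul_le_mul_right ((2 * S γ + 1) ^ 3 * (c * (M γ + 1) ^ k) + 1) (hlen γ)
      have h2 := Nat.le_mul_of_pos_left (Tl γ) hW
      have h3 := Nat.le_mul_of_pos_left (2 * μ γ) hW
      refine (Nat.add_le_add_left (hcost.trans h1) _).trans ?_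
      rw [one_mul, add_zero]
      calc _ ≤ (2 * S γ + 1) ^ 3 * Tl γ + ((2 * S γ + 1) ^ 3 * (2 * μ γ * (c * (M γ + 1) ^ k)) +
            (2 * S γ + 1) ^ 3 * (2 * μ γ)) := by
            refine add_le_add h2 ?_
            rw [mul_add, mul_one]
            refine add_le_add (le_of_eq ?_) h3
            ring
        _ ≤ _ := by
            refine (le_of_eq ?_).trans (Nat.le_succ _)
            ring
    · intro v hv st
      have h1 := hU ⟨γ, st, some v⟩
      have h2 : nec (I γ).G (I γ).d {v}ᶜ ≤ S γ := by
        rw [← LayoutTree.verts_leaf]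
        exact (le_max_right _ _).trans (LayoutTree.le_width (snec (I γ).G (I γ).d) hv)
      simp only [reduceCtorEq, if_false, Option.getD_some] at h1 ⊢
      refine Nat.mul_le_mul ?_ (h1.trans ?_)
      · exact (Nat.pow_le_pow_left (by omega) 2).trans (Nat.pow_le_pow_right (by omega) (by omega))
      · exact Nat.mul_le_mul_left _ (Nat.pow_le_pow_left (by simp only [hM]; omega) _)
    · intro l r hlr st
      have h1 := hU ⟨γ, (I γ).table r :: (I γ).table l :: st, none⟩
      simp only [if_true, List.tail_cons, List.headD_cons] at h1 ⊢
      have hl := LayoutTree.mem_nodes_trans (LayoutTree.mem_nodes_left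
        (LayoutTree.self_mem_nodes l)) hlr
      have hr := LayoutTree.mem_nodes_trans (LayoutTree.mem_nodes_right
        (LayoutTree.self_mem_nodes r)) hlr
      refine Nat.mul_le_mul ?_ (h1.trans (Nat.mul_le_mul_left _ (Nat.pow_le_pow_left ?_ _)))
      · refine Nat.pow_le_pow_left ?_ 3
        have : (I γ).stepWidth ((I γ).table l) ((I γ).table r) ≤ S γ := by
          rw [Inst.stepWidth, Inst.table_A, Inst.table_A, ← LayoutTree.verts_node]
          exact max_le ((le_max_left _ _).trans (LayoutTree.le_width (snec (I γ).G (I γ).d) hl))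
            (max_le ((le_max_left _ _).trans (LayoutTree.le_width (snec (I γ).G (I γ).d) hr))
              ((le_max_right _ _).trans (LayoutTree.le_width (snec (I γ).G (I γ).d) hlr)))
        omega
      · have h2 := (I γ).maxLen_table_le l
        have h3 := (I γ).maxLen_table_le r
        have h4 := (I γ).entryBound_le hl
        have h5 := (I γ).entryBound_le hr
        have h6 := (I γ).entryBound_le hlr
        have h7 := (I γ).nodeSize_le hlr
        rw [Inst.stepSize, Inst.table_A, Inst.table_A, ← LayoutTree.verts_node]
        rw [Inst.nodeSize] at h7
        simp only [hM, hE, hμ] at *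
        omega
  obtain ⟨T', hT', hres'⟩ : CT (fun γ => (2 * S γ + 1) ^ 3) m env
      fun γ => encList Item.enc [(I γ).table (I γ).T] :=
    ⟨_, hTl.add (((PolyBdd.const 2).mul hm).mul (((PolyBdd.const c).mul
      ((hMb.add (.const 1)).pow k)).add (.const 1))), hres⟩
  exact ⟨T', hT', Computes.fst (g := fun _ => .nil) hres'⟩

theorem PD.good {n : Γ → ℕ} {G : ∀ γ, SimpleGraph (Fin (n γ))} {X M : ∀ γ, Finset (Fin (n γ))}
    (h : HasGraph m env n G) (hX : PT m env fun γ => encSet (X γ))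
    (hM : PT m env fun γ => encSet (M γ)) : PD m env fun γ => Inst.Good (G γ) (X γ) (M γ) := by
  have hV := h.toHasVerts
  have h2 : PolyBdd m fun γ => 2 * (X γ).card := (PolyBdd.const 2).mul (.card hV _)
  have h2' : PolyBdd m fun γ => 2 * (M γ).card := (PolyBdd.const 2).mul (.card hV _)
  have ha : PolyBdd m fun γ => adjPairs (G γ) (X γ) :=
    (h.bdd.mul h.bdd).of_le fun γ => adjPairs_le _ _
  have hr := PT.reach h hX hM
  exact PD.and (PD.nat_eq (PT.nat_mul (PT.nat_const 2) (.const 2) (PT.card_set hV hX) (.card hV _))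
    h2 (PT.nat_add (PT.adjPairs h hX) ha (PT.nat_mul (PT.nat_const 2) (.const 2)
      (PT.card_set hV hM) (.card hV _))) (ha.add h2'))
    (PD.congr (PD.forall_fin hV (P := fun γ v => v ∈ reach (G γ) (X γ) (M γ) ↔ v ∈ X γ)
      (PD.iff (PD.mem_set hV.lift hr.lift PT.finElem) (PD.mem_set hV.lift hX.lift PT.finElem)))
      fun γ => Finset.ext_iff.symm)

theorem CT.solve (h : HasInst m env I)
    (htok : PT m env fun γ => encList encToken (I γ).T.tokens)
    (hm : PolyBdd m fun γ => (I γ).measure) :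
    CT (fun γ => (2 * (I γ).T.width (snec (I γ).G (I γ).d) + 1) ^ 3) m env
      fun γ => encList Config.enc (I γ).solve := by
  classical
  refine .bind (CT.tables h htok hm) (PT.toCT ?_ fun γ => Nat.one_le_pow _ _ (by omega))
  have h' := h.weaken fun γ => ((I γ).table (I γ).T).enc
  have hV := h'.toHasVerts
  have ht : PT m (insert (fun γ => ((I γ).table (I γ).T).enc) env)
    fun γ => ((I γ).table (I γ).T).enc := .mem (by simp)
  have hu : PT m (insert (fun γ => ((I γ).table (I γ).T).enc) env)
      fun γ => encSet (Finset.univ : Finset (Fin (I γ).n)) :=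
    PT.set hV (P := fun _ _ => True) (PD.const _) (by simp)
  have he : PT m (insert (fun γ => ((I γ).table (I γ).T).enc) env)
      fun γ => encSet (∅ : Finset (Fin (I γ).n)) := PT.empty hV
  have hl := PT.trie_lookup (t := fun γ => ((I γ).table (I γ).T).t) ht.snd
    (PT.key h' hu he he) (PolyBdd.key h')
  have hEb : PolyBdd m fun γ => 3 + ((I γ).measure + 1) ^ 3 *
      ((I γ).measure * (I γ).measure + 1) * (I γ).measure ^ 2 * (I γ).measure ^ 2 :=
    (PolyBdd.const 3).add (((((hm.add (.const 1)).pow 3).mul ((hm.mul hm).add (.const 1))).mul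
    (hm.pow 2)).mul (hm.pow 2))
  have hb : PolyBdd m fun γ => (((I γ).table (I γ).T).t.lookup
      ((I γ).key Finset.univ ∅ ∅)).length := hEb.of_le fun γ =>
    (Trie.length_lookup_le _ _).trans (((I γ).maxLen_table_le _).trans (Nat.add_le_add_left
      ((I γ).entryBound_le (LayoutTree.self_mem_nodes _)) 3))
  have hc : PT (fun q : Σ γ, Config (I γ).n => m q.1)
    (elEnv (insert (fun γ => ((I γ).table (I γ).T).enc) env) fun _ => Config.enc)
    fun q => q.2.enc := PT.elem
  refine (PT.sortConfigs h'.isMax (PT.filter hl hb (P := fun γ (c : Config (I γ).n) =>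
    Inst.Good (I γ).G c.X c.M) (PD.good h'.toHasGraph.lift hc.fst hc.snd.fst))
      (hb.of_le fun γ => List.length_filter_le _ _)).congr fun γ => ?_
  unfold Inst.solve
  congr!

end


/-! ### Reachability -/

section

variable {n : ℕ} {G : SimpleGraph (Fin n)} {X S T K : Finset (Fin n)}

/-- `K` is a union of components of `G[X]`. -/
def IsClosedIn (G : SimpleGraph (Fin n)) (X K : Finset (Fin n)) : Prop :=
  K ⊆ X ∧ ∀ u, u ∈ K → ∀ v, v ∈ X → G.Adj u v → v ∈ K

theorem IsClosedIn.sdiff (hK : IsClosedIn G X K) : IsClosedIn G X (X \ K) := by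
  refine ⟨Finset.sdiff_subset, fun u hu v hv huv => ?_⟩
  rw [Finset.mem_sdiff] at hu ⊢
  exact ⟨hv, fun h => hu.2 (hK.2 v h u hu.1 huv.symm)⟩

theorem IsClosedIn.union (hS : IsClosedIn G X S) (hK : IsClosedIn G X K) :
    IsClosedIn G X (S ∪ K) := by
  refine ⟨Finset.union_subset hS.1 hK.1, fun u hu v hv huv => ?_⟩
  rw [Finset.mem_union] at hu ⊢
  exact hu.imp (fun h => hS.2 u h v hv huv) fun h => hK.2 u h v hv huv

theorem IsClosedIn.inter (hS : IsClosedIn G X S) (hK : IsClosedIn G X K) :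
    IsClosedIn G X (S ∩ K) := by
  refine ⟨Finset.inter_subset_left.trans hS.1, fun u hu v hv huv => ?_⟩
  rw [Finset.mem_inter] at hu ⊢
  exact ⟨hS.2 u hu.1 v hv huv, hK.2 u hu.2 v hv huv⟩

theorem mem_grow {v : Fin n} :
    v ∈ grow G X S ↔ v ∈ X ∧ (v ∈ S ∨ ∃ u, u ∈ S ∧ G.Adj u v) := by
  simp [grow]

theorem grow_subset : grow G X S ⊆ X := fun _ hv => (mem_grow.1 hv).1

theorem subset_grow (h : S ⊆ X) : S ⊆ grow G X S := fun _ hv => mem_grow.2 ⟨h hv, .inl hv⟩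

theorem grow_subset_of_isClosedIn (hK : IsClosedIn G X K) (h : S ⊆ K) : grow G X S ⊆ K := by
  intro v hv
  obtain ⟨hvX, hv | ⟨u, hu, huv⟩⟩ := mem_grow.1 hv
  · exact h hv
  · exact hK.2 u (h hu) v hvX huv

theorem isClosedIn_of_grow_subset (hS : S ⊆ X) (h : grow G X S ⊆ S) : IsClosedIn G X S :=
  ⟨hS, fun u hu _ hv huv => h (mem_grow.2 ⟨hv, .inr ⟨u, hu, huv⟩⟩)⟩

/-- The result of `k` growth steps. -/
noncomputable def growIter (G : SimpleGraph (Fin n)) (X S : Finset (Fin n)) (k : ℕ) :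
    Finset (Fin n) := (grow G X)^[k] S

theorem reach_eq_growIter : reach G X S = growIter G X S n := by
  have : ∀ (l : List (Fin n)) (S : Finset (Fin n)),
      l.foldl (fun S _ => grow G X S) S = growIter G X S l.length := by
    intro l
    induction l with
    | nil => intro S; rfl
    | cons v l ih => intro S; exact ih _
  rw [reach, this, List.length_finRange]

theorem growIter_succ (k : ℕ) : growIter G X S (k + 1) = grow G X (growIter G X S k) :=
  Function.iterate_succ_apply' _ _ _

theorem growIter_subset (h : S ⊆ X) (k : ℕ) : growIter G X S k ⊆ X := by
  cases k with
  | zero => exact h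
  | succ k => rw [growIter_succ]; exact grow_subset

theorem subset_growIter (h : S ⊆ X) (k : ℕ) : S ⊆ growIter G X S k := by
  induction k with
  | zero => exact subset_rfl
  | succ k ih => rw [growIter_succ]; exact ih.trans (subset_grow (growIter_subset h k))

theorem growIter_subset_of_isClosedIn (hK : IsClosedIn G X K) (h : S ⊆ K) (k : ℕ) :
    growIter G X S k ⊆ K := by
  induction k with
  | zero => exact h
  | succ k ih => rw [growIter_succ]; exact grow_subset_of_isClosedIn hK ih

/-- A growth step either adds a vertex or changes nothing, and in the latter case the set is closed
already. Hence `n` steps suffice for reachability. -/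
theorem card_growIter (h : S ⊆ X) (k : ℕ) :
    k ≤ (growIter G X S k).card ∨ IsClosedIn G X (growIter G X S k) := by
  induction k with
  | zero => exact .inl (Nat.zero_le _)
  | succ k ih =>
    have hsub := subset_grow (G := G) (growIter_subset (G := G) h k)
    by_cases heq : grow G X (growIter G X S k) ⊆ growIter G X S k
    · right
      rw [growIter_succ, heq.antisymm hsub]
      exact isClosedIn_of_grow_subset (growIter_subset h k) heq
    · rcases ih with ih | ih
      · left
        rw [growIter_succ]
        exact ih.trans_lt (Finset.card_lt_card ⟨hsub, heq⟩)
      · exact absurd (grow_subset_of_isClosedIn ih subset_rfl) heq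

theorem isClosedIn_reach (h : S ⊆ X) : IsClosedIn G X (reach G X S) := by
  rw [reach_eq_growIter]
  rcases card_growIter (G := G) h n with hc | hc
  · have : growIter G X S n = Finset.univ := Finset.eq_univ_of_card _
      (le_antisymm (Finset.card_le_univ _) (by simpa using hc))
    exact isClosedIn_of_grow_subset (growIter_subset h n) (this ▸ Finset.subset_univ _)
  · exact hc

theorem subset_reach (h : S ⊆ X) : S ⊆ reach G X S := by
  rw [reach_eq_growIter]
  exact subset_growIter h n

theorem reach_subset (h : S ⊆ X) : reach G X S ⊆ X := (isClosedIn_reach h).1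

theorem reach_subset_of_isClosedIn (hK : IsClosedIn G X K) (h : S ⊆ K) : reach G X S ⊆ K := by
  rw [reach_eq_growIter]
  exact growIter_subset_of_isClosedIn hK h n

theorem isClosedIn_empty : IsClosedIn G X ∅ := ⟨by simp, by simp⟩

theorem reach_empty : reach G X ∅ = ∅ :=
  Finset.subset_empty.1 (reach_subset_of_isClosedIn isClosedIn_empty subset_rfl)

/-! ### Forests -/

/-- The graph `G[X]` together with a vertex `none` that is adjacent to `M` and to the vertices
outside of `X`. -/
def cone (G : SimpleGraph (Fin n)) (X M : Finset (Fin n)) : SimpleGraph (Option (Fin n)) where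
  Adj
    | none, none => False
    | none, some v => v ∈ M ∨ v ∉ X
    | some v, none => v ∈ M ∨ v ∉ X
    | some u, some v => u ∈ X ∧ v ∈ X ∧ G.Adj u v
  symm := ⟨by
    rintro (_ | u) (_ | v) h
    · exact h
    · exact h
    · exact h
    · exact ⟨h.2.1, h.1, h.2.2.symm⟩⟩
  loopless := ⟨by
    rintro (_ | u) h
    · exact h
    · exact G.loopless.irrefl u h.2.2⟩

theorem sum_option {f : Option (Fin n) → ℕ} : ∑ x, f x = f none + ∑ v, f (some v) :=
  Fintype.sum_option f

/-- The degree sum: every mark and every vertex outside of `X` accounts for one edge at the apex,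
and the remaining edges are those of `G[X]`. -/
theorem two_mul_card_cone {M : Finset (Fin n)} (hM : M ⊆ X) :
    2 * Nat.card (cone G X M).edgeSet = 2 * M.card + 2 * (n - X.card) + adjPairs G X := by
  classical
  have h1 := (cone G X M).sum_degrees_eq_twice_card_edges
  rw [Nat.card_eq_fintype_card, ← SimpleGraph.edgeFinset_card, ← h1, sum_option]
  have hdeg : ∀ x, (cone G X M).degree x = ∑ y, if (cone G X M).Adj x y then 1 else 0 := by
    intro x
    rw [← SimpleGraph.card_neighborFinset_eq_degree, SimpleGraph.neighborFinset_eq_filter,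
      Finset.card_filter]
  have hnone : (cone G X M).degree none = M.card + (n - X.card) := by
    rw [hdeg, sum_option, if_neg ((cone G X M).loopless.irrefl none), zero_add]
    have : ∀ v, (if (cone G X M).Adj none (some v) then 1 else 0) =
        (if v ∈ M then 1 else 0) + if v ∈ Xᶜ then 1 else 0 := by
      intro v
      have h : (cone G X M).Adj none (some v) ↔ v ∈ M ∨ v ∉ X := Iff.rfl
      have h' := @hM v
      simp only [h, Finset.mem_compl]
      by_cases h2 : v ∈ M <;> by_cases h3 : v ∈ X <;> simp_all
    simp only [this, Finset.sum_add_distrib]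
    rw [← Finset.card_filter, ← Finset.card_filter, Finset.filter_mem_eq_inter,
      Finset.filter_mem_eq_inter, Finset.univ_inter, Finset.univ_inter, Finset.card_compl,
      Fintype.card_fin]
  have hsome : ∀ v, (cone G X M).degree (some v) = ((if v ∈ M then 1 else 0) +
      if v ∈ Xᶜ then 1 else 0) + if v ∈ X then nbrCount G X v else 0 := by
    intro v
    rw [hdeg, sum_option]
    congr 1
    · have h : (cone G X M).Adj (some v) none ↔ v ∈ M ∨ v ∉ X := Iff.rfl
      have h' := @hM v
      simp only [h, Finset.mem_compl]
      by_cases h2 : v ∈ M <;> by_cases h3 : v ∈ X <;> simp_all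
    · have h : ∀ u, (cone G X M).Adj (some v) (some u) ↔ v ∈ X ∧ u ∈ X ∧ G.Adj v u :=
        fun u => Iff.rfl
      simp only [h]
      split_ifs with hv
      · rw [nbrCount_eq_card, Finset.card_filter, ← Finset.sum_filter_add_sum_filter_not _ (· ∈ X)]
        rw [Finset.sum_eq_zero (s := Finset.univ.filter fun u => ¬ u ∈ X), add_zero,
          Finset.filter_mem_eq_inter, Finset.univ_inter]
        · exact Finset.sum_congr rfl fun u hu => by simp [hv, hu]
        · intro u hu
          rw [Finset.mem_filter] at hu
          simp [hu.2]
      · simp [hv]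
  simp only [hsome, Finset.sum_add_distrib, hnone, adjPairs]
  rw [← Finset.card_filter, ← Finset.card_filter, Finset.filter_mem_eq_inter,
    Finset.filter_mem_eq_inter, Finset.univ_inter, Finset.univ_inter, Finset.card_compl,
    Fintype.card_fin]
  ring

theorem cone_reachable_of_mem {M : Finset (Fin n)} (hM : M ⊆ X) {v : Fin n}
    (hv : v ∈ reach G X M) : (cone G X M).Reachable none (some v) := by
  classical
  have h : IsClosedIn G X (X.filter fun v => (cone G X M).Reachable none (some v)) := by
    refine ⟨Finset.filter_subset _ _, fun u hu v hv huv => ?_⟩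
    rw [Finset.mem_filter] at hu ⊢
    exact ⟨hv, hu.2.trans (SimpleGraph.Adj.reachable (show u ∈ X ∧ v ∈ X ∧ G.Adj u v from
      ⟨hu.1, hv, huv⟩))⟩
  have h' : M ⊆ X.filter fun v => (cone G X M).Reachable none (some v) := fun v hv =>
    Finset.mem_filter.2 ⟨hM hv, SimpleGraph.Adj.reachable (show v ∈ M ∨ v ∉ X from .inl hv)⟩
  exact (Finset.mem_filter.1 (reach_subset_of_isClosedIn h h' hv)).2

theorem mem_reach_of_cone_walk {M : Finset (Fin n)} (hM : M ⊆ X) {x y : Option (Fin n)}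
    (p : (cone G X M).Walk x y) (hx : ∀ v, x = some v → v ∈ X → v ∈ reach G X M) :
    ∀ v, y = some v → v ∈ X → v ∈ reach G X M := by
  induction p with
  | nil => exact hx
  | @cons x z y hxz p ih =>
    refine ih fun v hv hvX => ?_
    subst hv
    cases x with
    | none =>
      rcases (hxz : v ∈ M ∨ v ∉ X) with h | h
      · exact subset_reach hM h
      · exact absurd hvX h
    | some u =>
      obtain ⟨hu, -, huv⟩ := (hxz : u ∈ X ∧ v ∈ X ∧ G.Adj u v)
      exact (isClosedIn_reach hM).2 u (hx u rfl hu) v hvX huv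

/-- The apex reaches a component of `G[X]` only through a mark in it, and the vertices outside of
`X` are pendant at the apex. -/
theorem cone_connected_iff {M : Finset (Fin n)} (hM : M ⊆ X) :
    (cone G X M).Connected ↔ reach G X M = X := by
  constructor
  · refine fun h => (reach_subset hM).antisymm fun v hv => ?_
    obtain ⟨p⟩ := h.preconnected none (some v)
    exact mem_reach_of_cone_walk hM p (by simp) v rfl hv
  · intro h
    have h0 : ∀ x, (cone G X M).Reachable none x := by
      rintro (_ | v)
      · exact .refl _
      · by_cases hv : v ∈ X
        · exact cone_reachable_of_mem hM (by rwa [h])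
        · exact SimpleGraph.Adj.reachable (show v ∈ M ∨ v ∉ X from .inr hv)
    exact ⟨fun x y => (h0 x).symm.trans (h0 y)⟩

/-- A tree is a connected graph with one edge less than vertices. Here there are `n + 1` vertices
and `|M| + (n - |X|) + e(X)` edges, so the condition on the number of edges is `|X| = e(X) + |M|`.
-/
theorem cone_isTree_iff {M : Finset (Fin n)} (hM : M ⊆ X) :
    (cone G X M).IsTree ↔ Inst.Good G X M := by
  rw [SimpleGraph.isTree_iff_connected_and_card, cone_connected_iff hM, Inst.Good, and_comm]
  have h1 := two_mul_card_cone (G := G) hM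
  have h2 : X.card ≤ n := (Finset.card_le_univ X).trans (by simp)
  have h3 : Nat.card (Option (Fin n)) = n + 1 := by simp
  rw [h3]
  refine and_congr_left fun _ => ?_
  omega

theorem Inst.Good.isAcyclic {M : Finset (Fin n)} (hM : M ⊆ X) (h : Inst.Good G X M) :
    (G.induce (X : Set (Fin n))).IsAcyclic := by
  refine SimpleGraph.IsAcyclic.comap (G' := cone G X M)
    ⟨fun v => some v.1, fun {u v} huv => ⟨u.2, v.2, huv⟩⟩ (fun u v huv => ?_)
    ((cone_isTree_iff hM).2 h).isAcyclic
  exact Subtype.ext (Option.some_injective _ huv)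

/-- The graph `G[X]` with isolated vertices. -/
def pad (G : SimpleGraph (Fin n)) (X : Finset (Fin n)) : SimpleGraph (Option (Fin n)) where
  Adj x y := ∃ u v, x = some u ∧ y = some v ∧ u ∈ X ∧ v ∈ X ∧ G.Adj u v
  symm := ⟨fun _ _ ⟨u, v, h1, h2, h3, h4, h5⟩ => ⟨v, u, h2, h1, h4, h3, h5.symm⟩⟩
  loopless := ⟨by
    rintro _ ⟨u, v, rfl, h, -, -, huv⟩
    exact huv.ne (Option.some_injective _ h)⟩

/-- Each vertex of a cycle lies on one of its edges, and both ends of an edge belong to `X`. So a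
cycle would live in `G[X]` already. -/
theorem pad_isAcyclic (h : (G.induce (X : Set (Fin n))).IsAcyclic) : (pad G X).IsAcyclic := by
  intro x p hp
  set s : Set (Option (Fin n)) := {x | ∃ v, v ∈ X ∧ x = some v} with hs
  have hsup : ∀ y ∈ p.support, y ∈ s := by
    intro y hy
    obtain ⟨e, he, hye⟩ := SimpleGraph.Walk.mem_support_iff_exists_mem_edges_of_not_nil
      (hp.not_nil) |>.1 hy
    have h1 := p.edges_subset_edgeSet he
    induction e with
    | _ a b =>
      obtain ⟨u, v, rfl, rfl, hu, hv, -⟩ := h1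
      rw [Sym2.mem_iff] at hye
      rcases hye with rfl | rfl
      · exact ⟨u, hu, rfl⟩
      · exact ⟨v, hv, rfl⟩
  have hcyc : ((pad G X).induce s).IsAcyclic := by
    have hmem : ∀ x : s, ∃ v, v ∈ X ∧ x.1 = some v := fun x => x.2
    choose f hf hf' using hmem
    refine SimpleGraph.IsAcyclic.comap (G' := G.induce (X : Set (Fin n)))
      ⟨fun x => ⟨f x, hf x⟩, fun {x y} hxy => ?_⟩ (fun x y hxy => ?_) h
    · obtain ⟨u, v, hu, hv, -, -, huv⟩ := (hxy : (pad G X).Adj x.1 y.1)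
      have hu' : f x = u := Option.some_injective _ ((hf' x).symm.trans hu)
      have hv' : f y = v := Option.some_injective _ ((hf' y).symm.trans hv)
      change G.Adj (f x) (f y)
      rwa [hu', hv']
    · have h1 : f x = f y := congrArg Subtype.val hxy
      exact Subtype.ext (by rw [hf', hf', h1])
  refine hcyc (p.induce s hsup) (SimpleGraph.Walk.IsCycle.of_map
    (f := (SimpleGraph.Embedding.induce s).toHom) ?_)
  rw [SimpleGraph.Walk.map_induce]
  exact hp

/-- The cone over all of `X` is connected and contains the forest `G[X]`, which extends to a
spanning tree. The neighbors of the apex in this tree that lie in `X` are the marks. -/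
theorem exists_good (h : (G.induce (X : Set (Fin n))).IsAcyclic) :
    ∃ M, M ⊆ X ∧ Inst.Good G X M := by
  classical
  have hcon : (cone G X X).Connected :=
    (cone_connected_iff subset_rfl).2 ((reach_subset subset_rfl).antisymm (subset_reach subset_rfl))
  have hle : pad G X ≤ cone G X X := by
    rintro _ _ ⟨u, v, rfl, rfl, hu, hv, huv⟩
    exact ⟨hu, hv, huv⟩
  obtain ⟨F, hF, hF', hT⟩ := hcon.exists_isTree_le_of_le_of_isAcyclic hle (pad_isAcyclic h)
  refine ⟨X.filter fun v => F.Adj none (some v), Finset.filter_subset _ _, ?_⟩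
  rw [← cone_isTree_iff (Finset.filter_subset _ _)]
  convert hT
  -- A vertex outside of `X` has no neighbor but the apex, so the tree must use this edge.
  have hout : ∀ v, v ∉ X → F.Adj none (some v) := by
    intro v hv
    obtain ⟨p⟩ := hT.connected.preconnected (some v) none
    cases p with
    | @cons _ x _ hx p =>
      cases x with
      | none => exact hx.symm
      | some u => exact absurd (hF' hx).1 hv
  ext x y
  have key : ∀ v, (cone G X (X.filter fun v => F.Adj none (some v))).Adj none (some v) ↔
      F.Adj none (some v) := by
    intro v
    change v ∈ X.filter _ ∨ v ∉ X ↔ _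
    rw [Finset.mem_filter]
    have := hout v
    tauto
  cases x with
  | none =>
    cases y with
    | none => exact iff_of_false (SimpleGraph.irrefl _) (SimpleGraph.irrefl _)
    | some v => exact key v
  | some u =>
    cases y with
    | none => rw [SimpleGraph.adj_comm, key, SimpleGraph.adj_comm]
    | some v =>
      constructor
      · rintro ⟨hu, hv, huv⟩
        exact hF ⟨u, v, rfl, rfl, hu, hv, huv⟩
      · intro huv
        exact hF' huv

theorem isAcyclic_mono {Y : Finset (Fin n)} (h : (G.induce (X : Set (Fin n))).IsAcyclic)
    (hYX : Y ⊆ X) : (G.induce (Y : Set (Fin n))).IsAcyclic := by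
  have hs : (Y : Set (Fin n)) ⊆ X := by exact_mod_cast hYX
  exact SimpleGraph.IsAcyclic.comap (SimpleGraph.induceHomOfLE G hs).toHom
    (SimpleGraph.induceHomOfLE G hs).injective h

/-- A non-empty forest needs at least one mark, as nothing is reached from the empty set; so it has
fewer edges than vertices. -/
theorem adjPairs_lt_of_isAcyclic (h : (G.induce (X : Set (Fin n))).IsAcyclic)
    (hX : X.Nonempty) : adjPairs G X < 2 * X.card := by
  obtain ⟨M, hM, h1, h2⟩ := exists_good h
  have : 0 < M.card := by
    rw [Finset.card_pos, Finset.nonempty_iff_ne_empty]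
    rintro rfl
    rw [reach_empty] at h2
    exact hX.ne_empty h2.symm
  omega

end


/-! ### Counting cuts modulo two -/

section

variable {n : ℕ} {G : SimpleGraph (Fin n)} {X Y M R R' : Finset (Fin n)}

theorem mem_touch {v : Fin n} : v ∈ touch G X R ↔ v ∈ X ∧ ∃ u, u ∈ R ∧ G.Adj u v := by
  simp [touch]

theorem touch_subset : touch G X R ⊆ X := fun _ h => (mem_touch.1 h).1

theorem nbrCount_pos_iff {u : Fin n} : 0 < nbrCount G X u ↔ ∃ v, v ∈ X ∧ G.Adj u v := by
  classical
  rw [nbrCount_eq_card, Finset.card_pos]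
  simp [Finset.Nonempty]

/-- Whether a vertex of `A` has a neighbor in `R` is all that the 1-neighbor class of `R` records.
-/
theorem touch_eq_of_similar {A : Finset (Fin n)} (hX : X ⊆ A) (h : Similar G 1 Aᶜ R R') :
    touch G X R = touch G X R' := by
  ext v
  rw [mem_touch, mem_touch]
  refine and_congr_right fun hv => ?_
  have h1 := h v (by simpa using hX hv)
  have h2 : 0 < nbrCount G R v ↔ 0 < nbrCount G R' v := by omega
  simpa only [nbrCount_pos_iff, G.adj_comm] using h2

-- The sets `K` in question contain everything that is reached from `L` and avoid everything that is
-- reached from `R`. If the two reached sets meet, there is no such `K`; if they partition `X`,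
-- there is exactly one. Otherwise the rest `U` of `X` is a non-empty closed set, and the sets `K`
-- are paired up by symmetric difference with `U`.
open Classical in
theorem card_closed_mod_two {L R : Finset (Fin n)} (hL : L ⊆ X) (hR : R ⊆ X) :
    ((Finset.univ.filter fun K => IsClosedIn G X K ∧ L ⊆ K ∧ Disjoint R K).card : ZMod 2) =
      if ∀ v, v ∈ X → (v ∈ reach G X L ↔ v ∉ reach G X R) then 1 else 0 := by
  have ha := isClosedIn_reach (G := G) hL
  have hb := isClosedIn_reach (G := G) hR
  set a := reach G X L with ha'
  set b := reach G X R with hb'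
  have hK : ∀ K, IsClosedIn G X K → L ⊆ K → Disjoint R K → a ⊆ K ∧ Disjoint b K := by
    intro K hK h1 h2
    refine ⟨reach_subset_of_isClosedIn hK h1, ?_⟩
    have : b ⊆ X \ K := reach_subset_of_isClosedIn hK.sdiff fun v hv =>
      Finset.mem_sdiff.2 ⟨hR hv, Finset.disjoint_left.1 h2 hv⟩
    exact Finset.disjoint_left.2 fun v hv => (Finset.mem_sdiff.1 (this hv)).2
  split_ifs with h
  · have : (Finset.univ.filter fun K => IsClosedIn G X K ∧ L ⊆ K ∧ Disjoint R K) = {a} := by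
      ext K
      simp only [Finset.mem_filter, Finset.mem_univ, true_and, Finset.mem_singleton]
      constructor
      · rintro ⟨h1, h2, h3⟩
        obtain ⟨h4, h5⟩ := hK K h1 h2 h3
        refine Finset.Subset.antisymm (fun v hv => ?_) h4
        exact (h v (h1.1 hv)).2 fun hvb => Finset.disjoint_left.1 h5 hvb hv
      · rintro rfl
        refine ⟨ha, subset_reach hL, Finset.disjoint_left.2 fun v hv hva => ?_⟩
        exact (h v (hR hv)).1 hva (subset_reach hR hv)
    rw [this]
    simp
  · push Not at h
    obtain ⟨v, hvX, hv⟩ := h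
    by_cases hvb : v ∈ b
    · have hva : v ∈ a := by tauto
      rw [Finset.filter_eq_empty_iff.2, Finset.card_empty, Nat.cast_zero]
      rintro K - ⟨h1, h2, h3⟩
      obtain ⟨h4, h5⟩ := hK K h1 h2 h3
      exact Finset.disjoint_left.1 h5 hvb (h4 hva)
    · have hva : v ∉ a := by tauto
      rw [Finset.card_eq_sum_ones, Nat.cast_sum, Nat.cast_one]
      set U := X \ (a ∪ b) with hU
      have hUc : IsClosedIn G X U := (ha.union hb).sdiff
      have hvU : v ∈ U := by simp [hU, hvX, hva, hvb]
      -- The involution has no fixed points, because it moves `v` in or out of `K`.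
      refine Finset.sum_involution (fun K _ => (K \ U) ∪ (U \ K)) (fun _ _ => by decide)
        (fun K _ _ heq => ?_) (fun K hKm => ?_) (fun K _ => ?_)
      · have h1 : v ∈ (K \ U) ∪ (U \ K) ↔ v ∈ K := by rw [heq]
        simp only [Finset.mem_union, Finset.mem_sdiff] at h1
        tauto
      · simp only [Finset.mem_filter, Finset.mem_univ, true_and] at hKm ⊢
        obtain ⟨h1, h2, h3⟩ := hKm
        obtain ⟨h4, h5⟩ := hK K h1 h2 h3
        have e1 : K \ U = K ∩ (X \ U) := by
          ext w
          have := @h1.1 w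
          simp only [Finset.mem_sdiff, Finset.mem_inter]
          tauto
        have e2 : U \ K = U ∩ (X \ K) := by
          ext w
          have := @hUc.1 w
          simp only [Finset.mem_sdiff, Finset.mem_inter]
          tauto
        refine ⟨?_, fun w hw => ?_, Finset.disjoint_left.2 fun w hw => ?_⟩
        · rw [e1, e2]
          exact (h1.inter hUc.sdiff).union (hUc.inter h1.sdiff)
        · have : w ∈ a := subset_reach hL hw
          have := h2 hw
          simp only [hU, Finset.mem_union, Finset.mem_sdiff]
          tauto
        · have : w ∈ b := subset_reach hR hw
          have := Finset.disjoint_left.1 h3 hw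
          simp only [hU, Finset.mem_union, Finset.mem_sdiff]
          tauto
      · ext w
        simp only [Finset.mem_union, Finset.mem_sdiff]
        tauto

/-- Edges inside of `X` or inside of `Y` give the first two conditions. The edges between `X` and
`Y` give the others: neighbors of `L` must belong to `K`, and neighbors of `Y \ L` must not. -/
theorem isClosedIn_union_iff (hXY : Disjoint X Y) {K L : Finset (Fin n)} (hK : K ⊆ X) (hL : L ⊆ Y) :
    IsClosedIn G (X ∪ Y) (K ∪ L) ↔ IsClosedIn G X K ∧ IsClosedIn G Y L ∧
      touch G X L ⊆ K ∧ Disjoint (touch G X (Y \ L)) K := by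
  have hd : ∀ v, v ∈ X → v ∉ Y := fun v hv hvY => Finset.disjoint_left.1 hXY hv hvY
  constructor
  · rintro ⟨-, h⟩
    have h' : ∀ u, (u ∈ K ∨ u ∈ L) → ∀ v, v ∈ X ∨ v ∈ Y → G.Adj u v → v ∈ K ∨ v ∈ L := by
      simpa only [Finset.mem_union] using h
    refine ⟨⟨hK, fun u hu v hv huv => ?_⟩, ⟨hL, fun u hu v hv huv => ?_⟩, fun v hv => ?_,
      Finset.disjoint_left.2 fun v hv hvK => ?_⟩
    · exact (h' u (.inl hu) v (.inl hv) huv).resolve_right fun hvL => hd v hv (hL hvL)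
    · exact (h' u (.inr hu) v (.inr hv) huv).resolve_left fun hvK => hd v (hK hvK) hv
    · obtain ⟨hvX, u, hu, huv⟩ := mem_touch.1 hv
      exact (h' u (.inr hu) v (.inl hvX) huv).resolve_right fun hvL => hd v hvX (hL hvL)
    · obtain ⟨hvX, u, hu, huv⟩ := mem_touch.1 hv
      rw [Finset.mem_sdiff] at hu
      rcases h' v (.inl hvK) u (.inr hu.1) huv.symm with h1 | h1
      · exact hd u (hK h1) hu.1
      · exact hu.2 h1
  · rintro ⟨h1, h2, h3, h4⟩
    refine ⟨Finset.union_subset_union hK hL, fun u hu v hv huv => ?_⟩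
    rw [Finset.mem_union] at hu hv ⊢
    rcases hu with hu | hu <;> rcases hv with hv | hv
    · exact .inl (h1.2 u hu v hv huv)
    · right
      by_contra hvL
      exact Finset.disjoint_left.1 h4
        (mem_touch.2 ⟨hK hu, v, Finset.mem_sdiff.2 ⟨hv, hvL⟩, huv.symm⟩) hu
    · exact .inl (h3 (mem_touch.2 ⟨hv, u, hu, huv⟩))
    · exact .inr (h2.2 u hu v hv huv)

open Classical in
/-- Connectivity of a union, as a linear function of the compatibilities of one side. -/
theorem reach_union_eq {MY : Finset (Fin n)} (hXY : Disjoint X Y) (hM : M ⊆ X) (hMY : MY ⊆ Y) :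
    (if reach G (X ∪ Y) (M ∪ MY) = X ∪ Y then 1 else 0 : ZMod 2) =
      ∑ L ∈ Finset.univ.filter fun L => IsClosedIn G Y L ∧ MY ⊆ L,
        if Compat G X M L (Y \ L) then 1 else 0 := by
  have hd : ∀ v, v ∈ X → v ∉ Y := fun v hv hvY => Finset.disjoint_left.1 hXY hv hvY
  have hMM : M ∪ MY ⊆ X ∪ Y := Finset.union_subset_union hM hMY
  -- With nothing to avoid, the number of closed sets containing all marks is odd exactly if the
  -- marks reach all of `X ∪ Y`.
  have h0 := card_closed_mod_two (G := G) hMM (Finset.empty_subset _)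
  rw [reach_empty] at h0
  have e0 : (if reach G (X ∪ Y) (M ∪ MY) = X ∪ Y then 1 else 0 : ZMod 2) =
      if ∀ v, v ∈ X ∪ Y → (v ∈ reach G (X ∪ Y) (M ∪ MY) ↔ v ∉ (∅ : Finset (Fin n)))
        then 1 else 0 := by
    refine if_congr ⟨fun h v hv => ?_, fun h => ?_⟩ rfl rfl
    · rw [h]
      simpa using hv
    · exact (reach_subset hMM).antisymm fun v hv => (h v hv).2 (by simp)
  rw [e0, ← h0]
  have e1 : ∀ L ∈ Finset.univ.filter fun L => IsClosedIn G Y L ∧ MY ⊆ L,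
      (if Compat G X M L (Y \ L) then 1 else 0 : ZMod 2) =
      ((Finset.univ.filter fun K => IsClosedIn G X K ∧ M ∪ touch G X L ⊆ K ∧
        Disjoint (touch G X (Y \ L)) K).card : ZMod 2) := fun L _ => by
    rw [card_closed_mod_two (Finset.union_subset hM touch_subset) touch_subset]
    exact if_congr Iff.rfl rfl rfl
  -- The sum counts pairs of compatible closed sets `L` of `Y` and `K` of `X`, which correspond to
  -- the closed sets `K ∪ L` of the union.
  rw [Finset.sum_congr rfl e1, ← Nat.cast_sum, ← Finset.card_sigma]
  congr 1
  symm
  refine Finset.card_bij (fun p _ => p.2 ∪ p.1) (fun p hp => ?_) (fun p hp q hq hpq => ?_)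
    (fun K hK => ?_)
  · simp only [Finset.mem_sigma, Finset.mem_filter, Finset.mem_univ, true_and] at hp ⊢
    obtain ⟨⟨h1, h2⟩, h3, h4, h5⟩ := hp
    rw [Finset.union_subset_iff] at h4
    exact ⟨(isClosedIn_union_iff hXY h3.1 h1.1).2 ⟨h3, h1, h4.2, h5⟩,
      Finset.union_subset_union h4.1 h2, by simp⟩
  · simp only [Finset.mem_sigma, Finset.mem_filter, Finset.mem_univ, true_and] at hp hq
    obtain ⟨L, K⟩ := p
    obtain ⟨L', K'⟩ := q
    have hK := hp.2.1.1
    have hK' := hq.2.1.1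
    have hL := hp.1.1.1
    have hL' := hq.1.1.1
    have hmem : ∀ v, v ∈ K ∨ v ∈ L ↔ v ∈ K' ∨ v ∈ L' := fun v => by
      simpa using Finset.ext_iff.1 hpq v
    have eL : L = L' := by
      ext v
      have := hmem v
      have := hd v
      have := @hK v
      have := @hK' v
      have := @hL v
      have := @hL' v
      tauto
    have eK : K = K' := by
      ext v
      have := hmem v
      have := hd v
      have := @hK v
      have := @hK' v
      have := @hL v
      have := @hL' v
      tauto
    rw [eL, eK]
  · simp only [Finset.mem_filter, Finset.mem_univ, true_and] at hK
    obtain ⟨h1, h2, -⟩ := hK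
    have e : K = (K ∩ X) ∪ (K ∩ Y) := by
      rw [← Finset.inter_union_distrib_left, Finset.inter_eq_left.2 h1.1]
    rw [e, isClosedIn_union_iff hXY Finset.inter_subset_right Finset.inter_subset_right] at h1
    obtain ⟨h3, h4, h5, h6⟩ := h1
    rw [Finset.union_subset_iff] at h2
    refine ⟨⟨K ∩ Y, K ∩ X⟩, ?_, e.symm⟩
    simp only [Finset.mem_sigma, Finset.mem_filter, Finset.mem_univ, true_and]
    exact ⟨⟨h4, Finset.subset_inter h2.2 hMY⟩, h3,
      Finset.union_subset (Finset.subset_inter h2.1 hM) h5, h6⟩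

/-- For this reason a feature vector needs only one coordinate for each pair of 1-neighbor classes,
although the completions are arbitrary. -/
theorem compat_congr {A L L' : Finset (Fin n)} (hX : X ⊆ A) (h : Similar G 1 Aᶜ R L)
    (h' : Similar G 1 Aᶜ R' L') : Compat G X M R R' ↔ Compat G X M L L' := by
  rw [Compat, Compat, touch_eq_of_similar hX h, touch_eq_of_similar hX h']

/-! ### The number of edges of a union -/

theorem sum_nbrCount_comm (X Y : Finset (Fin n)) :
    ∑ x ∈ X, nbrCount G Y x = ∑ y ∈ Y, nbrCount G X y := by
  classical
  simp only [nbrCount_eq_card, Finset.card_filter]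
  rw [Finset.sum_comm]
  simp only [G.adj_comm]

theorem adjPairs_eq_sum (X : Finset (Fin n)) : adjPairs G X = ∑ x ∈ X, nbrCount G X x := by
  classical
  rw [adjPairs, ← Finset.sum_filter, Finset.filter_mem_eq_inter, Finset.univ_inter]

theorem adjPairs_union (hXY : Disjoint X Y) :
    adjPairs G (X ∪ Y) = adjPairs G X + adjPairs G Y + 2 * ∑ x ∈ X, nbrCount G Y x := by
  simp only [adjPairs_eq_sum]
  rw [Finset.sum_union hXY]
  simp only [nbrCount_union hXY, Finset.sum_add_distrib]
  rw [sum_nbrCount_comm Y X]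
  ring

theorem mem_big {v : Fin n} : v ∈ big G R X ↔ v ∈ X ∧ 2 ≤ nbrCount G R v := by
  simp [big]

theorem mem_one {v : Fin n} : v ∈ one G R X ↔ v ∈ X ∧ nbrCount G R v = 1 := by
  simp [one]

theorem big_eq_of_similar {A : Finset (Fin n)} (hX : X ⊆ A) (h : Similar G 2 Aᶜ R R') :
    big G R X = big G R' X := by
  ext v
  rw [mem_big, mem_big]
  refine and_congr_right fun hv => ?_
  have := h v (by simpa using hX hv)
  omega

theorem one_eq_of_similar {A : Finset (Fin n)} (hX : X ⊆ A) (h : Similar G 2 Aᶜ R R') :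
    one G R X = one G R' X := by
  ext v
  rw [mem_one, mem_one]
  refine and_congr_right fun hv => ?_
  have := h v (by simpa using hX hv)
  omega

/-- The edges between `X` and `Y` are counted differently for the two kinds of vertices of `X`:
those with exactly one neighbor in `Y` contribute one each, and the edges at those with more are
counted from the side of `Y`. -/
theorem sum_nbrCount_eq (X Y : Finset (Fin n)) :
    ∑ x ∈ X, nbrCount G Y x = (one G Y X).card + ∑ y ∈ Y, nbrCount G (big G Y X) y := by
  classical
  rw [sum_nbrCount_comm Y (big G Y X), one, big, Finset.card_filter, Finset.sum_filter,
    ← Finset.sum_add_distrib]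
  refine Finset.sum_congr rfl fun x _ => ?_
  split_ifs <;> omega

/-- Which vertices have no, one or more neighbors in `Y` is determined by the 2-neighbor class,
which is where `2 ≤ d` is needed. So the invariants can be computed with `R` in place of the unknown
`Y`. -/
theorem adjPairs_union_congr {A : Finset (Fin n)} {c c' : Config n} (h : SameKey G A R c c')
    (hc : c.X ⊆ A) (hc' : c'.X ⊆ A) (hY : Y ⊆ Aᶜ) (hR : Similar G 2 Aᶜ R Y) :
    adjPairs G (c.X ∪ Y) = adjPairs G (c'.X ∪ Y) := by
  have hd : ∀ X, X ⊆ A → Disjoint X Y := fun X hX =>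
    Finset.disjoint_left.2 fun v hv hvY => Finset.mem_compl.1 (hY hvY) (hX hv)
  obtain ⟨-, h1, h2, -, h3⟩ := h
  rw [one_eq_of_similar hc hR, one_eq_of_similar hc' hR] at h2
  rw [big_eq_of_similar hc hR, big_eq_of_similar hc' hR] at h3
  rw [adjPairs_union (hd _ hc), adjPairs_union (hd _ hc'), h1, sum_nbrCount_eq c.X,
    sum_nbrCount_eq c'.X, h2,
    Finset.sum_congr rfl fun y hy => h3 y (Finset.mem_compl.1 (hY hy))]

end


/-! ### Vertices with two neighbors on the other side -/

section

variable {n : ℕ} {G : SimpleGraph (Fin n)} {A X Y S : Finset (Fin n)}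

/-- Let `B` be the set of vertices of `Y` with at least two neighbors in `S`. If every vertex of `S`
had two neighbors in `B`, the bipartite graph between `S` and `B` would have minimum degree two,
which is impossible in a forest. A vertex `x` with at most one neighbor in `B` has another neighbor
`y` in `Y \ B`, and `x` is the only neighbor of `y` in `S`. -/
theorem exists_private (h : (G.induce ((X ∪ Y : Finset (Fin n)) : Set (Fin n))).IsAcyclic)
    (hXY : Disjoint X Y) (hS : S ⊆ big G Y X) (hne : S.Nonempty) :
    ∃ x ∈ S, nbrCount G (big G S Y) x ≤ 1 ∧ ∃ y ∈ Y, G.Adj y x ∧ ∀ v ∈ S, G.Adj y v → v = x := by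
  classical
  have hSX : S ⊆ X := fun v hv => (mem_big.1 (hS hv)).1
  have hYY : big G S Y ⊆ Y := fun v hv => (mem_big.1 hv).1
  have hd : Disjoint S (big G S Y) := hXY.mono hSX hYY
  obtain ⟨x, hx, hx1⟩ : ∃ x ∈ S, nbrCount G (big G S Y) x ≤ 1 := by
    by_contra! hcon
    have h1 := adjPairs_lt_of_isAcyclic
      (isAcyclic_mono h (Finset.union_subset_union hSX hYY)) (hne.mono Finset.subset_union_left)
    rw [adjPairs_union hd, Finset.card_union_of_disjoint hd] at h1
    have h2 : S.card * 2 ≤ ∑ x ∈ S, nbrCount G (big G S Y) x :=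
      Finset.card_nsmul_le_sum S _ 2 fun x hx => hcon x hx
    have h3 : (big G S Y).card * 2 ≤ ∑ y ∈ big G S Y, nbrCount G S y :=
      Finset.card_nsmul_le_sum _ _ 2 fun y hy => (mem_big.1 hy).2
    rw [← sum_nbrCount_comm] at h3
    omega
  refine ⟨x, hx, hx1, ?_⟩
  have hx2 := (mem_big.1 (hS hx)).2
  obtain ⟨y, hy, hyx⟩ : ∃ y, y ∈ Y \ big G S Y ∧ G.Adj x y := by
    rw [← nbrCount_pos_iff]
    have := nbrCount_union (H := G) (Finset.disjoint_sdiff (s := big G S Y) (t := Y)) x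
    rw [Finset.union_sdiff_of_subset hYY] at this
    omega
  rw [Finset.mem_sdiff, mem_big] at hy
  refine ⟨y, hy.1, hyx.symm, fun v hv hyv => ?_⟩
  have h1 : nbrCount G S y ≤ 1 := by
    have := hy.2
    by_contra hlt
    exact this ⟨hy.1, by omega⟩
  rw [nbrCount_eq_card, Finset.card_le_one] at h1
  exact h1 v (by simp [hv, hyv]) x (by simp [hx, hyx.symm])

/-- Induction by removal of a vertex `x` as in `exists_private`, whose neighbor `y` is private
within all of `S`. Reinserting `x` can only spoil a private neighbor `z a` that is adjacent to `x`.
There is at most one such `a`, and `x` is put into the part that does not contain it. -/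
theorem exists_split_aux (h : (G.induce ((X ∪ Y : Finset (Fin n)) : Set (Fin n))).IsAcyclic)
    (hXY : Disjoint X Y) : ∀ (k : ℕ) (S : Finset (Fin n)), S.card = k → S ⊆ big G Y X →
    ∃ (z : Fin n → Fin n) (C D : Finset (Fin n)), Disjoint C D ∧ C ∪ D = S ∧
      (∀ x ∈ S, z x ∈ Y ∧ G.Adj (z x) x) ∧ (∀ x ∈ S, ∀ y ∈ S, z x = z y → x = y) ∧
      (∀ x ∈ C, ∀ y ∈ C, G.Adj (z x) y → y = x) ∧ ∀ x ∈ D, ∀ y ∈ D, G.Adj (z x) y → y = x := by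
  classical
  intro k
  induction k with
  | zero =>
    intro S hS _
    rw [Finset.card_eq_zero] at hS
    subst hS
    exact ⟨id, ∅, ∅, by simp, by simp, by simp, by simp, by simp, by simp⟩
  | succ k ih =>
    intro S hS hSb
    obtain ⟨x, hx, hx1, y, hy, hyx, hyu⟩ := exists_private h hXY hSb
      (Finset.card_pos.1 (by omega))
    obtain ⟨z, C, D, hCD, hU, hz, hinj, hC, hD⟩ := ih (S.erase x)
      (by rw [Finset.card_erase_of_mem hx]; omega) ((Finset.erase_subset _ _).trans hSb)
    have hmem : ∀ v, v ∈ C ∨ v ∈ D ↔ v ≠ x ∧ v ∈ S := fun v => by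
      rw [← Finset.mem_union, hU, Finset.mem_erase]
    have hxC : x ∉ C := fun hc => ((hmem x).1 (.inl hc)).1 rfl
    have hxD : x ∉ D := fun hc => ((hmem x).1 (.inr hc)).1 rfl
    -- Such a vertex `z a` has the two neighbors `a` and `x` in `S`, and `x` has at most one
    -- neighbor of this kind; `z` is injective.
    have huniq : ∀ a b, a ∈ S.erase x → b ∈ S.erase x → G.Adj (z a) x → G.Adj (z b) x →
        a = b := by
      have hbig : ∀ a, a ∈ S.erase x → G.Adj (z a) x → z a ∈ big G S Y := by
        intro a ha hax
        refine mem_big.2 ⟨(hz a ha).1, ?_⟩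
        rw [nbrCount_eq_card]
        refine Nat.succ_le_of_lt (Finset.one_lt_card.2 ⟨a, ?_, x, ?_, (Finset.mem_erase.1 ha).1⟩)
        · simp [(Finset.mem_erase.1 ha).2, (hz a ha).2]
        · simp [hx, hax]
      intro a b ha hb hax hbx
      refine hinj a ha b hb ?_
      rw [nbrCount_eq_card, Finset.card_le_one] at hx1
      exact hx1 _ (by simp [hbig a ha hax, hax.symm]) _ (by simp [hbig b hb hbx, hbx.symm])
    have hz' : ∀ a ∈ S, Function.update z x y a ∈ Y ∧ G.Adj (Function.update z x y a) a := by
      intro a ha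
      by_cases hax : a = x
      · subst hax
        simp [hy, hyx]
      · rw [Function.update_of_ne hax]
        exact hz a (Finset.mem_erase.2 ⟨hax, ha⟩)
    have hinj' : ∀ a ∈ S, ∀ b ∈ S, Function.update z x y a = Function.update z x y b → a = b := by
      intro a ha b hb hab
      have key : ∀ c ∈ S, c ≠ x → z c ≠ y := fun c hc hcx hzc =>
        hcx (hyu c hc (hzc ▸ (hz c (Finset.mem_erase.2 ⟨hcx, hc⟩)).2))
      by_cases hax : a = x <;> by_cases hbx : b = x
      · rw [hax, hbx]
      · subst hax
        rw [Function.update_self, Function.update_of_ne hbx] at hab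
        exact absurd hab.symm (key b hb hbx)
      · subst hbx
        rw [Function.update_self, Function.update_of_ne hax] at hab
        exact absurd hab (key a ha hax)
      · rw [Function.update_of_ne hax, Function.update_of_ne hbx] at hab
        exact hinj a (Finset.mem_erase.2 ⟨hax, ha⟩) b (Finset.mem_erase.2 ⟨hbx, hb⟩) hab
    have hkeep : ∀ E : Finset (Fin n), x ∉ E → (∀ a ∈ E, ∀ b ∈ E, G.Adj (z a) b → b = a) →
        ∀ a ∈ E, ∀ b ∈ E, G.Adj (Function.update z x y a) b → b = a := by
      intro E hxE hE a ha b hb hab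
      rw [Function.update_of_ne (by rintro rfl; exact hxE ha)] at hab
      exact hE a ha b hb hab
    have hadd : ∀ E : Finset (Fin n), x ∉ E → E ⊆ S → (∀ a ∈ E, ∀ b ∈ E, G.Adj (z a) b → b = a) →
        (∀ a ∈ E, ¬ G.Adj (z a) x) →
        ∀ a ∈ insert x E, ∀ b ∈ insert x E, G.Adj (Function.update z x y a) b → b = a := by
      intro E hxE hES hE hno a ha b hb hab
      rw [Finset.mem_insert] at ha hb
      rcases ha with rfl | ha
      · rw [Function.update_self] at hab
        exact hyu b (hb.elim (fun e => e ▸ hx) fun hb => hES hb) hab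
      · rw [Function.update_of_ne (by rintro rfl; exact hxE ha)] at hab
        rcases hb with rfl | hb
        · exact absurd hab (hno a ha)
        · exact hE a ha b hb hab
    have hCS : C ⊆ S := fun v hv => ((hmem v).1 (.inl hv)).2
    have hDS : D ⊆ S := fun v hv => ((hmem v).1 (.inr hv)).2
    by_cases hcase : ∃ a ∈ C, G.Adj (z a) x
    · obtain ⟨a, ha, hax⟩ := hcase
      refine ⟨Function.update z x y, C, insert x D, ?_, ?_, hz', hinj', hkeep C hxC hC,
        hadd D hxD hDS hD fun b hb hbx => ?_⟩
      · rw [Finset.disjoint_insert_right]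
        exact ⟨hxC, hCD⟩
      · rw [Finset.union_insert, hU, Finset.insert_erase hx]
      · have := huniq a b (hU ▸ Finset.mem_union_left _ ha) (hU ▸ Finset.mem_union_right _ hb) hax hbx
        subst this
        exact Finset.disjoint_left.1 hCD ha hb
    · push Not at hcase
      refine ⟨Function.update z x y, insert x C, D, ?_, ?_, hz', hinj', hadd C hxC hCS hC hcase,
        hkeep D hxD hD⟩
      · rw [Finset.disjoint_insert_left]
        exact ⟨hxD, hCD⟩
      · rw [Finset.insert_union, hU, Finset.insert_erase hx]

/-- This justifies the filter in `reduce`: a partial solution without a splitting has no acyclic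
completion in the class considered. -/
theorem splitList_big_ne_nil
    (h : (G.induce ((X ∪ Y : Finset (Fin n)) : Set (Fin n))).IsAcyclic)
    (hX : X ⊆ A) (hY : Y ⊆ Aᶜ) : splitList G A (big G Y X) ≠ [] := by
  have hXY : Disjoint X Y := Finset.disjoint_left.2 fun v hv hvY =>
    Finset.mem_compl.1 (hY hvY) (hX hv)
  obtain ⟨z, C, D, hCD, hU, hz, -, hC, hD⟩ := exists_split_aux h hXY _ _ rfl subset_rfl
  refine splitList_ne_nil_iff.2 ⟨C, D, hCD, hU, ?_, ?_⟩
  · have hs : ∀ v ∈ C, v ∈ big G Y X := fun v hv => hU ▸ Finset.mem_union_left _ hv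
    refine ⟨fun v hv => hX (mem_big.1 (hs v hv)).1, fun x hx =>
      ⟨z x, Finset.mem_compl.1 (hY (hz x (hs x hx)).1), fun y hy => ⟨hC x hx y hy, ?_⟩⟩⟩
    rintro rfl
    exact (hz _ (hs _ hy)).2
  · have hs : ∀ v ∈ D, v ∈ big G Y X := fun v hv => hU ▸ Finset.mem_union_right _ hv
    refine ⟨fun v hv => hX (mem_big.1 (hs v hv)).1, fun x hx =>
      ⟨z x, Finset.mem_compl.1 (hY (hz x (hs x hx)).1), fun y hy => ⟨hD x hx y hy, ?_⟩⟩⟩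
    rintro rfl
    exact (hz _ (hs _ hy)).2

end


/-! ### The reduced lists represent all partial solutions -/

section

variable {n : ℕ} {G : SimpleGraph (Fin n)} {A R Y MY : Finset (Fin n)}

theorem disjoint_of_subset_compl {X : Finset (Fin n)} (hX : X ⊆ A) (hY : Y ⊆ Aᶜ) : Disjoint X Y :=
  Finset.disjoint_left.2 fun _ hv hvY => Finset.mem_compl.1 (hY hvY) (hX hv)

-- For the fixed completion `Y`, `MY`, connectivity of the union is the value of the functional
-- `lam` at the feature vector. Elimination provides an element of the same class, at least as good,
-- on which `lam` does not vanish. The equality of the invariants then gives the condition on the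
-- number of edges.
open Classical in
theorem exists_mem_reduce (goal : Goal) {P : List (Finset (Fin n) × Finset (Fin n))}
    {l : List (Config n)} (hl : ∀ c ∈ l, c.X ⊆ A ∧ c.M ⊆ c.X) (hY : Y ⊆ Aᶜ) (hMY : MY ⊆ Y)
    (hR : Similar G 2 Aᶜ R Y) (hP : ∀ L L', L ⊆ Aᶜ → L' ⊆ Aᶜ →
      ∃ p ∈ P, Similar G 1 Aᶜ p.1 L ∧ Similar G 1 Aᶜ p.2 L') {c : Config n} (hc : c ∈ l)
    (hgood : Inst.Good G (c.X ∪ Y) (c.M ∪ MY)) :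
    ∃ c' ∈ reduce G goal A R P l, Inst.Good G (c'.X ∪ Y) (c'.M ∪ MY) ∧ goal.le c.w c'.w := by
  have hidx : ∀ L : Finset (Fin n), ∃ j : Fin P.length, L ⊆ Y →
      Similar G 1 Aᶜ P[j].1 L ∧ Similar G 1 Aᶜ P[j].2 (Y \ L) := by
    intro L
    -- This only shows that `P` is non-empty, so that an unused default index exists for sets that
    -- are not contained in `Y`.
    obtain ⟨p, hp, -⟩ := hP ∅ ∅ (by simp) (by simp)
    by_cases hL : L ⊆ Y
    · obtain ⟨p, hp, h⟩ := hP L (Y \ L) (hL.trans hY) (Finset.sdiff_subset.trans hY)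
      obtain ⟨i, hi, rfl⟩ := List.getElem_of_mem hp
      exact ⟨⟨i, hi⟩, fun _ => h⟩
    · exact ⟨⟨0, List.length_pos_of_mem hp⟩, fun h => absurd h hL⟩
  choose idx hidx using hidx
  -- The coordinate of the pair `(L, Y \ L)` is replaced by that of an equivalent pair in `P`, and
  -- the functional sums these coordinates over the closed sets of `Y` that contain the marks.
  let lam : (Fin P.length → ZMod 2) →+ ZMod 2 :=
    ∑ L ∈ Finset.univ.filter fun L => IsClosedIn G Y L ∧ MY ⊆ L,
      Pi.evalAddMonoidHom (fun _ => ZMod 2) (idx L)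
  have hlam : ∀ c ∈ l, lam (feature G P c) =
      if reach G (c.X ∪ Y) (c.M ∪ MY) = c.X ∪ Y then 1 else 0 := by
    intro c hc
    obtain ⟨h1, h2⟩ := hl c hc
    rw [reach_union_eq (disjoint_of_subset_compl h1 hY) h2 hMY,
      AddMonoidHom.finsetSum_apply]
    refine Finset.sum_congr rfl fun L hL => ?_
    obtain ⟨h3, h4⟩ := hidx L (Finset.mem_filter.1 hL).2.1.1
    exact if_congr (compat_congr h1 h3 h4) rfl rfl
  have hmem : c ∈ sortConfigs goal (l.filter fun c => ¬ splitList G A (big G R c.X) = []) := by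
    rw [mem_sortConfigs, List.mem_filter]
    refine ⟨hc, ?_⟩
    rw [big_eq_of_similar (hl c hc).1 hR]
    have hac := hgood.isAcyclic (Finset.union_subset_union (hl c hc).2 hMY)
    simpa using splitList_big_ne_nil hac (hl c hc).1 hY
  obtain ⟨c', hc', hkey, hle, hne⟩ := exists_mem_elim (sameKey_iff (G := G) (A := A) R)
    (pairwise_sortConfigs (goal := goal) _) (fun x => Goal.le_refl x.w) hmem lam
    (φ := feature G P) (by rw [hlam c hc, if_pos hgood.2]; exact one_ne_zero)
  have hcl : c' ∈ l := by
    have := mem_of_mem_elim hc'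
    rw [mem_sortConfigs] at this
    exact (List.mem_filter.1 this).1
  refine ⟨c', hc', ⟨?_, ?_⟩, hle⟩
  · have hsame := (sameKey_iff R c' c).2 hkey
    have h1 := adjPairs_union_congr hsame (hl _ hcl).1 (hl _ hc).1 hY hR
    have h2 := hgood.1
    obtain ⟨e1, -, -, e2, -⟩ := hsame
    have d1 : ∀ c ∈ l, Disjoint c.X Y := fun c hc => disjoint_of_subset_compl (hl c hc).1 hY
    have d2 : ∀ c ∈ l, Disjoint c.M MY := fun c hc => (d1 c hc).mono (hl c hc).2 hMY
    rw [Finset.card_union_of_disjoint (d1 _ hc), Finset.card_union_of_disjoint (d2 _ hc)] at h2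
    rw [Finset.card_union_of_disjoint (d1 _ hcl), Finset.card_union_of_disjoint (d2 _ hcl), h1]
    omega
  · rw [hlam c' hcl] at hne
    by_contra hcon
    exact hne (if_neg hcon)

end


/-! ### Correctness of the dynamic program -/

theorem foldl_preserves {α β : Type} {f : α → β → α} {P : α → Prop} {l : List β}
    (h : ∀ a, P a → ∀ b ∈ l, P (f a b)) {a : α} (ha : P a) : P (l.foldl f a) := by
  induction l generalizing a with
  | nil => exact ha
  | cons b l ih => exact ih (fun a ha b hb => h a ha b (by simp [hb])) (h a ha b (by simp))

/-- Under the invariant `P`, the property `Q` is produced by one entry `b` of the list and is not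
destroyed by the other ones. -/
theorem foldl_establishes {α β : Type} {f : α → β → α} {P Q : α → Prop} {l : List β}
    (h : ∀ a, P a → ∀ b ∈ l, P (f a b)) (h' : ∀ a, P a → Q a → ∀ b ∈ l, Q (f a b)) {b : β}
    (hb : b ∈ l) (hb' : ∀ a, P a → Q (f a b)) {a : α} (ha : P a) : Q (l.foldl f a) := by
  induction l generalizing a with
  | nil => simp at hb
  | cons x l ih =>
    rw [List.foldl_cons]
    have hx := h a ha x (by simp)
    have ht : ∀ a, P a → ∀ b ∈ l, P (f a b) := fun a ha b hb => h a ha b (by simp [hb])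
    have ht' : ∀ a, P a → Q a → ∀ b ∈ l, Q (f a b) := fun a ha hq b hb =>
      h' a ha hq b (by simp [hb])
    rcases List.mem_cons.1 hb with rfl | hb
    · exact (foldl_preserves (P := fun a => P a ∧ Q a)
        (fun a ha b hb => ⟨ht a ha.1 b hb, ht' a ha.1 ha.2 b hb⟩) ⟨hx, hb' a ha⟩).2
    · exact ih ht ht' hb hx

namespace Inst

variable {I : Inst} {A B X Y R R' : Finset (Fin I.n)}

theorem length_key_eq {R₁ R₁' : Finset (Fin I.n)} :
    (I.key A R R').length = (I.key A R₁ R₁').length := by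
  rw [length_key, length_key]

theorem key_eq_iff {R₁ R₁' : Finset (Fin I.n)} : I.key A R R' = I.key A R₁ R₁' ↔
    Similar I.G I.d A R R₁ ∧ Similar I.G I.d Aᶜ R' R₁' := by
  rw [key, key, ← keyOf_eq_iff, ← keyOf_eq_iff]
  exact ⟨fun h => List.append_inj h (by rw [length_keyOf, length_keyOf]), fun h => by rw [h.1, h.2]⟩

theorem ok_congr {X' : Finset (Fin I.n)} (h : ∀ u ∈ A, (u ∈ X ↔ u ∈ X') ∧
    min I.d (nbrCount I.G (X ∪ R) u) = min I.d (nbrCount I.G (X' ∪ R') u)) :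
    I.Ok A X R ↔ I.Ok A X' R' := by
  refine forall_congr' fun u => forall_congr' fun hu => ?_
  obtain ⟨h1, h2⟩ := h u hu
  rw [h1, ← I.mem_σ, h2, I.mem_σ, ← I.mem_ρ (nbrCount I.G (X ∪ R) u), h2, I.mem_ρ]

theorem ok_congr_right (hX : X ⊆ A) (hR : R ⊆ Aᶜ) (hR' : R' ⊆ Aᶜ) (h : Similar I.G I.d Aᶜ R R') :
    I.Ok A X R ↔ I.Ok A X R' := by
  refine ok_congr fun u hu => ⟨Iff.rfl, ?_⟩
  rw [nbrCount_union (disjoint_of_subset_compl hX hR), nbrCount_union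
    (disjoint_of_subset_compl hX hR')]
  have := h u (by simpa using hu)
  omega

/-- All entries of the table are partial solutions. -/
def Sound (I : Inst) (A : Finset (Fin I.n)) (t : Trie (List (Config I.n))) : Prop :=
  ∀ R R', R ⊆ A → R' ⊆ Aᶜ → ∀ c ∈ t.lookup (I.key A R R'), c.X ⊆ A ∧ c.M ⊆ c.X ∧
    c.w = ∑ v ∈ c.X, I.w v ∧ Similar I.G I.d A c.X R ∧ I.Ok A c.X R'

/-- The table has a completion that is at least as good as `X`. -/
def Serves (I : Inst) (A : Finset (Fin I.n)) (X Y MY : Finset (Fin I.n))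
    (t : Trie (List (Config I.n))) : Prop :=
  ∃ c ∈ t.lookup (I.key A X Y), Good I.G (c.X ∪ Y) (c.M ∪ MY) ∧
    I.goal.le (∑ v ∈ X, I.w v) c.w

/-- The entries of the table represent all partial solutions. -/
def Complete (I : Inst) (A : Finset (Fin I.n)) (t : Trie (List (Config I.n))) : Prop :=
  ∀ X M Y MY, X ⊆ A → M ⊆ X → Y ⊆ Aᶜ → MY ⊆ Y → I.Ok A X Y → Good I.G (X ∪ Y) (M ∪ MY) →
    I.Serves A X Y MY t

theorem sound_empty : I.Sound A .empty := by
  intro R R' _ _ c hc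
  rw [Trie.lookup_empty] at hc
  simp at hc

theorem Sound.insert {t : Trie (List (Config I.n))} {l : List (Config I.n)} (h : I.Sound A t)
    (hl : ∀ c ∈ l, c.X ⊆ A ∧ c.M ⊆ c.X ∧ c.w = ∑ v ∈ c.X, I.w v ∧ Similar I.G I.d A c.X R ∧
      I.Ok A c.X R') (hR' : R' ⊆ Aᶜ) : I.Sound A (t.insert (I.key A R R') l) := by
  intro S S' hS hS' c hc
  rw [Trie.lookup_insert _ _ _ length_key_eq] at hc
  split_ifs at hc with hk
  · obtain ⟨h1, h2, h3, h4, h5⟩ := hl c hc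
    obtain ⟨h6, h7⟩ := key_eq_iff.1 hk
    exact ⟨h1, h2, h3, h4.trans h6, (ok_congr_right h1 hR' hS' h7).1 h5⟩
  · exact h S S' hS hS' c hc

theorem mem_leafEntry {v : Fin I.n} {c : Config I.n} :
    c ∈ I.leafEntry v R R' ↔ c ∈ I.leafConfigs v ∧ Similar I.G I.d {v} c.X R ∧
      I.Ok {v} c.X R' := by
  simp [leafEntry]

theorem mem_leafConfigs {v : Fin I.n} {c : Config I.n} (h : c ∈ I.leafConfigs v) :
    c.X ⊆ {v} ∧ c.M ⊆ c.X ∧ c.w = ∑ v ∈ c.X, I.w v := by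
  simp only [leafConfigs, List.mem_cons, List.not_mem_nil, or_false] at h
  rcases h with rfl | rfl | rfl <;> simp

theorem Sound.leafStep {v : Fin I.n} {t : Trie (List (Config I.n))} (h : I.Sound {v} t)
    (hR' : R' ⊆ {v}ᶜ) : I.Sound {v} (I.leafStep v t R') := by
  have key : ∀ R, ∀ c ∈ I.leafEntry v R R', c.X ⊆ {v} ∧ c.M ⊆ c.X ∧ c.w = ∑ v ∈ c.X, I.w v ∧
      Similar I.G I.d {v} c.X R ∧ I.Ok {v} c.X R' := by
    intro R c hc
    obtain ⟨h1, h2, h3⟩ := mem_leafEntry.1 hc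
    obtain ⟨h4, h5, h6⟩ := mem_leafConfigs h1
    exact ⟨h4, h5, h6, h2, h3⟩
  exact (h.insert (key _) hR').insert (key _) hR'

theorem sound_leafItem (v : Fin I.n) : I.Sound {v} (I.leafItem v).t :=
  foldl_preserves (fun _ ht _ hR' => ht.leafStep ((isReps_reps ..).subset _ hR')) sound_empty

/-- There is no reduction at a leaf, so the partial solution itself is found in its entry. The
representative equivalent to `Y` puts it there, and other representatives write to other addresses.
-/
theorem complete_leafItem (v : Fin I.n) : I.Complete {v} (I.leafItem v).t := by
  intro X M Y MY hX hM hY hMY hok hgood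
  obtain ⟨R', hR', hsim⟩ := exists_similar_reps (G := I.G) (d := I.d) hY
  have hR'A := (isReps_reps (G := I.G) (d := I.d) (A := {v}ᶜ)).subset _ hR'
  have hcfg : ∃ c ∈ I.leafConfigs v, c.X = X ∧ c.M = M := by
    simp only [leafConfigs, List.mem_cons, List.not_mem_nil, or_false, exists_eq_or_imp,
      exists_eq_left]
    rcases Finset.subset_singleton_iff.1 hX with rfl | rfl
    · rw [Finset.subset_empty] at hM
      simp [hM]
    · rcases Finset.subset_singleton_iff.1 hM with rfl | rfl <;> simp
  obtain ⟨c, hc, rfl, rfl⟩ := hcfg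
  have hcX := mem_leafConfigs hc
  -- the entries for `∅` and for `{v}` contain all configurations that are similar
  have hstep : ∀ t : Trie (List (Config I.n)), ∀ S' ∈ reps I.G I.d {v}ᶜ,
      Similar I.G I.d {v}ᶜ S' Y → c ∈ (I.leafStep v t S').lookup (I.key {v} c.X Y) := by
    intro t S' hS' hS'Y
    have hS'A := (isReps_reps (G := I.G) (d := I.d) (A := {v}ᶜ)).subset _ hS'
    have hmem : ∀ R, I.key {v} R S' = I.key {v} c.X Y → c ∈ I.leafEntry v R S' := by
      intro R hk
      refine mem_leafEntry.2 ⟨hc, (key_eq_iff.1 hk).1.symm, ?_⟩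
      exact (ok_congr_right hcX.1 hY hS'A hS'Y.symm).1 hok
    rw [Inst.leafStep, Trie.lookup_insert _ _ _ length_key_eq]
    split_ifs with h1
    · exact hmem _ h1
    · rw [Trie.lookup_insert _ _ _ length_key_eq]
      split_ifs with h2
      · exact hmem _ h2
      · rcases Finset.subset_singleton_iff.1 hcX.1 with h | h
        · exact absurd (key_eq_iff.2 ⟨h ▸ .refl _, hS'Y⟩) h2
        · exact absurd (key_eq_iff.2 ⟨h ▸ .refl _, hS'Y⟩) h1
  refine ⟨c, ?_, hgood, hcX.2.2 ▸ Goal.le_refl _⟩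
  refine foldl_establishes (P := fun _ => True)
    (Q := fun t => c ∈ t.lookup (I.key {v} c.X Y)) (fun _ _ _ _ => trivial)
    (fun t _ ht S' hS' => ?_) hR' (fun t _ => hstep t R' hR' hsim) trivial
  by_cases hs : Similar I.G I.d {v}ᶜ S' Y
  · exact hstep t S' hS' hs
  · have hne : ∀ R, I.key {v} R S' ≠ I.key {v} c.X Y := fun R hk => hs (key_eq_iff.1 hk).2
    rw [Inst.leafStep, Trie.lookup_insert _ _ _ length_key_eq, if_neg (hne _),
      Trie.lookup_insert _ _ _ length_key_eq, if_neg (hne _)]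
    exact ht

/-! ### Correctness of the table of an internal node. -/

section Join

variable {x y : Item I.n}

theorem mem_joinEntry {S : Finset (Fin I.n)} {c : Config I.n} :
    c ∈ I.joinEntry x y R S R' ↔ ∃ c₁ ∈ x.t.lookup (I.key x.A R (S ∪ R')),
      ∃ c₂ ∈ y.t.lookup (I.key y.A S (R ∪ R')), c₁.union c₂ = c := by
  simp [joinEntry]

theorem mem_of_mem_reduce {G : SimpleGraph (Fin I.n)} {goal : Goal}
    {P : List (Finset (Fin I.n) × Finset (Fin I.n))} {l : List (Config I.n)} {c : Config I.n}
    (h : c ∈ reduce G goal A R P l) : c ∈ l := by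
  have := mem_of_mem_elim h
  rw [mem_sortConfigs] at this
  exact (List.mem_filter.1 this).1

/-- A vertex on the left sees the right partial solution only through its class, so up to truncation
at `d` its neighbors there may be counted in `S` instead, and symmetrically. -/
theorem joinEntry_sound (hx : I.Sound x.A x.t) (hy : I.Sound y.A y.t) (hd : Disjoint x.A y.A)
    {S : Finset (Fin I.n)} (hR : R ⊆ x.A) (hS : S ⊆ y.A) (hR' : R' ⊆ (x.A ∪ y.A)ᶜ)
    {c : Config I.n} (hc : c ∈ I.joinEntry x y R S R') :
    c.X ⊆ x.A ∪ y.A ∧ c.M ⊆ c.X ∧ c.w = ∑ v ∈ c.X, I.w v ∧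
      Similar I.G I.d (x.A ∪ y.A) c.X (R ∪ S) ∧ I.Ok (x.A ∪ y.A) c.X R' := by
  obtain ⟨c₁, h₁, c₂, h₂, rfl⟩ := mem_joinEntry.1 hc
  have hxc : y.A ⊆ x.Aᶜ := fun v hv => Finset.mem_compl.2 fun h => Finset.disjoint_left.1 hd h hv
  have hyc : x.A ⊆ y.Aᶜ := fun v hv => Finset.mem_compl.2 fun h => Finset.disjoint_left.1 hd hv h
  have hR'x : R' ⊆ x.Aᶜ := hR'.trans (Finset.compl_subset_compl.2 Finset.subset_union_left)
  have hR'y : R' ⊆ y.Aᶜ := hR'.trans (Finset.compl_subset_compl.2 Finset.subset_union_right)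
  obtain ⟨a1, a2, a3, a4, a5⟩ := hx _ _ hR (Finset.union_subset (hS.trans hxc) hR'x) _ h₁
  obtain ⟨b1, b2, b3, b4, b5⟩ := hy _ _ hS (Finset.union_subset (hR.trans hyc) hR'y) _ h₂
  have hcd : Disjoint c₁.X c₂.X := hd.mono a1 b1
  have hRS : Disjoint R S := hd.mono hR hS
  have d1 : Disjoint c₁.X R' := disjoint_of_subset_compl a1 hR'x
  have d2 : Disjoint c₂.X R' := disjoint_of_subset_compl b1 hR'y
  have d3 : Disjoint R R' := disjoint_of_subset_compl hR hR'x
  have d4 : Disjoint S R' := disjoint_of_subset_compl hS hR'y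
  have d5 : Disjoint c₁.X S := hd.mono a1 hS
  have d6 : Disjoint c₂.X R := hd.symm.mono b1 hR
  refine ⟨Finset.union_subset_union a1 b1, Finset.union_subset_union a2 b2, ?_, ?_, ?_⟩
  · change c₁.w + c₂.w = _
    rw [a3, b3]
    exact (Finset.sum_union hcd).symm
  · exact (a4.anti Finset.subset_union_left).union (b4.anti Finset.subset_union_right) hcd hRS
  · intro u hu
    rcases Finset.mem_union.1 hu with hu | hu
    · have hu2 : u ∉ y.A := Finset.disjoint_left.1 hd hu
      -- The condition is transferred at the single vertex `u`, as the truncated counts agree only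
      -- for vertices on this side.
      refine (ok_congr (A := {u}) (X := c₁.X) (R := S ∪ R') (X' := c₁.X ∪ c₂.X) (R' := R')
        fun v hv => ?_).1 (fun v hv => a5 v (by rw [Finset.mem_singleton.1 hv]; exact hu)) u
          (Finset.mem_singleton_self u)
      rw [Finset.mem_singleton] at hv
      subst hv
      have := b4 v hu2
      rw [nbrCount_union (Finset.disjoint_union_right.2 ⟨d5, d1⟩), nbrCount_union d4,
        nbrCount_union (Finset.disjoint_union_left.2 ⟨d1, d2⟩), nbrCount_union hcd]
      refine ⟨?_, by omega⟩
      have : v ∉ c₂.X := fun h => hu2 (b1 h)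
      simp [this]
    · have hu2 : u ∉ x.A := Finset.disjoint_right.1 hd hu
      refine (ok_congr (A := {u}) (X := c₂.X) (R := R ∪ R') (X' := c₁.X ∪ c₂.X) (R' := R')
        fun v hv => ?_).1 (fun v hv => b5 v (by rw [Finset.mem_singleton.1 hv]; exact hu)) u
          (Finset.mem_singleton_self u)
      rw [Finset.mem_singleton] at hv
      subst hv
      have := a4 v hu2
      rw [nbrCount_union (Finset.disjoint_union_right.2 ⟨d6, d2⟩), nbrCount_union d3,
        nbrCount_union (Finset.disjoint_union_left.2 ⟨d1, d2⟩), nbrCount_union hcd]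
      refine ⟨?_, by omega⟩
      have : v ∉ c₁.X := fun h => hu2 (a1 h)
      simp [this]

theorem sound_joinStep (hx : I.Sound x.A x.t) (hy : I.Sound y.A y.t) (hd : Disjoint x.A y.A)
    {P : List (Finset (Fin I.n) × Finset (Fin I.n))}
    {S : Finset (Fin I.n)} (hR : R ⊆ x.A) (hS : S ⊆ y.A) (hR' : R' ⊆ (x.A ∪ y.A)ᶜ)
    {t : Trie (List (Config I.n))} (ht : I.Sound (x.A ∪ y.A) t) :
    I.Sound (x.A ∪ y.A) (I.joinStep x y P R S t R') := by
  refine ht.insert (fun c hc => ?_) hR'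
  rcases List.mem_append.1 (mem_of_mem_reduce hc) with hc | hc
  · exact ht _ _ (Finset.union_subset_union hR hS) hR' c hc
  · exact joinEntry_sound hx hy hd hR hS hR' hc

theorem exists_cuts (A : Finset (Fin I.n)) (L L' : Finset (Fin I.n)) (hL : L ⊆ Aᶜ) (hL' : L' ⊆ Aᶜ) :
    ∃ p ∈ I.cuts A, Similar I.G 1 Aᶜ p.1 L ∧ Similar I.G 1 Aᶜ p.2 L' := by
  obtain ⟨R, hR, h⟩ := exists_similar_reps (G := I.G) (d := 1) hL
  obtain ⟨R', hR', h'⟩ := exists_similar_reps (G := I.G) (d := 1) hL'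
  exact ⟨(R, R'), by simp [cuts, hR, hR'], h, h'⟩

/-- The reduction of an entry keeps a good completion of each completable partial solution. -/
theorem serves_joinStep (hx : I.Sound x.A x.t) (hy : I.Sound y.A y.t) (hd : Disjoint x.A y.A)
    {S MY : Finset (Fin I.n)} (hR : R ⊆ x.A) (hS : S ⊆ y.A) (hR' : R' ⊆ (x.A ∪ y.A)ᶜ)
    {t : Trie (List (Config I.n))} (ht : I.Sound (x.A ∪ y.A) t) (hY : Y ⊆ (x.A ∪ y.A)ᶜ)
    (hMY : MY ⊆ Y) (h : I.Serves (x.A ∪ y.A) X Y MY t ∨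
      I.key (x.A ∪ y.A) (R ∪ S) R' = I.key (x.A ∪ y.A) X Y ∧
        ∃ c ∈ I.joinEntry x y R S R', Good I.G (c.X ∪ Y) (c.M ∪ MY) ∧
          I.goal.le (∑ v ∈ X, I.w v) c.w) :
    I.Serves (x.A ∪ y.A) X Y MY (I.joinStep x y (I.cuts (x.A ∪ y.A)) R S t R') := by
  unfold Serves
  rw [Inst.joinStep, Trie.lookup_insert _ _ _ length_key_eq]
  split_ifs with hk
  · obtain ⟨c, hc, hg, hle⟩ : ∃ c ∈ t.lookup (I.key (x.A ∪ y.A) (R ∪ S) R') ++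
        I.joinEntry x y R S R', Good I.G (c.X ∪ Y) (c.M ∪ MY) ∧
          I.goal.le (∑ v ∈ X, I.w v) c.w := by
      rcases h with ⟨c, hc, h⟩ | ⟨-, c, hc, h⟩
      · exact ⟨c, List.mem_append_left _ (hk ▸ hc), h⟩
      · exact ⟨c, List.mem_append_right _ hc, h⟩
    have hl : ∀ c ∈ t.lookup (I.key (x.A ∪ y.A) (R ∪ S) R') ++ I.joinEntry x y R S R',
        c.X ⊆ x.A ∪ y.A ∧ c.M ⊆ c.X := by
      intro c hc
      rcases List.mem_append.1 hc with hc | hc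
      · obtain ⟨h1, h2, -⟩ := ht _ _ (Finset.union_subset_union hR hS) hR' c hc
        exact ⟨h1, h2⟩
      · obtain ⟨h1, h2, -⟩ := joinEntry_sound hx hy hd hR hS hR' hc
        exact ⟨h1, h2⟩
    obtain ⟨c', hc', hg', hle'⟩ := exists_mem_reduce I.goal hl hY hMY
      ((key_eq_iff.1 hk).2.mono I.two_le) (exists_cuts _) hc hg
    exact ⟨c', hc', hg', Goal.le_trans hle hle'⟩
  · exact h.resolve_right fun h => hk h.1

theorem sound_joinItem (hx : I.Sound x.A x.t) (hy : I.Sound y.A y.t) (hd : Disjoint x.A y.A) :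
    I.Sound (x.A ∪ y.A) (I.joinItem x y).t :=
  foldl_preserves (fun _ ht _ hR => foldl_preserves (fun _ ht _ hS => foldl_preserves
    (fun _ ht _ hR' => sound_joinStep hx hy hd ((isReps_reps ..).subset _ hR)
      ((isReps_reps ..).subset _ hS) ((isReps_reps ..).subset _ hR') ht) ht) ht) sound_empty

/-- The two parts of the solution are exchanged one after the other: `X₁` by an entry `c₁` of the
left table for the completion `X₂ ∪ Y`, and then `X₂` by an entry of the right table for the
completion `c₁.X ∪ Y`. The second completion contains the part already exchanged, so the final union
is good. -/
theorem exists_mem_joinEntry (hx : I.Sound x.A x.t) (hx' : I.Complete x.A x.t)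
    (hy' : I.Complete y.A y.t) (hd : Disjoint x.A y.A) {X₁ X₂ M₁ M₂ S MY : Finset (Fin I.n)}
    (hR : Similar I.G I.d x.A R X₁) (hS : Similar I.G I.d y.A S X₂)
    (hR' : Similar I.G I.d (x.A ∪ y.A)ᶜ R' Y) (hRx : R ⊆ x.A) (hSy : S ⊆ y.A)
    (hR'c : R' ⊆ (x.A ∪ y.A)ᶜ) (hX₁ : X₁ ⊆ x.A) (hX₂ : X₂ ⊆ y.A) (hM₁ : M₁ ⊆ X₁) (hM₂ : M₂ ⊆ X₂)
    (hY : Y ⊆ (x.A ∪ y.A)ᶜ) (hMY : MY ⊆ Y) (hok : I.Ok (x.A ∪ y.A) (X₁ ∪ X₂) Y)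
    (hgood : Good I.G ((X₁ ∪ X₂) ∪ Y) ((M₁ ∪ M₂) ∪ MY)) :
    ∃ c ∈ I.joinEntry x y R S R', Good I.G (c.X ∪ Y) (c.M ∪ MY) ∧
      I.goal.le (∑ v ∈ X₁ ∪ X₂, I.w v) c.w := by
  have hxc : y.A ⊆ x.Aᶜ := fun v hv => Finset.mem_compl.2 fun h => Finset.disjoint_left.1 hd h hv
  have hyc : x.A ⊆ y.Aᶜ := fun v hv => Finset.mem_compl.2 fun h => Finset.disjoint_left.1 hd hv h
  have hcx : (x.A ∪ y.A)ᶜ ⊆ x.Aᶜ := Finset.compl_subset_compl.2 Finset.subset_union_left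
  have hcy : (x.A ∪ y.A)ᶜ ⊆ y.Aᶜ := Finset.compl_subset_compl.2 Finset.subset_union_right
  have hyY : Disjoint X₂ Y := disjoint_of_subset_compl hX₂ (hY.trans hcy)
  have hxY : Disjoint X₁ Y := disjoint_of_subset_compl hX₁ (hY.trans hcx)
  have hSR' : Disjoint S R' := disjoint_of_subset_compl hSy (hR'c.trans hcy)
  have hRR' : Disjoint R R' := disjoint_of_subset_compl hRx (hR'c.trans hcx)
  have hok₁ : I.Ok x.A X₁ (X₂ ∪ Y) := by
    intro u hu
    have h := hok u (Finset.mem_union_left _ hu)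
    have hu2 : u ∉ X₂ := fun h => Finset.disjoint_left.1 hd hu (hX₂ h)
    rw [Finset.mem_union, or_iff_left hu2, Finset.union_assoc] at h
    exact h
  obtain ⟨c₁, hc₁, hg₁, hle₁⟩ := hx' X₁ M₁ (X₂ ∪ Y) (M₂ ∪ MY) hX₁ hM₁
    (Finset.union_subset (hX₂.trans hxc) (hY.trans hcx)) (Finset.union_subset_union hM₂ hMY) hok₁
    (by rwa [← Finset.union_assoc, ← Finset.union_assoc])
  obtain ⟨a1, a2, a3, a4, -⟩ := hx _ _ hX₁
    (Finset.union_subset (hX₂.trans hxc) (hY.trans hcx)) _ hc₁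
  have hcY : Disjoint c₁.X Y := disjoint_of_subset_compl a1 (hY.trans hcx)
  have e1 : c₁.X ∪ (X₂ ∪ Y) = X₂ ∪ (c₁.X ∪ Y) := Finset.union_left_comm _ _ _
  have e2 : c₁.M ∪ (M₂ ∪ MY) = M₂ ∪ (c₁.M ∪ MY) := Finset.union_left_comm _ _ _
  rw [e1, e2] at hg₁
  -- The set `c₁.X` is equivalent to `X₁`, so the degrees of the vertices on the right are unchanged
  -- up to truncation.
  have hok₂ : I.Ok y.A X₂ (c₁.X ∪ Y) := by
    intro u hu
    refine (ok_congr (A := {u}) (X := X₁ ∪ X₂) (R := Y) (X' := X₂) (R' := c₁.X ∪ Y)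
        fun v hv => ?_).1 (fun v hv => hok v (by
          rw [Finset.mem_singleton.1 hv]; exact Finset.mem_union_right _ hu)) u
          (Finset.mem_singleton_self u)
    rw [Finset.mem_singleton] at hv
    subst hv
    have hv2 : v ∉ x.A := Finset.disjoint_right.1 hd hu
    have := a4 v hv2
    rw [nbrCount_union (Finset.disjoint_union_left.2 ⟨hxY, hyY⟩), nbrCount_union (hd.mono hX₁ hX₂),
      nbrCount_union (Finset.disjoint_union_right.2 ⟨hd.symm.mono hX₂ a1, hyY⟩),
      nbrCount_union hcY]
    refine ⟨?_, by omega⟩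
    have : v ∉ X₁ := fun h => hv2 (hX₁ h)
    simp [this]
  obtain ⟨c₂, hc₂, hg₂, hle₂⟩ := hy' X₂ M₂ (c₁.X ∪ Y) (c₁.M ∪ MY) hX₂ hM₂
    (Finset.union_subset (a1.trans hyc) (hY.trans hcy)) (Finset.union_subset_union a2 hMY) hok₂ hg₁
  have k1 : I.key x.A R (S ∪ R') = I.key x.A X₁ (X₂ ∪ Y) :=
    key_eq_iff.2 ⟨hR, (hS.anti hxc).union (hR'.anti hcx) hSR' hyY⟩
  have k2 : I.key y.A S (R ∪ R') = I.key y.A X₂ (c₁.X ∪ Y) :=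
    key_eq_iff.2 ⟨hS, ((hR.trans a4.symm).anti hyc).union (hR'.anti hcy) hRR' hcY⟩
  refine ⟨c₁.union c₂, mem_joinEntry.2 ⟨c₁, k1 ▸ hc₁, c₂, k2 ▸ hc₂, rfl⟩, ?_, ?_⟩
  · change Good I.G ((c₁.X ∪ c₂.X) ∪ Y) ((c₁.M ∪ c₂.M) ∪ MY)
    rwa [Finset.union_comm c₁.X, Finset.union_comm c₁.M, Finset.union_assoc, Finset.union_assoc]
  · change I.goal.le _ (c₁.w + c₂.w)
    rw [Finset.sum_union (hd.mono hX₁ hX₂)]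
    revert hle₁ hle₂
    cases I.goal
    · exact fun h1 h2 => add_le_add h1 h2
    · exact fun h1 h2 => add_le_add h1 h2

/-- The representatives of the two parts of `X` and of `Y` determine one iteration of the three
loops in which a good completion is put into the entry. Before it the table is sound, and every
later step retains a good completion after its reduction. -/
theorem complete_joinItem (hx : I.Sound x.A x.t) (hy : I.Sound y.A y.t) (hd : Disjoint x.A y.A)
    (hx' : I.Complete x.A x.t) (hy' : I.Complete y.A y.t) :
    I.Complete (x.A ∪ y.A) (I.joinItem x y).t := by
  intro X M Y MY hX hM hY hMY hok hgood
  have split : ∀ Z : Finset (Fin I.n), Z ⊆ x.A ∪ y.A → Z = (Z ∩ x.A) ∪ (Z ∩ y.A) := fun Z hZ => by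
    rw [← Finset.inter_union_distrib_left, Finset.inter_eq_left.2 hZ]
  have eX := split X hX
  have eM := split M (hM.trans hX)
  obtain ⟨R, hR, hRs⟩ := exists_similar_reps (G := I.G) (d := I.d)
    (Finset.inter_subset_right : X ∩ x.A ⊆ x.A)
  obtain ⟨S, hS, hSs⟩ := exists_similar_reps (G := I.G) (d := I.d)
    (Finset.inter_subset_right : X ∩ y.A ⊆ y.A)
  obtain ⟨R', hR', hRs'⟩ := exists_similar_reps (G := I.G) (d := I.d) hY
  have hsub : ∀ (A : Finset (Fin I.n)), ∀ Z ∈ reps I.G I.d A, Z ⊆ A := fun A Z hZ =>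
    (isReps_reps ..).subset _ hZ
  have hentry := exists_mem_joinEntry (M₁ := M ∩ x.A) (M₂ := M ∩ y.A) hx hx' hy' hd hRs hSs hRs'
    (hsub _ _ hR) (hsub _ _ hS) (hsub _ _ hR') Finset.inter_subset_right Finset.inter_subset_right
    (Finset.inter_subset_inter_right hM) (Finset.inter_subset_inter_right hM) hY hMY
    (by rwa [← eX]) (by rwa [← eX, ← eM])
  rw [← eX] at hentry
  have hk : I.key (x.A ∪ y.A) (R ∪ S) R' = I.key (x.A ∪ y.A) X Y := by
    rw [key_eq_iff]
    have h := (hRs.anti (Finset.subset_union_left : x.A ⊆ x.A ∪ y.A)).union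
      (hSs.anti (Finset.subset_union_right : y.A ⊆ x.A ∪ y.A))
      (hd.mono (hsub _ _ hR) (hsub _ _ hS))
      (hd.mono Finset.inter_subset_right Finset.inter_subset_right)
    rw [← eX] at h
    exact ⟨h, hRs'⟩
  have hstep : ∀ {R S R' : Finset (Fin I.n)}, R ∈ reps I.G I.d x.A → S ∈ reps I.G I.d y.A →
      R' ∈ reps I.G I.d (x.A ∪ y.A)ᶜ → ∀ t, I.Sound (x.A ∪ y.A) t →
      I.Sound (x.A ∪ y.A) (I.joinStep x y (I.cuts (x.A ∪ y.A)) R S t R') :=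
    fun hR hS hR' t ht => sound_joinStep hx hy hd (hsub _ _ hR) (hsub _ _ hS) (hsub _ _ hR') ht
  have hkeep : ∀ {R S R' : Finset (Fin I.n)}, R ∈ reps I.G I.d x.A → S ∈ reps I.G I.d y.A →
      R' ∈ reps I.G I.d (x.A ∪ y.A)ᶜ → ∀ t, I.Sound (x.A ∪ y.A) t →
      I.Serves (x.A ∪ y.A) X Y MY t →
      I.Serves (x.A ∪ y.A) X Y MY (I.joinStep x y (I.cuts (x.A ∪ y.A)) R S t R') :=
    fun hR hS hR' t ht h => serves_joinStep hx hy hd (hsub _ _ hR) (hsub _ _ hS) (hsub _ _ hR') ht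
      hY hMY (.inl h)
  refine foldl_establishes (P := I.Sound (x.A ∪ y.A)) (Q := I.Serves (x.A ∪ y.A) X Y MY)
    (fun t ht R hR => foldl_preserves (fun t ht S hS => foldl_preserves
      (fun t ht R' hR' => hstep hR hS hR' t ht) ht) ht)
    (fun t ht hq R hR => (foldl_preserves (P := fun t => I.Sound _ t ∧ I.Serves _ X Y MY t)
      (fun t ht S hS => foldl_preserves (P := fun t => I.Sound _ t ∧ I.Serves _ X Y MY t)
      (fun t ht R' hR' => ⟨hstep hR hS hR' t ht.1, hkeep hR hS hR' t ht.1 ht.2⟩) ht) ⟨ht, hq⟩).2)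
    hR (fun t ht => ?_) sound_empty
  refine foldl_establishes (P := I.Sound (x.A ∪ y.A)) (Q := I.Serves (x.A ∪ y.A) X Y MY)
    (fun t ht S hS => foldl_preserves (fun t ht R' hR' => hstep hR hS hR' t ht) ht)
    (fun t ht hq S hS => (foldl_preserves (P := fun t => I.Sound _ t ∧ I.Serves _ X Y MY t)
      (fun t ht R' hR' => ⟨hstep hR hS hR' t ht.1, hkeep hR hS hR' t ht.1 ht.2⟩) ⟨ht, hq⟩).2)
    hS (fun t ht => ?_) ht
  refine foldl_establishes (P := I.Sound (x.A ∪ y.A)) (Q := I.Serves (x.A ∪ y.A) X Y MY)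
    (fun t ht R' hR' => hstep hR hS hR' t ht) (fun t ht hq R' hR' => hkeep hR hS hR' t ht hq)
    hR' (fun t ht => ?_) ht
  exact serves_joinStep hx hy hd (hsub _ _ hR) (hsub _ _ hS) (hsub _ _ hR') ht hY hMY
    (.inr ⟨hk, hentry⟩)

end Join

theorem table_spec (T : LayoutTree (Fin I.n)) (hT : T.leaves.Nodup) :
    I.Sound (I.table T).A (I.table T).t ∧ I.Complete (I.table T).A (I.table T).t := by
  induction T with
  | leaf v => exact ⟨sound_leafItem v, complete_leafItem v⟩
  | node l r ihl ihr =>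
    rw [LayoutTree.leaves, List.nodup_append] at hT
    have hd : Disjoint (I.table l).A (I.table r).A := by
      rw [table_A, table_A, Finset.disjoint_left]
      intro v hv hv'
      exact hT.2.2 v (List.mem_toFinset.1 hv) v (List.mem_toFinset.1 hv') rfl
    obtain ⟨h1, h2⟩ := ihl hT.1
    obtain ⟨h3, h4⟩ := ihr hT.2.1
    exact ⟨sound_joinItem h1 h3 hd, complete_joinItem h1 h3 hd h2 h4⟩

theorem ok_univ_iff : I.Ok Finset.univ X ∅ ↔
    ∀ u, (u ∈ X → nbrCount I.G X u ∈ I.σ) ∧ (u ∉ X → nbrCount I.G X u ∈ I.ρ) := by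
  simp [Ok]

theorem mem_solve {c : Config I.n} : c ∈ I.solve ↔
    c ∈ (I.table I.T).t.lookup (I.key Finset.univ ∅ ∅) ∧ Good I.G c.X c.M := by
  classical
  rw [solve, mem_sortConfigs, List.mem_filter, decide_eq_true_eq]

theorem table_A_univ : (I.table I.T).A = Finset.univ := by
  rw [table_A, Finset.eq_univ_iff_forall]
  exact fun v => List.mem_toFinset.2 (I.isLayout.2 v)

theorem isAcyclicDominating_of_mem_solve {c : Config I.n} (hc : c ∈ I.solve) :
    IsAcyclicDominating I.G I.σ I.ρ c.X ∧ c.w = ∑ v ∈ c.X, I.w v := by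
  obtain ⟨h1, h2⟩ := mem_solve.1 hc
  have hs := (table_spec I.T I.isLayout.1).1
  rw [table_A_univ] at hs
  obtain ⟨-, h3, h4, -, h5⟩ := hs ∅ ∅ (by simp) (by simp) c h1
  exact ⟨⟨ok_univ_iff.1 h5, h2.isAcyclic h3⟩, h4⟩

theorem exists_mem_solve {D : Finset (Fin I.n)} (hD : IsAcyclicDominating I.G I.σ I.ρ D) :
    ∃ c ∈ I.solve, I.goal.le (∑ v ∈ D, I.w v) c.w := by
  obtain ⟨M, hM, hgood⟩ := exists_good hD.2
  have hs := (table_spec I.T I.isLayout.1).2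
  rw [table_A_univ] at hs
  obtain ⟨c, h1, h2, h3⟩ := hs D M ∅ ∅ (Finset.subset_univ _) hM (by simp) (by simp)
    (ok_univ_iff.2 hD.1) (by simpa using hgood)
  -- No vertex lies outside of the whole set, so all sets are equivalent at the root and a single
  -- entry remains.
  have hk : I.key Finset.univ D ∅ = I.key Finset.univ ∅ ∅ :=
    key_eq_iff.2 ⟨fun u hu => absurd (Finset.mem_univ u) hu, .refl _⟩
  exact ⟨c, mem_solve.2 ⟨hk ▸ h1, by simpa using h2⟩, h3⟩

theorem solve_eq_nil_iff : I.solve = [] ↔ ¬ ∃ D, IsAcyclicDominating I.G I.σ I.ρ D := by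
  constructor
  · rintro h ⟨D, hD⟩
    obtain ⟨c, hc, -⟩ := exists_mem_solve hD
    rw [h] at hc
    simp at hc
  · intro h
    rw [List.eq_nil_iff_forall_not_mem]
    exact fun c hc => h ⟨c.X, (isAcyclicDominating_of_mem_solve hc).1⟩

/-- Every solution is dominated by some element of the list, and the list is sorted with the best
element first. -/
theorem isOptimal_of_solve_eq_cons {c : Config I.n} {l : List (Config I.n)}
    (h : I.solve = c :: l) : IsOptimal I.goal I.G I.σ I.ρ I.w c.X := by
  obtain ⟨h1, h2⟩ := isAcyclicDominating_of_mem_solve (c := c) (by rw [h]; simp)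
  refine ⟨h1, fun D hD => ?_⟩
  obtain ⟨c', hc', hle⟩ := exists_mem_solve hD
  have hp : (c :: l).Pairwise fun a b => I.goal.le b.w a.w := by
    rw [← h, solve]
    exact pairwise_sortConfigs _
  have hle' : I.goal.le c'.w c.w := by
    rw [h, List.mem_cons] at hc'
    rcases hc' with rfl | hc'
    · exact Goal.le_refl _
    · exact (List.pairwise_cons.1 hp).1 _ hc'
  have := Goal.le_trans hle hle'
  rw [h2] at this
  revert this
  cases I.goal <;> exact id

end Inst


/-! ### Bounds for the numbers of neighbor classes -/

section

variable {n : ℕ} {G : SimpleGraph (Fin n)} {A S X Y : Finset (Fin n)}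

theorem nbrCount_mono (h : X ⊆ Y) (u : Fin n) : nbrCount G X u ≤ nbrCount G Y u := by
  rw [← Finset.union_sdiff_of_subset h, nbrCount_union Finset.disjoint_sdiff]
  exact Nat.le_add_right _ _

/-- A subset of `X` of least size in its class is irredundant: removing an element changes the
class, so some outside vertex loses its only neighbor. -/
theorem exists_irredundant_similar (hX : X ⊆ A) :
    ∃ C, Irredundant G A C ∧ Similar G 1 A C X := by
  classical
  obtain ⟨C, hC, hmin⟩ := Finset.exists_min_image
    (X.powerset.filter fun C => Similar G 1 A C X) Finset.card
    ⟨X, Finset.mem_filter.2 ⟨Finset.mem_powerset_self X, .refl X⟩⟩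
  rw [Finset.mem_filter, Finset.mem_powerset] at hC
  refine ⟨C, ⟨hC.1.trans hX, fun x hx => ?_⟩, hC.2⟩
  have hne : ¬ Similar G 1 A (C.erase x) X := fun h => by
    have := hmin (C.erase x) (Finset.mem_filter.2
      ⟨Finset.mem_powerset.2 ((Finset.erase_subset _ _).trans hC.1), h⟩)
    have := Finset.card_erase_lt_of_mem hx
    omega
  unfold Similar at hne
  push Not at hne
  obtain ⟨u, hu, hne⟩ := hne
  have h1 := hC.2 u hu
  have h2 := nbrCount_mono (G := G) (Finset.erase_subset x C) u
  have h3 : nbrCount G (C.erase x) u = 0 := by omega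
  have h4 : 0 < nbrCount G C u := by omega
  have h5 : ∀ y ∈ C, G.Adj u y → y = x := by
    intro y hy huy
    by_contra hyx
    have : 0 < nbrCount G (C.erase x) u :=
      nbrCount_pos_iff.2 ⟨y, Finset.mem_erase.2 ⟨hyx, hy⟩, huy⟩
    omega
  obtain ⟨z, hz, huz⟩ := nbrCount_pos_iff.1 h4
  refine ⟨u, hu, fun y hy => ⟨h5 y hy, ?_⟩⟩
  rintro rfl
  rwa [h5 z hz huz] at huz

-- Each class contains an irredundant set, and the class is determined by the support of the vector
-- of neighbor counts of that set.
open Classical in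
theorem nec_one_le_card_irrSums : nec G 1 A ≤ (irrSums G A).card := by
  let F : Finset (Fin n) → Finset (Fin n) := fun X =>
    Finset.univ.filter fun u => 0 < outCount G A X u
  have hF : ∀ X Y, F X = F Y ↔ Similar G 1 A X Y := by
    intro X Y
    simp only [F, Finset.ext_iff, Finset.mem_filter, Finset.mem_univ, true_and]
    refine forall_congr' fun u => ?_
    by_cases hu : u ∈ A
    · simp [outCount, hu]
    · simp only [outCount, hu, if_false, not_false_eq_true, true_implies]
      omega
  have hle : nec G 1 A ≤ ((irrSums G A).image fun f => Finset.univ.filter fun u => 0 < f u).card := by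
    rw [nec, ← Nat.card_eq_finsetCard]
    refine Nat.card_le_card_of_injective (Quotient.lift (fun X => ⟨F X.1, ?_⟩) ?_) ?_
    · obtain ⟨C, hC, hCX⟩ := exists_irredundant_similar (G := G) X.2
      rw [← (hF C X.1).2 hCX]
      exact Finset.mem_image_of_mem _ (Finset.mem_image_of_mem _ (by simpa using hC))
    · intro X Y h
      exact Subtype.ext ((hF X.1 Y.1).2 h)
    · intro a b
      induction a, b using Quotient.inductionOn₂ with
      | _ X Y => exact fun h => Quotient.sound ((hF X.1 Y.1).1 (congrArg Subtype.val h))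
  exact hle.trans Finset.card_image_le

-- A set `Y` outside of `A` is sent to the set `F Y` of the vertices of `A` without a neighbor in
-- `Y`. The class of `F Y` determines that of `Y`: if `x` sees `y ∈ Y` but nothing in `Y'`, then `y`
-- sees `F Y'`, hence also `F Y`, contrary to the definition of `F Y`.
open Classical in
theorem nec_one_compl_le : nec G 1 Aᶜ ≤ nec G 1 A := by
  have hcount : ∀ (X : Finset (Fin n)) (u : Fin n), min 1 (nbrCount G X u) =
      if ∃ v, v ∈ X ∧ G.Adj u v then 1 else 0 := by
    intro X u
    have := nbrCount_pos_iff (G := G) (X := X) (u := u)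
    split_ifs with h
    · have := this.2 h
      omega
    · have := mt this.1 h
      omega
  have hsim : ∀ B X Y, Similar G 1 B X Y ↔
      ∀ u, u ∉ B → ((∃ v, v ∈ X ∧ G.Adj u v) ↔ ∃ v, v ∈ Y ∧ G.Adj u v) := by
    intro B X Y
    refine forall_congr' fun u => forall_congr' fun _ => ?_
    rw [hcount, hcount]
    split_ifs with h1 h2 h2 <;> simp [h1, h2]
  let F : Finset (Fin n) → Finset (Fin n) := fun Y =>
    A.filter fun x => ¬ ∃ v, v ∈ Y ∧ G.Adj x v
  have hFA : ∀ Y, F Y ⊆ A := fun Y => Finset.filter_subset _ _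
  have h1 : ∀ Y Y', Similar G 1 Aᶜ Y Y' → F Y = F Y' := by
    intro Y Y' h
    refine Finset.filter_congr fun x hx => ?_
    rw [(hsim _ _ _).1 h x (by simpa using hx)]
  have h2 : ∀ Y Y', Y ⊆ Aᶜ → Similar G 1 A (F Y) (F Y') → ∀ x ∈ A, (∃ v, v ∈ Y ∧ G.Adj x v) →
      ∃ v, v ∈ Y' ∧ G.Adj x v := by
    rintro Y Y' hY h x hx ⟨y, hy, hxy⟩
    by_contra hcon
    obtain ⟨z, hz, hyz⟩ := ((hsim _ _ _).1 h y (Finset.mem_compl.1 (hY hy))).2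
      ⟨x, Finset.mem_filter.2 ⟨hx, hcon⟩, hxy.symm⟩
    exact (Finset.mem_filter.1 hz).2 ⟨y, hy, hyz.symm⟩
  refine Nat.card_le_card_of_injective (Quotient.lift (fun Y : {Y // Y ⊆ Aᶜ} =>
    Quotient.mk (nbrSetoid G 1 A) ⟨F Y.1, hFA _⟩) ?_) ?_
  · intro Y Y' h
    simp only [h1 Y.1 Y'.1 h]
  · intro a b
    induction a, b using Quotient.inductionOn₂ with
    | _ Y Y' =>
      intro h
      have hr : Similar G 1 A (F Y.1) (F Y'.1) := Quotient.exact h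
      refine Quotient.sound ((hsim _ _ _).2 fun u hu => ?_)
      have hu' : u ∈ A := by simpa using hu
      exact ⟨h2 _ _ Y.2 hr u hu', h2 _ _ Y'.2 hr.symm u hu'⟩

theorem nec_le_two_pow {d : ℕ} : nec G d A ≤ 2 ^ n := by
  have h1 : nec G d A ≤ Nat.card {X : Finset (Fin n) // X ⊆ A} :=
    Nat.card_le_card_of_surjective _ Quotient.mk_surjective
  have h2 : Nat.card {X : Finset (Fin n) // X ⊆ A} ≤ Nat.card (Finset (Fin n)) :=
    Nat.card_le_card_of_injective _ Subtype.val_injective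
  rw [Nat.card_eq_fintype_card (α := Finset (Fin n)), Fintype.card_finset, Fintype.card_fin] at h2
  exact h1.trans h2

theorem card_irrSums_le_two_pow : (irrSums G A).card ≤ 2 ^ n := by
  classical
  refine Finset.card_image_le.trans ((Finset.card_filter_le _ _).trans ?_)
  rw [Finset.card_univ, Fintype.card_finset, Fintype.card_fin]

/-! ### Rows of the adjacency matrix of a cut -/

open Classical in
/-- The neighbors of `v` outside of `A`. -/
noncomputable def outNbrs (G : SimpleGraph (Fin n)) (A : Finset (Fin n)) (v : Fin n) :
    Finset (Fin n) := Finset.univ.filter fun u => u ∉ A ∧ G.Adj u v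

theorem mem_outNbrs {u v : Fin n} : u ∈ outNbrs G A v ↔ u ∉ A ∧ G.Adj u v := by
  simp [outNbrs]

open Classical in
noncomputable def outRows (G : SimpleGraph (Fin n)) (A : Finset (Fin n)) :
    Finset (Finset (Fin n)) := A.image (outNbrs G A)

open Classical in
theorem outCount_eq_sum (S : Finset (Fin n)) (u : Fin n) :
    outCount G A S u = ∑ v ∈ S, if u ∈ outNbrs G A v then 1 else 0 := by
  rw [← Finset.card_filter, outCount]
  split_ifs with hu
  · simp [mem_outNbrs, hu]
  · simp [nbrCount_eq_card, mem_outNbrs, hu]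

theorem Irredundant.injOn (h : Irredundant G A S) : Set.InjOn (outNbrs G A) S := by
  intro x hx y hy hxy
  obtain ⟨u, hu, hux⟩ := h.2 x hx
  have h1 : u ∈ outNbrs G A x := mem_outNbrs.2 ⟨hu, (hux x hx).2 rfl⟩
  rw [hxy, mem_outNbrs] at h1
  exact ((hux y hy).1 h1.2).symm

theorem card_outRows_eq_mw : (outRows G A).card = mw G A := by
  classical
  have h : (fun v => G.neighborSet v ∩ (A : Set (Fin n))ᶜ) '' A =
      (fun s : Finset (Fin n) => (s : Set (Fin n))) '' (outRows G A : Set (Finset (Fin n))) := by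
    rw [outRows, Finset.coe_image, Set.image_image]
    refine Set.image_congr fun v _ => ?_
    ext u
    simp [mem_outNbrs, and_comm, G.adj_comm]
  rw [mw, h, Set.ncard_image_of_injective _ Finset.coe_injective, Set.ncard_coe_finset]

/-- The vertices of an irredundant set have distinct rows, so the vector of counts is the sum over a
set of rows. -/
theorem card_irrSums_le_mw : (irrSums G A).card ≤ 2 ^ mw G A := by
  classical
  rw [← card_outRows_eq_mw, ← Finset.card_powerset]
  have : irrSums G A ⊆ (outRows G A).powerset.image fun 𝓡 u =>
      ∑ r ∈ 𝓡, if u ∈ r then 1 else 0 := by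
    intro f hf
    obtain ⟨S, hS, rfl⟩ := Finset.mem_image.1 hf
    have hS' : Irredundant G A S := (Finset.mem_filter.1 hS).2
    refine Finset.mem_image.2 ⟨S.image (outNbrs G A), Finset.mem_powerset.2
      (Finset.image_subset_image hS'.1), ?_⟩
    funext u
    rw [Finset.sum_image hS'.injOn, outCount_eq_sum]
  exact (Finset.card_le_card this).trans Finset.card_image_le

/-- Each vector is a sum of at most `k` rows; it is encoded by a sequence of `k` rows in which
`none` fills the unused places. -/
theorem card_irrSums_le_of_card_le {k : ℕ} (hk : ∀ S, Irredundant G A S → S.card ≤ k) :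
    (irrSums G A).card ≤ ((outRows G A).card + 1) ^ k := by
  classical
  have hcard : ((outRows G A).card + 1) ^ k =
      (Finset.univ : Finset (Fin k → Option (outRows G A))).card := by
    simp
  rw [hcard]
  have : irrSums G A ⊆ (Finset.univ : Finset (Fin k → Option (outRows G A))).image fun g u =>
      ∑ i, (g i).elim 0 fun r => if u ∈ r.1 then 1 else 0 := by
    intro f hf
    obtain ⟨S, hS, rfl⟩ := Finset.mem_image.1 hf
    have hS' : Irredundant G A S := (Finset.mem_filter.1 hS).2
    let ι : S → Fin k := fun x => Fin.castLE (hk S hS') (S.equivFin x)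
    have hι : Function.Injective ι :=
      (Fin.castLE_injective _).comp S.equivFin.injective
    refine Finset.mem_image.2 ⟨Function.extend ι (fun x => some ⟨outNbrs G A x.1,
      Finset.mem_image_of_mem _ (hS'.1 x.2)⟩) fun _ => none, Finset.mem_univ _, ?_⟩
    funext u
    rw [outCount_eq_sum, ← Finset.sum_coe_sort S]
    symm
    refine Fintype.sum_of_injective ι hι _ _ (fun i hi => ?_) fun x => ?_
    · rw [Function.extend_apply' _ _ _ hi]
      rfl
    · rw [hι.extend_apply]
      rfl
  exact (Finset.card_le_card this).trans Finset.card_image_le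

end

/-! ### Irredundant sets and ranks of cut matrices. -/

section Rank

variable {n : ℕ} {G : SimpleGraph (Fin n)} {A S : Finset (Fin n)} {K : Type} [Field K]

/-- The rows of `S` restricted to the columns of the private neighbors form an identity matrix, over
every field. -/
theorem Irredundant.card_le_rank (h : Irredundant G A S) : S.card ≤ (cutMatrix G K A).rank := by
  classical
  have hch : ∀ x : S, ∃ u : {v // v ∈ Aᶜ}, ∀ y ∈ S, G.Adj u y ↔ y = x := fun x => by
    obtain ⟨u, hu, h⟩ := h.2 x.1 x.2
    exact ⟨⟨u, Finset.mem_compl.2 hu⟩, h⟩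
  choose u hu using hch
  have hli : LinearIndependent K fun x : S => (cutMatrix G K A).row ⟨x.1, h.1 x.2⟩ := by
    rw [Fintype.linearIndependent_iff]
    intro g hg x
    have h1 := congrFun hg (u x)
    rw [Finset.sum_apply, Finset.sum_eq_single x] at h1
    · have : G.Adj x.1 (u x) := ((hu x x.1 x.2).2 rfl).symm
      simpa [cutMatrix, this] using h1
    · intro y _ hyx
      have : ¬ G.Adj y.1 (u x) := fun hadj => hyx (Subtype.ext ((hu x y.1 y.2).1 hadj.symm))
      simp [cutMatrix, this]
    · simp
  rw [Matrix.rank_eq_finrank_span_row, ← Fintype.card_coe, ← finrank_span_eq_card hli]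
  exact Submodule.finrank_mono (Submodule.span_mono (by rintro _ ⟨x, rfl⟩; exact ⟨_, rfl⟩))

/-- A set of columns that determines all linear combinations of the rows. -/
theorem exists_columns : ∃ J : Finset {v // v ∈ Aᶜ}, J.card ≤ (cutMatrix G K A).rank ∧
    ∀ g : {v // v ∈ A} → K, (∀ j ∈ J, ∑ a, g a * cutMatrix G K A a j = 0) →
      ∀ j, ∑ a, g a * cutMatrix G K A a j = 0 := by
  classical
  set M := cutMatrix G K A
  obtain ⟨κ, a, ha, hspan, hli⟩ := exists_linearIndependent' K M.col
  have : Finite κ := Finite.of_injective a ha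
  have : Fintype κ := Fintype.ofFinite κ
  refine ⟨Finset.univ.image a, ?_, fun g hg j => ?_⟩
  · rw [Finset.card_image_of_injective _ ha, Finset.card_univ, Matrix.rank_eq_finrank_span_cols,
      ← hspan, finrank_span_eq_card hli]
  · let φ : ({v // v ∈ A} → K) →ₗ[K] K := Fintype.linearCombination K g
    have hφ : ∀ c : {v // v ∈ A} → K, φ c = ∑ i, g i * c i := fun c => by
      simp [φ, Fintype.linearCombination_apply, mul_comm]
    have hle : Submodule.span K (Set.range M.col) ≤ LinearMap.ker φ := by
      rw [← hspan, Submodule.span_le]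
      rintro _ ⟨k, rfl⟩
      rw [SetLike.mem_coe, LinearMap.mem_ker, hφ]
      exact hg (a k) (Finset.mem_image_of_mem _ (Finset.mem_univ _))
    have := hle (Submodule.subset_span ⟨j, rfl⟩)
    rwa [LinearMap.mem_ker, hφ] at this

/-- By linearity two rows that agree on the columns of `exists_columns` are equal, so a row is
determined by a subset of these columns. -/
theorem card_outRows_le_rw : (outRows G A).card ≤ 2 ^ rw G A := by
  classical
  obtain ⟨J, hJ, hdet⟩ := exists_columns (G := G) (A := A) (K := ZMod 2)
  have h1 : (outRows G A).card ≤ J.powerset.card := by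
    have hch : ∀ r : A.image (outNbrs G A), ∃ v : {v // v ∈ A}, outNbrs G A v.1 = r.1 := fun r => by
      obtain ⟨v, hv, h⟩ := Finset.mem_image.1 r.2
      exact ⟨⟨v, hv⟩, h⟩
    choose v hv using hch
    rw [outRows, ← Fintype.card_coe, ← Finset.card_univ]
    refine Finset.card_le_card_of_injOn (fun r => J.filter fun j => G.Adj (v r) j)
      (fun r _ => Finset.mem_powerset.2 (Finset.filter_subset _ _)) fun r _ r' _ hrr => ?_
    have hsum : ∀ (c : {v // v ∈ Aᶜ}), ∑ a, (Pi.single (v r) 1 - Pi.single (v r') 1 :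
        {v // v ∈ A} → ZMod 2) a * cutMatrix G (ZMod 2) A a c =
          cutMatrix G (ZMod 2) A (v r) c - cutMatrix G (ZMod 2) A (v r') c := by
      intro c
      simp [sub_mul, Finset.sum_sub_distrib, Pi.single_apply]
    have hzero := hdet (Pi.single (v r) 1 - Pi.single (v r') 1) fun j hj => by
      have := Finset.ext_iff.1 hrr j
      simp only [Finset.mem_filter, hj, true_and] at this
      rw [hsum]
      simp [cutMatrix, this]
    refine Subtype.ext ?_
    rw [← hv r, ← hv r']
    ext u
    rw [mem_outNbrs, mem_outNbrs]
    refine and_congr_right fun hu => ?_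
    have h2 := hzero ⟨u, Finset.mem_compl.2 hu⟩
    rw [hsum, sub_eq_zero] at h2
    simp only [cutMatrix] at h2
    rw [G.adj_comm u, G.adj_comm u]
    by_cases h3 : G.Adj (v r) u <;> by_cases h4 : G.Adj (v r') u <;> simp [h3, h4] at h2 ⊢
  rw [Finset.card_powerset] at h1
  exact h1.trans (Nat.pow_le_pow_right (by norm_num) hJ)

theorem card_irrSums_le_rw : (irrSums G A).card ≤ (2 ^ rw G A + 1) ^ rw G A :=
  (card_irrSums_le_of_card_le fun _ hS => hS.card_le_rank).trans
    (Nat.pow_le_pow_left (Nat.add_le_add_right card_outRows_le_rw 1) _)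

/-- Over the rationals, a vector of counts is a linear combination of rows and therefore determined
by its values at `rwQ` columns at most. Each value is at most the size of an irredundant set, hence
at most `rwQ`. -/
theorem card_irrSums_le_rwQ : (irrSums G A).card ≤ (rwQ G A + 1) ^ rwQ G A := by
  classical
  obtain ⟨J, hJ, hdet⟩ := exists_columns (G := G) (A := A) (K := ℚ)
  have hcount : ∀ (S : Finset (Fin n)) (c : {v // v ∈ Aᶜ}),
      ∑ a : {v // v ∈ A}, (if a.1 ∈ S then (1 : ℚ) else 0) * cutMatrix G ℚ A a c =
        ∑ a : {v // v ∈ A}, if a.1 ∈ S ∧ G.Adj a.1 c then 1 else 0 := by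
    intro S c
    refine Finset.sum_congr rfl fun a _ => ?_
    by_cases h1 : a.1 ∈ S <;> by_cases h2 : G.Adj a.1 c <;> simp [cutMatrix, h1, h2]
  have hout : ∀ (S : Finset (Fin n)), S ⊆ A → ∀ c : {v // v ∈ Aᶜ},
      ∑ a : {v // v ∈ A}, (if a.1 ∈ S then (1 : ℚ) else 0) * cutMatrix G ℚ A a c =
        outCount G A S c := by
    intro S hS c
    rw [hcount, Finset.sum_boole, outCount, if_neg (Finset.mem_compl.1 c.2), nbrCount_eq_card]
    congr 1
    refine Finset.card_bij (fun a _ => a.1) (fun a ha => ?_) (fun a _ b _ h => Subtype.ext h)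
      fun v hv => ?_
    · simp only [Finset.mem_filter, Finset.mem_univ, true_and] at ha ⊢
      exact ⟨ha.1, ha.2.symm⟩
    · rw [Finset.mem_filter] at hv
      exact ⟨⟨v, hS hv.1⟩, by simp [hv.1, hv.2.symm], rfl⟩
  have hle : (irrSums G A).card ≤ (Finset.univ : Finset (J → Fin (rwQ G A + 1))).card := by
    refine Finset.card_le_card_of_injOn (fun f j => Fin.ofNat _ (f j.1.1)) (by simp) ?_
    intro f hf f' hf' hff
    obtain ⟨S, hS, rfl⟩ := Finset.mem_image.1 hf
    obtain ⟨S', hS', rfl⟩ := Finset.mem_image.1 hf'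
    rw [Finset.mem_filter] at hS hS'
    -- The counts lie below the modulus of `Fin.ofNat`, so the reduction is injective on them.
    have hlt : ∀ S, Irredundant G A S → ∀ u, outCount G A S u < rwQ G A + 1 := by
      intro S hS u
      have h1 : S.card ≤ rwQ G A := hS.card_le_rank
      rw [outCount]
      split_ifs
      · omega
      · rw [nbrCount_eq_card]
        exact Nat.lt_succ_of_le ((Finset.card_filter_le _ _).trans h1)
    have hJ' : ∀ j ∈ J, outCount G A S j.1 = outCount G A S' j.1 := by
      intro j hj
      have := congrArg Fin.val (congrFun hff ⟨j, hj⟩)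
      simpa [Fin.ofNat, Nat.mod_eq_of_lt (hlt S hS.2 _), Nat.mod_eq_of_lt (hlt S' hS'.2 _)] using this
    have hsum : ∀ c : {v // v ∈ Aᶜ}, ∑ a : {v // v ∈ A}, ((if a.1 ∈ S then (1 : ℚ) else 0) -
        (if a.1 ∈ S' then (1 : ℚ) else 0)) * cutMatrix G ℚ A a c =
        outCount G A S c - outCount G A S' c := by
      intro c
      simp only [sub_mul, Finset.sum_sub_distrib]
      rw [hout S hS.2.1, hout S' hS'.2.1]
    have hzero := hdet (fun a => (if a.1 ∈ S then (1 : ℚ) else 0) - if a.1 ∈ S' then 1 else 0)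
      fun j hj => by rw [hsum, hJ' j hj, sub_self]
    funext u
    by_cases hu : u ∈ A
    · simp [outCount, hu]
    · have h2 := hzero ⟨u, Finset.mem_compl.2 hu⟩
      rw [hsum, sub_eq_zero] at h2
      exact_mod_cast h2
  refine hle.trans ?_
  rw [Finset.card_univ, Fintype.card_fun, Fintype.card_fin, Fintype.card_coe]
  exact Nat.pow_le_pow_right (by omega) hJ

end Rank

/-! ### Irredundant sets and induced matchings. -/

section Matching

variable {n : ℕ} {G : SimpleGraph (Fin n)} {A S : Finset (Fin n)}

/-- The edges from the vertices of `S` to their private neighbors form an induced matching of the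
cut. -/
theorem Irredundant.card_le_mim (h : Irredundant G A S) : S.card ≤ mim G A := by
  classical
  have hch : ∀ x, ∃ u, x ∈ S → u ∉ A ∧ ∀ y ∈ S, G.Adj u y ↔ y = x := fun x => by
    by_cases hx : x ∈ S
    · obtain ⟨u, hu, h⟩ := h.2 x hx
      exact ⟨u, fun _ => ⟨hu, h⟩⟩
    · exact ⟨x, fun h => absurd h hx⟩
  choose u hu using hch
  have hA : ∀ x ∈ S, x ∈ A := h.1
  have huA : ∀ x ∈ S, u x ∉ A := fun x hx => (hu x hx).1
  have hadj : ∀ x ∈ S, ∀ y ∈ S, G.Adj (u x) y ↔ y = x := fun x hx => (hu x hx).2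
  let M : (SimpleGraph.between (A : Set (Fin n)) (A : Set (Fin n))ᶜ G).Subgraph :=
    { verts := {v | v ∈ S ∨ ∃ x ∈ S, v = u x}
      Adj := fun a b => (a ∈ S ∧ b = u a) ∨ (b ∈ S ∧ a = u b)
      adj_sub := by
        rintro a b (⟨ha, rfl⟩ | ⟨hb, rfl⟩)
        · rw [SimpleGraph.between_adj]
          exact ⟨((hadj a ha a ha).2 rfl).symm, .inl ⟨hA a ha, huA a ha⟩⟩
        · rw [SimpleGraph.between_adj]
          exact ⟨(hadj b hb b hb).2 rfl, .inr ⟨huA b hb, hA b hb⟩⟩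
      edge_vert := by
        rintro a b (⟨ha, rfl⟩ | ⟨hb, rfl⟩)
        · exact .inl ha
        · exact .inr ⟨b, hb, rfl⟩
      symm := ⟨fun a b h => h.symm⟩ }
  have hinj : ∀ x ∈ S, ∀ y ∈ S, u x = u y → x = y := fun x hx y hy hxy =>
    (hadj y hy x hx).1 (hxy ▸ (hadj x hx x hx).2 rfl)
  refine le_csSup ⟨Nat.card (Sym2 (Fin n)), ?_⟩ ⟨M, ?_, ?_, ?_⟩
  · rintro k ⟨M', -, -, rfl⟩
    exact Set.ncard_le_card _
  · rintro v (hv | ⟨x, hx, rfl⟩)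
    · refine ⟨u v, .inl ⟨hv, rfl⟩, ?_⟩
      rintro y (⟨-, rfl⟩ | ⟨hy, rfl⟩)
      · rfl
      · exact absurd (hA _ hv) (huA y hy)
    · refine ⟨x, .inr ⟨hx, rfl⟩, ?_⟩
      rintro y (⟨hy, -⟩ | ⟨hy, hxy⟩)
      · exact absurd (hA _ hy) (huA x hx)
      · exact hinj y hy x hx hxy.symm
  · intro a ha b hb hab
    rw [SimpleGraph.between_adj] at hab
    obtain ⟨hG, ⟨h1, h2⟩ | ⟨h1, h2⟩⟩ := hab
    · rcases ha with ha | ⟨x, hx, rfl⟩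
      · rcases hb with hb | ⟨y, hy, rfl⟩
        · exact absurd (hA b hb) h2
        · rw [(hadj y hy a ha).1 hG.symm]
          exact .inl ⟨hy, rfl⟩
      · exact absurd h1 (huA x hx)
    · rcases hb with hb | ⟨x, hx, rfl⟩
      · rcases ha with ha | ⟨y, hy, rfl⟩
        · exact absurd (hA a ha) h1
        · rw [(hadj y hy b hb).1 hG]
          exact .inr ⟨hy, rfl⟩
      · exact absurd h2 (huA x hx)
  · have hE : M.edgeSet = (fun x => s(x, u x)) '' (S : Set (Fin n)) := by
      ext e
      induction e with
      | _ a b =>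
        simp only [SimpleGraph.Subgraph.mem_edgeSet, Set.mem_image, Finset.mem_coe, Sym2.eq_iff]
        constructor
        · rintro (⟨ha, rfl⟩ | ⟨hb, rfl⟩)
          · exact ⟨a, ha, .inl ⟨rfl, rfl⟩⟩
          · exact ⟨b, hb, .inr ⟨rfl, rfl⟩⟩
        · rintro ⟨x, hx, ⟨rfl, rfl⟩ | ⟨rfl, rfl⟩⟩
          · exact .inl ⟨hx, rfl⟩
          · exact .inr ⟨hx, rfl⟩
    rw [hE, Set.InjOn.ncard_image, Set.ncard_coe_finset]
    intro x hx y hy hxy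
    rw [Sym2.eq_iff] at hxy
    rcases hxy with ⟨h1, -⟩ | ⟨h1, -⟩
    · exact h1
    · exact absurd (h1 ▸ hA x hx) (huA y hy)

theorem card_outRows_le : (outRows G A).card ≤ n :=
  Finset.card_image_le.trans ((Finset.card_le_univ A).trans (by simp))

theorem card_irrSums_le_mim : (irrSums G A).card ≤ (n + 1) ^ mim G A :=
  (card_irrSums_le_of_card_le fun _ hS => hS.card_le_mim).trans
    (Nat.pow_le_pow_left (Nat.add_le_add_right card_outRows_le 1) _)

end Matching

/-! ### Comparison with the bound of the theorem -/

section

variable {n : ℕ} (G : SimpleGraph (Fin n)) (T : LayoutTree (Fin n))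

theorem le_boundN (hn : 0 < n) (f : WidthParam) : n ≤ boundN G T f := by
  cases f
  · have : 0 < 2 ^ T.width (mw G) := by positivity
    simp only [boundN]
    nlinarith
  · have : 0 < 2 ^ (2 * T.width (rw G) ^ 2) := by positivity
    simp only [boundN]
    nlinarith
  · have : 0 < (2 * T.width (rwQ G) + 1) ^ T.width (rwQ G) := by positivity
    simp only [boundN]
    nlinarith
  · have : n ^ 1 ≤ n ^ (2 * T.width (mim G) + 1) := Nat.pow_le_pow_right hn (by omega)
    rw [pow_one] at this
    simp only [boundN]
    omega

theorem card_irrSums_le_boundN (hn : 0 < n) (f : WidthParam) {S : LayoutTree (Fin n)}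
    (hS : S ∈ T.nodes) : (irrSums G S.verts).card ≤ boundN G T f := by
  have hmul : ∀ a b : ℕ, a ≤ b → a ≤ b * (2 * n) := fun a b h => by nlinarith
  cases f with
  | mw =>
    exact hmul _ _ (card_irrSums_le_mw.trans
      (Nat.pow_le_pow_right (by norm_num) (LayoutTree.le_width _ hS)))
  | rw =>
    refine hmul _ _ (card_irrSums_le_rw.trans ?_)
    have hk := LayoutTree.le_width (rw G) hS
    refine le_trans ?_ (Nat.pow_le_pow_right (by norm_num) (Nat.mul_le_mul_left 2
      (Nat.pow_le_pow_left hk 2)))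
    generalize rw G S.verts = k
    have h1 : 2 ^ k + 1 ≤ 2 ^ (k + 1) := by
      have : 1 ≤ 2 ^ k := Nat.one_le_two_pow
      rw [pow_succ]
      omega
    refine (Nat.pow_le_pow_left h1 k).trans ?_
    rw [← pow_mul]
    exact Nat.pow_le_pow_right (by norm_num) (by nlinarith [Nat.le_self_pow two_ne_zero k])
  | rwQ =>
    refine hmul _ _ (card_irrSums_le_rwQ.trans ?_)
    have hk := LayoutTree.le_width (rwQ G) hS
    exact (Nat.pow_le_pow_left (by omega) _).trans (Nat.pow_le_pow_right (by omega) hk)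
  | mim =>
    rw [boundN]
    -- The estimate `n + 1 ≤ n ^ 2` fails for a single vertex, where the trivial bound `2 ^ n` is
    -- enough.
    rcases Nat.lt_or_ge n 2 with h2 | h2
    · obtain rfl : n = 1 := by omega
      simpa using card_irrSums_le_two_pow (G := G) (A := S.verts)
    · refine card_irrSums_le_mim.trans ?_
      have hk := LayoutTree.le_width (mim G) hS
      have h3 : n + 1 ≤ n ^ 2 := by nlinarith
      refine (Nat.pow_le_pow_left h3 _).trans ?_
      rw [← pow_mul]
      refine (Nat.pow_le_pow_right hn (?_ : _ ≤ 2 * T.width (mim G) + 1)).trans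
        (Nat.le_mul_of_pos_left _ (by norm_num))
      omega

/-- Each of the three terms of `nodeSize` is at most the number of elements of `irrSums`, hence at
most `boundN`. -/
theorem width_nodeSize_le (I : Inst) (f : WidthParam) :
    I.T.width I.nodeSize ≤ 3 * boundN I.G I.T f := by
  refine LayoutTree.width_le fun S hS => ?_
  have h1 := card_irrSums_le_boundN I.G I.T I.n_pos f hS
  have h2 := nec_one_le_card_irrSums (G := I.G) (A := S.verts)
  have h3 := nec_one_compl_le (G := I.G) (A := S.verts)
  rw [Inst.nodeSize]
  omega

theorem one_le_boundN (hn : 0 < n) (f : WidthParam) : 1 ≤ boundN G T f :=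
  hn.trans_le (le_boundN G T hn f)

theorem one_le_width_snec (d : ℕ) : 1 ≤ T.width (snec G d) :=
  (nec_pos.trans (le_max_left _ _ : nec G d T.verts ≤ snec G d T.verts)).trans
    (LayoutTree.le_width (snec G d) T.self_mem_nodes)

theorem width_snec_le (d : ℕ) : T.width (snec G d) ≤ 2 ^ n :=
  LayoutTree.width_le fun _ _ => max_le nec_le_two_pow nec_le_two_pow

end

/-- The product of non-empty matrices needs at least one step, while `C * m ^ τ` tends to zero for
negative `τ`. -/
theorem matMulExponent_nonneg (K : Type) [Field K] : 0 ≤ matMulExponent K := by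
  refine Real.sInf_nonneg fun τ hτ => ?_
  obtain ⟨C, hC⟩ := hτ
  by_contra! hneg
  have hL : ∀ m : ℕ, 0 < m → (1 : ℝ) ≤ C * (m : ℝ) ^ τ := by
    intro m hm
    obtain ⟨L, ⟨g, -, hg⟩, hle⟩ := hC m
    obtain ⟨t, -⟩ := hg ⟨0, hm⟩ ⟨0, hm⟩
    have : 1 ≤ L := Nat.one_le_iff_ne_zero.2 (by rintro rfl; exact t.elim0)
    exact (by exact_mod_cast this : (1 : ℝ) ≤ L).trans hle
  have ht : Filter.Tendsto (fun m : ℕ => C * (m : ℝ) ^ τ) Filter.atTop (nhds (C * 0)) := by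
    refine Filter.Tendsto.const_mul C ?_
    have := (tendsto_rpow_neg_atTop (neg_pos.2 hneg)).comp tendsto_natCast_atTop_atTop
    simpa [Function.comp_def] using this
  rw [mul_zero] at ht
  have := ge_of_tendsto ht (Filter.eventually_atTop.2 ⟨1, fun m hm => hL m hm⟩)
  linarith

/-- From `dOf μ` on, all numbers belong to `μ` or none does, so truncation at `d` does not affect
membership. -/
theorem min_mem_iff {μ : Set ℕ} (hfin : μ.Finite ∨ μᶜ.Finite) {d : ℕ} (hd : dOf μ ≤ d) (k : ℕ) :
    min d k ∈ μ ↔ k ∈ μ := by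
  rcases Nat.lt_or_ge d k with hlt | hge
  swap
  · rw [min_eq_right hge]
  rw [min_eq_left hlt.le]
  by_cases hu : μ = Set.univ
  · simp [hu]
  rw [dOf, if_neg hu] at hd
  split_ifs at hd with hf
  · have h1 : ∀ j ∈ μ, j < d := fun j hj => by
      have := le_csSup hf.bddAbove hj
      omega
    exact iff_of_false (fun h => (h1 d h).false) fun h => (h1 k h).not_gt hlt
  · have hc := hfin.resolve_left hf
    have h1 : ∀ j ∈ μᶜ, j < d := fun j hj => by
      have := le_csSup hc.bddAbove hj
      omega
    refine iff_of_true ?_ ?_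
    · by_contra h
      exact (h1 d h).false
    · by_contra h
      exact (h1 k h).not_gt hlt


/-! ### Conversion of the input -/

theorem frame_trans {s s₁ s₂ : State} {k : ℕ} (h : ∀ j, 2 ≤ j → j < k → s₁.var j = s.var j)
    (h' : ∀ j, 2 ≤ j → j < k → s₂.var j = s₁.var j) : ∀ j, 2 ≤ j → j < k → s₂.var j = s.var j :=
  fun j h2 hj => (h' j h2 hj).trans (h j h2 hj)

/-- Run `body` for all values of variable `x + 1` below its current one, in decreasing order, and
collect the results in a list. -/
def countProg (x : ℕ) (body : Prog) : Prog :=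
  .loop (.var (x + 1)) <| .seq (.assign (x + 1) (.sub (.var (x + 1)) (.const 1))) <|
    .seq body (consProg x (x + 2) x)

/-- Counting down while consing gives the list in increasing order. The counter is not a pointer and
may exceed the free position, as for the `2 n - 1` tokens; only its bit length has to be comparable.
-/
theorem exec_count {x N b : ℕ} {g : ℕ → Data} {body : Prog} {s : State} (hx : 2 ≤ x)
    (hs : HeapOk s) (hN : N.size ≤ 4 * (1 + (s.var 1).size))
    (hbody : ∀ s', Extends s s' → (∀ j, 2 ≤ j → j < x → s'.var j = s.var j) →
      s'.var (x + 1) < N → Exec body s' (x + 2) b fun s'' =>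
        Rep s'' (g (s'.var (x + 1))) (s''.var (x + 2))) :
    ∀ (j : ℕ) (l : List Data) (s₁ : State), Extends s s₁ →
      (∀ j, 2 ≤ j → j < x → s₁.var j = s.var j) → s₁.var (x + 1) = j → j ≤ N →
      Rep s₁ (encL l) (s₁.var x) →
      Exec (countProg x body) s₁ x (j * (b + 60) + 10) fun s' =>
        Rep s' (encL ((List.range j).map g ++ l)) (s'.var x) := by
  intro j
  induction j with
  | zero =>
    intro l s₁ he hf hj hjN hl
    refine (exec_loop_done (c := 10) ?_ ?_ ?_).mono le_rfl (by omega) fun s' _ _ h => h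
    · simp [Expr.cost, hj]
      omega
    · simp [Expr.eval, hj]
    · simpa using hl
  | succ j ih =>
    intro l s₁ he hf hj hjN hl
    have hsz : (j + 1).size ≤ 4 * (1 + (s₁.var 1).size) := by
      have h1 := Nat.size_le_size hjN
      have h2 := Nat.size_le_size he.ptr_le
      omega
    have hsz' : j.size ≤ 4 * (1 + (s₁.var 1).size) := (Nat.size_le_size (Nat.le_succ j)).trans hsz
    refine Exec.mono (k := x) (b := (13 + (b + 20 + 1) + 1) + (j * (b + 60) + 10) + 6)
      (exec_loop_step ?_ ?_ (Exec.seq' (k' := x) (b := 13) (b' := b + 20 + 1)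
        (exec_assign 13 (by omega) (by omega) ?_) le_rfl le_rfl fun s₂ he₂ hf₂ e₂ =>
        Exec.seq' (k' := x + 2) (b := b) (b' := 20) (hbody s₂ (he.trans he₂) (frame_trans hf hf₂) ?_)
          (by omega) le_rfl fun s₃ he₃ hf₃ h₃ => ?_)) le_rfl ?_ fun s' _ _ h => h
    · simp only [Expr.cost, hj]
      omega
    · simp [Expr.eval, hj]
    · simp only [Expr.cost, Expr.eval, hj, Nat.add_sub_cancel, Nat.size_one]
      omega
    · subst e₂
      simp [Expr.eval, hj]
      omega
    · have hj₂ : s₂.var (x + 1) = j := by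
        subst e₂
        simp [Expr.eval, hj]
      have hx₂ : s₂.var x = s₁.var x := by
        subst e₂
        exact setVar_var_of_ne (by omega)
      have hs₃ := hs.extends ((he.trans he₂).trans he₃)
      have hl₃ : Rep s₃ (encL l) (s₃.var x) := by
        rw [hf₃ x hx (by omega), hx₂]
        exact hl.extends (he₂.trans he₃)
      rw [hj₂] at h₃
      refine (exec_cons hs₃ hx le_rfl h₃ hl₃).mono le_rfl le_rfl fun s₄ he₄ hf₄ h₄ => ?_
      have := ih (g j :: l) s₄ (((he.trans he₂).trans he₃).trans he₄)
        (frame_trans (frame_trans hf (frame_trans hf₂ fun j h2 hj => hf₃ j h2 (by omega))) hf₄) ?_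
        (by omega) h₄.2
      · rwa [List.range_succ, List.map_append, List.append_assoc]
      · rw [h₄.1 _ (by omega) (by omega), hf₃ _ (by omega) (by omega), hj₂]
    · ring_nf
      omega

/-- The list of the results of `body` for the values of variable `x + 1` below `e`. -/
def tabulateProg (x : ℕ) (e : Expr) (body : Prog) : Prog :=
  .seq (.assign (x + 1) e) (.seq (.assign x (.const 0)) (countProg x body))

theorem exec_tabulate {x N b : ℕ} {g : ℕ → Data} {e : Expr} {body : Prog} {s : State} (hx : 2 ≤ x)
    (hs : HeapOk s) (he : 1 + e.cost s ≤ 13 * (1 + (s.var 1).size)) (hN : e.eval s = N)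
    (hsz : N.size ≤ 4 * (1 + (s.var 1).size))
    (hbody : ∀ s', Extends s s' → (∀ j, 2 ≤ j → j < x → s'.var j = s.var j) →
      s'.var (x + 1) < N → Exec body s' (x + 2) b fun s'' =>
        Rep s'' (g (s'.var (x + 1))) (s''.var (x + 2))) :
    Exec (tabulateProg x e body) s x (N * (b + 60) + 30) fun s' =>
      Rep s' (encL ((List.range N).map g)) (s'.var x) := by
  refine Exec.seq' (k' := x) (b := 13) (b' := 2 + (N * (b + 60) + 10) + 1)
    (exec_assign 13 (by omega) (by omega) he) le_rfl (by omega) fun s₁ he₁ hf₁ e₁ =>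
    Exec.seq' (k' := x) (b := 2) (exec_zero hx le_rfl) le_rfl le_rfl fun s₂ he₂ hf₂ e₂ => ?_
  have h1 : s₂.var (x + 1) = N := by
    subst e₂ e₁
    rw [setVar_var_of_ne (by omega)]
    simpa using hN
  have h2 : Rep s₂ (encL []) (s₂.var x) := by
    subst e₂
    simp [encL, Rep]
  simpa using exec_count hx hs hsz hbody N [] s₂ (he₁.trans he₂) (frame_trans hf₁ hf₂) h1 le_rfl h2

theorem exec_encNat {x N : ℕ} {e : Expr} {s : State} (hx : 2 ≤ x) (hs : HeapOk s)
    (he : 1 + e.cost s ≤ 13 * (1 + (s.var 1).size)) (hN : e.eval s = N)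
    (hsz : N.size ≤ 4 * (1 + (s.var 1).size)) :
    Exec (tabulateProg x e (.assign (x + 2) (.const 0))) s x (N * 62 + 30) fun s' =>
      Rep s' (encNat N) (s'.var x) := by
  refine (exec_tabulate (g := fun _ => .nil) (b := 2) hx hs he hN hsz fun s' _ _ _ => ?_).mono
    le_rfl le_rfl fun s' _ _ h => ?_
  · refine (exec_zero (by omega) le_rfl).mono le_rfl le_rfl fun s'' _ _ h => ?_
    subst h
    simp [Rep]
  · rwa [encNat, encList, List.map_replicate, List.map_const', List.length_range] at *

theorem exec_encProp {x k a c : ℕ} {i : Expr} {s : State} (hx : 2 ≤ x) (hk : k ≤ x) (hs : HeapOk s)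
    (he : 1 + (Expr.get a i).cost s ≤ c * (1 + (s.var 1).size)) :
    Exec (.branch (.get a i) (.seq (.assign x (.const 0)) (consProg x x x)) (.assign x (.const 0)))
      s k (23 + c) fun s' => Rep s' (encProp (s.arr a (i.eval s) ≠ 0)) (s'.var x) := by
  refine exec_branch he (fun h => ?_) fun h => ?_
  · refine Exec.seq' (k' := k) (b := 2) (b' := 20) (exec_zero hx hk) le_rfl le_rfl
      fun s₁ he₁ _ e₁ => ?_
    have h1 : Rep s₁ .nil (s₁.var x) := by
      subst e₁
      simp [Rep]
    refine (exec_cons (hs.extends he₁) hx hk h1 h1).mono le_rfl le_rfl fun s₂ _ _ h₂ => ?_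
    rw [encProp, if_pos (by simpa [Expr.eval] using h)]
    exact h₂.2
  · refine (exec_zero hx hk).mono le_rfl (by omega) fun s₁ _ _ e₁ => ?_
    subst e₁
    rw [encProp, if_neg (by simpa [Expr.eval] using h)]
    simp [Rep]

/-- Trees without weights. -/
def Data.IsPlain : Data → Prop
  | .nil => True
  | .cons a b => a.IsPlain ∧ b.IsPlain
  | .wt _ => False

theorem isPlain_encL {l : List Data} (h : ∀ x ∈ l, x.IsPlain) : (encL l).IsPlain := by
  induction l with
  | nil => trivial
  | cons x l ih => exact ⟨h x (by simp), ih fun y hy => h y (by simp [hy])⟩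

theorem isPlain_encNat (k : ℕ) : (encNat k).IsPlain := by
  refine isPlain_encL fun x hx => ?_
  obtain ⟨_, -, rfl⟩ := List.mem_map.1 hx
  trivial

theorem isPlain_encProp (P : Prop) : (encProp P).IsPlain := by
  unfold encProp
  split_ifs
  · exact ⟨trivial, trivial⟩
  · trivial

theorem Computes.plain {Γ : Type} {env : Set (Γ → Data)} {x : Data} (hx : x.IsPlain) :
    Computes env (fun _ => x) fun _ => 0 := by
  induction x with
  | nil => exact Computes.nil
  | cons a b iha ihb => exact (Computes.cons (iha hx.1) (ihb hx.2)).of_le 1 (by simp)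
  | wt q => exact hx.elim

theorem exists_exec_plain {x : Data} (hx : x.IsPlain) (k : ℕ) (hk : 2 ≤ k) :
    ∃ p c, ∀ s, HeapOk s → Exec p s k c fun s' => Rep s' x (s'.var k) := by
  obtain ⟨c, h⟩ := Computes.plain (Γ := Unit) (env := ∅) hx
  obtain ⟨p, hp⟩ := h (fun _ => 0) k hk (by simp)
  exact ⟨p, c * (0 + 1), fun s hs => hp s () hs (by simp)⟩

theorem encVec_eq {n : ℕ} {f : Fin n → Data} {g : ℕ → Data} (h : ∀ v : Fin n, g v = f v) :
    encL ((List.range n).map g) = encVec f := by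
  rw [encVec, encList, ← List.map_coe_finRange_eq_range, List.map_map]
  congr 1
  exact List.map_congr_left fun v _ => h v

namespace LayoutTree

theorem postorder_eq {n : ℕ} (T : LayoutTree (Fin n)) :
    T.postorder = T.tokens.map fun o => o.elim 0 fun v => v.val + 1 := by
  induction T with
  | leaf v => rfl
  | node l r ihl ihr => simp [postorder, tokens, ihl, ihr]

theorem length_leaves {n : ℕ} {T : LayoutTree (Fin n)} (h : T.IsLayout) : T.leaves.length = n := by
  rw [← List.toFinset_card_of_nodup h.1, Finset.card_eq_of_equiv_fin]
  have : T.leaves.toFinset = Finset.univ :=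
    Finset.eq_univ_iff_forall.2 fun v => List.mem_toFinset.2 (h.2 v)
  rw [this]
  exact Equiv.subtypeUnivEquiv (fun _ => Finset.mem_univ _)

theorem length_postorder {n : ℕ} {T : LayoutTree (Fin n)} (h : T.IsLayout) :
    T.postorder.length = 2 * n - 1 := by
  have := T.length_tokens
  rw [length_leaves h] at this
  rw [postorder_eq, List.length_map]
  omega

theorem getD_postorder_le {n : ℕ} (T : LayoutTree (Fin n)) (k : ℕ) : T.postorder.getD k 0 ≤ n := by
  rw [postorder_eq, List.getD_eq_getElem?_getD, List.getElem?_map]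
  cases T.tokens[k]? with
  | none => simp
  | some o =>
    cases o with
    | none => simp
    | some v => simpa using v.2

end LayoutTree

theorem encL_postorder {n : ℕ} {T : LayoutTree (Fin n)} (h : T.IsLayout) :
    encL ((List.range (2 * n - 1)).map fun k => encNat (T.postorder.getD k 0)) =
      encList encToken T.tokens := by
  have h1 : (List.range (2 * n - 1)).map (fun k => T.postorder.getD k 0) = T.postorder := by
    rw [← LayoutTree.length_postorder h]
    refine List.ext_getElem (by simp) fun i h1 h2 => ?_
    simp [List.getD_eq_getElem?_getD, h2]
  have h2 : (List.range (2 * n - 1)).map (fun k => encNat (T.postorder.getD k 0)) =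
      T.postorder.map encNat := by
    conv_rhs => rw [← h1, List.map_map]
    rfl
  rw [h2, encList, LayoutTree.postorder_eq, List.map_map]
  rfl


/-! ### The data of an instance -/

/-- The data in registers `2` to `10`. -/
noncomputable def Inst.inputs (i : ℕ) (I : Inst) : Data :=
  match i with
  | 0 => encNat I.n
  | 1 => encVec fun u : Fin I.n => encVec fun v => encProp (I.G.Adj u v)
  | 2 => encList encToken I.T.tokens
  | 3 => encVec fun v : Fin I.n => .wt (I.w v)
  | 4 => .wt 0
  | 5 => encNat I.d
  | 6 => encVec fun i : Fin (I.d + 1) => encProp (i.val ∈ I.σ)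
  | 7 => encVec fun i : Fin (I.d + 1) => encProp (i.val ∈ I.ρ)
  | _ => encProp (I.goal = .max)

/-- The bound for the running time, up to constant factors and the bit length of addresses. -/
noncomputable def Inst.timeBound (I : Inst) (k : ℕ) : ℕ :=
  (2 * I.T.width (snec I.G I.d) + 1) ^ 3 * (I.measure + 1) ^ k

theorem Inst.pow_le_timeBound (I : Inst) (k : ℕ) : (I.measure + 1) ^ k ≤ I.timeBound k :=
  Nat.le_mul_of_pos_left _ (by positivity)

theorem Inst.one_le_timeBound (I : Inst) (k : ℕ) : 1 ≤ I.timeBound k :=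
  (Nat.one_le_pow _ _ (by omega)).trans (I.pow_le_timeBound k)

theorem Inst.timeBound_mono (I : Inst) {k k' : ℕ} (h : k ≤ k') : I.timeBound k ≤ I.timeBound k' :=
  Nat.mul_le_mul_left _ (Nat.pow_le_pow_right (by omega) h)

theorem hasInst_inputs : HasInst Inst.measure {f | ∃ i, i < 9 ∧ Inst.inputs i = f} id := by
  have h : ∀ i, i < 9 → PT Inst.measure {f | ∃ i, i < 9 ∧ Inst.inputs i = f} (Inst.inputs i) :=
    fun i hi => PT.mem ⟨i, hi, rfl⟩
  have hn : PolyBdd Inst.measure fun I => I.n := .le_self fun I => by rw [Inst.measure]; omega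
  exact ⟨⟨.of_nat (h 0 (by omega)) hn, h 1 (by omega)⟩, h 3 (by omega), h 4 (by omega),
    h 5 (by omega), .le_self fun I => by rw [Inst.measure]; simp; omega, h 6 (by omega),
    h 7 (by omega), h 8 (by omega)⟩

/-- The set `Inst` serves as the parameter space of the family, so that a single program works for
all instances. -/
theorem exists_solver : ∃ (p : Prog) (c k : ℕ), ∀ (s : State) (I : Inst), HeapOk s →
    (∀ i, i < 9 → Rep s (Inst.inputs i I) (s.var (2 + i))) →
    Exec p s 11 (c * I.timeBound k) fun s' => Rep s' (encList Config.enc I.solve) (s'.var 11) := by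
  classical
  obtain ⟨T, ⟨c₁, k, hT⟩, c₀, h⟩ := CT.solve hasInst_inputs
    (PT.mem ⟨2, by omega, rfl⟩) (.le_self fun _ => le_rfl)
  have hch : ∀ f : Inst → Data, ∃ i, (∃ j, j < 9 ∧ Inst.inputs j = f) → i < 9 ∧ Inst.inputs i = f := by
    intro f
    by_cases hf : ∃ j, j < 9 ∧ Inst.inputs j = f
    · exact ⟨hf.choose, fun _ => hf.choose_spec⟩
    · exact ⟨0, fun h => absurd h hf⟩
  choose idx hidx using hch
  obtain ⟨p, hp⟩ := h (fun f => 2 + idx f) 11 (by omega) fun f hf =>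
    ⟨by omega, by have := (hidx f hf).1; omega⟩
  refine ⟨p, c₀ * (c₁ + 1), k, fun s I hs hr => (hp s I hs fun f hf => ?_).mono le_rfl ?_
    fun _ _ _ h => h⟩
  · have := hr _ (hidx f hf).1
    rwa [(hidx f hf).2] at this
  · have h1 := hT I
    have h2 := I.one_le_timeBound k
    rw [mul_assoc]
    refine Nat.mul_le_mul_left _ ?_
    have h3 : (2 * I.T.width (snec I.G I.d) + 1) ^ 3 * T I ≤ c₁ * I.timeBound k := by
      rw [Inst.timeBound, mul_left_comm]
      exact Nat.mul_le_mul_left _ h1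
    simp only [id]
    nlinarith

/-! ### Loading the input -/

/-- The input arrays describe `I`, and the heap starts behind the weights. -/
structure Loaded (I : Inst) (s : State) : Prop where
  heap : HeapOk s
  var_zero : s.var 0 = I.n
  ptr : I.n + 1 ≤ s.var 1
  adj_le : ∀ k, s.arr 0 k ≤ 1
  adj : ∀ u v : Fin I.n, s.arr 0 (u * I.n + v) ≠ 0 ↔ I.G.Adj u v
  tok : ∀ k, s.arr 1 k = I.T.postorder.getD k 0
  wt : ∀ v : Fin I.n, s.wt 0 v = I.w v
  wt_n : s.wt 0 I.n = 0

theorem Loaded.extends {I : Inst} {s s' : State} (h : Loaded I s) (he : Extends s s') :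
    Loaded I s' where
  heap := h.heap.extends he
  var_zero := he.var_zero.trans h.var_zero
  ptr := h.ptr.trans he.ptr_le
  adj_le k := by rw [he.arr_zero]; exact h.adj_le k
  adj u v := by rw [he.arr_zero]; exact h.adj u v
  tok k := by rw [he.arr_one]; exact h.tok k
  wt v := by
    have := h.ptr
    rw [he.wt_eq _ (by omega)]
    exact h.wt v
  wt_n := by
    have := h.ptr
    rw [he.wt_eq _ (by omega)]
    exact h.wt_n

theorem Loaded.size_le {I : Inst} {s : State} (h : Loaded I s) {k : ℕ} (hk : k ≤ I.n) :
    k.size ≤ (s.var 1).size :=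
  Nat.size_le_size (hk.trans ((Nat.le_succ _).trans h.ptr))

/-- The memory after the allocation of the heap. -/
noncomputable def Inst.start (I : Inst) : State := (input I.G I.w I.T).setVar 1 (I.n + 1)

theorem Inst.loaded_start (I : Inst) : Loaded I I.start where
  heap := ⟨by simp [Inst.start], rfl, rfl⟩
  var_zero := rfl
  ptr := by simp [Inst.start]
  adj_le k := by
    simp only [Inst.start, State.setVar, input, if_true]
    split_ifs <;> omega
  adj u v := by
    classical
    have h : I.start.arr 0 (u * I.n + v) = if ∃ i j : Fin I.n, I.G.Adj i j ∧
      u.val * I.n + v.val = i.val * I.n + j.val then 1 else 0 := by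
      simp only [Inst.start, State.setVar, input, if_true]
    rw [h]
    split_ifs with hc
    · obtain ⟨i, j, hij, he⟩ := hc
      have h1 : u.val = i.val := by
        have h2 := congrArg (· / I.n) he
        simpa [Nat.add_div_of_dvd_right, Nat.mul_div_cancel _ I.n_pos,
          Nat.div_eq_of_lt v.2, Nat.div_eq_of_lt j.2] using h2
      have h2 : v.val = j.val := by
        rw [h1] at he
        omega
      rw [Fin.ext h1, Fin.ext h2]
      simp [hij]
    · simp only [ne_eq, not_true, false_iff]
      exact fun h => hc ⟨u, v, h, rfl⟩
  tok k := rfl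
  wt v := by simp [Inst.start, State.setVar, input]
  wt_n := by simp [Inst.start, State.setVar, input]

/-- Heap positions below `n` are left to the vertex weights, which already stand in weight array
`0`; position `n`, still zero there, represents the weight zero. -/
theorem Inst.exec_start (I : Inst) :
    Exec (.assign 1 (.add (.var 0) (.const 1))) (input I.G I.w I.T) 2 (I.n + 20) fun s' =>
      s' = I.start := by
  have h0 : (input I.G I.w I.T).var 0 = I.n := rfl
  have h1 : (input I.G I.w I.T).var 1 = 0 := rfl
  refine ⟨_, _, .assign _ 1 _, ⟨?_, fun _ _ => rfl, fun _ _ => rfl, fun _ _ => rfl, rfl, rfl, rfl⟩,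
    fun j h2 hj => by omega, ?_, ?_, ?_⟩
  · rw [h1]
    exact Nat.zero_le _
  · simp [Expr.eval, h0, h1]
  · have h2 := Nat.size_le_size (Nat.le_succ I.n)
    rw [setVar_var_self]
    simp only [Expr.eval, Expr.cost, h0, Nat.size_one] at h2 ⊢
    have h3 : 1 ≤ (I.n + 1).size := Nat.size_pos.2 (by omega)
    simp only [Nat.succ_eq_add_one] at h2
    nlinarith
  · rfl

theorem size_mul_le (a b : ℕ) : (a * b).size ≤ a.size + b.size := by
  rw [Nat.size_le, pow_add]
  rcases Nat.eq_zero_or_pos b with rfl | hb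
  · simp
  · exact Nat.mul_lt_mul_of_lt_of_le (Nat.lt_size_self a) (Nat.lt_size_self b).le (by positivity)

/-- The entry of the adjacency matrix. -/
def adjProg (x y z : ℕ) : Prog :=
  .branch (.get 0 (.add (.mul (.var y) (.var 0)) (.var z)))
    (.seq (.assign x (.const 0)) (consProg x x x)) (.assign x (.const 0))

theorem Loaded.exec_adj {I : Inst} {s : State} (h : Loaded I s) :
    Exec (tabulateProg 3 (.var 0) (tabulateProg 5 (.var 0) (adjProg 7 4 6))) s 3
      (I.n * ((I.n * 91 + 30) + 60) + 30) fun s' => Rep s' (Inst.inputs 1 I) (s'.var 3) := by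
  classical
  have hcost : ∀ s', Extends s s' → 1 + (Expr.var 0).cost s' ≤ 13 * (1 + (s'.var 1).size) := by
    intro s' he
    have := (h.extends he).size_le le_rfl
    simp only [Expr.cost, (h.extends he).var_zero]
    omega
  have hsize : ∀ s', Extends s s' → I.n.size ≤ 4 * (1 + (s'.var 1).size) := by
    intro s' he
    have := (h.extends he).size_le le_rfl
    omega
  let cell : ℕ → ℕ → Data := fun i j => encProp (s.arr 0 (i * I.n + j) ≠ 0)
  refine (exec_tabulate (N := I.n) (g := fun i => encL ((List.range I.n).map (cell i)))
    (b := I.n * 91 + 30) (by omega) h.heap (hcost _ (.refl s)) h.var_zero (hsize _ (.refl s))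
    fun s₁ he₁ _ h₁ => ?_).mono le_rfl le_rfl fun s' he hf hr => ?_
  · change s₁.var 4 < I.n at h₁
    have hl₁ := h.extends he₁
    refine (exec_tabulate (N := I.n) (g := cell (s₁.var 4)) (b := 31) (by omega) hl₁.heap
      (hcost _ he₁) hl₁.var_zero (hsize _ he₁) fun s₂ he₂ hf₂ h₂ => ?_).mono le_rfl le_rfl
      fun s' _ _ hr => hr
    change s₂.var 6 < I.n at h₂
    have hl₂ := hl₁.extends he₂
    have e4 : s₂.var 4 = s₁.var 4 := hf₂ 4 (by omega) (by omega)
    refine (exec_encProp (x := 7) (a := 0) (c := 8) (by omega) le_rfl hl₂.heap ?_).mono le_rfl le_rfl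
      fun s' _ _ hr => ?_
    · have h1 := hl₂.size_le (le_refl I.n)
      have h2 := hl₂.size_le h₁.le
      have h3 := hl₂.size_le h₂.le
      have h4 : (s₁.var 4 * I.n + s₂.var 6).size ≤ I.n.size + I.n.size := by
        refine (Nat.size_le_size (?_ : _ ≤ I.n * I.n)).trans (size_mul_le _ _)
        nlinarith [h₁, h₂]
      have h5 := size_mul_le (s₁.var 4) I.n
      have h6 : (s₂.arr 0 (s₁.var 4 * I.n + s₂.var 6)).size ≤ 1 := Nat.size_le_size (hl₂.adj_le _)
      simp only [Expr.cost, Expr.eval, hl₂.var_zero, e4]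
      omega
    · simp only [Expr.eval, hl₂.var_zero, e4, (he₁.trans he₂).arr_zero] at hr
      exact hr
  · have : encL ((List.range I.n).map fun i => encL ((List.range I.n).map (cell i))) =
        Inst.inputs 1 I := by
      refine encVec_eq fun u => encVec_eq fun v => ?_
      simp only [cell, h.adj]
    rwa [← this]

theorem Loaded.exec_tokens {I : Inst} {s : State} (h : Loaded I s) :
    Exec (tabulateProg 4 (.sub (.mul (.const 2) (.var 0)) (.const 1))
        (tabulateProg 6 (.get 1 (.var 5)) (.assign 8 (.const 0)))) s 4
      ((2 * I.n - 1) * ((I.n * 62 + 30) + 60) + 30) fun s' =>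
        Rep s' (Inst.inputs 2 I) (s'.var 4) := by
  have hsz : ∀ s', Extends s s' → ∀ k, k ≤ 2 * I.n → k.size ≤ (s'.var 1).size + 2 := by
    intro s' he k hk
    have h1 := (h.extends he).size_le le_rfl
    have h2 := size_mul_le 2 I.n
    have h3 := Nat.size_le_size hk
    have h4 : Nat.size 2 = 2 := by decide
    omega
  have h4 : Nat.size 2 = 2 := by decide
  refine (exec_tabulate (N := 2 * I.n - 1) (g := fun k => encNat (I.T.postorder.getD k 0))
    (b := I.n * 62 + 30) (by omega) h.heap ?_ ?_ ?_ fun s₁ he₁ _ h₁ => ?_).mono le_rfl le_rfl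
    fun s' _ _ hr => ?_
  · have h1 := h.size_le le_rfl
    have h2 := hsz s (.refl s) (2 * I.n) le_rfl
    have h3 := hsz s (.refl s) (2 * I.n - 1) (by omega)
    simp only [Expr.cost, Expr.eval, h.var_zero, h4, Nat.size_one]
    omega
  · simp [Expr.eval, h.var_zero]
  · have h3 := hsz s (.refl s) (2 * I.n - 1) (by omega)
    omega
  · change s₁.var 5 < 2 * I.n - 1 at h₁
    have hl₁ := h.extends he₁
    have hle := I.T.getD_postorder_le (s₁.var 5)
    have h2 := hl₁.size_le hle
    have h3 := hsz s₁ he₁ (s₁.var 5) (by omega)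
    refine (exec_encNat (x := 6) (N := I.T.postorder.getD (s₁.var 5) 0) (by omega) hl₁.heap ?_ ?_
      ?_).mono le_rfl ?_ fun s' _ _ hr => hr
    · simp only [Expr.cost, Expr.eval, hl₁.tok]
      omega
    · simp only [Expr.eval, hl₁.tok]
    · omega
    · omega
  · rwa [encL_postorder I.isLayout] at hr

/-- A weight is represented by its position, so the index of a vertex already is a pointer to its
weight and nothing is copied. -/
theorem Loaded.exec_weights {I : Inst} {s : State} (h : Loaded I s) :
    Exec (tabulateProg 5 (.var 0) (.assign 7 (.var 6))) s 5 (I.n * 62 + 30) fun s' =>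
      Rep s' (Inst.inputs 3 I) (s'.var 5) := by
  have h1 := h.size_le le_rfl
  refine (exec_tabulate (N := I.n) (e := .var 0) (g := fun i => .wt (s.wt 0 i)) (b := 2)
    (by omega) h.heap ?_ h.var_zero (by omega) fun s₁ he₁ _ h₁ => ?_).mono le_rfl le_rfl fun s' _ _ hr => ?_
  · simp only [Expr.cost, h.var_zero]
    omega
  · change s₁.var 6 < I.n at h₁
    have h2 := (h.extends he₁).ptr
    have h3 := h.ptr
    refine (exec_copy (by omega) le_rfl (by omega)).mono le_rfl le_rfl fun s' he _ e => ?_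
    subst e
    rw [setVar_var_self]
    refine ⟨?_, ?_⟩
    · rw [setVar_var_of_ne (by omega)]
      omega
    · exact he₁.wt_eq _ (by omega)
  · rwa [encVec_eq fun v => by rw [h.wt v]] at hr

theorem Loaded.exec_zero {I : Inst} {s : State} (h : Loaded I s) :
    Exec (.assign 6 (.var 0)) s 6 2 fun s' => Rep s' (Inst.inputs 4 I) (s'.var 6) := by
  have h1 := h.ptr
  refine (exec_copy (by omega) le_rfl (by rw [h.var_zero]; omega)).mono le_rfl le_rfl
    fun s' he _ e => ?_
  subst e
  rw [setVar_var_self, h.var_zero]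
  refine ⟨?_, h.wt_n⟩
  rw [setVar_var_of_ne (by omega)]
  omega

/-- Run the programs `p 0`, …, `p (m - 1)`. -/
def chain (p : ℕ → Prog) : ℕ → Prog
  | 0 => .skip
  | m + 1 => .seq (chain p m) (p m)

theorem exec_chain {I : Inst} {p : ℕ → Prog} {B : ℕ} {D : ℕ → Data} (m : ℕ)
    (hp : ∀ i, i < m → ∀ s, Loaded I s → Exec (p i) s (2 + i) B fun s' =>
      Rep s' (D i) (s'.var (2 + i))) {s : State} (hs : Loaded I s) :
    Exec (chain p m) s 2 (m * (B + 1) + 1) fun s' => ∀ i, i < m → Rep s' (D i) (s'.var (2 + i)) := by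
  induction m with
  | zero => exact ⟨s, 1, .skip s, .refl s, fun _ _ _ => rfl, by omega, by omega, by simp⟩
  | succ m ih =>
    refine Exec.seq' (k' := 2) (b' := B) (ih fun i hi => hp i (by omega)) le_rfl
      (by rw [Nat.succ_mul]; omega) fun s₁ he₁ _ h₁ => ?_
    refine (hp m (by omega) s₁ (hs.extends he₁)).mono (by omega) le_rfl fun s₂ he₂ hf₂ h₂ i hi => ?_
    rcases Nat.lt_succ_iff_lt_or_eq.1 hi with hi | rfl
    · rw [hf₂ (2 + i) (by omega) (by omega)]
      exact (h₁ i hi).extends he₂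
    · exact h₂

theorem isPlain_encVec {n : ℕ} {f : Fin n → Data} (h : ∀ v, (f v).IsPlain) : (encVec f).IsPlain := by
  refine isPlain_encL fun x hx => ?_
  obtain ⟨v, -, rfl⟩ := List.mem_map.1 hx
  exact h v

/-- The data of `d`, `σ`, `ρ` and the version are constants of the program. The square comes from
the adjacency matrix and from the unary numbers in the listing. -/
theorem exists_load (d : ℕ) (σ ρ : Set ℕ) (goal : Goal) : ∃ (p : Prog) (c : ℕ), ∀ I : Inst,
    I.d = d → I.σ = σ → I.ρ = ρ → I.goal = goal →
    Exec p (input I.G I.w I.T) 2 (c * (I.n + 1) ^ 2) fun s' => Loaded I s' ∧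
      ∀ i, i < 9 → Rep s' (Inst.inputs i I) (s'.var (2 + i)) := by
  obtain ⟨p₅, c₅, h₅⟩ := exists_exec_plain (isPlain_encNat d) 7 (by omega)
  obtain ⟨p₆, c₆, h₆⟩ := exists_exec_plain (isPlain_encVec
    fun i : Fin (d + 1) => isPlain_encProp (i.val ∈ σ)) 8 (by omega)
  obtain ⟨p₇, c₇, h₇⟩ := exists_exec_plain (isPlain_encVec
    fun i : Fin (d + 1) => isPlain_encProp (i.val ∈ ρ)) 9 (by omega)
  obtain ⟨p₈, c₈, h₈⟩ := exists_exec_plain (isPlain_encProp (goal = .max)) 10 (by omega)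
  let p : ℕ → Prog := fun i => match i with
    | 0 => tabulateProg 2 (.var 0) (.assign 4 (.const 0))
    | 1 => tabulateProg 3 (.var 0) (tabulateProg 5 (.var 0) (adjProg 7 4 6))
    | 2 => tabulateProg 4 (.sub (.mul (.const 2) (.var 0)) (.const 1))
        (tabulateProg 6 (.get 1 (.var 5)) (.assign 8 (.const 0)))
    | 3 => tabulateProg 5 (.var 0) (.assign 7 (.var 6))
    | 4 => .assign 6 (.var 0)
    | 5 => p₅
    | 6 => p₆
    | 7 => p₇
    | _ => p₈
  refine ⟨.seq (.assign 1 (.add (.var 0) (.const 1))) (chain p 9),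
    9 * (500 + c₅ + c₆ + c₇ + c₈) + 40, fun I hd hσ hρ hgoal => ?_⟩
  subst hd hσ hρ hgoal
  have hstep : ∀ i, i < 9 → ∀ s, Loaded I s →
      Exec (p i) s (2 + i) ((499 + c₅ + c₆ + c₇ + c₈) * (I.n + 1) ^ 2) fun s' =>
        Rep s' (Inst.inputs i I) (s'.var (2 + i)) := by
    have hb : ∀ c b, b ≤ c * (I.n + 1) ^ 2 → c ≤ 499 + c₅ + c₆ + c₇ + c₈ →
        b ≤ (499 + c₅ + c₆ + c₇ + c₈) * (I.n + 1) ^ 2 := fun c b h h' =>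
      h.trans (Nat.mul_le_mul_right _ h')
    have hone : 1 ≤ (I.n + 1) ^ 2 := Nat.one_le_pow _ _ (by omega)
    intro i hi s hs
    have h1 := hs.size_le le_rfl
    interval_cases i
    · refine (exec_encNat (x := 2) (N := I.n) (e := .var 0) le_rfl hs.heap ?_ hs.var_zero (by omega)).mono le_rfl
        (hb 200 _ (by nlinarith) (by omega)) fun _ _ _ h => h
      simp only [Expr.cost, hs.var_zero]
      omega
    · exact hs.exec_adj.mono le_rfl (hb 400 _ (by nlinarith) (by omega)) fun _ _ _ h => h
    · refine hs.exec_tokens.mono le_rfl (hb 400 _ ?_ (by omega)) fun _ _ _ h => h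
      have : 2 * I.n - 1 ≤ 2 * I.n := by omega
      nlinarith
    · exact hs.exec_weights.mono le_rfl (hb 200 _ (by nlinarith) (by omega)) fun _ _ _ h => h
    · exact hs.exec_zero.mono le_rfl (hb 2 _ (by nlinarith) (by omega)) fun _ _ _ h => h
    · exact (h₅ s hs.heap).mono le_rfl (hb c₅ _ (by nlinarith) (by omega)) fun _ _ _ h => h
    · exact (h₆ s hs.heap).mono le_rfl (hb c₆ _ (by nlinarith) (by omega)) fun _ _ _ h => h
    · exact (h₇ s hs.heap).mono le_rfl (hb c₇ _ (by nlinarith) (by omega)) fun _ _ _ h => h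
    · exact (h₈ s hs.heap).mono le_rfl (hb c₈ _ (by nlinarith) (by omega)) fun _ _ _ h => h
  refine Exec.seq' (k' := 2) (b := I.n + 20)
    (b' := 9 * ((499 + c₅ + c₆ + c₇ + c₈) * (I.n + 1) ^ 2 + 1) + 1) I.exec_start le_rfl ?_
    fun s₁ _ _ e₁ => ?_
  · have hone : 1 ≤ (I.n + 1) ^ 2 := Nat.one_le_pow _ _ (by omega)
    nlinarith
  · subst e₁
    exact (exec_chain 9 hstep I.loaded_start).mono le_rfl le_rfl
      fun s₂ he₂ _ h₂ => ⟨I.loaded_start.extends he₂, h₂⟩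


/-! ### Output and running time -/

theorem exec_store {s : State} {k c : ℕ} {i e : Expr}
    (h : 1 + i.cost s + e.cost s ≤ c * (1 + (s.var 1).size)) :
    Exec (.store 2 i e) s k c fun s' => s' = s.setArr 2 (i.eval s) (e.eval s) :=
  ⟨_, _, .store s 2 i e, ⟨le_rfl, fun _ _ => rfl, fun _ _ => rfl, fun _ _ => rfl, rfl, rfl, rfl⟩,
    fun _ _ _ => rfl, Nat.le_add_right _ _, h, rfl⟩

theorem setArr_arr (s : State) (i v j : ℕ) :
    (s.setArr 2 i v).arr 2 j = if j = i then v else s.arr 2 j := by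
  simp [State.setArr, Function.update_apply]

/-- Write the entries of the list at variable `12` to the output array. -/
def writeLoop : Prog :=
  .loop (.var 12) <| .seq (.store 2 (.var 13) (.get 3 (.var 12))) <|
    .seq (.assign 12 (.get 4 (.var 12))) (.assign 13 (.add (.var 13) (.const 1)))

/-- The cells of array `2`, which is not part of the heap, receive pointers to truth values. Such a
pointer is non-zero exactly if the value is true, which is how the output set is read. -/
theorem exec_writeLoop : ∀ (l : List Data) (s : State) (i : ℕ), HeapOk s →
    Rep s (encL l) (s.var 12) → s.var 13 = i → i + l.length ≤ s.var 1 →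
    Exec writeLoop s 12 (l.length * 60 + 10) fun s' =>
      (∀ j < i, s'.arr 2 j = s.arr 2 j) ∧
        ∀ j (h : j < l.length), Rep s' l[j] (s'.arr 2 (i + j)) := by
  intro l
  induction l with
  | nil =>
    intro s i hs hr hi hle
    have h0 : s.var 12 = 0 := hr
    refine (exec_loop_done (c := 10) ?_ ?_ ?_).mono le_rfl (by simp) fun s' _ _ h => h
    · simp [Expr.cost, h0]
      omega
    · exact h0
    · exact ⟨fun _ _ => rfl, fun j h => absurd h (Nat.not_lt_zero j)⟩
  | cons x l ih =>
    intro s i hs hr hi hle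
    obtain ⟨hne, hlt, ha, hb⟩ := hr
    rw [List.length_cons] at hle
    have s1 := Nat.size_le_size hlt.le
    have s2 := Nat.size_le_size (ha.lt hs).le
    have s3 := Nat.size_le_size (hb.lt hs).le
    have s4 : i.size ≤ (s.var 1).size := Nat.size_le_size (by omega)
    have s5 : (i + 1).size ≤ (s.var 1).size := Nat.size_le_size (by omega)
    refine Exec.mono (k := 12) (b := (6 + (6 + 6 + 1) + 1) + (l.length * 60 + 10) + 3)
      (exec_loop_step ?_ hne (Exec.seq' (k' := 12) (b := 6) (exec_store ?_) le_rfl le_rfl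
        fun s₁ he₁ _ e₁ => Exec.seq' (k' := 12) (b := 6) (exec_assign 6 (by omega) le_rfl ?_) le_rfl
        le_rfl fun s₂ he₂ _ e₂ => (exec_assign 6 (by omega) (by omega) ?_).mono le_rfl le_rfl
        fun s₃ he₃ _ e₃ => ?_)) le_rfl ?_ fun s' _ _ h => h
    · simp only [Expr.cost]
      omega
    · simp only [Expr.cost, Expr.eval, hi]
      omega
    · subst e₁
      simp only [Expr.cost, Expr.eval, State.setArr, Function.update_of_ne (show 4 ≠ 2 by decide)]
      omega
    · subst e₂ e₁
      simp only [Expr.cost, Expr.eval, State.setVar, State.setArr, hi, Nat.size_one,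
        Function.update_of_ne (show 13 ≠ 12 by decide), Function.update_of_ne (show 1 ≠ 12 by decide)]
      omega
    · have he := (he₁.trans he₂).trans he₃
      have hv12 : s₃.var 12 = s.arr 4 (s.var 12) := by
        subst e₃ e₂ e₁
        simp [Expr.eval, State.setVar, State.setArr]
      have hv13 : s₃.var 13 = i + 1 := by
        subst e₃ e₂ e₁
        simp [Expr.eval, State.setVar, State.setArr, hi]
      have harr : ∀ j, s₃.arr 2 j = if j = i then s.arr 3 (s.var 12) else s.arr 2 j := by
        intro j
        subst e₃ e₂ e₁
        rw [← hi]
        exact setArr_arr s _ _ j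
      refine (ih s₃ (i + 1) (hs.extends he) (hv12 ▸ hb.extends he) hv13
        (by have := he.ptr_le; omega)).mono le_rfl le_rfl fun s₄ he₄ _ h₄ => ⟨fun j hj => ?_,
          fun j hj => ?_⟩
      · rw [h₄.1 j (by omega), harr, if_neg (by omega)]
      · cases j with
        | zero =>
          rw [Nat.add_zero, h₄.1 i (by omega), harr, if_pos rfl]
          exact ha.extends (he.trans he₄)
        | succ j =>
          have := h₄.2 j (by simpa using hj)
          rwa [Nat.add_right_comm, Nat.add_assoc] at this
    · rw [List.length_cons, Nat.succ_mul]
      omega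

/-- Write the set of vertices of the first entry of the list at variable `11` to the output
array. -/
def writeProg : Prog :=
  .seq (.assign 12 (.get 3 (.var 11))) <| .seq (.assign 12 (.get 3 (.var 12))) <|
    .seq (.assign 13 (.const 0)) writeLoop

theorem exec_writeProg {n : ℕ} {s : State} {c : Config n} {l : List (Config n)} (hs : HeapOk s)
    (hn : n ≤ s.var 1) (hr : Rep s (encList Config.enc (c :: l)) (s.var 11)) :
    Exec writeProg s 12 (n * 60 + 30) fun s' => outputSet n s' = c.X := by
  classical
  obtain ⟨-, hlt, hc, -⟩ := hr
  have hX := hc.2.2.1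
  have s1 := Nat.size_le_size hlt.le
  have s2 := Nat.size_le_size (hc.lt hs).le
  have s3 := Nat.size_le_size (hX.lt hs).le
  refine Exec.seq' (k' := 12) (b := 3) (b' := 3 + (2 + (n * 60 + 10) + 1) + 1)
    (exec_assign 3 (by omega) le_rfl ?_) le_rfl (by omega) fun s₁ he₁ _ e₁ =>
    Exec.seq' (k' := 12) (b := 3) (exec_assign 3 (by omega) le_rfl ?_) le_rfl le_rfl
    fun s₂ he₂ _ e₂ => Exec.seq' (k' := 12) (b := 2) (exec_zero (by omega) (by omega)) le_rfl le_rfl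
    fun s₃ he₃ _ e₃ => ?_
  · simp only [Expr.cost, Expr.eval]
    omega
  · subst e₁
    simp only [Expr.cost, Expr.eval, State.setVar, Function.update_self,
      Function.update_of_ne (show 1 ≠ 12 by decide)]
    omega
  · have he := (he₁.trans he₂).trans he₃
    have hv12 : s₃.var 12 = s.arr 3 (s.arr 3 (s.var 11)) := by
      subst e₃ e₂ e₁
      simp [Expr.eval, State.setVar]
    have hv13 : s₃.var 13 = 0 := by
      subst e₃
      simp
    have hX' : Rep s₃ (encL ((List.finRange n).map fun v => encProp (v ∈ c.X))) (s₃.var 12) :=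
      hv12 ▸ hX.extends he
    refine (exec_writeLoop _ s₃ 0 (hs.extends he) hX' hv13 ?_).mono le_rfl (by simp)
      fun s₄ _ _ h₄ => ?_
    · have := he.ptr_le
      simp
      omega
    · ext v
      have := h₄.2 v.val (by simp)
      rw [Nat.zero_add, List.getElem_map, List.getElem_finRange] at this
      simp only [outputSet, Finset.mem_filter, Finset.mem_univ, true_and]
      exact rep_encProp this

/-- The running time of the algorithm on the machine. -/
theorem exists_algorithm : ∃ k : ℕ, ∀ (d : ℕ) (σ ρ : Set ℕ) (goal : Goal), ∃ (p : Prog) (c : ℕ),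
    ∀ I : Inst, I.d = d → I.σ = σ → I.ρ = ρ → I.goal = goal → ∃ s t,
      Run p (input I.G I.w I.T) s t ∧ CorrectOutput goal I.G σ ρ I.w s ∧
        t ≤ c * I.timeBound k * (1 + (c * I.timeBound k).size) := by
  obtain ⟨q, c₁, k, hq⟩ := exists_solver
  refine ⟨k + 2, fun d σ ρ goal => ?_⟩
  obtain ⟨p, c₂, hp⟩ := exists_load d σ ρ goal
  refine ⟨.seq p (.seq q (.branch (.var 11) writeProg (.assign 0 (.const 0)))),
    c₁ + c₂ + 120, fun I hd hσ hρ hgoal => ?_⟩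
  have hload := hp I hd hσ hρ hgoal
  subst hσ hρ hgoal
  set U := I.timeBound (k + 2) with hU
  have hU1 : I.timeBound k ≤ U := I.timeBound_mono (by omega)
  have hU2 : (I.n + 1) ^ 2 ≤ U := by
    refine le_trans ?_ ((I.pow_le_timeBound 2).trans (I.timeBound_mono (by omega)))
    exact Nat.pow_le_pow_left (by rw [Inst.measure]; omega) 2
  have hU3 : I.n ≤ U := by nlinarith
  have hU4 : 1 ≤ U := I.one_le_timeBound _
  cases hsol : I.solve with
  | nil =>
    -- The final assignment to variable `0` violates `Extends`. Thus only the part before it is an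
    -- `Exec`, and the run is completed by hand.
    have hex : Exec (.seq p q) (input I.G I.w I.T) 2 (c₂ * U + c₁ * U + 1) fun s' =>
        s'.var 11 = 0 := by
      refine Exec.seq' (k' := 2) (b := c₂ * U) (b' := c₁ * U)
        (hload.mono le_rfl (Nat.mul_le_mul_left _ hU2) fun _ _ _ h => h) le_rfl le_rfl
        fun s₁ _ _ h₁ => ?_
      refine (hq s₁ I h₁.1.heap h₁.2).mono (by omega) (Nat.mul_le_mul_left _ hU1)
        fun s₂ _ _ h₂ => ?_
      rw [hsol] at h₂
      exact h₂
    obtain ⟨s, t, hrun, -, -, hvar, ht, hs⟩ := hex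
    cases hrun with
    | @seq _ _ _ s₁ _ t₁ t₂ h₁ h₂ =>
      refine ⟨_, _, .seq h₁ (.seq h₂ (.branchFalse hs (.assign s 0 (.const 0)))),
        .inl ⟨rfl, Inst.solve_eq_nil_iff.1 hsol⟩, ?_⟩
      have h0 : (input I.G I.w I.T).var 1 = 0 := rfl
      rw [h0, Nat.zero_add] at hvar
      have hle : c₂ * U + c₁ * U + 1 ≤ (c₁ + c₂ + 120) * U := by nlinarith
      have h3 := Nat.size_le_size (hvar.trans hle)
      have h4 := Nat.mul_le_mul (le_refl (c₂ * U + c₁ * U + 1)) (Nat.add_le_add_left h3 1)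
      have h5 : (c₂ * U + c₁ * U + 1 + 20) * (1 + ((c₁ + c₂ + 120) * U).size) ≤
          (c₁ + c₂ + 120) * U * (1 + ((c₁ + c₂ + 120) * U).size) :=
        Nat.mul_le_mul_right _ (by nlinarith)
      simp only [Expr.cost, hs, Nat.size_zero]
      rw [Nat.add_mul] at h5
      have h6 := Nat.zero_le ((c₁ + c₂ + 120) * U).size
      omega
  | cons c l =>
    have hex : Exec (.seq p (.seq q (.branch (.var 11) writeProg (.assign 0 (.const 0)))))
        (input I.G I.w I.T) 2 ((c₁ + c₂ + 120) * U) fun s' =>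
          outputSet I.n s' = c.X := by
      refine Exec.seq' (k' := 2) (b := c₂ * U) (b' := c₁ * U + (I.n * 60 + 30 + 2) + 1)
        (hload.mono le_rfl (Nat.mul_le_mul_left _ hU2) fun _ _ _ h => h) le_rfl (by nlinarith)
        fun s₁ _ _ h₁ => ?_
      refine Exec.seq' (k' := 11) (b := c₁ * U)
        ((hq s₁ I h₁.1.heap h₁.2).mono le_rfl (Nat.mul_le_mul_left _ hU1) fun _ _ _ h => h)
        (by omega) le_rfl fun s₂ he₂ _ h₂ => ?_
      have hl₂ := h₁.1.extends he₂
      rw [hsol] at h₂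
      refine exec_branch (c := 2) (var_cost_le (h₂.lt hl₂.heap).le) (fun _ => ?_)
        fun h => absurd h h₂.1
      exact (exec_writeProg hl₂.heap ((Nat.le_succ _).trans hl₂.ptr) h₂).mono (by omega) le_rfl
        fun _ _ _ h => h
    obtain ⟨s, t, hrun, he, -, hvar, ht, hs⟩ := hex
    have h0 : (input I.G I.w I.T).var 1 = 0 := rfl
    rw [h0, Nat.zero_add] at hvar
    refine ⟨s, t, hrun, .inr ⟨?_, hs ▸ Inst.isOptimal_of_solve_eq_cons hsol⟩,
      ht.trans (Nat.mul_le_mul_left _ (Nat.add_le_add_left (Nat.size_le_size hvar) 1))⟩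
    -- Variable `0` still holds `n`, which is positive and so announces a solution.
    rw [he.var_zero]
    exact I.n_pos.ne'

theorem Inst.timeBound_le (I : Inst) (f : WidthParam) (k : ℕ) :
    I.timeBound k ≤ 27 * (I.d + 5) ^ k *
      (I.T.width (snec I.G I.d) ^ 3 * boundN I.G I.T f ^ k) := by
  have h1 := one_le_width_snec I.G I.T I.d
  have h2 := width_nodeSize_le I f
  have h3 := le_boundN I.G I.T I.n_pos f
  have h4 := one_le_boundN I.G I.T I.n_pos f
  -- The summands of the measure are `n`, `d` and the width of `nodeSize`, the first and the last
  -- being at most `boundN` and three times `boundN`.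
  have h5 : I.measure + 1 ≤ (I.d + 5) * boundN I.G I.T f := by
    rw [Inst.measure]
    nlinarith
  calc I.timeBound k ≤ (3 * I.T.width (snec I.G I.d)) ^ 3 * ((I.d + 5) * boundN I.G I.T f) ^ k :=
        Nat.mul_le_mul (Nat.pow_le_pow_left (by omega) 3) (Nat.pow_le_pow_left h5 k)
    _ = _ := by
      rw [mul_pow, mul_pow]
      ring

/-- The number of addresses is at most `2 ^ (3 * n)` times a polynomial in `N`, since `S ≤ 2 ^ n`.
Their bit length is thus at most a constant times `N ^ k`, and the logarithmic cost only doubles the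
exponent of `N`. -/
theorem time_le {c S N n k t U e : ℕ} (hk : 1 ≤ k) (hN : 1 ≤ N) (hn : n ≤ N) (hS : S ≤ 2 ^ n)
    (hU : U ≤ e * (S ^ 3 * N ^ k)) (ht : t ≤ c * U * (1 + (c * U).size)) :
    t ≤ (c * e * (4 + c * e)) * (S ^ 3 * N ^ (2 * k)) := by
  have h1 : c * U ≤ c * e * N ^ k * 2 ^ (3 * n) := by
    have : S ^ 3 ≤ 2 ^ (3 * n) := (Nat.pow_le_pow_left hS 3).trans (by rw [← pow_mul, mul_comm])
    calc c * U ≤ c * (e * (2 ^ (3 * n) * N ^ k)) :=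
          Nat.mul_le_mul_left _ (hU.trans (Nat.mul_le_mul_left _ (Nat.mul_le_mul_right _ this)))
      _ = _ := by ring
  have h2 : (c * U).size ≤ c * e * N ^ k + 3 * n := by
    rw [Nat.size_le, pow_add]
    exact h1.trans_lt (Nat.mul_lt_mul_of_pos_right Nat.lt_two_pow_self (by positivity))
  have h3 : N ≤ N ^ k := Nat.le_self_pow (by omega) N
  have h4 : 1 + (c * U).size ≤ (4 + c * e) * N ^ k := by nlinarith
  calc t ≤ c * U * (1 + (c * U).size) := ht
    _ ≤ c * (e * (S ^ 3 * N ^ k)) * ((4 + c * e) * N ^ k) :=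
        Nat.mul_le_mul (Nat.mul_le_mul_left _ hU) h4
    _ = _ := by
      rw [two_mul, pow_add]
      ring

end AcyclicDom

theorem theorem5p10 (K : Type) [Field K] (f : AcyclicDom.WidthParam) :
    ∃ c : ℕ, ∀ (σ ρ : Set ℕ), σ.Nonempty → ρ.Nonempty →
      (σ.Finite ∨ σᶜ.Finite) → (ρ.Finite ∨ ρᶜ.Finite) → ∀ goal : AcyclicDom.Goal,
      ∃ (p : AcyclicDom.Prog) (C : ℝ),
        ∀ (n : ℕ) (G : SimpleGraph (Fin n)) (w : Fin n → ℚ) (T : AcyclicDom.LayoutTree (Fin n)),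
          T.IsLayout →
          ∃ (s : AcyclicDom.State) (t : ℕ),
            AcyclicDom.Run p (AcyclicDom.input G w T) s t ∧
            AcyclicDom.CorrectOutput goal G σ ρ w s ∧
            (t : ℝ) ≤ C *
              ((T.width (AcyclicDom.snec G
                  (max 2 (max (AcyclicDom.dOf σ) (AcyclicDom.dOf ρ)))) : ℝ) ^ 3 *
                (T.width (AcyclicDom.snec G 1) : ℝ) ^ (2 * (AcyclicDom.matMulExponent K + 1)) *
                (AcyclicDom.boundN G T f : ℝ) ^ c * (n : ℝ) ^ 3) := by
  obtain ⟨k, hk⟩ := AcyclicDom.exists_algorithm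
  refine ⟨2 * (k + 1), fun σ ρ _ _ hσ hρ goal => ?_⟩
  set d := max 2 (max (AcyclicDom.dOf σ) (AcyclicDom.dOf ρ)) with hd
  obtain ⟨p, c, hp⟩ := hk d σ ρ goal
  refine ⟨p, ((c * (27 * (d + 5) ^ (k + 1)) * (4 + c * (27 * (d + 5) ^ (k + 1))) : ℕ) : ℝ),
    fun n G w T hT => ?_⟩
  let I : AcyclicDom.Inst := ⟨n, G, w, T, hT, d, le_max_left _ _, σ, ρ,
    AcyclicDom.min_mem_iff hσ (le_max_of_le_right (le_max_left _ _)),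
    AcyclicDom.min_mem_iff hρ (le_max_of_le_right (le_max_right _ _)), goal⟩
  have hn : 0 < n := I.n_pos
  obtain ⟨s, t, hrun, hcorrect, ht⟩ := hp I rfl rfl rfl rfl
  refine ⟨s, t, hrun, hcorrect, ?_⟩
  have hU := (I.timeBound_mono (Nat.le_succ k)).trans (I.timeBound_le f (k + 1))
  have hle := AcyclicDom.time_le (Nat.le_add_left 1 k) (AcyclicDom.one_le_boundN G T hn f)
    (AcyclicDom.le_boundN G T hn f) (AcyclicDom.width_snec_le G T d) hU ht
  have hle' : (t : ℝ) ≤ ((c * (27 * (d + 5) ^ (k + 1)) * (4 + c * (27 * (d + 5) ^ (k + 1))) : ℕ) : ℝ) *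
      ((T.width (AcyclicDom.snec G d) : ℝ) ^ 3 *
        (AcyclicDom.boundN G T f : ℝ) ^ (2 * (k + 1))) := by
    exact_mod_cast hle
  -- The bound obtained has neither the factor with `snec G 1` nor the factor `n ^ 3`; both are at
  -- least one.
  refine hle'.trans (mul_le_mul_of_nonneg_left ?_ (Nat.cast_nonneg _))
  have h1 : (1 : ℝ) ≤ (T.width (AcyclicDom.snec G 1) : ℝ) ^
      (2 * (AcyclicDom.matMulExponent K + 1)) := by
    refine Real.one_le_rpow ?_ ?_
    · exact_mod_cast AcyclicDom.one_le_width_snec G T 1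
    · have := AcyclicDom.matMulExponent_nonneg K
      linarith
  have h2 : (1 : ℝ) ≤ (n : ℝ) ^ 3 := one_le_pow₀ (by exact_mod_cast hn)
  calc (T.width (AcyclicDom.snec G d) : ℝ) ^ 3 * (AcyclicDom.boundN G T f : ℝ) ^ (2 * (k + 1))
      = (T.width (AcyclicDom.snec G d) : ℝ) ^ 3 * 1 *
          (AcyclicDom.boundN G T f : ℝ) ^ (2 * (k + 1)) * 1 := by ring
    _ ≤ _ := by gcongr
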